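/- **Symbols.** Let $\mathcal S$ be the free commutative monoid with a unary operation $\mathcal I$ generated by symbols $\Xi,X_0,\dots,X_3$; in linear combinations of symbols put $\mathcal I(X^k)=0$ for every multiindex $k$. Fix $0<\kappa<\frac1{14}$ and set $|\Xi|=-\frac52-\kappa$, $|X_0|=2$, $|X_1|=|X_2|=|X_3|=1$, $|\mathcal I(\tau)|=|\tau|+2$, $|\tau\bar\tau|=|\tau|+|\bar\tau|$; write $|k|=2k_0+k_1+k_2+k_3$. Let $\mathcal U$ be the smallest set of symbols containing all $X^k$ and $\mathcal I(\Xi)$ and, with $\tau_1,\tau_2,\tau_3$, also $\mathcal I(\tau_1\tau_2\tau_3)$ (unless $\tau_1\tau_2\tau_3$ is some $X^k$). The model space $T$ is spanned by $\Xi$ and the products $\tau_1\tau_2\tau_3$, $\tau_i\in\mathcal U$. Write $\Psi=\mathcal I(\Xi)$. Let $L_1$, $L_2$ be the linear maps sending a symbol to the sum of all symbols obtained from it by one substitution $\Psi^2\mapsto 1$, respectively $\mathcal I(\Psi^2)\Psi^2\mapsto 1$, at some node, where whatever else is attached to the substituted part is kept as a factor at that node (e.g. $L_1\Psi^3=3\Psi$,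 $L_2\,\mathcal I(\Psi^3)\Psi^2=3\Psi$). For $C_1,C_2\in\mathbf R$ let $M=\exp(-C_1L_1-C_2L_2)$. **Kernel.** Let $G$ be the heat kernel of $\partial_t-\Delta$ on $\mathbf R\times\mathbf R^3$ and $G=K+\hat K$ away from $0$, with $\hat K$ smooth on $\mathbf R^4$ and $K=\sum_{n\ge0}K_n$, $K_n$ smooth, supported in $\{|t|^{1/2}+\sum_i|x_i|\le2^{-n}\}$, $\sup|D^kK_n|\le C_k2^{n(3+|k|)}$, and $\int K_n P=0$ for polynomials $P$ of parabolic degree at most $N$. **Model.** Let $\xi$ be a smooth function on $\mathbf R\times\mathbf T^3$ (a space-periodic smooth function on $\mathbf R^4$). Let $\boldsymbol\Pi$ be the multiplicative linear map into functions on $\mathbf R^4$ with $\boldsymbol\Pi\Xi=\xi$, $(\boldsymbol\Pi X_i)(x)=x_i$, $\boldsymbol\Pi\mathcal I(\tau)=K*\boldsymbol\Pi\tau$, and put $\boldsymbol\Pi^M=\boldsymbol\Pi\circ M$. The renormalised model $(\Pi^M,\Gamma^M)=M\iota\xi$ is $\Pi^M_x=\boldsymbol\Pi^MF_x$, $\Gamma^M_{xy}=F_x^{-1}F_y$,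 where $F_x$ is the multiplicative linear map determined recursively by $F_x\Xi=\Xi$, $F_xX_i=X_i-x_i$ and $$F_x\mathcal I(\tau)=\mathcal I(F_x\tau)-\sum_{|k|<|\tau|+2}\frac{(X-x)^k}{k!}\int D^kK(x-y)\,(\Pi^M_x\tau)(y)\,dy .$$ Integrals against $D^kK$ are understood as $\sum_n\int D^kK_n$. For $\tau$ not of the form $X^k$ let $\mathcal J(x)\tau=\sum_{|k|<|\tau|+2}\frac{X^k}{k!}\int D^kK(x-y)(\Pi^M_x\tau)(y)\,dy$; put $\mathcal J(x)X^k=0$. **Fixed point problem.** Let $\gamma>1+2\kappa$, $\gamma'=\gamma-1-2\kappa$, $N\ge\gamma'+2$, $\eta>-\frac23$, $T>0$, and let $\Phi_0$ be a distribution on $\mathbf T^3$ with harmonic extension $G\Phi_0$. Let $\mathcal D^{\gamma,\eta}$ be the space of modelled distributions on $(0,T)\times\mathbf R^3$ with values in the span of the elements of $\mathcal U$ of homogeneity $<\gamma$, with weight at $t=0$: with $\|\cdot\|_\alpha$ the norm of the component of homogeneity $\alpha$, with parabolic distances, and with $|z|_0=1\wedge|t|^{1/2}$ for $z=(t,x)$,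 one requires for every $\alpha<\gamma$ that, uniformly over $(0,T)\times\mathbf R^3$, $\|f(z)\|_\alpha\lesssim|z|_0^{(\eta-\alpha)\wedge0}$ and $\|f(z)-\Gamma^M_{zw}f(w)\|_\alpha\lesssim|z-w|^{\gamma-\alpha}(|z|_0\wedge|w|_0)^{\eta-\gamma}$ whenever $|z-w|\le|z|_0\wedge|w|_0$. The reconstruction $\mathcal R^Mf$ of an $f$ of order $\delta>0$ is the continuous function on $(0,T)\times\mathbf R^3$ with $|(\mathcal R^Mf-\Pi^M_xf(x))(\varphi^\lambda_x)|\lesssim\lambda^\delta$ as $\lambda\to0$, uniformly over $\varphi$ in the unit ball of $\mathcal C^3$ with support in the unit ball and locally uniformly in $x$; in the convolutions below it is extended by $0$ outside the slab. Let $\Phi\in\mathcal D^{\gamma,\eta}$ be a space-periodic solution on $(0,T)\times\mathbf R^3$, up to order $\gamma$, of $$\Phi=\mathcal K(f)+\hat{\mathcal K}(f)+G\Phi_0,\qquad f=\Xi-\Phi^3\ \text{ (up to order }\gamma'),$$ where $G\Phi_0$ is lifted by its Taylor expansion and $$\mathcal K f(z)=\mathcal I f(z)+\mathcal J(z)f(z)+\sum_{|k|<\gamma'+2}\frac{X^k}{k!}\int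 D^kK(z-w)\,(\mathcal R^Mf-\Pi^M_zf(z))(w)\,dw,\qquad \hat{\mathcal K}f(z)=\sum_k\frac{X^k}{k!}(D^k\hat K*\mathcal R^Mf)(z).$$ **Claim.** The function $u=\mathcal R^M\Phi$ is a classical solution on $(0,T)\times\mathbf R^3$ of $$\partial_tu=\Delta u-u^3+(3C_1-9C_2)\,u+\xi .$$ (That is: $u$ and $\partial_tu$ exist and are continuous there, $u$ is twice continuously differentiable in space at each fixed time, and the equation holds pointwise.) -/

import Mathlib

open Set Filter Topology MeasureTheory
open scoped SchwartzMap ContDiff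

namespace Phi43

/-! ## Space-time -/

/-- Space-time `ℝ × ℝ³`; the coordinate `0` is time, the coordinates `1, 2, 3` are space. -/
abbrev Spacetime : Type := Fin 4 → ℝ

/-- The parabolic size `|t|^{1/2} + |x₁| + |x₂| + |x₃|`. -/
noncomputable def pnorm (z : Spacetime) : ℝ := Real.sqrt |z 0| + |z 1| + |z 2| + |z 3|

/-- The parabolic degree `2k₀ + k₁ + k₂ + k₃` of a multiindex. -/
def sdeg (k : Fin 4 → ℕ) : ℕ := 2 * k 0 + k 1 + k 2 + k 3

/-- The finite set of multiindices of parabolic degree `< γ`. -/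
noncomputable def multiBelow (γ : ℝ) : Finset (Fin 4 → ℕ) :=
  open Classical in
  (Fintype.piFinset fun _ => Finset.range ⌈γ⌉₊).filter fun k => (sdeg k : ℝ) < γ

theorem mem_multiBelow {γ : ℝ} {k : Fin 4 → ℕ} : k ∈ multiBelow γ ↔ (sdeg k : ℝ) < γ := by
  classical
  simp only [multiBelow, Finset.mem_filter, Fintype.mem_piFinset, Finset.mem_range,
    and_iff_right_iff_imp]
  intro h i
  rw [Nat.lt_ceil]
  refine lt_of_le_of_lt ?_ h
  have : k i ≤ sdeg k := by
    unfold sdeg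
    fin_cases i <;> simp <;> omega
  exact_mod_cast this

/-- The partial derivative in the `i`-th coordinate direction. -/
noncomputable def pd (i : Fin 4) (f : Spacetime → ℝ) : Spacetime → ℝ :=
  fun z => lineDeriv ℝ f z (Pi.single i 1)

/-- The iterated partial derivative `D^k`. -/
noncomputable def mpd (k : Fin 4 → ℕ) (f : Spacetime → ℝ) : Spacetime → ℝ :=
  (pd 0)^[k 0] ((pd 1)^[k 1] ((pd 2)^[k 2] ((pd 3)^[k 3] f)))

/-- The open slab `(0, T) × ℝ³`. -/
def slab (T : ℝ) : Set Spacetime := {z | 0 < z 0 ∧ z 0 < T}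

/-! ## The heat kernel and its decomposition -/

/-- The heat kernel of `∂_t - Δ` on `ℝ × ℝ³`. -/
noncomputable def heatKernel (z : Spacetime) : ℝ :=
  if 0 < z 0 then
    (4 * Real.pi * z 0) ^ (-(3 / 2) : ℝ) *
      Real.exp (-(z 1 ^ 2 + z 2 ^ 2 + z 3 ^ 2) / (4 * z 0))
  else 0

/-- A decomposition `G = K + K̂` of the heat kernel into a smooth function `K̂` and
a kernel `K = ∑ₙ Kₙ`, where `Kₙ` is smooth, supported in the parabolic ball of radius `2⁻ⁿ`, obeys
the bounds of a kernel of order `β = 2` in effective dimension `5`, and annihilates all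
polynomials of parabolic degree at most `N`. -/
structure HeatKernelSplit (N : ℕ) where
  /-- the pieces `Kₙ` of the singular part -/
  Kn : ℕ → Spacetime → ℝ
  /-- the smooth remainder `K̂` -/
  Khat : Spacetime → ℝ
  smooth_Kn : ∀ n, ContDiff ℝ ∞ (Kn n)
  support_Kn : ∀ n z, Kn n z ≠ 0 → pnorm z ≤ (2 : ℝ) ^ (-(n : ℤ))
  bound_Kn : ∀ k : Fin 4 → ℕ, ∃ C : ℝ, ∀ n z, |mpd k (Kn n) z| ≤ C * 2 ^ (n * (3 + sdeg k))
  annihilate : ∀ (n : ℕ) (k : Fin 4 → ℕ), sdeg k ≤ N → ∫ z, Kn n z * ∏ i, z i ^ k i = 0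
  smooth_Khat : ContDiff ℝ ∞ Khat
  decomp : ∀ z, z ≠ 0 → HasSum (fun n => Kn n z) (heatKernel z - Khat z)

namespace HeatKernelSplit

variable {N : ℕ} (K : HeatKernelSplit N)

/-- Convolution `K * g` of the singular part with a function. -/
noncomputable def conv (g : Spacetime → ℝ) : Spacetime → ℝ :=
  fun x => ∫ y, (∑' n, K.Kn n (x - y)) * g y

/-- `∫ D^k K(x - y) g(y) dy`, understood as `∑ₙ ∫ D^k Kₙ(x - y) g(y) dy`. -/
noncomputable def coeffAt (k : Fin 4 → ℕ) (x : Spacetime) (g : Spacetime → ℝ) : ℝ :=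
  ∑' n, ∫ y, mpd k (K.Kn n) (x - y) * g y

end HeatKernelSplit

/-! ## The symbols

The formal expressions are the elements of the free commutative monoid with a unary operation
`int` (abstract integration) generated by the noise and the four coordinates. -/

/-- Terms built from `1`, the noise, the coordinates, products and the integration map. -/
inductive PreSymbol : Type
  | one : PreSymbol
  | noise : PreSymbol
  | coord : Fin 4 → PreSymbol
  | mul : PreSymbol → PreSymbol → PreSymbol
  | int : PreSymbol → PreSymbol

/-- The smallest congruence that makes the product commutative, associative and unital. -/
inductive PreSymbol.Rel : PreSymbol → PreSymbol → Prop
  | refl (a) : Rel a a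
  | symm {a b} : Rel a b → Rel b a
  | trans {a b c} : Rel a b → Rel b c → Rel a c
  | mul {a a' b b'} : Rel a a' → Rel b b' → Rel (.mul a b) (.mul a' b')
  | int {a a'} : Rel a a' → Rel (.int a) (.int a')
  | mul_comm (a b) : Rel (.mul a b) (.mul b a)
  | mul_assoc (a b c) : Rel (.mul (.mul a b) c) (.mul a (.mul b c))
  | one_mul (a) : Rel (.mul .one a) a

instance PreSymbol.setoid : Setoid PreSymbol :=
  ⟨PreSymbol.Rel, ⟨.refl, .symm, .trans⟩⟩

/-- Formal expressions, up to commutativity and associativity of the product. -/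
def Symbol : Type := Quotient PreSymbol.setoid

namespace Symbol

/-- The class of a term. -/
def mk (a : PreSymbol) : Symbol := Quotient.mk _ a

instance : CommMonoid Symbol where
  mul := Quotient.map₂ PreSymbol.mul fun _ _ h _ _ h' => .mul h h'
  one := mk .one
  mul_assoc := by
    rintro ⟨a⟩ ⟨b⟩ ⟨c⟩
    exact Quotient.sound (.mul_assoc a b c)
  mul_comm := by
    rintro ⟨a⟩ ⟨b⟩
    exact Quotient.sound (.mul_comm a b)
  one_mul := by
    rintro ⟨a⟩
    exact Quotient.sound (.one_mul a)
  mul_one := by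
    rintro ⟨a⟩
    exact Quotient.sound (.trans (.mul_comm a .one) (.one_mul a))

noncomputable instance : DecidableEq Symbol := Classical.decEq _

/-- The noise symbol `Ξ`. -/
def noise : Symbol := mk .noise

/-- The coordinate symbol `X_i`. -/
def coord (i : Fin 4) : Symbol := mk (.coord i)

/-- The symbol `I(τ)`. -/
def int : Symbol → Symbol := Quotient.map PreSymbol.int fun _ _ h => .int h

theorem mk_mul (a b : PreSymbol) : mk (.mul a b) = mk a * mk b := rfl

theorem mk_int (a : PreSymbol) : mk (.int a) = int (mk a) := rfl

@[elab_as_elim]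
theorem induction {p : Symbol → Prop} (one : p 1) (noise : p noise) (coord : ∀ i, p (coord i))
    (mul : ∀ a b, p a → p b → p (a * b)) (int : ∀ a, p a → p (int a)) (σ : Symbol) : p σ := by
  refine Quotient.inductionOn σ fun a => ?_
  induction a with
  | one => exact one
  | noise => exact noise
  | coord i => exact coord i
  | mul a b ha hb => exact mul _ _ ha hb
  | int a ha => exact int _ ha

section fold

variable {B : Type*} [CommMonoid B] (b : B) (x : Fin 4 → B) (j : Symbol → B → B)

/-- Structural recursion on terms, with values in a commutative monoid. -/
def preFold : PreSymbol → B
  | .one => 1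
  | .noise => b
  | .coord i => x i
  | .mul s t => preFold s * preFold t
  | .int s => j (mk s) (preFold s)

/-- Structural recursion on symbols: the multiplicative map with `Ξ ↦ b`, `X_i ↦ x i` and
`I(τ) ↦ j τ (value at τ)`. -/
def fold : Symbol →* B where
  toFun := Quotient.lift (preFold b x j) (by
    intro s t h
    change PreSymbol.Rel s t at h
    induction h with
    | refl => rfl
    | symm _ ih => exact ih.symm
    | trans _ _ ih ih' => exact ih.trans ih'
    | mul _ _ ih ih' => simp only [preFold, ih, ih']
    | @int a a' h ih =>
      have : mk a = mk a' := Quotient.sound h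
      simp only [preFold, ih, this]
    | mul_comm a c => exact mul_comm _ _
    | mul_assoc a c d => exact mul_assoc _ _ _
    | one_mul a => exact one_mul _)
  map_one' := rfl
  map_mul' := by
    rintro ⟨s⟩ ⟨t⟩
    rfl

@[simp] theorem fold_noise : fold b x j noise = b := rfl

@[simp] theorem fold_coord (i : Fin 4) : fold b x j (coord i) = x i := rfl

@[simp] theorem fold_int (τ : Symbol) : fold b x j (int τ) = j τ (fold b x j τ) := by
  refine Quotient.inductionOn τ fun s => ?_
  rfl

end fold

/-- The monomial `X^k`. -/
def mono (k : Fin 4 → ℕ) : Symbol := ∏ i, coord i ^ k i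

/-- `τ` is one of the `X^k`. -/
def IsPoly (τ : Symbol) : Prop := ∃ k, τ = mono k

/-- The homogeneity, with `|Ξ| = -5/2 - κ`, `|X₀| = 2`, `|X₁| = |X₂| = |X₃| = 1`,
`|I(τ)| = |τ| + 2` and `|τσ| = |τ| + |σ|`. -/
noncomputable def homog (κ : ℝ) (τ : Symbol) : ℝ :=
  Multiplicative.toAdd (fold (B := Multiplicative ℝ) (Multiplicative.ofAdd (-(5 / 2) - κ))
    (fun i => Multiplicative.ofAdd (if i = 0 then 2 else 1))
    (fun _ a => Multiplicative.ofAdd (Multiplicative.toAdd a + 2)) τ)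

/-- The number of factors `Ξ` at the root. -/
def rootNoise (τ : Symbol) : ℕ :=
  Multiplicative.toAdd (fold (B := Multiplicative ℕ) (Multiplicative.ofAdd 1)
    (fun _ => 1) (fun _ _ => 1) τ)

/-- The exponent of the polynomial factor at the root. -/
def rootPoly (τ : Symbol) : Fin 4 → ℕ :=
  Multiplicative.toAdd (fold (B := Multiplicative (Fin 4 → ℕ)) 1
    (fun i => Multiplicative.ofAdd (Pi.single i 1)) (fun _ _ => 1) τ)

/-- The multiset of all `σ` such that `I(σ)` is a factor at the root. -/
def children (τ : Symbol) : Multiset Symbol :=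
  Multiplicative.toAdd (fold (B := Multiplicative (Multiset Symbol)) 1
    (fun _ => 1) (fun σ _ => Multiplicative.ofAdd {σ}) τ)

/-- The symbol is recovered from the data at the root. -/
theorem eq_of_root (τ : Symbol) :
    τ = noise ^ rootNoise τ * mono (rootPoly τ) * ((children τ).map int).prod := by
  induction τ using Symbol.induction with
  | one => simp [rootNoise, rootPoly, children, mono]
  | noise => simp [rootNoise, rootPoly, children, mono]
  | coord i => simp [rootNoise, rootPoly, children, mono, Pi.single_apply]
  | mul a b ha hb =>
    have h1 : rootNoise (a * b) = rootNoise a + rootNoise b := by simp [rootNoise]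
    have h2 : rootPoly (a * b) = rootPoly a + rootPoly b := by simp [rootPoly]
    have h3 : children (a * b) = children a + children b := by simp [children]
    have h4 : mono (rootPoly a + rootPoly b) = mono (rootPoly a) * mono (rootPoly b) := by
      simp [mono, pow_add, Finset.prod_mul_distrib]
    rw [h1, h2, h3, h4, Multiset.map_add, Multiset.prod_add, pow_add]
    nth_rewrite 1 [ha, hb]
    ac_rfl
  | int a _ => simp [rootNoise, rootPoly, children, mono]

/-- `τ` with the factors `I(σ)`, `σ ∈ s`, at the root removed. -/
noncomputable def prune (τ : Symbol) (s : Multiset Symbol) : Symbol :=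
  noise ^ rootNoise τ * mono (rootPoly τ) * ((children τ - s).map int).prod

/-- The number of factors `I(Ξ)` at the root. -/
noncomputable def numPsi (τ : Symbol) : ℕ := (children τ).count noise

/-- The collection `U`: it contains the monomials `X^k` and `I(Ξ)`, and
`I(τ₁ τ₂ τ₃)` whenever it contains `τ₁, τ₂, τ₃`; since `I(X^k) = 0`, integrals of monomials
are left out. The basis of the model space `T` consists of `Ξ` and of the products of three
elements of `U`. -/
inductive InU : Symbol → Prop
  | mono (k : Fin 4 → ℕ) : InU (mono k)
  | psi : InU (int noise)
  | int {a b c : Symbol} : InU a → InU b → InU c → ¬ IsPoly (a * b * c) → InU (int (a * b * c))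

end Symbol

/-! ## Linear combinations of symbols -/

/-- Formal linear combinations of symbols, with the product of symbols extended bilinearly.
The model space `T` is the span of the symbols `Ξ` and `τ₁ τ₂ τ₃` with `τᵢ ∈ U`. -/
abbrev Alg : Type := MonoidAlgebra ℝ Symbol

namespace Alg

/-- A symbol as a basis vector. -/
noncomputable def of (τ : Symbol) : Alg := MonoidAlgebra.of ℝ Symbol τ

/-- The linear map with given values on the symbols. -/
noncomputable def extend {V : Type*} [AddCommGroup V] [Module ℝ V] (f : Symbol → V) :
    Alg →ₗ[ℝ] V :=
  Finsupp.linearCombination ℝ f ∘ₗ (MonoidAlgebra.coeffLinearEquiv ℝ).toLinearMap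

/-- The multiplicative linear map with given values on the symbols. -/
noncomputable def extendAlg {V : Type*} [CommRing V] [Algebra ℝ V] (f : Symbol →* V) :
    Alg →ₐ[ℝ] V :=
  MonoidAlgebra.lift ℝ V Symbol f

@[simp] theorem extend_of {V : Type*} [AddCommGroup V] [Module ℝ V] (f : Symbol → V)
    (τ : Symbol) : extend f (of τ) = f τ := by
  simp [extend, of, MonoidAlgebra.of_apply, MonoidAlgebra.coeffLinearEquiv]

@[simp] theorem extendAlg_of {V : Type*} [CommRing V] [Algebra ℝ V] (f : Symbol →* V)
    (τ : Symbol) : extendAlg f (of τ) = f τ := by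
  simp [extendAlg, of]

/-- The projection onto the components of homogeneity `< γ`. -/
noncomputable def trunc (κ γ : ℝ) : Alg →ₗ[ℝ] Alg :=
  open Classical in extend fun τ => if τ.homog κ < γ then of τ else 0

/-- The norm of the component of homogeneity `α`. -/
noncomputable def normAt (κ α : ℝ) (a : Alg) : ℝ :=
  open Classical in ∑ τ ∈ a.coeff.support.filter (fun τ => τ.homog κ = α), |a.coeff τ|

/-- The abstract integration map `I`, with `I(X^k) = 0`. -/
noncomputable def int : Alg →ₗ[ℝ] Alg :=
  open Classical in extend fun τ => if τ.IsPoly then 0 else of τ.int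

/-- `∑_{|k| < γ} (c k / k!) P^k` for a quadruple `P`. -/
noncomputable def jetIn (P : Fin 4 → Alg) (γ : ℝ) (c : (Fin 4 → ℕ) → ℝ) : Alg :=
  ∑ k ∈ multiBelow γ, (c k / ((∏ i, (k i).factorial : ℕ) : ℝ)) • ∏ i, P i ^ k i

/-- `∑_{|k| < γ} (c k / k!) X^k`. -/
noncomputable def jet (γ : ℝ) (c : (Fin 4 → ℕ) → ℝ) : Alg :=
  jetIn (fun i => of (Symbol.coord i)) γ c

end Alg

/-! ## The renormalisation map -/

section renormalisation

open Phi43.Symbol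

/-- Sum, over all nodes of a term other than the root, of the results of applying the operation
`P` at that node (a derivation for the product). -/
noncomputable def preBelowRoot (P : Symbol → Alg) : PreSymbol → Alg
  | .one => 0
  | .noise => 0
  | .coord _ => 0
  | .mul a b => preBelowRoot P a * Alg.of (mk b) + Alg.of (mk a) * preBelowRoot P b
  | .int a => Alg.int (P (mk a) + preBelowRoot P a)

/-- Sum, over all nodes of a symbol other than the root, of the results of applying the
operation `P` at that node. -/
noncomputable def belowRoot (P : Symbol → Alg) : Symbol → Alg :=
  Quotient.lift (preBelowRoot P) (by
    intro s t h
    change PreSymbol.Rel s t at h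
    have hof : ∀ a b : Symbol, Alg.of (a * b) = Alg.of a * Alg.of b := fun a b => by
      simp [Alg.of]
    have hone : Alg.of (mk .one) = 1 := map_one (MonoidAlgebra.of ℝ Symbol)
    have hmk : ∀ {a a' : PreSymbol}, PreSymbol.Rel a a' → mk a = mk a' :=
      fun h => Quotient.sound h
    induction h with
    | refl => rfl
    | symm _ ih => exact ih.symm
    | trans _ _ ih ih' => exact ih.trans ih'
    | mul h h' ih ih' => simp only [preBelowRoot, ih, ih', hmk h, hmk h']
    | int h ih => simp only [preBelowRoot, ih, hmk h]
    | mul_comm a c => simp only [preBelowRoot]; ring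
    | mul_assoc a c d => simp only [preBelowRoot, mk_mul, hof]; ring
    | one_mul a => simp only [preBelowRoot, hone]; ring)

/-- Sum over all nodes of the results of applying `P` at that node. -/
noncomputable def everywhere (P : Symbol → Alg) : Alg →ₗ[ℝ] Alg :=
  Alg.extend fun τ => P τ + belowRoot P τ

/-- The substitution `I(Ξ)² ↦ 1` at the root, in all possible ways. -/
noncomputable def contract₁ (τ : Symbol) : Alg :=
  (τ.numPsi.choose 2 : ℝ) • Alg.of (τ.prune {noise, noise})

/-- The substitution `I(I(Ξ)²) I(Ξ)² ↦ 1` at the root, in all possible ways: choose two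
factors `I(Ξ)` and a further factor `I(σ)` at the root, and two factors `I(Ξ)` of `σ`; what
is left over of `σ` becomes a factor at the root. -/
noncomputable def contract₂ (τ : Symbol) : Alg :=
  (τ.numPsi.choose 2 : ℝ) • (τ.children.map fun σ => (σ.numPsi.choose 2 : ℝ) •
    Alg.of (τ.prune {noise, noise, σ} * σ.prune {noise, noise})).sum

/-- The generator `L₁`, given by the substitution `I(Ξ)² ↦ 1`. -/
noncomputable def L₁ : Alg →ₗ[ℝ] Alg := everywhere contract₁

/-- The generator `L₂`, given by the substitution `I(I(Ξ)²) I(Ξ)² ↦ 1`. -/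
noncomputable def L₂ : Alg →ₗ[ℝ] Alg := everywhere contract₂

/-- `M = exp(-C₁ L₁ - C₂ L₂)`. Both generators remove noises, so that the exponential series of
every symbol is a finite sum. -/
noncomputable def renormMap (C₁ C₂ : ℝ) : Alg →ₗ[ℝ] Alg :=
  Alg.extend fun τ => ∑ᶠ n : ℕ, ((n.factorial : ℝ)⁻¹) • ((-(C₁ • L₁) - C₂ • L₂) ^ n) (Alg.of τ)

end renormalisation

/-! ## Models

A model is encoded by a linear map `PP : T → C(ℝ⁴)` (the "bold `Π`"), from which the maps `F_x`,
`Π_x = PP ∘ F_x` and `Γ_{xy} = F_x⁻¹ ∘ F_y` are recovered recursively. -/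

section model

variable (κ : ℝ) {N : ℕ} (K : HeatKernelSplit N)

/-- The canonical `PP` of a function `ξ`: multiplicative, with `PP Ξ = ξ`, `(PP X_i)(x) = x_i` and
`PP I(τ) = K * PP τ`. -/
noncomputable def canonicalPP (ξ : Spacetime → ℝ) : Alg →ₗ[ℝ] (Spacetime → ℝ) :=
  (Alg.extendAlg (Symbol.fold ξ (fun i x => x i) (fun _ g => K.conv g))).toLinearMap

variable (PP : Alg →ₗ[ℝ] (Spacetime → ℝ))

/-- The map `F_x`: multiplicative, with `F_x Ξ = Ξ`, `F_x X_i = X_i - x_i` and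
`F_x I(τ) = I(F_x τ) - ∑_{|k| < |τ| + 2} (X - x)^k / k! ∫ D^k K(x - y) (Π_x τ)(y) dy`, where
`Π_x τ = PP (F_x τ)`. -/
noncomputable def recenter (x : Spacetime) : Alg →ₐ[ℝ] Alg :=
  Alg.extendAlg (Symbol.fold (Alg.of Symbol.noise)
    (fun i => Alg.of (Symbol.coord i) - algebraMap ℝ Alg (x i))
    (fun τ a => Alg.int a -
      Alg.jetIn (fun i => Alg.of (Symbol.coord i) - algebraMap ℝ Alg (x i)) (τ.homog κ + 2)
        (fun k => K.coeffAt k x (PP a))))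

/-- The map `Π_x`. -/
noncomputable def modelPi (x : Spacetime) : Alg →ₗ[ℝ] (Spacetime → ℝ) :=
  PP ∘ₗ (recenter κ K PP x).toLinearMap

/-- `J(x) τ = ∑_{|k| < |τ| + 2} X^k / k! ∫ D^k K(x - y) (Π_x τ)(y) dy`; for `τ = X^k` all these
integrals vanish since `K` annihilates polynomials, and `J(x) X^k` is set to `0` for all `k`. -/
noncomputable def modelJ (x : Spacetime) : Alg →ₗ[ℝ] Alg :=
  open Classical in Alg.extend fun τ =>
    if τ.IsPoly then 0
    else Alg.jet (τ.homog κ + 2) (fun k => K.coeffAt k x (modelPi κ K PP x (Alg.of τ)))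

/-- The inverse of `F_x`: multiplicative, with `Ξ ↦ Ξ`, `X_i ↦ X_i + x_i` and
`F_x⁻¹ I(τ) = (I + J(x)) F_x⁻¹ τ`. -/
noncomputable def recenterInv (x : Spacetime) : Alg →ₐ[ℝ] Alg :=
  Alg.extendAlg (Symbol.fold (Alg.of Symbol.noise)
    (fun i => Alg.of (Symbol.coord i) + algebraMap ℝ Alg (x i))
    (fun _ a => Alg.int a + modelJ κ K PP x a))

/-- `Γ_{xy} = F_x⁻¹ F_y`. -/
noncomputable def modelGamma (x y : Spacetime) : Alg →ₐ[ℝ] Alg :=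
  (recenterInv κ K PP x).comp (recenter κ K PP y)

/-! ### The maps `F_x` and `F_x⁻¹` are inverse to each other -/

section inverse

open Phi43.Symbol

/-- The symbols that do not contain any `I(X^k)`. -/
inductive Symbol.Reduced : Symbol → Prop
  | one : Reduced 1
  | noise : Reduced noise
  | coord (i : Fin 4) : Reduced (coord i)
  | mul {a b : Symbol} : Reduced a → Reduced b → Reduced (a * b)
  | int {a : Symbol} : Reduced a → ¬ Symbol.IsPoly a → Reduced (int a)

theorem Alg.of_mul (a b : Symbol) : Alg.of (a * b) = Alg.of a * Alg.of b := by simp [Alg.of]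

theorem Alg.of_one : Alg.of 1 = 1 := map_one (MonoidAlgebra.of ℝ Symbol)

theorem Alg.of_mono (k : Fin 4 → ℕ) : Alg.of (mono k) = ∏ i, Alg.of (coord i) ^ k i := by
  simp [Alg.of, mono]

theorem Alg.induction {p : Alg → Prop} (a : Alg) (of : ∀ τ, p (Alg.of τ))
    (add : ∀ a b, p a → p b → p (a + b)) (smul : ∀ (r : ℝ) a, p a → p (r • a)) : p a :=
  MonoidAlgebra.induction_on a (fun τ => of τ) (fun a b => add a b) (fun r a => smul r a)

/-- The span of the polynomials `X^k`. -/
noncomputable def polySub : Subalgebra ℝ Alg :=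
  Algebra.adjoin ℝ (Set.range fun i => Alg.of (coord i))

theorem polySub_span {a : Alg} (ha : a ∈ polySub) :
    a ∈ Submodule.span ℝ (Set.range fun k => Alg.of (mono k)) := by
  induction ha using Algebra.adjoin_induction with
  | mem x hx =>
    obtain ⟨i, rfl⟩ := hx
    refine Submodule.subset_span ⟨Pi.single i 1, ?_⟩
    simp only
    congr 1
    simp [mono, Pi.single_apply]
  | algebraMap r =>
    rw [Algebra.algebraMap_eq_smul_one]
    refine Submodule.smul_mem _ _ (Submodule.subset_span ⟨0, ?_⟩)
    simp [mono, Alg.of_one]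
  | add x y _ _ hx hy => exact Submodule.add_mem _ hx hy
  | mul x y _ _ hx hy =>
    have := Submodule.mul_mem_mul hx hy
    rw [Submodule.span_mul_span] at this
    refine Submodule.span_mono ?_ this
    rintro _ ⟨_, ⟨k, rfl⟩, _, ⟨l, rfl⟩, rfl⟩
    exact ⟨k + l, by simp [Alg.of_mono, pow_add, Finset.prod_mul_distrib]⟩

theorem int_of_poly {a : Alg} (ha : a ∈ polySub) : Alg.int a = 0 := by
  have : Submodule.span ℝ (Set.range fun k => Alg.of (mono k)) ≤ LinearMap.ker Alg.int := by
    rw [Submodule.span_le]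
    rintro _ ⟨k, rfl⟩
    simp [Alg.int, Symbol.IsPoly]
  exact this (polySub_span ha)

variable (x : Spacetime)

theorem modelJ_of_poly {a : Alg} (ha : a ∈ polySub) : modelJ κ K PP x a = 0 := by
  have : Submodule.span ℝ (Set.range fun k => Alg.of (mono k)) ≤
      LinearMap.ker (modelJ κ K PP x) := by
    rw [Submodule.span_le]
    rintro _ ⟨k, rfl⟩
    simp [modelJ, Symbol.IsPoly]
  exact this (polySub_span ha)

theorem coord_mem (i : Fin 4) : Alg.of (coord i) ∈ polySub :=
  Algebra.subset_adjoin ⟨i, rfl⟩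

theorem map_mono_mem (F : Alg →ₐ[ℝ] Alg) (hF : ∀ i, F (Alg.of (coord i)) ∈ polySub)
    (k : Fin 4 → ℕ) : F (Alg.of (mono k)) ∈ polySub := by
  rw [Alg.of_mono, map_prod]
  refine Subalgebra.prod_mem _ fun i _ => ?_
  rw [map_pow]
  exact Subalgebra.pow_mem _ (hF i) _

theorem recenter_coord (i : Fin 4) : recenter κ K PP x (Alg.of (coord i)) =
    Alg.of (coord i) - algebraMap ℝ Alg (x i) := by simp [recenter]

theorem recenterInv_coord (i : Fin 4) : recenterInv κ K PP x (Alg.of (coord i)) =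
    Alg.of (coord i) + algebraMap ℝ Alg (x i) := by simp [recenterInv]

theorem recenter_of_int (τ : Symbol) : recenter κ K PP x (Alg.of (int τ)) =
    Alg.int (recenter κ K PP x (Alg.of τ)) -
      recenter κ K PP x (Alg.jet (τ.homog κ + 2)
        fun k => K.coeffAt k x (modelPi κ K PP x (Alg.of τ))) := by
  simp only [Alg.jet, Alg.jetIn, map_sum, map_smul, map_prod, map_pow, recenter_coord, modelPi,
    LinearMap.comp_apply, AlgHom.toLinearMap_apply]
  simp [recenter, Alg.jetIn]

theorem recenterInv_of_int (τ : Symbol) : recenterInv κ K PP x (Alg.of (int τ)) =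
    Alg.int (recenterInv κ K PP x (Alg.of τ)) +
      modelJ κ K PP x (recenterInv κ K PP x (Alg.of τ)) := by
  simp [recenterInv]

theorem recenter_int_add_modelJ (a : Alg) :
    recenter κ K PP x (Alg.int a + modelJ κ K PP x a) = Alg.int (recenter κ K PP x a) := by
  induction a using Alg.induction with
  | of τ =>
    by_cases h : τ.IsPoly
    · obtain ⟨k, rfl⟩ := h
      have hm : Alg.of (mono k) ∈ polySub := map_mono_mem (AlgHom.id ℝ Alg) coord_mem k
      have h1 := map_mono_mem (recenter κ K PP x) (fun i => by
        rw [recenter_coord]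
        exact sub_mem (coord_mem i) (Subalgebra.algebraMap_mem _ _)) k
      rw [int_of_poly hm, modelJ_of_poly κ K PP x hm, int_of_poly h1, add_zero, map_zero]
    · have h1 : Alg.int (Alg.of τ) = Alg.of (int τ) := by simp [Alg.int, h]
      rw [h1, map_add, recenter_of_int]
      simp [modelJ, h]
  | add a b ha hb =>
    rw [map_add Alg.int, map_add (modelJ κ K PP x), add_add_add_comm, map_add, ha, hb, map_add,
      map_add]
  | smul r a ha =>
    rw [map_smul, map_smul, ← smul_add, map_smul, ha, map_smul, map_smul]

theorem recenterInv_int (a : Alg) : recenterInv κ K PP x (Alg.int a) =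
    Alg.int (recenterInv κ K PP x a) + modelJ κ K PP x (recenterInv κ K PP x a) := by
  induction a using Alg.induction with
  | of τ =>
    by_cases h : τ.IsPoly
    · obtain ⟨k, rfl⟩ := h
      have hm : Alg.of (mono k) ∈ polySub := map_mono_mem (AlgHom.id ℝ Alg) coord_mem k
      have h1 := map_mono_mem (recenterInv κ K PP x) (fun i => by
        rw [recenterInv_coord]
        exact add_mem (coord_mem i) (Subalgebra.algebraMap_mem _ _)) k
      rw [int_of_poly hm, int_of_poly h1, modelJ_of_poly κ K PP x h1, add_zero, map_zero]
    · have h1 : Alg.int (Alg.of τ) = Alg.of (int τ) := by simp [Alg.int, h]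
      rw [h1, recenterInv_of_int]
  | add a b ha hb => simp only [map_add, ha, hb]; abel
  | smul r a ha => simp only [map_smul, ha, smul_add]

theorem recenter_recenterInv {τ : Symbol} (h : τ.Reduced) :
    recenter κ K PP x (recenterInv κ K PP x (Alg.of τ)) = Alg.of τ := by
  induction h with
  | one => simp [Alg.of_one]
  | noise => simp [recenter, recenterInv]
  | coord i => rw [recenterInv_coord, map_add, recenter_coord, AlgHom.commutes, sub_add_cancel]
  | mul _ _ ha hb => rw [Alg.of_mul, map_mul, map_mul, ha, hb]
  | @int a _ hp ha =>
    rw [recenterInv_of_int, recenter_int_add_modelJ, ha]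
    simp [Alg.int, hp]

theorem recenterInv_recenter {τ : Symbol} (h : τ.Reduced) :
    recenterInv κ K PP x (recenter κ K PP x (Alg.of τ)) = Alg.of τ := by
  induction h with
  | one => simp [Alg.of_one]
  | noise => simp [recenter, recenterInv]
  | coord i => rw [recenter_coord, map_sub, recenterInv_coord, AlgHom.commutes,
      add_sub_cancel_right]
  | mul _ _ ha hb => rw [Alg.of_mul, map_mul, map_mul, ha, hb]
  | @int a _ hp ha =>
    have hj : ∀ (γ : ℝ) (c : (Fin 4 → ℕ) → ℝ),
        recenterInv κ K PP x (recenter κ K PP x (Alg.jet γ c)) = Alg.jet γ c := by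
      intro γ c
      simp only [Alg.jet, Alg.jetIn, map_sum, map_smul, map_prod, map_pow, recenter_coord,
        map_sub, recenterInv_coord, AlgHom.commutes, add_sub_cancel_right]
    rw [recenter_of_int, map_sub, recenterInv_int, ha, hj]
    simp [Alg.int, modelJ, hp]

end inverse

/-- The renormalised model `M ι ξ` is the model of `PP ∘ M`, where `PP` belongs to `ι ξ`. -/
noncomputable def renormPP (C₁ C₂ : ℝ) (ξ : Spacetime → ℝ) : Alg →ₗ[ℝ] (Spacetime → ℝ) :=
  canonicalPP K ξ ∘ₗ renormMap C₁ C₂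

/-! ## Modelled distributions and reconstruction -/

/-- The space `D^{γ,η}` on `(0, T) × ℝ³`, with a possible singularity at time `0`, of functions
with values in the span of `U`; `ζ z = 1 ∧ |t|^{1/2}` is the distance to the time-zero plane. -/
structure IsModelled (γ η T : ℝ) (f : Spacetime → Alg) : Prop where
  mem_U : ∀ z ∈ slab T, ∀ τ ∈ (f z).coeff.support, τ.InU ∧ τ.homog κ < γ
  size : ∀ α < γ, ∃ C : ℝ, ∀ z ∈ slab T,
    Alg.normAt κ α (f z) ≤ C * (min 1 (Real.sqrt (z 0))) ^ (min (η - α) 0)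
  increment : ∀ α < γ, ∃ C : ℝ, ∀ z ∈ slab T, ∀ w ∈ slab T,
    pnorm (z - w) ≤ min 1 (Real.sqrt (min (z 0) (w 0))) →
    Alg.normAt κ α (f z - modelGamma κ K PP z w (f w)) ≤
      C * pnorm (z - w) ^ (γ - α) * (min 1 (Real.sqrt (min (z 0) (w 0)))) ^ (η - γ)

/-- `φ` belongs to `B_3`: class `C³` with norm at most `1`, supported in the unit ball. -/
def IsTest (φ : Spacetime → ℝ) : Prop :=
  ContDiff ℝ 3 φ ∧ (∀ m ≤ 3, ∀ y, ‖iteratedFDeriv ℝ m φ y‖ ≤ 1) ∧ ∀ y, φ y ≠ 0 → pnorm y ≤ 1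

/-- The test function `φ` recentred at `x` and parabolically rescaled by `r`. -/
noncomputable def rescale (φ : Spacetime → ℝ) (x : Spacetime) (r : ℝ) : Spacetime → ℝ :=
  fun y => (r ^ 5)⁻¹ * φ (fun i => (y i - x i) / (if i = 0 then r ^ 2 else r))

/-- `g` is a continuous function on `(0, T) × ℝ³`, extended by `0`, which is a reconstruction of
`f` there: `|(g - Π_x f(x))(φ_x^r)| ≲ r^γ` uniformly over `φ` and locally uniformly in `x`. -/
def IsReconstruction (γ T : ℝ) (f : Spacetime → Alg) (g : Spacetime → ℝ) : Prop :=
  (∀ z ∉ slab T, g z = 0) ∧ ContinuousOn g (slab T) ∧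
  ∀ A ⊆ slab T, IsCompact A → ∃ C : ℝ, ∃ r₀ > 0, ∀ x ∈ A, ∀ r, 0 < r → r ≤ r₀ →
    ∀ φ, IsTest φ →
      |∫ y, (g y - modelPi κ K PP x (f x) y) * rescale φ x r y| ≤ C * r ^ γ

/-- The reconstruction operator on `(0, T) × ℝ³` (for a model consisting of continuous functions
the reconstruction is a continuous function). For `γ > 0` there is at most one reconstruction. -/
noncomputable def reconstruct (γ T : ℝ) (f : Spacetime → Alg) : Spacetime → ℝ :=
  open Classical in
  if h : ∃ g, IsReconstruction κ K PP γ T f g then h.choose else 0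

/-! ## The abstract fixed point problem -/

/-- Periodicity with period one in each space direction. -/
def SpacePeriodic {V : Type*} (f : Spacetime → V) : Prop :=
  ∀ z, ∀ i : Fin 3, f (z + Pi.single i.succ 1) = f z

/-- Tempered distributions on `ℝ³` with period one in each direction, i.e. distributions on the
torus. -/
def PeriodicDistribution (Φ₀ : 𝓢(EuclideanSpace ℝ (Fin 3), ℝ) →L[ℝ] ℝ) : Prop :=
  ∀ (i : Fin 3) (φ ψ : 𝓢(EuclideanSpace ℝ (Fin 3), ℝ)),
    (∀ x, ψ x = φ (x + EuclideanSpace.single i 1)) → Φ₀ ψ = Φ₀ φ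

/-- The harmonic extension `(G Φ₀)(t, x) = Φ₀(G(t, x - ·))`; `G(t, ·)` is a Schwartz function. -/
noncomputable def harmonicExt (Φ₀ : 𝓢(EuclideanSpace ℝ (Fin 3), ℝ) →L[ℝ] ℝ)
    (z : Spacetime) : ℝ :=
  open Classical in
  if h : ∃ g : 𝓢(EuclideanSpace ℝ (Fin 3), ℝ),
      ∀ y, g y = heatKernel (Fin.cons (z 0) fun i : Fin 3 => z i.succ - y i)
    then Φ₀ h.choose else 0

/-- The order `γ - 1 - 2κ` up to which the right hand side is described if the solution is
described up to order `γ`. -/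
noncomputable def rhsOrder (γ : ℝ) : ℝ := γ - 1 - 2 * κ

/-- The right hand side `Ξ - Φ³`, up to order `γ - 1 - 2κ`. -/
noncomputable def rhs (γ : ℝ) (Φ : Spacetime → Alg) (z : Spacetime) : Alg :=
  Alg.trunc κ (rhsOrder κ γ) (Alg.of Symbol.noise - Φ z ^ 3)

/-- The lift of convolution with `K`, applied to `f` of order `γ` on `(0, T) × ℝ³` (extended by
zero): `I f(z) + J(z) f(z) + ∑_{|k| < γ + 2} X^k / k! ∫ D^k K(z - w) (R f - Π_z f(z))(dw)`. -/
noncomputable def liftK (γ T : ℝ) (f : Spacetime → Alg) (z : Spacetime) : Alg :=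
  Alg.int (f z) + modelJ κ K PP z (f z) +
    Alg.jet (γ + 2) fun k =>
      K.coeffAt k z fun w => reconstruct κ K PP γ T f w - modelPi κ K PP z (f z) w

/-- The lift of convolution with `K̂`, up to order `γ'`:
`∑_{|k| < γ'} X^k / k! (D^k K̂ * R f)(z)`. -/
noncomputable def liftKhat (γ T γ' : ℝ) (f : Spacetime → Alg) (z : Spacetime) : Alg :=
  Alg.jet γ' fun k => ∫ w, mpd k K.Khat (z - w) * reconstruct κ K PP γ T f w

/-- `Φ ∈ D^{γ,η}` is a space-periodic solution on `(0, T)` of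
`Φ = 𝒦(Ξ - Φ³) + 𝒦̂(Ξ - Φ³) + G Φ₀`, where the right hand side `Ξ - Φ³` is restricted to times
in `(0, T)` and the equation is read up to order `γ`. -/
structure IsAbstractSolution (γ η T : ℝ) (Φ₀ : 𝓢(EuclideanSpace ℝ (Fin 3), ℝ) →L[ℝ] ℝ)
    (Φ : Spacetime → Alg) : Prop where
  periodic : SpacePeriodic Φ
  modelled : IsModelled κ K PP γ η T Φ
  fixedPoint : ∀ z ∈ slab T, Φ z = Alg.trunc κ γ
    (liftK κ K PP (rhsOrder κ γ) T (rhs κ γ Φ) z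
      + liftKhat κ K PP (rhsOrder κ γ) T γ (rhs κ γ Φ) z
      + Alg.jet γ fun k => mpd k (harmonicExt Φ₀) z)

end model

/-- `u` is a classical solution of `∂_t u = Δu - u³ + c u + ξ` on `(0, T) × ℝ³`. -/
structure IsClassicalSolution (T c : ℝ) (ξ u : Spacetime → ℝ) : Prop where
  continuousOn : ContinuousOn u (slab T)
  differentiable_time : ∀ z ∈ slab T, DifferentiableAt ℝ (fun t => u (Function.update z 0 t)) (z 0)
  continuousOn_time : ContinuousOn (pd 0 u) (slab T)
  contDiff_space : ∀ z ∈ slab T,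
    ContDiffAt ℝ 2 (fun x : Fin 3 → ℝ => u (Fin.cons (z 0) x)) (fun i => z i.succ)
  equation : ∀ z ∈ slab T,
    pd 0 u z = (∑ i : Fin 3, pd i.succ (pd i.succ u) z) - u z ^ 3 + c * u z + ξ z

end Phi43

/-! The renormalisation map M fails to be multiplicative in one controlled way. An element of U has
at most one factor `I(Ξ)` at its root, so the substitutions at the root of a product abc of three
elements of U select two factors `I(Ξ)` and act on the third one by −C₁ − C₂Q, where Q
(`childContract`) contracts a pair of `I(Ξ)` at a node next to the root. Let T = `contractTriple
(genLoop C₁ C₂)` be the resulting trilinear form. The generator of M is a derivation plus T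
(`gen_mul`). It commutes with Q and its values contain no `I(Ξ)`, so it acts on T by the Leibniz
rule, and comparing two linear differential equations in the flow parameter gives M(abc) = Ma·Mb·Mc
+ M T(a,b,c) (`renormMap_mul`). The maps F_x are compatible with T, because their polynomial
corrections contain neither `I(Ξ)` nor anything that Q could act on. Hence Π_x(abc) = Π_x a·Π_x
b·Π_x c + Π_x T(a,b,c) (`modelPi_mul`).

A solution has the form Φ = I(Ξ − Φ³) + polynomials, up to truncation. So its coefficient of `I(Ξ)`
is 1 (`psi_eq`), and QΦ = −3Φ up to truncation (`childContract_eq`), since contracting Φ³ at the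
root gives 3Φ. Consequently T(Φ,Φ,Φ) = −3C₁Φ + 9C₂Φ up to truncation, and this is the source of the
mass term.

Since ξ is smooth, the model consists of smooth functions. Π_x I(τ) is a Taylor remainder of K * Π_x
τ, hence of size |v|^max(|I(τ)|, 0) at x + v, locally uniformly in x (`taylorRem_bound`,
`modelPi_bound`). Therefore the reconstruction of Φ is u(z) = (Π_z Φ(z))(z), and that of the
right-hand side is g = ξ − u³ + (3C₁ − 9C₂)u; everything lost by truncation is of order γ − 1 − 2κ
(`IsModelled.reconstruct_rhs`). At the base point only the symbols 1 and `I(Ξ)` are visible, and the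
constant component of the fixed point equation becomes the mild equation u = G * g + GΦ₀
(`diag_eq_integral`).

It remains to see that mild solutions are classical (`classical_of_mild`). The source g is dominated
by an integrable function of time, because the cube of u costs at most t^(3 min(η,0)/2) and η >
−2/3; it is Lipschitz for the parabolic distance on time intervals away from 0 and T. Cutting small
times out of G gives Schwartz kernels, whose convolutions with distributions are smooth. Their first
and second space derivatives converge uniformly, since a derivative of the kernel has integral zero
and the Lipschitz bound pays for half of the singularity t⁻¹; applying ∂_t − Δ produces an
approximate identity, hence g. The initial datum enters as a distribution on the time-zero plane.
Space periodicity makes all these bounds uniform over ℝ³. -/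

namespace Phi43

open Phi43.Symbol

/-! ## Spans of symbols -/

namespace Alg

/-- The span of a set of symbols. -/
noncomputable def spanOf (s : Set Symbol) : Submodule ℝ Alg := Submodule.span ℝ (Alg.of '' s)

theorem of_mem_spanOf {s : Set Symbol} {τ : Symbol} (h : τ ∈ s) : Alg.of τ ∈ spanOf s :=
  Submodule.subset_span ⟨τ, h, rfl⟩

theorem spanOf_mono {s t : Set Symbol} (h : s ⊆ t) : spanOf s ≤ spanOf t :=
  Submodule.span_mono (Set.image_mono h)

theorem spanOf_le {s : Set Symbol} {V : Submodule ℝ Alg} (h : ∀ τ ∈ s, Alg.of τ ∈ V) :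
    spanOf s ≤ V := by
  rw [spanOf, Submodule.span_le]
  rintro _ ⟨τ, hτ, rfl⟩
  exact h τ hτ

theorem map_spanOf {E : Type*} [AddCommGroup E] [Module ℝ E] {s : Set Symbol} {V : Submodule ℝ E}
    (f : Alg →ₗ[ℝ] E) (h : ∀ τ ∈ s, f (Alg.of τ) ∈ V) {a : Alg} (ha : a ∈ spanOf s) : f a ∈ V := by
  have : spanOf s ≤ V.comap f := spanOf_le h
  exact this ha

theorem eq_of_spanOf {E : Type*} [AddCommGroup E] [Module ℝ E] {s : Set Symbol}
    {f g : Alg →ₗ[ℝ] E} (h : ∀ τ ∈ s, f (Alg.of τ) = g (Alg.of τ)) {a : Alg}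
    (ha : a ∈ spanOf s) : f a = g a := by
  have : spanOf s ≤ LinearMap.eqLocus f g := spanOf_le h
  exact this ha

theorem ext_of {E : Type*} [AddCommGroup E] [Module ℝ E] {f g : Alg →ₗ[ℝ] E}
    (h : ∀ τ, f (Alg.of τ) = g (Alg.of τ)) : f = g := by
  refine LinearMap.ext fun a => ?_
  induction a using Alg.induction with
  | of τ => exact h τ
  | add a b ha hb => rw [map_add, map_add, ha, hb]
  | smul r a ha => rw [map_smul, map_smul, ha]

/-- The coefficient of a symbol, as a linear functional. -/
noncomputable def lcoeff (σ : Symbol) : Alg →ₗ[ℝ] ℝ :=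
  Finsupp.lapply σ ∘ₗ (MonoidAlgebra.coeffLinearEquiv ℝ).toLinearMap

theorem lcoeff_apply (σ : Symbol) (a : Alg) : lcoeff σ a = a.coeff σ := rfl

theorem lcoeff_of (σ τ : Symbol) : lcoeff σ (Alg.of τ) = if τ = σ then 1 else 0 := by
  simp [lcoeff_apply, Alg.of, MonoidAlgebra.coeff_single, Finsupp.single_apply]

theorem eq_sum (a : Alg) : a = ∑ τ ∈ a.coeff.support, a.coeff τ • Alg.of τ := by
  refine MonoidAlgebra.coeff_injective ?_
  rw [MonoidAlgebra.coeff_sum]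
  ext σ
  rw [Finset.sum_apply']
  simp only [MonoidAlgebra.coeff_smul_apply, ← lcoeff_apply, lcoeff_of]
  by_cases h : σ ∈ a.coeff.support
  · simp [h]
  · simp only [smul_eq_mul, mul_ite, mul_one, mul_zero, Finset.sum_ite_eq', h, if_false]
    simpa [lcoeff_apply] using h

theorem mem_spanOf {s : Set Symbol} {a : Alg} :
    a ∈ spanOf s ↔ ∀ τ ∈ a.coeff.support, τ ∈ s := by
  constructor
  · intro h
    by_contra! hc
    obtain ⟨τ, hτ, hs⟩ := hc
    have : lcoeff τ a = (0 : Alg →ₗ[ℝ] ℝ) a := eq_of_spanOf (fun σ hσ => by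
      rw [lcoeff_of, if_neg, LinearMap.zero_apply]
      rintro rfl
      exact hs hσ) h
    simp only [Finsupp.mem_support_iff] at hτ
    exact hτ this
  · intro h
    rw [eq_sum a]
    exact Submodule.sum_mem _ fun τ hτ => Submodule.smul_mem _ _ (of_mem_spanOf (h τ hτ))

theorem mem_spanOf_inter {s t : Set Symbol} {a : Alg} (hs : a ∈ spanOf s) (ht : a ∈ spanOf t) :
    a ∈ spanOf (s ∩ t) := by
  rw [mem_spanOf] at *
  exact fun τ hτ => ⟨hs τ hτ, ht τ hτ⟩

theorem mul_mem_spanOf {s t u : Set Symbol} (h : ∀ σ ∈ s, ∀ τ ∈ t, σ * τ ∈ u) {a b : Alg}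
    (ha : a ∈ spanOf s) (hb : b ∈ spanOf t) : a * b ∈ spanOf u := by
  have h1 := Submodule.mul_mem_mul ha hb
  rw [spanOf, spanOf, Submodule.span_mul_span] at h1
  refine Submodule.span_mono ?_ h1
  rintro _ ⟨_, ⟨σ, hσ, rfl⟩, _, ⟨τ, hτ, rfl⟩, rfl⟩
  exact ⟨σ * τ, h σ hσ τ hτ, Alg.of_mul _ _⟩

theorem int_of {τ : Symbol} (h : ¬ τ.IsPoly) : Alg.int (Alg.of τ) = Alg.of τ.int := by
  simp [Alg.int, h]

theorem int_of_isPoly {τ : Symbol} (h : τ.IsPoly) : Alg.int (Alg.of τ) = 0 := by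
  simp [Alg.int, h]

theorem trunc_of (κ γ : ℝ) (τ : Symbol) :
    Alg.trunc κ γ (Alg.of τ) = if τ.homog κ < γ then Alg.of τ else 0 := by
  simp [Alg.trunc]

end Alg

/-! ## Root data and weights of symbols -/

namespace Symbol

@[simp] theorem rootNoise_mul (a b : Symbol) :
    rootNoise (a * b) = rootNoise a + rootNoise b := by simp [rootNoise]
@[simp] theorem rootNoise_noise : rootNoise noise = 1 := by simp [rootNoise]
@[simp] theorem rootNoise_int (a : Symbol) : rootNoise (int a) = 0 := by simp [rootNoise]
@[simp] theorem rootPoly_mul (a b : Symbol) :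
    rootPoly (a * b) = rootPoly a + rootPoly b := by simp [rootPoly]
@[simp] theorem rootPoly_int (a : Symbol) : rootPoly (int a) = 0 := by simp [rootPoly]
@[simp] theorem children_mul (a b : Symbol) :
    children (a * b) = children a + children b := by simp [children]
@[simp] theorem children_noise : children noise = 0 := by simp [children]
@[simp] theorem children_int (a : Symbol) : children (int a) = {a} := by simp [children]

theorem mono_one : mono 0 = 1 := by simp [mono]

theorem mono_add (k l : Fin 4 → ℕ) : mono (k + l) = mono k * mono l := by
  simp [mono, pow_add, Finset.prod_mul_distrib]

theorem coord_eq_mono (i : Fin 4) : coord i = mono (Pi.single i 1) := by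
  simp [mono, Pi.single_apply]

@[simp] theorem children_mono (k : Fin 4 → ℕ) : children (mono k) = 0 := by
  simp [children, mono]

@[simp] theorem rootNoise_mono (k : Fin 4 → ℕ) : rootNoise (mono k) = 0 := by
  simp [rootNoise, mono]

@[simp] theorem rootPoly_mono (k : Fin 4 → ℕ) : rootPoly (mono k) = k := by
  simp only [rootPoly, mono, map_prod, map_pow, fold_coord, toAdd_prod, toAdd_pow, toAdd_ofAdd]
  ext j
  simp [Finset.sum_apply, Pi.single_apply]

theorem mono_injective : Function.Injective mono := fun k l h => by
  simpa using congrArg rootPoly h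

theorem int_injective : Function.Injective int := fun a b h => by
  simpa using congrArg children h

theorem not_isPoly_int (a : Symbol) : ¬ (int a).IsPoly := by
  rintro ⟨k, h⟩
  simpa using congrArg children h

theorem not_isPoly_noise : ¬ noise.IsPoly := by
  rintro ⟨k, h⟩
  simpa using congrArg rootNoise h

/-- The total number of noises in a symbol. -/
def noiseCount (τ : Symbol) : ℕ :=
  Multiplicative.toAdd (fold (B := Multiplicative ℕ) (Multiplicative.ofAdd 1)
    (fun _ => 1) (fun _ a => a) τ)

/-- The parabolic degree of all the coordinates in a symbol. -/
def polyDegree (τ : Symbol) : ℕ :=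
  Multiplicative.toAdd (fold (B := Multiplicative ℕ) 1
    (fun i => Multiplicative.ofAdd (if i = 0 then 2 else 1)) (fun _ a => a) τ)

@[simp] theorem noiseCount_mul (a b : Symbol) :
    noiseCount (a * b) = noiseCount a + noiseCount b := by simp [noiseCount]
@[simp] theorem noiseCount_int (a : Symbol) : noiseCount (int a) = noiseCount a := by
  simp [noiseCount]
@[simp] theorem noiseCount_noise : noiseCount noise = 1 := by simp [noiseCount]
@[simp] theorem noiseCount_mono (k : Fin 4 → ℕ) : noiseCount (mono k) = 0 := by
  simp [noiseCount, mono]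
@[simp] theorem polyDegree_mul (a b : Symbol) :
    polyDegree (a * b) = polyDegree a + polyDegree b := by simp [polyDegree]
@[simp] theorem polyDegree_int (a : Symbol) : polyDegree (int a) = polyDegree a := by
  simp [polyDegree]
@[simp] theorem polyDegree_noise : polyDegree noise = 0 := by simp [polyDegree]
@[simp] theorem polyDegree_mono (k : Fin 4 → ℕ) : polyDegree (mono k) = sdeg k := by
  simp [polyDegree, mono, sdeg, Fin.sum_univ_four]
  ring

@[simp] theorem homog_mul (κ : ℝ) (a b : Symbol) :
    homog κ (a * b) = homog κ a + homog κ b := by simp [homog]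
@[simp] theorem homog_one (κ : ℝ) : homog κ 1 = 0 := by simp [homog]
@[simp] theorem homog_int (κ : ℝ) (a : Symbol) : homog κ (int a) = homog κ a + 2 := by
  simp [homog]
@[simp] theorem homog_noise (κ : ℝ) : homog κ noise = -(5 / 2) - κ := by simp [homog]
@[simp] theorem homog_mono (κ : ℝ) (k : Fin 4 → ℕ) : homog κ (mono k) = sdeg k := by
  simp [homog, mono, sdeg, Fin.sum_univ_four]
  ring

/-- Lets every additive statistic of a contracted symbol (noises, polynomial degree, homogeneity) be
read off from the original one. The condition on s is needed because subtraction of multisets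
truncates. -/
theorem prune_mul {τ : Symbol} {s : Multiset Symbol} (h : s ≤ children τ) :
    prune τ s * (s.map int).prod = τ := by
  conv_rhs => rw [eq_of_root τ]
  rw [prune, mul_assoc, ← Multiset.prod_add, ← Multiset.map_add, tsub_add_cancel_of_le h]

theorem pair_le_children {τ : Symbol} (h : 2 ≤ numPsi τ) : {noise, noise} ≤ children τ := by
  have := Multiset.le_count_iff_replicate_le.1 h
  simpa [Multiset.replicate_succ] using this

theorem numPsi_mul (a b : Symbol) : numPsi (a * b) = numPsi a + numPsi b := by simp [numPsi]

theorem numPsi_mono (k : Fin 4 → ℕ) : numPsi (mono k) = 0 := by simp [numPsi]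

theorem numPsi_noise : numPsi noise = 0 := by simp [numPsi]

theorem numPsi_int (a : Symbol) : numPsi (int a) = if a = noise then 1 else 0 := by
  simp [numPsi, Multiset.count_singleton, eq_comm]

theorem prune_psi_psi_mul (c : Symbol) :
    prune (int noise * int noise * c) {noise, noise} = c := by
  conv_rhs => rw [eq_of_root c]
  simp [prune]

end Symbol

/-! ## Lowering operations -/

/-- Symbols with fewer noises than `τ` and no higher polynomial degree. -/
def lowerSet (τ : Symbol) : Set Symbol :=
  {σ | noiseCount σ < noiseCount τ ∧ polyDegree σ ≤ polyDegree τ}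

theorem contract₁_mem (τ : Symbol) : contract₁ τ ∈ Alg.spanOf (lowerSet τ) := by
  rw [contract₁]
  by_cases h : 2 ≤ numPsi τ
  · refine Submodule.smul_mem _ _ (Alg.of_mem_spanOf ?_)
    have h1 := prune_mul (pair_le_children h)
    have h2 := congrArg noiseCount h1
    have h3 := congrArg polyDegree h1
    simp at h2 h3
    rw [Multiset.insert_eq_cons]
    exact ⟨by omega, by omega⟩
  · rw [Nat.choose_eq_zero_of_lt (by omega)]
    simp

theorem contract₂_mem (τ : Symbol) : contract₂ τ ∈ Alg.spanOf (lowerSet τ) := by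
  rw [contract₂]
  by_cases h : 2 ≤ numPsi τ
  · refine Submodule.smul_mem _ _ (multiset_sum_mem _ fun x hx => ?_)
    obtain ⟨σ, hσ, rfl⟩ := Multiset.mem_map.1 hx
    by_cases h' : 2 ≤ numPsi σ
    · refine Submodule.smul_mem _ _ (Alg.of_mem_spanOf ?_)
      -- A symbol with two factors `I(Ξ)` is not `Ξ`, so the chosen child differs from the two
      -- contracted ones and all three can be removed together.
      have hne : σ ≠ noise := by
        rintro rfl
        simp [numPsi_noise] at h'
      have hle : ({noise, noise, σ} : Multiset Symbol) ≤ children τ := by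
        obtain ⟨r, hr⟩ := Multiset.le_iff_exists_add.1 (pair_le_children h)
        rw [hr] at hσ ⊢
        have : σ ∈ r := by simpa [hne] using hσ
        obtain ⟨r', rfl⟩ := Multiset.exists_cons_of_mem this
        refine Multiset.le_iff_exists_add.2 ⟨r', ?_⟩
        simp [Multiset.cons_swap σ]
      have h1 := prune_mul hle
      have h2 := congrArg noiseCount h1
      have h3 := congrArg polyDegree h1
      have h1' := prune_mul (pair_le_children h')
      have h2' := congrArg noiseCount h1'
      have h3' := congrArg polyDegree h1'
      simp at h2 h3 h2' h3'
      simp only [Multiset.insert_eq_cons]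
      refine ⟨?_, ?_⟩
      · rw [noiseCount_mul]
        omega
      · rw [polyDegree_mul]
        omega
    · rw [Nat.choose_eq_zero_of_lt (by omega)]
      simp
  · rw [Nat.choose_eq_zero_of_lt (by omega)]
    simp

@[simp] theorem belowRoot_noise (P : Symbol → Alg) : belowRoot P noise = 0 := rfl

@[simp] theorem belowRoot_one (P : Symbol → Alg) : belowRoot P 1 = 0 := rfl

@[simp] theorem belowRoot_coord (P : Symbol → Alg) (i : Fin 4) : belowRoot P (coord i) = 0 := rfl

theorem belowRoot_mul (P : Symbol → Alg) (a b : Symbol) :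
    belowRoot P (a * b) = belowRoot P a * Alg.of b + Alg.of a * belowRoot P b := by
  induction a using Quotient.inductionOn
  induction b using Quotient.inductionOn
  rfl

theorem belowRoot_int (P : Symbol → Alg) (a : Symbol) :
    belowRoot P (int a) = Alg.int (P a + belowRoot P a) := by
  induction a using Quotient.inductionOn
  rfl

/-- Both statistics are additive under products and unchanged by `Alg.int`, which otherwise kills
the symbol, so the strict loss at one node survives in the whole symbol. -/
theorem belowRoot_mem {P : Symbol → Alg} (hP : ∀ τ, P τ ∈ Alg.spanOf (lowerSet τ)) (τ : Symbol) :
    belowRoot P τ ∈ Alg.spanOf (lowerSet τ) := by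
  induction τ using Symbol.induction with
  | one => simp
  | noise => simp
  | coord i => simp
  | mul a b ha hb =>
    rw [belowRoot_mul]
    refine Submodule.add_mem _ ?_ ?_
    · refine Alg.mul_mem_spanOf (t := {b}) ?_ ha (Alg.of_mem_spanOf rfl)
      rintro σ ⟨h1, h2⟩ _ rfl
      refine ⟨?_, ?_⟩ <;> simp <;> omega
    · refine Alg.mul_mem_spanOf (s := {a}) ?_ (Alg.of_mem_spanOf rfl) hb
      rintro _ rfl σ ⟨h1, h2⟩
      refine ⟨?_, ?_⟩ <;> simp <;> omega
  | int a ha =>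
    rw [belowRoot_int]
    refine Alg.map_spanOf Alg.int (fun σ hσ => ?_) (Submodule.add_mem _ (hP a) ha)
    by_cases h : σ.IsPoly
    · rw [Alg.int_of_isPoly h]
      exact Submodule.zero_mem _
    · rw [Alg.int_of h]
      refine Alg.of_mem_spanOf ?_
      simpa [lowerSet] using hσ

end Phi43

namespace Phi43

open Phi43.Symbol

/-! ## The generator of the renormalisation map -/

/-- The coefficient of `I(Ξ)`. -/
noncomputable def psi : Alg →ₗ[ℝ] ℝ := Alg.lcoeff (int noise)

/-- The linear extension of the substitution `I(Ξ)² ↦ 1` at the root. -/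
noncomputable def rootContract : Alg →ₗ[ℝ] Alg := Alg.extend contract₁

/-- The substitution `I(Ξ)² ↦ 1` at the nodes next to the root. -/
noncomputable def childContract : Alg →ₗ[ℝ] Alg :=
  Alg.extend fun τ => (τ.children.map contract₁).sum

/-- The span of `U`. -/
noncomputable def spanU : Submodule ℝ Alg := Alg.spanOf {τ | InU τ}

/-- `τ` is the product of three elements of `U`. -/
def IsTriple (τ : Symbol) : Prop := ∃ a b c, InU a ∧ InU b ∧ InU c ∧ τ = a * b * c

theorem Symbol.InU.one : InU 1 := mono_one ▸ InU.mono 0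

theorem Symbol.InU.isTriple {τ : Symbol} (h : InU τ) : IsTriple τ :=
  ⟨τ, 1, 1, h, InU.one, InU.one, by simp⟩

theorem Symbol.InU.rootNoise_eq {τ : Symbol} (h : InU τ) : rootNoise τ = 0 := by
  cases h <;> simp

theorem IsTriple.rootNoise_eq {τ : Symbol} (h : IsTriple τ) : rootNoise τ = 0 := by
  obtain ⟨a, b, c, ha, hb, hc, rfl⟩ := h
  simp [ha.rootNoise_eq, hb.rootNoise_eq, hc.rootNoise_eq]

theorem IsTriple.ne_noise {τ : Symbol} (h : IsTriple τ) : τ ≠ noise := by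
  rintro rfl
  simpa using h.rootNoise_eq

theorem int_ne_psi {τ : Symbol} (h : IsTriple τ) : int τ ≠ int noise :=
  fun h' => h.ne_noise (int_injective h')

theorem mono_ne_psi (k : Fin 4 → ℕ) : mono k ≠ int noise := by
  intro h
  simpa using congrArg children h

theorem IsTriple.int {τ : Symbol} (h : IsTriple τ) (hp : ¬ τ.IsPoly) : InU τ.int := by
  obtain ⟨a, b, c, ha, hb, hc, rfl⟩ := h
  exact InU.int ha hb hc hp

/-- Elements of `U` are monomials, `I(Ξ)`, or `I` of a product of three elements of `U`. -/
theorem Symbol.InU.numPsi_eq {τ : Symbol} (h : InU τ) : numPsi τ = if τ = Symbol.int noise then 1 else 0 := by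
  cases h with
  | mono k => simp [numPsi_mono, mono_ne_psi]
  | psi => simp [numPsi_int]
  | int ha hb hc _ =>
    have : IsTriple _ := ⟨_, _, _, ha, hb, hc, rfl⟩
    rw [numPsi_int, if_neg this.ne_noise, if_neg (int_ne_psi this)]

theorem contract₁_of_lt {τ : Symbol} (h : numPsi τ < 2) : contract₁ τ = 0 := by
  rw [contract₁, Nat.choose_eq_zero_of_lt h]
  simp

theorem contract₂_of_lt {τ : Symbol} (h : numPsi τ < 2) : contract₂ τ = 0 := by
  rw [contract₂, Nat.choose_eq_zero_of_lt h]
  simp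

theorem Symbol.InU.numPsi_lt {τ : Symbol} (h : InU τ) : numPsi τ < 2 := by
  rw [h.numPsi_eq]
  split_ifs <;> omega

/-- The symmetric trilinear form given by contracting two factors `I(Ξ)`. -/
noncomputable def contractTriple (F : Alg →ₗ[ℝ] Alg) (a b c : Alg) : Alg :=
  (psi a * psi b) • F c + (psi a * psi c) • F b + (psi b * psi c) • F a

theorem contractTriple_perm₁ (F : Alg →ₗ[ℝ] Alg) (a b c : Alg) :
    contractTriple F a b c = contractTriple F a c b := by
  simp only [contractTriple, mul_comm (psi c) (psi b)]
  abel

theorem contractTriple_perm₂ (F : Alg →ₗ[ℝ] Alg) (a b c : Alg) :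
    contractTriple F a b c = contractTriple F c b a := by
  simp only [contractTriple, mul_comm (psi c), mul_comm (psi b) (psi a)]
  abel

theorem psi_psi : psi (Alg.of (int noise)) = 1 := by simp [psi, Alg.lcoeff_of]

theorem psi_of_ne {τ : Symbol} (h : τ ≠ int noise) : psi (Alg.of τ) = 0 := by
  simp [psi, Alg.lcoeff_of, h]

/-- A root operation that is invisible on products with at most one factor `I(Ξ)` is determined
by its values on products with two such factors. -/
theorem rootOp_triple {P : Symbol → Alg} {F : Alg →ₗ[ℝ] Alg}
    (h0 : ∀ τ, numPsi τ < 2 → P τ = 0)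
    (h2 : ∀ c, InU c → c ≠ int noise → P (int noise * int noise * c) = F (Alg.of c))
    (h3 : P (int noise * int noise * int noise) = (3 : ℝ) • F (Alg.of (int noise)))
    {a b c : Symbol} (ha : InU a) (hb : InU b) (hc : InU c) :
    P (a * b * c) = contractTriple F (Alg.of a) (Alg.of b) (Alg.of c) := by
  have key : ∀ c, InU c → P (int noise * int noise * c) =
      contractTriple F (Alg.of (int noise)) (Alg.of (int noise)) (Alg.of c) := by
    intro c hc
    by_cases h : c = int noise
    · subst h
      rw [h3, contractTriple, psi_psi]
      module
    · rw [h2 c hc h, contractTriple, psi_psi, psi_of_ne h]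
      simp
  by_cases h1 : a = int noise <;> by_cases h2 : b = int noise <;> by_cases h3 : c = int noise
  · rw [h1, h2]; exact key c hc
  · rw [h1, h2]; exact key c hc
  · rw [h1, h3, contractTriple_perm₁, ← key b hb]
    congr 1
    ac_rfl
  -- The case at the front has only one factor `I(Ξ)`; it is postponed to the block treating the
  -- four cases with at most one such factor, where both sides vanish.
  rotate_left
  · rw [h2, h3, contractTriple_perm₂, ← key a ha]
    congr 1
    ac_rfl
  all_goals
    rw [h0]
    · simp [contractTriple, psi_of_ne, psi_psi, *]
    · simp [numPsi_mul, ha.numPsi_eq, hb.numPsi_eq, hc.numPsi_eq, numPsi_int, *]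

theorem contract₁_psi_psi_mul (c : Symbol) :
    contract₁ (int noise * int noise * c) = ((2 + numPsi c).choose 2 : ℝ) • Alg.of c := by
  rw [contract₁, prune_psi_psi_mul]
  simp [numPsi_mul, numPsi_int]

theorem contract₁_triple {a b c : Symbol} (ha : InU a) (hb : InU b) (hc : InU c) :
    contract₁ (a * b * c) =
      contractTriple LinearMap.id (Alg.of a) (Alg.of b) (Alg.of c) := by
  refine rootOp_triple (fun τ h => contract₁_of_lt h) (fun c hc h => ?_) ?_ ha hb hc
  · rw [contract₁_psi_psi_mul, hc.numPsi_eq, if_neg h]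
    simp
  · rw [contract₁_psi_psi_mul, InU.psi.numPsi_eq]
    simp

theorem childContract_of (τ : Symbol) :
    childContract (Alg.of τ) = (τ.children.map contract₁).sum := by simp [childContract]

theorem rootContract_of (τ : Symbol) : rootContract (Alg.of τ) = contract₁ τ := by
  simp [rootContract]

theorem contract₁_noise : contract₁ noise = 0 := contract₁_of_lt (by simp [numPsi_noise])

/-- Only the third factor can supply the child σ, since `Ξ` carries no pair `I(Ξ)²`. Once σ and the
two `I(Ξ)` are removed the root is 1, and what remains of σ is its contraction at the root. -/
theorem contract₂_psi_psi_mul {c : Symbol} (hc : InU c) :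
    contract₂ (int noise * int noise * c) =
      ((2 + numPsi c).choose 2 : ℝ) • childContract (Alg.of c) := by
  rw [contract₂, childContract_of]
  have h1 : numPsi (int noise * int noise * c) = 2 + numPsi c := by
    simp [numPsi_mul, numPsi_int]
  have h2 : ∀ σ, c = int σ → prune (int noise * int noise * c) {noise, noise, σ} = 1 := by
    rintro σ rfl
    have : ({noise} + {noise} + {σ} - {noise, noise, σ} : Multiset Symbol) = 0 := by
      rw [tsub_eq_zero_iff_le]
      simp
    have h' : rootPoly (int noise * int noise * int σ) = 0 := by simp
    simp only [prune, children_mul, children_int, this, h']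
    simp [mono_one]
  have h3 : (noise.numPsi.choose 2 : ℝ) = 0 := by simp [numPsi_noise]
  rw [h1]
  refine congrArg _ ?_
  simp only [children_mul, children_int, Multiset.map_add, Multiset.map_singleton,
    Multiset.sum_add, Multiset.sum_singleton, h3, zero_smul, zero_add]
  cases hc with
  | mono k => simp only [children_mono, Multiset.map_zero]
  | psi => simp only [children_int, Multiset.map_singleton, Multiset.sum_singleton, h3, zero_smul,
      contract₁_noise]
  | int ha hb hc _ =>
    simp only [children_int, Multiset.map_singleton, Multiset.sum_singleton]
    rw [h2 _ rfl, one_mul, contract₁]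

section generator

variable (C₁ C₂ : ℝ)

/-- The generator `-C₁ L₁ - C₂ L₂` of the renormalisation map. -/
noncomputable def gen : Alg →ₗ[ℝ] Alg := -(C₁ • L₁) - C₂ • L₂

/-- The part of the generator acting at the root. -/
noncomputable def genRoot (τ : Symbol) : Alg := -(C₁ • contract₁ τ) - C₂ • contract₂ τ

/-- The part of the generator acting below the root. -/
noncomputable def genBelow (τ : Symbol) : Alg :=
  -(C₁ • belowRoot contract₁ τ) - C₂ • belowRoot contract₂ τ

/-- The linear map `-C₁ - C₂ Q` describing the generator at the root of a product of three
elements of `U`. -/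
noncomputable def genLoop : Alg →ₗ[ℝ] Alg := -(C₁ • LinearMap.id) - C₂ • childContract

theorem gen_of (τ : Symbol) : gen C₁ C₂ (Alg.of τ) = genRoot C₁ C₂ τ + genBelow C₁ C₂ τ := by
  simp only [gen, genRoot, genBelow, L₁, L₂, everywhere, LinearMap.sub_apply, LinearMap.neg_apply,
    LinearMap.smul_apply, Alg.extend_of, smul_add]
  abel

theorem genBelow_mul (a b : Symbol) :
    genBelow C₁ C₂ (a * b) = genBelow C₁ C₂ a * Alg.of b + Alg.of a * genBelow C₁ C₂ b := by
  simp only [genBelow, belowRoot_mul, sub_mul, mul_sub, neg_mul, mul_neg, smul_mul_assoc,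
    mul_smul_comm, smul_add]
  abel

theorem genBelow_int (a : Symbol) :
    genBelow C₁ C₂ (int a) = Alg.int (gen C₁ C₂ (Alg.of a)) := by
  rw [gen_of]
  simp only [genBelow, belowRoot_int, genRoot, map_add, map_sub, map_neg, map_smul, smul_add]
  abel

theorem genRoot_of_lt {τ : Symbol} (h : numPsi τ < 2) : genRoot C₁ C₂ τ = 0 := by
  simp [genRoot, contract₁_of_lt h, contract₂_of_lt h]

theorem gen_mem (τ : Symbol) : gen C₁ C₂ (Alg.of τ) ∈ Alg.spanOf (lowerSet τ) := by
  rw [gen_of, genRoot, genBelow]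
  refine Submodule.add_mem _ (Submodule.sub_mem _ (Submodule.neg_mem _ ?_) ?_)
    (Submodule.sub_mem _ (Submodule.neg_mem _ ?_) ?_) <;> refine Submodule.smul_mem _ _ ?_
  · exact contract₁_mem τ
  · exact contract₂_mem τ
  · exact belowRoot_mem contract₁_mem τ
  · exact belowRoot_mem contract₂_mem τ

theorem gen_of_noiseCount_eq_zero {τ : Symbol} (h : noiseCount τ = 0) :
    gen C₁ C₂ (Alg.of τ) = 0 := by
  have h1 := gen_mem C₁ C₂ τ
  have h2 : lowerSet τ = ∅ := by
    ext σ
    simp [lowerSet, h]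
  rw [h2] at h1
  simpa [Alg.spanOf] using h1

theorem gen_mono (k : Fin 4 → ℕ) : gen C₁ C₂ (Alg.of (mono k)) = 0 :=
  gen_of_noiseCount_eq_zero _ _ (by simp)

theorem gen_noise : gen C₁ C₂ (Alg.of noise) = 0 := by
  rw [gen_of, genRoot_of_lt _ _ (by simp [numPsi_noise])]
  simp [genBelow]

/-- The root of I(τ) carries at most one `I(Ξ)`, so nothing can be contracted there and the
generator acts entirely below the root. Monomials are killed on both sides. -/
theorem gen_int (a : Alg) : gen C₁ C₂ (Alg.int a) = Alg.int (gen C₁ C₂ a) := by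
  have : gen C₁ C₂ ∘ₗ Alg.int = Alg.int ∘ₗ gen C₁ C₂ := Alg.ext_of fun τ => by
    simp only [LinearMap.comp_apply]
    by_cases h : τ.IsPoly
    · rw [Alg.int_of_isPoly h]
      obtain ⟨k, rfl⟩ := h
      simp [gen_mono]
    · rw [Alg.int_of h, gen_of, genRoot_of_lt, zero_add, genBelow_int]
      rw [numPsi_int]
      split_ifs <;> omega
  exact LinearMap.congr_fun this a

theorem gen_psi : gen C₁ C₂ (Alg.of (int noise)) = 0 := by
  rw [← Alg.int_of not_isPoly_noise, gen_int, gen_noise, map_zero]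

theorem genRoot_triple {a b c : Symbol} (ha : InU a) (hb : InU b) (hc : InU c) :
    genRoot C₁ C₂ (a * b * c) =
      contractTriple (genLoop C₁ C₂) (Alg.of a) (Alg.of b) (Alg.of c) := by
  refine rootOp_triple (fun τ h => genRoot_of_lt _ _ h) (fun c hc h => ?_) ?_ ha hb hc
  · rw [genRoot, contract₁_psi_psi_mul, contract₂_psi_psi_mul hc, hc.numPsi_eq, if_neg h]
    simp [genLoop]
  · rw [genRoot, contract₁_psi_psi_mul, contract₂_psi_psi_mul InU.psi, InU.psi.numPsi_eq]
    simp [genLoop, childContract_of, contract₁_noise, smul_comm C₁]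

/-- The part below the root is a derivation, and on a single element of U it is the whole generator
because a pair `I(Ξ)²` is missing there. The contraction at the root of the product is the only
defect. -/
theorem gen_triple {a b c : Symbol} (ha : InU a) (hb : InU b) (hc : InU c) :
    gen C₁ C₂ (Alg.of (a * b * c)) =
      gen C₁ C₂ (Alg.of a) * Alg.of b * Alg.of c + Alg.of a * gen C₁ C₂ (Alg.of b) * Alg.of c +
      Alg.of a * Alg.of b * gen C₁ C₂ (Alg.of c) +
      contractTriple (genLoop C₁ C₂) (Alg.of a) (Alg.of b) (Alg.of c) := by
  have h : ∀ {d}, InU d → genBelow C₁ C₂ d = gen C₁ C₂ (Alg.of d) := fun hd => by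
    rw [gen_of, genRoot_of_lt _ _ hd.numPsi_lt, zero_add]
  rw [gen_of, genRoot_triple _ _ ha hb hc, genBelow_mul, genBelow_mul, h ha, h hb, h hc,
    Alg.of_mul]
  ring

/-- The node next to the root of I(τ) is the root of τ. The convention I(X^k) = 0 does no harm since
monomials contain no pair to contract. -/
theorem childContract_int (a : Alg) : childContract (Alg.int a) = rootContract a := by
  have : childContract ∘ₗ Alg.int = rootContract := Alg.ext_of fun τ => by
    simp only [LinearMap.comp_apply, rootContract_of]
    by_cases h : τ.IsPoly
    · rw [Alg.int_of_isPoly h]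
      obtain ⟨k, rfl⟩ := h
      rw [contract₁_of_lt (by simp [numPsi_mono]), map_zero]
    · rw [Alg.int_of h, childContract_of]
      simp
  exact LinearMap.congr_fun this a

theorem psi_int (a : Alg) : psi (Alg.int a) = Alg.lcoeff noise a := by
  have : psi ∘ₗ Alg.int = Alg.lcoeff noise := Alg.ext_of fun τ => by
    simp only [LinearMap.comp_apply]
    by_cases h : τ.IsPoly
    · rw [Alg.int_of_isPoly h, map_zero, Alg.lcoeff_of, if_neg]
      rintro rfl
      exact not_isPoly_noise h
    · rw [Alg.int_of h, psi, Alg.lcoeff_of, Alg.lcoeff_of]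
      simp [int_injective.eq_iff]
  exact LinearMap.congr_fun this a

/-- The span of the products of three elements of `U`. -/
noncomputable def spanT : Submodule ℝ Alg := Alg.spanOf {τ | IsTriple τ}

theorem spanU_le_spanT : spanU ≤ spanT := Alg.spanOf_mono fun _ h => InU.isTriple h

theorem mul_mem_spanT {a b c : Alg} (ha : a ∈ spanU) (hb : b ∈ spanU) (hc : c ∈ spanU) :
    a * b * c ∈ spanT := by
  refine Alg.mul_mem_spanOf (s := {τ | ∃ a b, InU a ∧ InU b ∧ τ = a * b}) (t := {τ | InU τ}) ?_
    (Alg.mul_mem_spanOf ?_ ha hb) hc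
  · rintro _ ⟨a, b, ha, hb, rfl⟩ c hc
    exact ⟨a, b, c, ha, hb, hc, rfl⟩
  · intro a ha b hb
    exact ⟨a, b, ha, hb, rfl⟩

theorem int_mem_spanU {a : Alg} (ha : a ∈ spanT) : Alg.int a ∈ spanU := by
  refine Alg.map_spanOf Alg.int (fun τ hτ => ?_) ha
  by_cases h : τ.IsPoly
  · rw [Alg.int_of_isPoly h]
    exact Submodule.zero_mem _
  · rw [Alg.int_of h]
    exact Alg.of_mem_spanOf (IsTriple.int hτ h)

theorem lcoeff_noise_of_spanT {a : Alg} (ha : a ∈ spanT) : Alg.lcoeff noise a = 0 := by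
  have := Alg.eq_of_spanOf (f := Alg.lcoeff noise) (g := 0) (fun τ (hτ : IsTriple τ) => by
    simp [Alg.lcoeff_of, hτ.ne_noise]) ha
  simpa using this

/-- Trilinearity of an unbundled function of three variables. -/
structure IsTrilinear {E : Type*} [AddCommGroup E] [Module ℝ E] (f : Alg → Alg → Alg → E) :
    Prop where
  fst : ∀ b c, IsLinearMap ℝ fun a => f a b c
  snd : ∀ a c, IsLinearMap ℝ fun b => f a b c
  trd : ∀ a b, IsLinearMap ℝ fun c => f a b c

theorem IsTrilinear.mul : IsTrilinear fun a b c : Alg => a * b * c :=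
  ⟨fun _ _ => ⟨fun _ _ => by ring, fun _ _ => by simp⟩,
    fun _ _ => ⟨fun _ _ => by ring, fun _ _ => by simp⟩,
    fun _ _ => ⟨fun _ _ => by ring, fun _ _ => by simp⟩⟩

theorem IsTrilinear.contractTriple (F : Alg →ₗ[ℝ] Alg) : IsTrilinear (contractTriple F) := by
  refine ⟨fun _ _ => ⟨fun _ _ => ?_, fun _ _ => ?_⟩, fun _ _ => ⟨fun _ _ => ?_, fun _ _ => ?_⟩,
    fun _ _ => ⟨fun _ _ => ?_, fun _ _ => ?_⟩⟩ <;>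
  simp only [Phi43.contractTriple, map_add, map_smul, smul_eq_mul] <;> module

theorem IsTrilinear.comp {E E' : Type*} [AddCommGroup E] [Module ℝ E] [AddCommGroup E']
    [Module ℝ E'] {f : Alg → Alg → Alg → E} (hf : IsTrilinear f) (L : E →ₗ[ℝ] E') :
    IsTrilinear fun a b c => L (f a b c) :=
  ⟨fun b c => (L ∘ₗ (hf.fst b c).mk').isLinear, fun a c => (L ∘ₗ (hf.snd a c).mk').isLinear,
    fun a b => (L ∘ₗ (hf.trd a b).mk').isLinear⟩

theorem IsTrilinear.add {E : Type*} [AddCommGroup E] [Module ℝ E] {f g : Alg → Alg → Alg → E}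
    (hf : IsTrilinear f) (hg : IsTrilinear g) : IsTrilinear fun a b c => f a b c + g a b c :=
  ⟨fun b c => ((hf.fst b c).mk' _ + (hg.fst b c).mk' _).isLinear,
    fun a c => ((hf.snd a c).mk' _ + (hg.snd a c).mk' _).isLinear,
    fun a b => ((hf.trd a b).mk' _ + (hg.trd a b).mk' _).isLinear⟩

/-- Trilinear identities need to be checked on symbols only. -/
theorem IsTrilinear.ext {E : Type*} [AddCommGroup E] [Module ℝ E] {s t u : Set Symbol}
    {f g : Alg → Alg → Alg → E} (hf : IsTrilinear f) (hg : IsTrilinear g)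
    (h : ∀ a ∈ s, ∀ b ∈ t, ∀ c ∈ u,
      f (Alg.of a) (Alg.of b) (Alg.of c) = g (Alg.of a) (Alg.of b) (Alg.of c))
    {a b c : Alg} (ha : a ∈ Alg.spanOf s) (hb : b ∈ Alg.spanOf t) (hc : c ∈ Alg.spanOf u) :
    f a b c = g a b c := by
  refine Alg.eq_of_spanOf (f := (hf.trd a b).mk' _) (g := (hg.trd a b).mk' _) (fun c hc => ?_) hc
  refine Alg.eq_of_spanOf (f := (hf.snd a _).mk' _) (g := (hg.snd a _).mk' _) (fun b hb => ?_) hb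
  exact Alg.eq_of_spanOf (f := (hf.fst _ _).mk' _) (g := (hg.fst _ _).mk' _)
    (fun a ha => h a ha b hb c hc) ha

theorem rootContract_mul {a b c : Alg} (ha : a ∈ spanU) (hb : b ∈ spanU) (hc : c ∈ spanU) :
    rootContract (a * b * c) = contractTriple LinearMap.id a b c := by
  refine (IsTrilinear.mul.comp rootContract).ext (.contractTriple LinearMap.id) ?_ ha hb hc
  intro a ha b hb c hc
  simp only [← Alg.of_mul, rootContract_of, contract₁_triple ha hb hc]

/-- Contracting two of three factors leaves an element of U, so the same node cannot be contracted
twice. This removes the quadratic terms when Q is commuted with the generator. -/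
theorem rootContract_of_spanU {a : Alg} (ha : a ∈ spanU) : rootContract a = 0 :=
  Alg.eq_of_spanOf (f := rootContract) (g := 0)
    (fun τ (hτ : InU τ) => by simp [rootContract_of, contract₁_of_lt hτ.numPsi_lt]) ha

theorem contractTriple_mem {F : Alg →ₗ[ℝ] Alg} {V : Submodule ℝ Alg} {a b c : Alg}
    (ha : F a ∈ V) (hb : F b ∈ V) (hc : F c ∈ V) : contractTriple F a b c ∈ V :=
  V.add_mem (V.add_mem (V.smul_mem _ hc) (V.smul_mem _ hb)) (V.smul_mem _ ha)

theorem childContract_mem {a : Alg} (ha : a ∈ spanU) : childContract a ∈ spanU := by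
  refine Alg.map_spanOf childContract (fun τ hτ => ?_) ha
  cases hτ with
  | mono k => simp [childContract_of]
  | psi => simp [childContract_of, contract₁_noise]
  | int ha hb hc _ =>
    rw [childContract_of, children_int, Multiset.map_singleton, Multiset.sum_singleton,
      contract₁_triple ha hb hc]
    exact contractTriple_mem (Alg.of_mem_spanOf ha) (Alg.of_mem_spanOf hb) (Alg.of_mem_spanOf hc)

theorem genLoop_mem {a : Alg} (ha : a ∈ spanU) : genLoop C₁ C₂ a ∈ spanU :=
  spanU.sub_mem (spanU.neg_mem (spanU.smul_mem _ ha)) (spanU.smul_mem _ (childContract_mem ha))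

theorem gen_mem_spanU_of {τ : Symbol} (h : InU τ) : gen C₁ C₂ (Alg.of τ) ∈ spanU := by
  induction h with
  | mono k => simp [gen_mono]
  | psi => simp [gen_psi]
  | int ha hb hc hp iha ihb ihc =>
    have ha' := Alg.of_mem_spanOf (s := {τ | InU τ}) ha
    have hb' := Alg.of_mem_spanOf (s := {τ | InU τ}) hb
    have hc' := Alg.of_mem_spanOf (s := {τ | InU τ}) hc
    rw [← Alg.int_of hp, gen_int, gen_triple _ _ ha hb hc]
    refine int_mem_spanU (add_mem (add_mem (add_mem ?_ ?_) ?_) ?_)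
    · exact mul_mem_spanT iha hb' hc'
    · exact mul_mem_spanT ha' ihb hc'
    · exact mul_mem_spanT ha' hb' ihc
    · exact spanU_le_spanT (contractTriple_mem (genLoop_mem _ _ ha') (genLoop_mem _ _ hb')
        (genLoop_mem _ _ hc'))

theorem gen_mem_spanU {a : Alg} (ha : a ∈ spanU) : gen C₁ C₂ a ∈ spanU :=
  Alg.map_spanOf _ (fun _ h => gen_mem_spanU_of C₁ C₂ h) ha

theorem gen_mul {a b c : Alg} (ha : a ∈ spanU) (hb : b ∈ spanU) (hc : c ∈ spanU) :
    gen C₁ C₂ (a * b * c) = gen C₁ C₂ a * b * c + a * gen C₁ C₂ b * c + a * b * gen C₁ C₂ c +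
      contractTriple (genLoop C₁ C₂) a b c := by
  have h1 : IsTrilinear fun a b c => gen C₁ C₂ a * b * c + a * gen C₁ C₂ b * c +
      a * b * gen C₁ C₂ c :=
    ⟨fun _ _ => ⟨fun _ _ => by simp only [map_add]; ring, fun _ _ => by simp⟩,
      fun _ _ => ⟨fun _ _ => by simp only [map_add]; ring, fun _ _ => by simp⟩,
      fun _ _ => ⟨fun _ _ => by simp only [map_add]; ring, fun _ _ => by simp⟩⟩
  refine (IsTrilinear.mul.comp (gen C₁ C₂)).ext (h1.add (.contractTriple (genLoop C₁ C₂))) ?_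
    ha hb hc
  intro a ha b hb c hc
  simp only [← Alg.of_mul, gen_triple C₁ C₂ ha hb hc]

theorem gen_mem_spanT {a : Alg} (ha : a ∈ spanT) : gen C₁ C₂ a ∈ spanT := by
  refine Alg.map_spanOf _ ?_ ha
  rintro _ ⟨a, b, c, ha, hb, hc, rfl⟩
  have ha' := Alg.of_mem_spanOf (s := {τ | InU τ}) ha
  have hb' := Alg.of_mem_spanOf (s := {τ | InU τ}) hb
  have hc' := Alg.of_mem_spanOf (s := {τ | InU τ}) hc
  rw [gen_triple _ _ ha hb hc]
  refine add_mem (add_mem (add_mem ?_ ?_) ?_) ?_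
  · exact mul_mem_spanT (gen_mem_spanU_of C₁ C₂ ha) hb' hc'
  · exact mul_mem_spanT ha' (gen_mem_spanU_of C₁ C₂ hb) hc'
  · exact mul_mem_spanT ha' hb' (gen_mem_spanU_of C₁ C₂ hc)
  · exact spanU_le_spanT (contractTriple_mem (genLoop_mem _ _ ha') (genLoop_mem _ _ hb')
      (genLoop_mem _ _ hc'))

/-- A linear map on `U` that comes from a map on products of three elements of `U` does not see
the factor `I(Ξ)`. -/
theorem psi_gen {a : Alg} (ha : a ∈ spanU) : psi (gen C₁ C₂ a) = 0 := by
  refine Alg.eq_of_spanOf (f := psi ∘ₗ gen C₁ C₂) (g := 0) (fun τ hτ => ?_) ha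
  cases hτ with
  | mono k => simp [gen_mono]
  | psi => simp [gen_psi]
  | int ha hb hc hp =>
    simp only [LinearMap.comp_apply, LinearMap.zero_apply]
    rw [← Alg.int_of hp, gen_int, psi_int, lcoeff_noise_of_spanT]
    exact gen_mem_spanT _ _ (Alg.of_mem_spanOf ⟨_, _, _, ha, hb, hc, rfl⟩)

/-- On I(abc) the map Q is the contraction at the root of abc. In the Leibniz terms the generator
only reaches the factor that is not contracted, because it never yields `I(Ξ)` (`psi_gen`), and the
defect term contains no further pair. -/
theorem childContract_gen {a : Alg} (ha : a ∈ spanU) :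
    childContract (gen C₁ C₂ a) = gen C₁ C₂ (childContract a) := by
  refine Alg.eq_of_spanOf (f := childContract ∘ₗ gen C₁ C₂) (g := gen C₁ C₂ ∘ₗ childContract)
    (fun τ hτ => ?_) ha
  simp only [LinearMap.comp_apply]
  cases hτ with
  | mono k => simp [gen_mono, childContract_of]
  | psi => simp [gen_psi, childContract_of, contract₁_noise]
  | int ha hb hc hp =>
    have ha' := Alg.of_mem_spanOf (s := {τ | InU τ}) ha
    have hb' := Alg.of_mem_spanOf (s := {τ | InU τ}) hb
    have hc' := Alg.of_mem_spanOf (s := {τ | InU τ}) hc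
    rw [← Alg.int_of hp, gen_int, childContract_int, childContract_int, rootContract_of,
      contract₁_triple ha hb hc, gen_triple _ _ ha hb hc, map_add, map_add, map_add,
      rootContract_mul (gen_mem_spanU _ _ ha') hb' hc',
      rootContract_mul ha' (gen_mem_spanU _ _ hb') hc',
      rootContract_mul ha' hb' (gen_mem_spanU _ _ hc'),
      rootContract_of_spanU (contractTriple_mem (genLoop_mem _ _ ha') (genLoop_mem _ _ hb')
        (genLoop_mem _ _ hc'))]
    simp only [contractTriple, psi_gen C₁ C₂ ha', psi_gen C₁ C₂ hb', psi_gen C₁ C₂ hc',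
      LinearMap.id_apply, map_add, map_smul]
    simp
    abel

/-- On the right, a term survives only when the generator hits the factor that is not contracted,
since `psi` vanishes on the range of the generator; there it passes through −C₁ − C₂Q by
`childContract_gen`. -/
theorem gen_contractTriple {a b c : Alg} (ha : a ∈ spanU) (hb : b ∈ spanU) (hc : c ∈ spanU) :
    gen C₁ C₂ (contractTriple (genLoop C₁ C₂) a b c) =
      contractTriple (genLoop C₁ C₂) (gen C₁ C₂ a) b c +
      contractTriple (genLoop C₁ C₂) a (gen C₁ C₂ b) c +
      contractTriple (genLoop C₁ C₂) a b (gen C₁ C₂ c) := by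
  have h : ∀ {d}, d ∈ spanU → genLoop C₁ C₂ (gen C₁ C₂ d) = gen C₁ C₂ (genLoop C₁ C₂ d) := by
    intro d hd
    simp only [genLoop, LinearMap.sub_apply, LinearMap.neg_apply, LinearMap.smul_apply,
      LinearMap.id_apply, map_sub, map_neg, map_smul, childContract_gen C₁ C₂ hd]
  simp only [contractTriple, psi_gen C₁ C₂ ha, psi_gen C₁ C₂ hb, psi_gen C₁ C₂ hc, h ha, h hb, h hc,
    map_add, map_smul]
  simp
  abel

end generator

end Phi43

namespace Phi43

open Phi43.Symbol

/-! ## The exponential of the generator -/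

section exponential

variable (C₁ C₂ : ℝ)

theorem gen_pow_mem (τ : Symbol) (n : ℕ) : (gen C₁ C₂ ^ n) (Alg.of τ) ∈
    Alg.spanOf {σ | noiseCount σ + n ≤ noiseCount τ ∧ polyDegree σ ≤ polyDegree τ} := by
  induction n with
  | zero => exact Alg.of_mem_spanOf ⟨by simp, le_rfl⟩
  | succ n ih =>
    rw [pow_succ', Module.End.mul_apply]
    refine Alg.map_spanOf _ (fun σ hσ => Alg.spanOf_mono ?_ (gen_mem C₁ C₂ σ)) ih
    rintro ρ ⟨h1, h2⟩
    exact ⟨by have := hσ.1; omega, h2.trans hσ.2⟩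

theorem gen_pow_eq_zero {τ : Symbol} {n : ℕ} (h : noiseCount τ < n) :
    (gen C₁ C₂ ^ n) (Alg.of τ) = 0 := by
  have h1 := gen_pow_mem C₁ C₂ τ n
  have h2 : {σ | noiseCount σ + n ≤ noiseCount τ ∧ polyDegree σ ≤ polyDegree τ} = ∅ := by
    ext σ
    simp
    omega
  rw [h2] at h1
  simpa [Alg.spanOf] using h1

/-- The polynomial `∑ₙ tⁿ / n! (-C₁ L₁ - C₂ L₂)ⁿ` in the flow parameter `t`. -/
noncomputable def genExp : Alg →ₗ[ℝ] Polynomial Alg :=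
  Alg.extend fun τ => ∑ n ∈ Finset.range (noiseCount τ + 1),
    Polynomial.monomial n (((n.factorial : ℝ)⁻¹) • (gen C₁ C₂ ^ n) (Alg.of τ))

theorem coeff_genExp (a : Alg) (n : ℕ) :
    (genExp C₁ C₂ a).coeff n = ((n.factorial : ℝ)⁻¹) • (gen C₁ C₂ ^ n) a := by
  have : (Polynomial.lcoeff Alg n).restrictScalars ℝ ∘ₗ genExp C₁ C₂ =
      ((n.factorial : ℝ)⁻¹) • (gen C₁ C₂ ^ n) := Alg.ext_of fun τ => by
    simp only [LinearMap.comp_apply, LinearMap.coe_restrictScalars, genExp, Alg.extend_of,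
      map_sum, Polynomial.lcoeff_apply, LinearMap.smul_apply, Polynomial.coeff_monomial]
    rw [Finset.sum_ite_eq']
    split_ifs with h
    · rfl
    · rw [gen_pow_eq_zero, smul_zero]
      simpa using h
  exact LinearMap.congr_fun this a

/-- The differential equation of the flow. With a formal parameter it is an identity of polynomials,
since the generator is nilpotent on each symbol. -/
theorem genExp_derivative (a : Alg) :
    Polynomial.derivative (genExp C₁ C₂ a) = genExp C₁ C₂ (gen C₁ C₂ a) := by
  ext1 n
  rw [Polynomial.coeff_derivative, coeff_genExp, coeff_genExp, pow_succ, Module.End.mul_apply,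
    Nat.factorial_succ]
  have h : ((n : Alg) + 1) = algebraMap ℝ Alg (n + 1) := by rw [map_add, map_natCast, map_one]
  rw [h, mul_comm, ← Algebra.smul_def, smul_smul]
  congr 1
  have : (n : ℝ) + 1 ≠ 0 := by positivity
  push_cast
  field_simp

theorem eval_genExp (a : Alg) :
    Polynomial.eval 1 (genExp C₁ C₂ a) = renormMap C₁ C₂ a := by
  have : (Polynomial.leval (1 : Alg)).restrictScalars ℝ ∘ₗ genExp C₁ C₂ = renormMap C₁ C₂ :=
      Alg.ext_of fun τ => by
    simp only [LinearMap.comp_apply, LinearMap.coe_restrictScalars, genExp, Alg.extend_of,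
      map_sum, Polynomial.leval_apply, Polynomial.eval_monomial, one_pow, mul_one, renormMap]
    refine (finsum_eq_sum_of_support_subset _ fun n hn => ?_).symm
    by_contra h
    refine hn ?_
    change _ • (gen C₁ C₂ ^ n) (Alg.of τ) = 0
    rw [gen_pow_eq_zero, smul_zero]
    simpa using h
  exact LinearMap.congr_fun this a

/-- Polynomials over `Alg` are determined by their derivative and their constant coefficient. -/
theorem polynomial_ext_derivative {p q : Polynomial Alg}
    (h : Polynomial.derivative p = Polynomial.derivative q) (h0 : p.coeff 0 = q.coeff 0) :
    p = q := by
  ext1 n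
  cases n with
  | zero => exact h0
  | succ n =>
    have h1 := congrArg (fun r => ((n : ℝ) + 1)⁻¹ • r.coeff n) h
    simp only [Polynomial.coeff_derivative] at h1
    have h : ((n : Alg) + 1) = algebraMap ℝ Alg (n + 1) := by rw [map_add, map_natCast, map_one]
    have h' : (n : ℝ) + 1 ≠ 0 := by positivity
    simpa only [h, mul_comm _ (algebraMap ℝ Alg _), ← Algebra.smul_def, smul_smul,
      inv_mul_cancel₀ h', one_smul] using h1

theorem genExp_of_gen_eq_zero {a : Alg} (h : gen C₁ C₂ a = 0) :
    genExp C₁ C₂ a = Polynomial.C a := by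
  refine polynomial_ext_derivative ?_ ?_
  · rw [genExp_derivative, h, map_zero, Polynomial.derivative_C]
  · simp [coeff_genExp]

/-- The failure of multiplicativity of the exponential. -/
noncomputable def genExpRhs (a b c : Alg) : Polynomial Alg :=
  genExp C₁ C₂ a * genExp C₁ C₂ b * genExp C₁ C₂ c +
    Polynomial.X * genExp C₁ C₂ (contractTriple (genLoop C₁ C₂) a b c)

theorem isTrilinear_genExpRhs : IsTrilinear (genExpRhs C₁ C₂) := by
  have h1 : IsTrilinear fun a b c => genExp C₁ C₂ a * genExp C₁ C₂ b * genExp C₁ C₂ c :=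
    ⟨fun _ _ => ⟨fun _ _ => by simp only [map_add]; ring, fun _ _ => by simp⟩,
      fun _ _ => ⟨fun _ _ => by simp only [map_add]; ring, fun _ _ => by simp⟩,
      fun _ _ => ⟨fun _ _ => by simp only [map_add]; ring, fun _ _ => by simp⟩⟩
  exact h1.add ((IsTrilinear.contractTriple (genLoop C₁ C₂)).comp
    (LinearMap.mulLeft ℝ (Polynomial.X : Polynomial Alg) ∘ₗ genExp C₁ C₂))

/-- Both sides solve the same differential equation in the flow parameter with the same initial
value. Induction on the total number of noises is available because the generator strictly lowers
it, so the identity is already known for each term of the derivative. -/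
theorem genExp_mul_of (n : ℕ) : ∀ a b c : Symbol, InU a → InU b → InU c →
    noiseCount a + noiseCount b + noiseCount c = n →
    genExp C₁ C₂ (Alg.of a * Alg.of b * Alg.of c) =
      genExpRhs C₁ C₂ (Alg.of a) (Alg.of b) (Alg.of c) := by
  induction n using Nat.strong_induction_on with
  | _ n ih =>
    intro a b c ha hb hc hn
    have ha' := Alg.of_mem_spanOf (s := {τ | InU τ}) ha
    have hb' := Alg.of_mem_spanOf (s := {τ | InU τ}) hb
    have hc' := Alg.of_mem_spanOf (s := {τ | InU τ}) hc
    have key : ∀ {a}, InU a → gen C₁ C₂ (Alg.of a) ∈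
        Alg.spanOf ({τ | InU τ} ∩ lowerSet a) := fun {a} ha =>
      Alg.mem_spanOf_inter (gen_mem_spanU_of C₁ C₂ ha) (gen_mem C₁ C₂ a)
    have htri := IsTrilinear.mul.comp (genExp C₁ C₂)
    have h1 := htri.ext (isTrilinear_genExpRhs C₁ C₂) (s := {τ | InU τ} ∩ lowerSet a)
      (t := {b}) (u := {c}) (by
        rintro a' ⟨ha', hl, -⟩ _ rfl _ rfl
        exact ih _ (by omega) _ _ _ ha' hb hc rfl) (key ha)
      (Alg.of_mem_spanOf rfl) (Alg.of_mem_spanOf rfl)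
    have h2 := htri.ext (isTrilinear_genExpRhs C₁ C₂) (s := {a})
      (t := {τ | InU τ} ∩ lowerSet b) (u := {c}) (by
        rintro _ rfl b' ⟨hb', hl, -⟩ _ rfl
        exact ih _ (by omega) _ _ _ ha hb' hc rfl)
      (Alg.of_mem_spanOf rfl) (key hb) (Alg.of_mem_spanOf rfl)
    have h3 := htri.ext (isTrilinear_genExpRhs C₁ C₂) (s := {a})
      (t := {b}) (u := {τ | InU τ} ∩ lowerSet c) (by
        rintro _ rfl _ rfl c' ⟨hc', hl, -⟩
        exact ih _ (by omega) _ _ _ ha hb hc' rfl)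
      (Alg.of_mem_spanOf rfl) (Alg.of_mem_spanOf rfl) (key hc)
    -- Differentiating the prefactor `Polynomial.X` produces the defect term of `gen_mul`; the other
    -- terms agree by the Leibniz rule for the trilinear form, `gen_contractTriple`.
    refine polynomial_ext_derivative ?_ ?_
    · rw [genExp_derivative, gen_mul C₁ C₂ ha' hb' hc', map_add, map_add, map_add, h1, h2, h3]
      simp only [genExpRhs, Polynomial.derivative_mul,
        genExp_derivative, Polynomial.derivative_X, gen_contractTriple C₁ C₂ ha' hb' hc', map_add]
      ring
    · simp [genExpRhs, coeff_genExp, Polynomial.mul_coeff_zero]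

theorem genExp_mul {a b c : Alg} (ha : a ∈ spanU) (hb : b ∈ spanU) (hc : c ∈ spanU) :
    genExp C₁ C₂ (a * b * c) = genExpRhs C₁ C₂ a b c :=
  (IsTrilinear.mul.comp (genExp C₁ C₂)).ext (isTrilinear_genExpRhs C₁ C₂)
    (fun a ha b hb c hc => genExp_mul_of C₁ C₂ _ a b c ha hb hc rfl) ha hb hc

/-- On products of three elements of `U`, the renormalisation map is multiplicative up to the
contraction of two factors `I(Ξ)`. -/
theorem renormMap_mul {a b c : Alg} (ha : a ∈ spanU) (hb : b ∈ spanU) (hc : c ∈ spanU) :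
    renormMap C₁ C₂ (a * b * c) = renormMap C₁ C₂ a * renormMap C₁ C₂ b * renormMap C₁ C₂ c +
      renormMap C₁ C₂ (contractTriple (genLoop C₁ C₂) a b c) := by
  simp only [← eval_genExp, genExp_mul C₁ C₂ ha hb hc, genExpRhs, Polynomial.eval_add,
    Polynomial.eval_mul, Polynomial.eval_X, one_mul]

theorem renormMap_of_gen_eq_zero {a : Alg} (h : gen C₁ C₂ a = 0) : renormMap C₁ C₂ a = a := by
  rw [← eval_genExp, genExp_of_gen_eq_zero _ _ h, Polynomial.eval_C]

theorem renormMap_of (τ : Symbol) : renormMap C₁ C₂ (Alg.of τ) =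
    ∑ n ∈ Finset.range (noiseCount τ + 1),
      ((n.factorial : ℝ)⁻¹) • (gen C₁ C₂ ^ n) (Alg.of τ) := by
  rw [← eval_genExp, genExp, Alg.extend_of, Polynomial.eval_finsetSum]
  simp

theorem gen_pow_int (n : ℕ) (a : Alg) :
    (gen C₁ C₂ ^ n) (Alg.int a) = Alg.int ((gen C₁ C₂ ^ n) a) := by
  induction n generalizing a with
  | zero => rfl
  | succ n ih => rw [pow_succ, Module.End.mul_apply, gen_int, ih, Module.End.mul_apply]

theorem renormMap_int (a : Alg) :
    renormMap C₁ C₂ (Alg.int a) = Alg.int (renormMap C₁ C₂ a) := by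
  have : renormMap C₁ C₂ ∘ₗ Alg.int = Alg.int ∘ₗ renormMap C₁ C₂ := Alg.ext_of fun τ => by
    simp only [LinearMap.comp_apply]
    by_cases h : τ.IsPoly
    · rw [Alg.int_of_isPoly h]
      obtain ⟨k, rfl⟩ := h
      rw [renormMap_of_gen_eq_zero _ _ (gen_mono _ _ _), Alg.int_of_isPoly ⟨k, rfl⟩, map_zero]
    · rw [Alg.int_of h, renormMap_of, renormMap_of, noiseCount_int, map_sum]
      simp only [map_smul, ← gen_pow_int, Alg.int_of h]
  exact LinearMap.congr_fun this a

theorem renormMap_polyDegree {m : ℕ} {a : Alg} (ha : a ∈ Alg.spanOf {σ | polyDegree σ ≤ m}) :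
    renormMap C₁ C₂ a ∈ Alg.spanOf {σ | polyDegree σ ≤ m} := by
  refine Alg.map_spanOf _ (fun τ hτ => ?_) ha
  rw [renormMap_of]
  refine Submodule.sum_mem _ fun n _ => Submodule.smul_mem _ _ ?_
  exact Alg.spanOf_mono (fun σ hσ => hσ.2.trans hτ) (gen_pow_mem C₁ C₂ τ n)

theorem renormMap_of_polySub {a : Alg} (ha : a ∈ polySub) : renormMap C₁ C₂ a = a := by
  have h := polySub_span ha
  refine renormMap_of_gen_eq_zero _ _ ?_
  have : Submodule.span ℝ (Set.range fun k => Alg.of (mono k)) ≤ LinearMap.ker (gen C₁ C₂) := by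
    rw [Submodule.span_le]
    rintro _ ⟨k, rfl⟩
    exact gen_mono C₁ C₂ k
  exact this h

theorem renormMap_noise : renormMap C₁ C₂ (Alg.of noise) = Alg.of noise :=
  renormMap_of_gen_eq_zero _ _ (gen_noise C₁ C₂)

theorem renormMap_psi : renormMap C₁ C₂ (Alg.of (int noise)) = Alg.of (int noise) :=
  renormMap_of_gen_eq_zero _ _ (gen_psi C₁ C₂)

end exponential

end Phi43

namespace Phi43

open Phi43.Symbol

/-! ## Recentering maps and homogeneities -/

/-- Monomials of parabolic degree at most `β`. -/
def monoLe (β : ℝ) : Set Symbol := {τ | ∃ k, τ = mono k ∧ (sdeg k : ℝ) ≤ β}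

/-- Monomials of parabolic degree less than `β`. -/
def monoLt (β : ℝ) : Set Symbol := {τ | ∃ k, τ = mono k ∧ (sdeg k : ℝ) < β}

/-- Elements of `U` of homogeneity at most `β`. -/
def setU (κ β : ℝ) : Set Symbol := {τ | InU τ ∧ homog κ τ ≤ β}

/-- Products of three elements of `U` of homogeneity at most `β`. -/
def setT (κ β : ℝ) : Set Symbol := {τ | IsTriple τ ∧ homog κ τ ≤ β}

theorem sdeg_add (k l : Fin 4 → ℕ) : sdeg (k + l) = sdeg k + sdeg l := by
  simp [sdeg]
  ring

theorem monoLe_mul {α β : ℝ} {a b : Alg} (ha : a ∈ Alg.spanOf (monoLe α))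
    (hb : b ∈ Alg.spanOf (monoLe β)) : a * b ∈ Alg.spanOf (monoLe (α + β)) := by
  refine Alg.mul_mem_spanOf ?_ ha hb
  rintro _ ⟨k, rfl, hk⟩ _ ⟨l, rfl, hl⟩
  refine ⟨k + l, (mono_add k l).symm, ?_⟩
  rw [sdeg_add]
  push_cast
  exact add_le_add hk hl

theorem one_mem_monoLe : (1 : Alg) ∈ Alg.spanOf (monoLe 0) := by
  rw [← Alg.of_one, ← mono_one]
  exact Alg.of_mem_spanOf ⟨0, rfl, by simp [sdeg]⟩

theorem monoLe_pow {α : ℝ} {a : Alg} (ha : a ∈ Alg.spanOf (monoLe α)) (n : ℕ) :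
    a ^ n ∈ Alg.spanOf (monoLe (n * α)) := by
  induction n with
  | zero => simpa using one_mem_monoLe
  | succ n ih =>
    rw [pow_succ]
    convert monoLe_mul ih ha using 2
    push_cast
    ring_nf

theorem shifted_mono_mem (c : Fin 4 → ℝ) (k : Fin 4 → ℕ) :
    ∏ i, (Alg.of (coord i) + algebraMap ℝ Alg (c i)) ^ k i ∈ Alg.spanOf (monoLe (sdeg k)) := by
  have h : ∀ i, Alg.of (coord i) + algebraMap ℝ Alg (c i) ∈
      Alg.spanOf (monoLe (if i = 0 then 2 else 1)) := by
    intro i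
    refine Submodule.add_mem _ ?_ ?_
    · rw [coord_eq_mono]
      refine Alg.of_mem_spanOf ⟨_, rfl, ?_⟩
      fin_cases i <;> simp [sdeg]
    · rw [Algebra.algebraMap_eq_smul_one]
      refine Submodule.smul_mem _ _ (Alg.spanOf_mono ?_ one_mem_monoLe)
      rintro _ ⟨k, rfl, hk⟩
      refine ⟨k, rfl, hk.trans ?_⟩
      split_ifs <;> norm_num
  rw [Fin.prod_univ_four]
  convert monoLe_mul (monoLe_mul (monoLe_mul (monoLe_pow (h 0) (k 0)) (monoLe_pow (h 1) (k 1)))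
    (monoLe_pow (h 2) (k 2))) (monoLe_pow (h 3) (k 3)) using 2
  simp [sdeg]
  ring_nf

theorem jetIn_mem (c : Fin 4 → ℝ) (γ : ℝ) (d : (Fin 4 → ℕ) → ℝ) :
    Alg.jetIn (fun i => Alg.of (coord i) + algebraMap ℝ Alg (c i)) γ d ∈
      Alg.spanOf (monoLt γ) := by
  refine Submodule.sum_mem _ fun k hk => Submodule.smul_mem _ _
    (Alg.spanOf_mono ?_ (shifted_mono_mem c k))
  rintro _ ⟨l, rfl, hl⟩
  exact ⟨l, rfl, hl.trans_lt (mem_multiBelow.1 hk)⟩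

theorem jet_mem (γ : ℝ) (d : (Fin 4 → ℕ) → ℝ) : Alg.jet γ d ∈ Alg.spanOf (monoLt γ) := by
  simpa [Alg.jet] using jetIn_mem 0 γ d

theorem monoLt_subset_setU {κ β : ℝ} : monoLt β ⊆ setU κ β := by
  rintro _ ⟨k, rfl, hk⟩
  exact ⟨.mono k, by simpa using hk.le⟩

theorem setU_subset {κ β : ℝ} : setU κ β ⊆ {τ | InU τ} := fun _ h => h.1

theorem setT_subset {κ β : ℝ} : setT κ β ⊆ {τ | IsTriple τ} := fun _ h => h.1

theorem mul_mem_setT {κ α β δ : ℝ} {a b c : Alg} (ha : a ∈ Alg.spanOf (setU κ α))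
    (hb : b ∈ Alg.spanOf (setU κ β)) (hc : c ∈ Alg.spanOf (setU κ δ)) :
    a * b * c ∈ Alg.spanOf (setT κ (α + β + δ)) := by
  refine Alg.mul_mem_spanOf (s := {τ | ∃ a b, a ∈ setU κ α ∧ b ∈ setU κ β ∧ τ = a * b}) ?_
    (Alg.mul_mem_spanOf ?_ ha hb) hc
  · rintro _ ⟨a, b, ha, hb, rfl⟩ c hc
    refine ⟨⟨a, b, c, ha.1, hb.1, hc.1, rfl⟩, ?_⟩
    simp only [homog_mul]
    linarith [ha.2, hb.2, hc.2]
  · intro a ha b hb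
    exact ⟨a, b, ha, hb, rfl⟩

theorem int_mem_setU {κ β : ℝ} {a : Alg} (ha : a ∈ Alg.spanOf (setT κ β)) :
    Alg.int a ∈ Alg.spanOf (setU κ (β + 2)) := by
  refine Alg.map_spanOf Alg.int (fun τ hτ => ?_) ha
  by_cases h : τ.IsPoly
  · rw [Alg.int_of_isPoly h]
    exact Submodule.zero_mem _
  · rw [Alg.int_of h]
    exact Alg.of_mem_spanOf ⟨hτ.1.int h, by simpa using hτ.2⟩

theorem psi_of_mono {β : ℝ} {a : Alg} (ha : a ∈ Alg.spanOf (monoLt β)) : psi a = 0 := by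
  refine Alg.eq_of_spanOf (f := psi) (g := 0) ?_ ha
  rintro _ ⟨k, rfl, -⟩
  exact psi_of_ne (mono_ne_psi k)

theorem childContract_of_mono {β : ℝ} {a : Alg} (ha : a ∈ Alg.spanOf (monoLt β)) :
    childContract a = 0 := by
  refine Alg.eq_of_spanOf (f := childContract) (g := 0) ?_ ha
  rintro _ ⟨k, rfl, -⟩
  simp [childContract_of]

/-- Algebra morphisms that commute with `I` up to polynomials, like `F_x` and its inverse. -/
structure IsRecentering (κ : ℝ) (F : Alg →ₐ[ℝ] Alg) : Prop where
  mono : ∀ k, F (Alg.of (mono k)) ∈ Alg.spanOf (monoLe (sdeg k))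
  psi : F (Alg.of (int noise)) = Alg.of (int noise)
  -- For the inverse map the polynomial correction is J(x) applied to F_x⁻¹τ; its degree is
  -- controlled only once F_x⁻¹τ is known not to exceed the homogeneity of τ. This premise feeds the
  -- induction over U.
  int : ∀ τ, ¬ τ.IsPoly → F (Alg.of τ) ∈ Alg.spanOf (setT κ (homog κ τ)) →
    F (Alg.of (int τ)) - Alg.int (F (Alg.of τ)) ∈ Alg.spanOf (monoLt (homog κ τ + 2))

namespace IsRecentering

variable {κ : ℝ} {F : Alg →ₐ[ℝ] Alg}

theorem map_of (hF : IsRecentering κ F) {τ : Symbol} (h : InU τ) :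
    F (Alg.of τ) ∈ Alg.spanOf (setU κ (homog κ τ)) := by
  induction h with
  | mono k =>
    refine Alg.spanOf_mono ?_ (hF.mono k)
    rintro _ ⟨l, rfl, hl⟩
    exact ⟨.mono l, by simpa using hl⟩
  | psi =>
    rw [hF.psi]
    exact Alg.of_mem_spanOf ⟨.psi, le_rfl⟩
  | @int a b c ha hb hc hp iha ihb ihc =>
    have h : F (Alg.of (a * b * c)) ∈ Alg.spanOf (setT κ (homog κ (a * b * c))) := by
      rw [Alg.of_mul, Alg.of_mul, map_mul, map_mul, homog_mul, homog_mul]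
      exact mul_mem_setT iha ihb ihc
    rw [← sub_add_cancel (F (Alg.of (a * b * c).int)) (Alg.int (F (Alg.of (a * b * c)))), homog_int]
    exact Submodule.add_mem _ (Alg.spanOf_mono monoLt_subset_setU (hF.int _ hp h)) (int_mem_setU h)

theorem map_of_triple (hF : IsRecentering κ F) {τ : Symbol} (h : IsTriple τ) :
    F (Alg.of τ) ∈ Alg.spanOf (setT κ (homog κ τ)) := by
  obtain ⟨a, b, c, ha, hb, hc, rfl⟩ := h
  rw [Alg.of_mul, Alg.of_mul, map_mul, map_mul, homog_mul, homog_mul]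
  exact mul_mem_setT (hF.map_of ha) (hF.map_of hb) (hF.map_of hc)

theorem map_setU (hF : IsRecentering κ F) {β : ℝ} {a : Alg} (ha : a ∈ Alg.spanOf (setU κ β)) :
    F a ∈ Alg.spanOf (setU κ β) := by
  refine Alg.map_spanOf F.toLinearMap (fun τ hτ => ?_) ha
  refine Alg.spanOf_mono ?_ (hF.map_of hτ.1)
  exact fun σ hσ => ⟨hσ.1, hσ.2.trans hτ.2⟩

theorem map_spanU (hF : IsRecentering κ F) {a : Alg} (ha : a ∈ spanU) : F a ∈ spanU :=
  Alg.map_spanOf F.toLinearMap (fun _ hτ => Alg.spanOf_mono setU_subset (hF.map_of hτ)) ha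

/-- F replaces I(τ) by I(Fτ) plus polynomials. Polynomials do not contain `I(Ξ)`, and Fτ contains no
`Ξ` when τ is a product of three elements of U. -/
theorem psi_map (hF : IsRecentering κ F) {a : Alg} (ha : a ∈ spanU) :
    Phi43.psi (F a) = Phi43.psi a := by
  refine Alg.eq_of_spanOf (f := Phi43.psi ∘ₗ F.toLinearMap) (g := Phi43.psi) (fun τ hτ => ?_) ha
  simp only [LinearMap.comp_apply, AlgHom.toLinearMap_apply]
  cases hτ with
  | mono k =>
    rw [psi_of_ne (mono_ne_psi k)]
    refine psi_of_mono (β := sdeg k + 1) (Alg.spanOf_mono ?_ (hF.mono k))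
    rintro _ ⟨l, rfl, hl⟩
    exact ⟨l, rfl, by linarith⟩
  | psi => rw [hF.psi]
  | @int a b c ha hb hc hp =>
    have ht : IsTriple (a * b * c) := ⟨a, b, c, ha, hb, hc, rfl⟩
    have h1 := psi_of_mono (hF.int _ hp (hF.map_of_triple ht))
    rw [map_sub, sub_eq_zero] at h1
    rw [h1, psi_int, lcoeff_noise_of_spanT (Alg.spanOf_mono setT_subset (hF.map_of_triple ht)),
      psi_of_ne (int_ne_psi ht)]

/-- Polynomial corrections have no nodes next to the root, so on I(abc) only the contraction of
F(a)F(b)F(c) at its root matters, and there the contracted coefficients are preserved by `psi_map`.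
-/
theorem childContract_map (hF : IsRecentering κ F) {a : Alg} (ha : a ∈ spanU) :
    childContract (F a) = F (childContract a) := by
  refine Alg.eq_of_spanOf (f := childContract ∘ₗ F.toLinearMap)
    (g := F.toLinearMap ∘ₗ childContract) (fun τ hτ => ?_) ha
  simp only [LinearMap.comp_apply, AlgHom.toLinearMap_apply]
  cases hτ with
  | mono k =>
    rw [childContract_of_mono (β := sdeg k + 1), childContract_of]
    · simp
    · refine Alg.spanOf_mono ?_ (hF.mono k)
      rintro _ ⟨l, rfl, hl⟩
      exact ⟨l, rfl, by linarith⟩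
  | psi => simp [hF.psi, childContract_of, contract₁_noise]
  | @int a b c ha hb hc hp =>
    have ht : IsTriple (a * b * c) := ⟨a, b, c, ha, hb, hc, rfl⟩
    have ha' := Alg.of_mem_spanOf (s := {τ | InU τ}) ha
    have hb' := Alg.of_mem_spanOf (s := {τ | InU τ}) hb
    have hc' := Alg.of_mem_spanOf (s := {τ | InU τ}) hc
    have h1 := childContract_of_mono (hF.int _ hp (hF.map_of_triple ht))
    rw [map_sub, sub_eq_zero] at h1
    rw [h1, childContract_int, Alg.of_mul, Alg.of_mul, map_mul F, map_mul F,
      rootContract_mul (hF.map_spanU ha') (hF.map_spanU hb') (hF.map_spanU hc'),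
      childContract_of, children_int, Multiset.map_singleton, Multiset.sum_singleton,
      contract₁_triple ha hb hc]
    simp only [contractTriple, hF.psi_map ha', hF.psi_map hb', hF.psi_map hc', map_add, map_smul,
      LinearMap.id_apply]

theorem contractTriple_map (hF : IsRecentering κ F) (C₁ C₂ : ℝ) {a b c : Alg} (ha : a ∈ spanU)
    (hb : b ∈ spanU) (hc : c ∈ spanU) :
    contractTriple (genLoop C₁ C₂) (F a) (F b) (F c) =
      F (contractTriple (genLoop C₁ C₂) a b c) := by
  simp only [contractTriple, hF.psi_map ha, hF.psi_map hb, hF.psi_map hc, map_add, map_smul,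
    genLoop, LinearMap.sub_apply, LinearMap.neg_apply, LinearMap.smul_apply, LinearMap.id_apply,
    hF.childContract_map ha, hF.childContract_map hb, hF.childContract_map hc, map_sub, map_neg]

end IsRecentering

theorem multiBelow_of_nonpos {γ : ℝ} (h : γ ≤ 0) : multiBelow γ = ∅ := by
  ext k
  rw [mem_multiBelow]
  simp only [Finset.notMem_empty, iff_false, not_lt]
  exact h.trans (by positivity)

section model

variable {κ : ℝ} {N : ℕ} (K : HeatKernelSplit N) (PP : Alg →ₗ[ℝ] (Spacetime → ℝ)) (x : Spacetime)

theorem isRecentering_recenter (hκ : 0 < κ) : IsRecentering κ (recenter κ K PP x) where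
  mono k := by
    rw [Alg.of_mono, map_prod]
    simp only [map_pow, recenter_coord]
    simpa [sub_eq_add_neg] using shifted_mono_mem (fun i => - x i) k
  psi := by
    -- |I(Ξ)| = −1/2 − κ is negative, so the Taylor sum is empty and `I(Ξ)` is not recentred.
    have h : homog κ noise + 2 ≤ 0 := by
      rw [homog_noise]
      linarith
    rw [recenter_of_int, Alg.jet, Alg.jetIn, multiBelow_of_nonpos h]
    simp [recenter, Alg.int_of not_isPoly_noise]
  int τ _ _ := by
    rw [recenter_of_int, sub_right_comm, sub_self, zero_sub]
    refine Submodule.neg_mem _ ?_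
    simp only [Alg.jet, Alg.jetIn, map_sum, map_smul, map_prod, map_pow, recenter_coord]
    simpa [sub_eq_add_neg, Alg.jetIn] using jetIn_mem (fun i => - x i) (homog κ τ + 2) _

theorem modelJ_mem {β : ℝ} {s : Set Symbol} (hs : ∀ τ ∈ s, homog κ τ ≤ β) {a : Alg}
    (ha : a ∈ Alg.spanOf s) : modelJ κ K PP x a ∈ Alg.spanOf (monoLt (β + 2)) := by
  classical
  refine Alg.map_spanOf _ (fun τ hτ => ?_) ha
  simp only [modelJ, Alg.extend_of]
  split_ifs
  · exact Submodule.zero_mem _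
  · refine Alg.spanOf_mono ?_ (jet_mem _ _)
    rintro _ ⟨k, rfl, hk⟩
    exact ⟨k, rfl, by linarith [hs τ hτ]⟩

theorem isRecentering_recenterInv (hκ : 0 < κ) : IsRecentering κ (recenterInv κ K PP x) where
  mono k := by
    rw [Alg.of_mono, map_prod]
    simp only [map_pow, recenterInv_coord]
    exact shifted_mono_mem x k
  psi := by
    have h : homog κ noise + 2 ≤ 0 := by
      rw [homog_noise]
      linarith
    have h1 : recenterInv κ K PP x (Alg.of noise) = Alg.of noise := by simp [recenterInv]
    have h2 : modelJ κ K PP x (Alg.of noise) = 0 := by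
      rw [modelJ, Alg.extend_of, if_neg not_isPoly_noise, Alg.jet, Alg.jetIn,
        multiBelow_of_nonpos h, Finset.sum_empty]
    rw [recenterInv_of_int, h1, h2, Alg.int_of not_isPoly_noise, add_zero]
  int τ _ h := by
    rw [recenterInv_of_int, add_sub_cancel_left]
    exact modelJ_mem K PP x (fun σ hσ => hσ.2) h

theorem reduced_mono (k : Fin 4 → ℕ) : Symbol.Reduced (mono k) := by
  have hpow : ∀ (i : Fin 4) (n : ℕ), Symbol.Reduced (coord i ^ n) := fun i n => by
    induction n with
    | zero => rw [pow_zero]; exact .one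
    | succ n ih => rw [pow_succ]; exact .mul ih (.coord i)
  rw [mono, Fin.prod_univ_four]
  exact .mul (.mul (.mul (hpow _ _) (hpow _ _)) (hpow _ _)) (hpow _ _)

theorem Symbol.InU.reduced {τ : Symbol} (h : InU τ) : Symbol.Reduced τ := by
  induction h with
  | mono k => exact reduced_mono k
  | psi => exact .int .noise not_isPoly_noise
  | int _ _ _ hp iha ihb ihc => exact .int (.mul (.mul iha ihb) ihc) hp

/-- This is F_x F_x⁻¹ = id, which holds on symbols without any I(X^k) inside; U consists of such
symbols and F_y preserves its span. -/
theorem modelPi_modelGamma (hκ : 0 < κ) (y : Spacetime) {a : Alg} (ha : a ∈ spanU) :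
    modelPi κ K PP x (modelGamma κ K PP x y a) = modelPi κ K PP y a := by
  have h := (isRecentering_recenter K PP y hκ).map_spanU ha
  simp only [modelPi, modelGamma, LinearMap.comp_apply, AlgHom.toLinearMap_apply,
    AlgHom.comp_apply]
  congr 1
  exact Alg.eq_of_spanOf
    (f := (recenter κ K PP x).toLinearMap ∘ₗ (recenterInv κ K PP x).toLinearMap)
    (g := LinearMap.id)
    (fun τ (hτ : InU τ) => recenter_recenterInv κ K PP x hτ.reduced) h

theorem modelGamma_mem (hκ : 0 < κ) (y : Spacetime) {β : ℝ} {a : Alg}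
    (ha : a ∈ Alg.spanOf (setU κ β)) : modelGamma κ K PP x y a ∈ Alg.spanOf (setU κ β) :=
  (isRecentering_recenterInv K PP x hκ).map_setU ((isRecentering_recenter K PP y hκ).map_setU ha)

variable (C₁ C₂ : ℝ) (ξ : Spacetime → ℝ)

theorem canonicalPP_mul (a b : Alg) :
    canonicalPP K ξ (a * b) = canonicalPP K ξ a * canonicalPP K ξ b := by
  simp [canonicalPP]

theorem modelPi_renormPP (a : Alg) : modelPi κ K (renormPP K C₁ C₂ ξ) x a =
    canonicalPP K ξ (renormMap C₁ C₂ (recenter κ K (renormPP K C₁ C₂ ξ) x a)) := rfl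

/-- F_x is multiplicative, preserves the span of U and commutes with the contraction form, so the
defect in `renormMap_mul` carries over unchanged. -/
theorem modelPi_mul (hκ : 0 < κ) {a b c : Alg} (ha : a ∈ spanU) (hb : b ∈ spanU)
    (hc : c ∈ spanU) :
    modelPi κ K (renormPP K C₁ C₂ ξ) x (a * b * c) =
      modelPi κ K (renormPP K C₁ C₂ ξ) x a * modelPi κ K (renormPP K C₁ C₂ ξ) x b *
        modelPi κ K (renormPP K C₁ C₂ ξ) x c +
      modelPi κ K (renormPP K C₁ C₂ ξ) x (contractTriple (genLoop C₁ C₂) a b c) := by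
  have hF := isRecentering_recenter K (renormPP K C₁ C₂ ξ) x hκ
  simp only [modelPi_renormPP, map_mul (recenter _ _ _ _), ← hF.contractTriple_map C₁ C₂ ha hb hc]
  rw [← canonicalPP_mul, ← canonicalPP_mul, ← map_add,
    renormMap_mul C₁ C₂ (hF.map_spanU ha) (hF.map_spanU hb) (hF.map_spanU hc)]

end model

/-! ## Lower bounds on homogeneities -/

/-- `I(Ξ)` is the extremal case, with equality. In I(abc) three deficits of 1/2 + κ accumulate, but
integration gains 2, which suffices because 3/2 + 3κ ≤ 2 + 1/2 + κ. -/
theorem Symbol.InU.polyDegree_le {κ : ℝ} (hκ : 0 < κ) (hκ' : κ < 1 / 14) {τ : Symbol}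
    (h : InU τ) : (polyDegree τ : ℝ) ≤ homog κ τ + 1 / 2 + κ := by
  induction h with
  | mono k => simp; linarith
  | psi => simp; norm_num; linarith
  | int _ _ _ _ iha ihb ihc => simp; linarith

theorem IsTriple.polyDegree_le {κ : ℝ} (hκ : 0 < κ) (hκ' : κ < 1 / 14) {τ : Symbol}
    (h : IsTriple τ) : (polyDegree τ : ℝ) ≤ homog κ τ + 3 / 2 + 3 * κ := by
  obtain ⟨a, b, c, ha, hb, hc, rfl⟩ := h
  have := ha.polyDegree_le hκ hκ'
  have := hb.polyDegree_le hκ hκ'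
  have := hc.polyDegree_le hκ hκ'
  simp
  linarith

theorem Symbol.InU.homog_ge {κ : ℝ} (hκ : 0 < κ) (hκ' : κ < 1 / 14) {τ : Symbol}
    (h : InU τ) : -(1 / 2) - κ ≤ homog κ τ := by
  have := h.polyDegree_le hκ hκ'
  have : (0 : ℝ) ≤ polyDegree τ := by positivity
  linarith

theorem IsTriple.homog_ge {κ : ℝ} (hκ : 0 < κ) (hκ' : κ < 1 / 14) {τ : Symbol}
    (h : IsTriple τ) : -(3 / 2) - 3 * κ ≤ homog κ τ := by
  have := h.polyDegree_le hκ hκ'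
  have : (0 : ℝ) ≤ polyDegree τ := by positivity
  linarith

end Phi43

namespace Phi43

/-! ## Partial derivatives of smooth functions -/

theorem pd_eq_fderiv {f : Spacetime → ℝ} (hf : ContDiff ℝ ∞ f) (i : Fin 4) :
    pd i f = fun z => fderiv ℝ f z (Pi.single i 1) := by
  ext z
  exact (hf.differentiable (by simp) z).lineDeriv_eq_fderiv

theorem contDiff_pd {f : Spacetime → ℝ} (hf : ContDiff ℝ ∞ f) (i : Fin 4) :
    ContDiff ℝ ∞ (pd i f) := by
  rw [pd_eq_fderiv hf]
  exact (hf.fderiv_right (m := ∞) (by simp)).clm_apply contDiff_const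

theorem pd_comm {f : Spacetime → ℝ} (hf : ContDiff ℝ ∞ f) (i j : Fin 4) :
    pd i (pd j f) = pd j (pd i f) := by
  rw [pd_eq_fderiv (contDiff_pd hf j), pd_eq_fderiv (contDiff_pd hf i), pd_eq_fderiv hf,
    pd_eq_fderiv hf]
  have hd : Differentiable ℝ (fderiv ℝ f) :=
    (hf.fderiv_right (m := ∞) (by simp)).differentiable (by simp)
  ext z
  have h : ∀ v w, fderiv ℝ (fun z => fderiv ℝ f z v) z w = fderiv ℝ (fderiv ℝ f) z w v := by
    intro v w
    rw [fderiv_clm_apply (hd z) (differentiableAt_const v)]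
    simp
  rw [h, h]
  exact ((contDiff_infty.1 hf 2).contDiffAt.isSymmSndFDerivAt (by simp)) _ _

theorem contDiff_pd_iterate {f : Spacetime → ℝ} (hf : ContDiff ℝ ∞ f) (i : Fin 4) (n : ℕ) :
    ContDiff ℝ ∞ ((pd i)^[n] f) := by
  induction n with
  | zero => exact hf
  | succ n ih =>
    rw [Function.iterate_succ_apply']
    exact contDiff_pd ih i

theorem pd_iterate_comm {f : Spacetime → ℝ} (hf : ContDiff ℝ ∞ f) (i j : Fin 4) (n : ℕ) :
    pd i ((pd j)^[n] f) = (pd j)^[n] (pd i f) := by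
  induction n with
  | zero => rfl
  | succ n ih =>
    rw [Function.iterate_succ_apply', pd_comm (contDiff_pd_iterate hf j n), ih,
      Function.iterate_succ_apply']

theorem contDiff_mpd {f : Spacetime → ℝ} (hf : ContDiff ℝ ∞ f) (k : Fin 4 → ℕ) :
    ContDiff ℝ ∞ (mpd k f) :=
  contDiff_pd_iterate (contDiff_pd_iterate (contDiff_pd_iterate (contDiff_pd_iterate hf _ _) _ _)
    _ _) _ _

theorem mpd_zero (f : Spacetime → ℝ) : mpd 0 f = f := rfl

theorem pd_mpd {f : Spacetime → ℝ} (hf : ContDiff ℝ ∞ f) (k : Fin 4 → ℕ) (i : Fin 4) :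
    pd i (mpd k f) = mpd k (pd i f) := by
  have h3 := contDiff_pd_iterate hf 3 (k 3)
  have h2 := contDiff_pd_iterate h3 2 (k 2)
  have h1 := contDiff_pd_iterate h2 1 (k 1)
  simp only [mpd]
  rw [pd_iterate_comm h1, pd_iterate_comm h2, pd_iterate_comm h3, pd_iterate_comm hf]

theorem mpd_add_single {f : Spacetime → ℝ} (hf : ContDiff ℝ ∞ f) (k : Fin 4 → ℕ) (i : Fin 4) :
    mpd (k + Pi.single i 1) f = mpd k (pd i f) := by
  have h3 := contDiff_pd_iterate hf 3 (k 3)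
  have h2 := contDiff_pd_iterate h3 2 (k 2)
  have h1 := contDiff_pd_iterate h2 1 (k 1)
  fin_cases i <;> simp only [mpd, Pi.add_apply, Fin.zero_eta, Fin.mk_one, Fin.reduceFinMk,
    Pi.single_apply, Fin.isValue, Fin.reduceEq, if_true, if_false, add_zero,
    Function.iterate_succ_apply]
  · rw [pd_iterate_comm h2, pd_iterate_comm h3, pd_iterate_comm hf]
  · rw [pd_iterate_comm h3, pd_iterate_comm hf]
  · rw [pd_iterate_comm hf]

theorem multiIndex_induction {p : (Fin 4 → ℕ) → Prop} (zero : p 0)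
    (add : ∀ k i, p k → p (k + Pi.single i 1)) (k : Fin 4 → ℕ) : p k := by
  have h : ∀ (n : ℕ) (k : Fin 4 → ℕ), ∑ i, k i = n → p k := by
    intro n
    induction n with
    | zero =>
      intro k hk
      have : k = 0 := by
        ext i
        simpa using (Finset.sum_eq_zero_iff.1 hk) i (Finset.mem_univ i)
      exact this ▸ zero
    | succ n ih =>
      intro k hk
      obtain ⟨i, hi⟩ : ∃ i, k i ≠ 0 := by
        by_contra! h
        simp [h] at hk
      have h1 : k = (k - Pi.single i 1) + Pi.single i 1 := by
        ext j
        by_cases hj : j = i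
        · subst hj
          simp
          omega
        · simp [hj]
      rw [h1] at hk ⊢
      refine add _ _ (ih _ ?_)
      simp only [Pi.add_apply, Finset.sum_add_distrib] at hk
      have : ∑ x, (Pi.single i 1 : Fin 4 → ℕ) x = 1 := by simp
      omega
  exact h _ k rfl

/-! ## The parabolic size -/

theorem pnorm_nonneg (z : Spacetime) : 0 ≤ pnorm z := by
  unfold pnorm
  positivity

theorem abs_time_le (z : Spacetime) : |z 0| ≤ pnorm z ^ 2 := by
  have h : √|z 0| ≤ pnorm z := by
    unfold pnorm
    linarith [abs_nonneg (z 1), abs_nonneg (z 2), abs_nonneg (z 3)]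
  calc |z 0| = √|z 0| ^ 2 := (Real.sq_sqrt (abs_nonneg _)).symm
    _ ≤ _ := by gcongr

theorem abs_space_le (z : Spacetime) {i : Fin 4} (hi : i ≠ 0) : |z i| ≤ pnorm z := by
  have := Real.sqrt_nonneg |z 0|
  unfold pnorm
  fin_cases i
  · exact absurd rfl hi
  all_goals
    simp
    linarith [abs_nonneg (z 1), abs_nonneg (z 2), abs_nonneg (z 3)]

/-- The parabolic box of size `r`. -/
def boxVec (r : ℝ) : Spacetime := fun i => if i = 0 then r ^ 2 else r

theorem mem_box_of_pnorm_le {z : Spacetime} {r : ℝ} (h : pnorm z ≤ r) :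
    z ∈ Icc (-boxVec r) (boxVec r) := by
  have h1 : ∀ i, |z i| ≤ boxVec r i := by
    intro i
    unfold boxVec
    split_ifs with hi
    · subst hi
      exact (abs_time_le z).trans (pow_le_pow_left₀ (pnorm_nonneg z) h 2)
    · exact (abs_space_le z hi).trans h
  exact ⟨fun i => (abs_le.1 (h1 i)).1, fun i => (abs_le.1 (h1 i)).2⟩

theorem norm_le_one_of_pnorm_le {z : Spacetime} (h : pnorm z ≤ 1) : ‖z‖ ≤ 1 := by
  rw [pi_norm_le_iff_of_nonneg zero_le_one]
  intro i
  have h1 := mem_box_of_pnorm_le h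
  have h2 : boxVec 1 i = 1 := by simp [boxVec]
  rw [Real.norm_eq_abs, abs_le]
  exact ⟨by simpa [h2] using h1.1 i, by simpa [h2] using h1.2 i⟩

theorem pnorm_sub_comm (x y : Spacetime) : pnorm (x - y) = pnorm (y - x) := by
  simp only [pnorm, Pi.sub_apply, abs_sub_comm]

/-- A sum of integrable functions with summable norms is integrable. -/
theorem integrable_tsum_of_summable {α : Type*} [MeasurableSpace α]
    {μ : Measure α} {F : ℕ → α → ℝ} (hF : ∀ n, Integrable (F n) μ)
    (hs : Summable fun n => ∫ a, ‖F n a‖ ∂μ) : Integrable (fun a => ∑' n, F n a) μ := by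
  have hfin : ∫⁻ a, ∑' n, ‖F n a‖ₑ ∂μ < ⊤ := by
    rw [lintegral_tsum fun n => (hF n).aestronglyMeasurable.enorm]
    have : ∀ n, ∫⁻ a, ‖F n a‖ₑ ∂μ = ENNReal.ofReal (∫ a, ‖F n a‖ ∂μ) := fun n =>
      (ofReal_integral_norm_eq_lintegral_enorm (hF n)).symm
    simp only [this]
    exact hs.tsum_ofReal_lt_top
  have hsum : ∀ᵐ a ∂μ, Summable fun n => F n a := by
    have h1 : ∀ᵐ a ∂μ, ∑' n, ‖F n a‖ₑ < ⊤ :=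
      ae_lt_top' (AEMeasurable.tsum fun n => (hF n).aestronglyMeasurable.enorm) hfin.ne
    filter_upwards [h1] with a ha
    refine Summable.of_norm ?_
    have := ENNReal.summable_toReal ha.ne
    simpa using this
  refine ⟨?_, ?_⟩
  · refine aestronglyMeasurable_of_tendsto_ae atTop
      (f := fun n a => ∑ i ∈ Finset.range n, F i a) (fun n => ?_) ?_
    · exact Finset.aestronglyMeasurable_fun_sum _ fun i _ => (hF i).aestronglyMeasurable
    · filter_upwards [hsum] with a ha
      exact ha.hasSum.tendsto_sum_nat
  · refine lt_of_le_of_lt (lintegral_mono_ae ?_) hfin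
    filter_upwards [hsum] with a ha
    exact enorm_tsum_le_tsum_enorm

theorem pnorm_continuous : Continuous pnorm := by
  unfold pnorm
  fun_prop

/-! ## The singular kernel -/

namespace HeatKernelSplit

variable {N : ℕ} (K : HeatKernelSplit N)

/-- The singular part `∑ₙ Kₙ` of the kernel. -/
noncomputable def total (z : Spacetime) : ℝ := ∑' n, K.Kn n z

theorem Kn_eq_zero {n : ℕ} {z : Spacetime} (h : 1 < ‖z‖) : K.Kn n z = 0 := by
  by_contra h0
  refine absurd (norm_le_one_of_pnorm_le ((K.support_Kn n z h0).trans ?_)) (not_le.2 h)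
  exact zpow_le_one_of_nonpos₀ one_le_two (by simp)

theorem hasCompactSupport_Kn (n : ℕ) : HasCompactSupport (K.Kn n) := by
  refine HasCompactSupport.intro (isCompact_closedBall (0 : Spacetime) 1) fun z hz => ?_
  exact K.Kn_eq_zero (by simpa using hz)

theorem integrable_Kn (n : ℕ) : Integrable (K.Kn n) :=
  (K.smooth_Kn n).continuous.integrable_of_hasCompactSupport (K.hasCompactSupport_Kn n)

/-- K_n is at most C·2^(3n) on a parabolic box of volume 16·2^(−5n), which leaves a factor 2^(−2n).
This is all that convergence of the sum over scales requires. -/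
theorem exists_integral_Kn_le : ∃ C : ℝ, 0 ≤ C ∧ ∀ n, ∫ z, ‖K.Kn n z‖ ≤ C * (1 / 4) ^ n := by
  obtain ⟨C, hC⟩ := K.bound_Kn 0
  have hC0 : 0 ≤ C := by
    have := (abs_nonneg _).trans (hC 0 0)
    simpa using this
  refine ⟨C * 16, by positivity, fun n => ?_⟩
  set r : ℝ := (2 : ℝ) ^ (-(n : ℤ)) with hr
  have hr0 : 0 < r := by positivity
  have hle : -boxVec r ≤ boxVec r := by
    intro i
    simp only [Pi.neg_apply, boxVec]
    split_ifs <;> nlinarith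
  have hvol : volume.real (Icc (-boxVec r) (boxVec r)) = 16 * r ^ 5 := by
    rw [Measure.real, Real.volume_Icc_pi_toReal hle, Fin.prod_univ_four]
    simp [boxVec]
    ring
  have h2 : (2 : ℝ) ^ n * r = 1 := by
    rw [hr, zpow_neg, zpow_natCast, mul_inv_cancel₀ (by positivity)]
  have h4 : (1 / 4 : ℝ) ^ n = r ^ 2 := by
    have : (1 / 4 : ℝ) ^ n = ((2 : ℝ) ^ n)⁻¹ ^ 2 := by
      rw [← inv_pow, ← pow_mul, mul_comm, pow_mul]
      norm_num
    rw [this, hr, zpow_neg, zpow_natCast]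
  rw [← setIntegral_eq_integral_of_forall_compl_eq_zero (s := Icc (-boxVec r) (boxVec r))]
  · refine (Real.le_norm_self _).trans ((norm_setIntegral_le_of_norm_le_const
      (C := C * 2 ^ (n * 3)) isCompact_Icc.measure_lt_top fun z _ => ?_).trans ?_)
    · simpa [mpd_zero, sdeg] using hC n z
    · rw [hvol, h4, pow_mul]
      refine le_of_eq ?_
      calc C * ((2 : ℝ) ^ n) ^ 3 * (16 * r ^ 5) = C * 16 * r ^ 2 * ((2 : ℝ) ^ n * r) ^ 3 := by ring
        _ = _ := by rw [h2]; ring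
  · intro z hz
    rw [norm_eq_zero]
    by_contra h0
    exact hz (mem_box_of_pnorm_le (K.support_Kn n z h0))

theorem summable_integral_Kn : Summable fun n => ∫ z, ‖K.Kn n z‖ := by
  obtain ⟨C, hC, h⟩ := K.exists_integral_Kn_le
  refine Summable.of_nonneg_of_le (fun n => integral_nonneg fun _ => norm_nonneg _) h ?_
  exact (summable_geometric_of_lt_one (by norm_num) (by norm_num)).mul_left C

theorem integrable_total : Integrable K.total :=
  integrable_tsum_of_summable K.integrable_Kn K.summable_integral_Kn

theorem total_eq_zero {z : Spacetime} (h : 1 < ‖z‖) : K.total z = 0 := by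
  simp [total, K.Kn_eq_zero h]

/-- Functions that are integrable near a point and bounded very near it can be integrated against
the kernel. -/
structure Admissible (x : Spacetime) (g : Spacetime → ℝ) : Prop where
  integrableOn : IntegrableOn g (Metric.closedBall x 1)
  bounded : ∃ r > 0, ∃ C, ∀ w, pnorm (x - w) ≤ r → |g w| ≤ C

theorem admissible_of_continuous {g : Spacetime → ℝ} (hg : Continuous g) (x : Spacetime) :
    Admissible x g := by
  refine ⟨hg.continuousOn.integrableOn_compact (isCompact_closedBall x 1), 1, one_pos, ?_⟩
  obtain ⟨C, hC⟩ := (isCompact_closedBall x 1).exists_bound_of_continuousOn hg.continuousOn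
  refine ⟨C, fun w hw => hC w ?_⟩
  rw [Metric.mem_closedBall, dist_comm, dist_eq_norm]
  exact norm_le_one_of_pnorm_le hw

theorem Admissible.sub {x : Spacetime} {g h : Spacetime → ℝ} (hg : Admissible x g)
    (hh : Admissible x h) : Admissible x fun w => g w - h w := by
  obtain ⟨r, hr, C, hC⟩ := hg.bounded
  obtain ⟨s, hs, D, hD⟩ := hh.bounded
  refine ⟨hg.integrableOn.sub hh.integrableOn, min r s, lt_min hr hs, C + D, fun w hw => ?_⟩
  exact (abs_sub _ _).trans (add_le_add (hC w (hw.trans (min_le_left _ _)))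
    (hD w (hw.trans (min_le_right _ _))))

section admissible

variable {x : Spacetime} {g : Spacetime → ℝ}

theorem integrable_Kn_mul (hg : Admissible x g) (n : ℕ) :
    Integrable fun w => K.Kn n (x - w) * g w := by
  have hc : Continuous fun w => K.Kn n (x - w) :=
    (K.smooth_Kn n).continuous.comp (continuous_const.sub continuous_id)
  have h1 : IntegrableOn (fun w => K.Kn n (x - w) * g w) (Metric.closedBall x 1) :=
    hg.integrableOn.continuousOn_mul hc.continuousOn (isCompact_closedBall x 1)
  refine (integrableOn_iff_integrable_of_support_subset fun w hw => ?_).1 h1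
  by_contra h
  refine hw ?_
  rw [Metric.mem_closedBall, dist_comm, dist_eq_norm, not_le] at h
  simp only [K.Kn_eq_zero h, zero_mul]

/-- Once 2⁻ⁿ is below the radius on which g is bounded, the terms are dominated by multiples of
∫|K_n|. The finitely many coarse scales only use local integrability of g. -/
theorem summable_integral_Kn_mul (hg : Admissible x g) :
    Summable fun n => ∫ w, ‖K.Kn n (x - w) * g w‖ := by
  obtain ⟨r, hr, C, hC⟩ := hg.bounded
  have hC0 : 0 ≤ C := (abs_nonneg _).trans (hC x (by simpa [pnorm] using hr.le))
  refine Summable.of_norm_bounded_eventually_nat (K.summable_integral_Kn.mul_left C) ?_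
  have h1 : Tendsto (fun n : ℕ => (2 : ℝ) ^ (-(n : ℤ))) atTop (𝓝 0) := by
    have := tendsto_pow_atTop_nhds_zero_of_lt_one (r := (1 / 2 : ℝ)) (by norm_num) (by norm_num)
    refine this.congr fun n => ?_
    rw [zpow_neg, zpow_natCast, one_div, inv_pow]
  filter_upwards [h1.eventually (gt_mem_nhds hr)] with n hn
  rw [Real.norm_of_nonneg (integral_nonneg fun _ => norm_nonneg _), ← integral_const_mul,
    ← integral_sub_left_eq_self (fun z => C * ‖K.Kn n z‖) volume x]
  refine integral_mono (K.integrable_Kn_mul hg n).norm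
    ((((K.integrable_Kn n).norm.comp_sub_left x)).const_mul C) fun w => ?_
  simp only [norm_mul]
  by_cases h0 : K.Kn n (x - w) = 0
  · simp [h0]
  · rw [mul_comm]
    gcongr
    exact hC w ((K.support_Kn n _ h0).trans hn.le)

theorem integrable_total_mul (hg : Admissible x g) :
    Integrable fun w => K.total (x - w) * g w := by
  have := integrable_tsum_of_summable (K.integrable_Kn_mul hg) (K.summable_integral_Kn_mul hg)
  simp only [tsum_mul_right] at this
  exact this

theorem hasSum_integral (hg : Admissible x g) :
    HasSum (fun n => ∫ w, K.Kn n (x - w) * g w) (∫ w, K.total (x - w) * g w) := by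
  have := hasSum_integral_of_summable_integral_norm (K.integrable_Kn_mul hg)
    (K.summable_integral_Kn_mul hg)
  simp only [tsum_mul_right] at this
  exact this

theorem coeffAt_zero (hg : Admissible x g) : K.coeffAt 0 x g = K.conv g x :=
  (K.hasSum_integral hg).tsum_eq

theorem conv_sub {h : Spacetime → ℝ} (hg : Admissible x g) (hh : Admissible x h) :
    K.conv (fun w => g w - h w) x = K.conv g x - K.conv h x := by
  simp only [conv, mul_sub]
  exact integral_sub (K.integrable_total_mul hg) (K.integrable_total_mul hh)

theorem conv_add {h : Spacetime → ℝ} (hg : Admissible x g) (hh : Admissible x h) :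
    K.conv (fun w => g w + h w) x = K.conv g x + K.conv h x := by
  simp only [conv, mul_add]
  exact integral_add (K.integrable_total_mul hg) (K.integrable_total_mul hh)

theorem conv_smul (c : ℝ) : K.conv (fun w => c * g w) x = c * K.conv g x := by
  simp only [conv]
  rw [← integral_const_mul]
  congr 1
  ext w
  ring

end admissible

theorem conv_eq (g : Spacetime → ℝ) (x : Spacetime) :
    K.conv g x = ∫ w, K.total w * g (x - w) := by
  rw [conv, ← integral_sub_left_eq_self _ volume x]
  simp [total]

theorem hasFDerivAt_conv {g : Spacetime → ℝ} (hg : ContDiff ℝ ∞ g) (x : Spacetime) :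
    HasFDerivAt (K.conv g) (∫ w, K.total w • fderiv ℝ g (x - w)) x := by
  have hd : Continuous (fderiv ℝ g) := hg.continuous_fderiv (by simp)
  -- Radius 2 is one unit for moving the base point and one for the support of the kernel.
  obtain ⟨M, hM⟩ := (isCompact_closedBall x 2).exists_bound_of_continuousOn hd.continuousOn
  have h := hasFDerivAt_integral_of_dominated_of_fderiv_le (μ := volume) (x₀ := x)
    (F := fun x w => K.total w * g (x - w)) (F' := fun x w => K.total w • fderiv ℝ g (x - w))
    (s := Metric.ball x 1) (bound := fun w => ‖K.total w‖ * M)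
    (Metric.ball_mem_nhds x one_pos) (Eventually.of_forall fun y => ?_) ?_ ?_ ?_ ?_ ?_
  · refine h.congr_of_eventuallyEq (Eventually.of_forall fun y => K.conv_eq g y)
  · exact K.integrable_total.aestronglyMeasurable.mul
      (hg.continuous.comp (continuous_const.sub continuous_id)).aestronglyMeasurable
  · have := (K.integrable_total_mul (admissible_of_continuous hg.continuous x)).comp_sub_left x
    simpa using this
  · exact K.integrable_total.aestronglyMeasurable.smul
      (hd.comp (continuous_const.sub continuous_id)).aestronglyMeasurable
  · refine Eventually.of_forall fun w y hy => ?_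
    rw [norm_smul]
    by_cases hw : 1 < ‖w‖
    · simp [K.total_eq_zero hw]
    · gcongr
      refine hM _ ?_
      rw [Metric.mem_closedBall, dist_eq_norm]
      rw [Metric.mem_ball, dist_eq_norm] at hy
      calc ‖y - w - x‖ = ‖(y - x) - w‖ := by congr 1; abel
        _ ≤ ‖y - x‖ + ‖w‖ := norm_sub_le _ _
        _ ≤ 2 := by linarith [not_lt.1 hw]
  · exact K.integrable_total.norm.mul_const M
  · refine Eventually.of_forall fun w y _ => ?_
    have h1 : HasFDerivAt (fun y => g (y - w)) (fderiv ℝ g (y - w)) y :=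
      by simpa [Function.comp_def] using
        (hg.differentiable (by simp) (y - w)).hasFDerivAt.comp y ((hasFDerivAt_id y).sub_const w)
    exact h1.const_mul (K.total w)

theorem fderiv_conv {g : Spacetime → ℝ} (hg : ContDiff ℝ ∞ g) (x v : Spacetime) :
    fderiv ℝ (K.conv g) x v = K.conv (fun z => fderiv ℝ g z v) x := by
  have hd : Continuous (fderiv ℝ g) := hg.continuous_fderiv (by simp)
  rw [(K.hasFDerivAt_conv hg x).fderiv, ContinuousLinearMap.integral_apply, conv_eq]
  · simp
  · obtain ⟨M, hM⟩ := (isCompact_closedBall x 1).exists_bound_of_continuousOn hd.continuousOn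
    refine (K.integrable_total.norm.mul_const M).mono'
      (K.integrable_total.aestronglyMeasurable.smul
        (hd.comp (continuous_const.sub continuous_id)).aestronglyMeasurable)
      (Eventually.of_forall fun w => ?_)
    rw [norm_smul]
    by_cases hw : 1 < ‖w‖
    · simp [K.total_eq_zero hw]
    · gcongr
      refine hM _ ?_
      rw [Metric.mem_closedBall, dist_eq_norm]
      simpa using hw

theorem contDiff_conv {g : Spacetime → ℝ} (hg : ContDiff ℝ ∞ g) : ContDiff ℝ ∞ (K.conv g) := by
  rw [contDiff_infty]
  intro n
  induction n generalizing g with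
  | zero =>
    rw [Nat.cast_zero, contDiff_zero]
    exact continuous_iff_continuousAt.2 fun x => (K.hasFDerivAt_conv hg x).continuousAt
  | succ n ih =>
    rw [Nat.cast_succ, contDiff_succ_iff_fderiv_apply]
    refine ⟨fun x => (K.hasFDerivAt_conv hg x).differentiableAt, by simp, fun v => ?_⟩
    simp only [K.fderiv_conv hg]
    exact ih ((hg.fderiv_right (m := ∞) (by simp)).clm_apply contDiff_const)

theorem pd_conv {g : Spacetime → ℝ} (hg : ContDiff ℝ ∞ g) (i : Fin 4) :
    pd i (K.conv g) = K.conv (pd i g) := by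
  rw [pd_eq_fderiv (K.contDiff_conv hg), pd_eq_fderiv hg]
  ext x
  exact K.fderiv_conv hg x _

theorem mpd_conv {g : Spacetime → ℝ} (hg : ContDiff ℝ ∞ g) (k : Fin 4 → ℕ) :
    mpd k (K.conv g) = K.conv (mpd k g) := by
  induction k using multiIndex_induction generalizing g with
  | zero => rfl
  | add k i ih =>
    rw [mpd_add_single (K.contDiff_conv hg), mpd_add_single hg, K.pd_conv hg, ih (contDiff_pd hg i)]

theorem integral_pd_mul {f g : Spacetime → ℝ} (hf : ContDiff ℝ ∞ f) (hc : HasCompactSupport f)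
    (hg : ContDiff ℝ ∞ g) (i : Fin 4) (x : Spacetime) :
    ∫ y, pd i f (x - y) * g y = ∫ y, f (x - y) * pd i g y := by
  have hsub : ContDiff ℝ ∞ fun y : Spacetime => x - y := contDiff_const.sub contDiff_id
  have hF : ContDiff ℝ ∞ fun y => f (x - y) := hf.comp hsub
  have hFc : HasCompactSupport fun y => f (x - y) :=
    hc.comp_homeomorph (Homeomorph.subLeft x)
  have hder : ∀ y, fderiv ℝ (fun y => f (x - y)) y (Pi.single i 1) = - pd i f (x - y) := by
    intro y
    have h1 : HasFDerivAt (fun y => f (x - y)) (-(fderiv ℝ f (x - y))) y := by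
      have := (hf.differentiable (by simp) (x - y)).hasFDerivAt.comp y
        ((hasFDerivAt_id y).const_sub x)
      rw [ContinuousLinearMap.comp_neg, ContinuousLinearMap.comp_id] at this
      exact this
    rw [h1.fderiv, pd_eq_fderiv hf]
    rfl
  have hcont : ∀ {p q : Spacetime → ℝ}, Continuous p → Continuous q → HasCompactSupport p →
      Integrable fun y => p y * q y := fun hp hq hpc =>
    (hp.mul hq).integrable_of_hasCompactSupport hpc.mul_right
  have hFd : Continuous fun y => fderiv ℝ (fun y => f (x - y)) y (Pi.single i 1) :=
    (hF.continuous_fderiv (by simp)).clm_apply continuous_const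
  have hgd : Continuous fun y => fderiv ℝ g y (Pi.single i 1) :=
    (hg.continuous_fderiv (by simp)).clm_apply continuous_const
  have hFdc : HasCompactSupport fun y => fderiv ℝ (fun y => f (x - y)) y (Pi.single i 1) :=
    (hFc.fderiv ℝ).comp_left (g := fun L : Spacetime →L[ℝ] ℝ => L (Pi.single i 1)) rfl
  have := integral_mul_fderiv_eq_neg_fderiv_mul_of_integrable (μ := volume)
    (f := fun y => f (x - y)) (g := g) (v := Pi.single i 1)
    (hcont hFd hg.continuous hFdc) (hcont hF.continuous hgd hFc)
    (hcont hF.continuous hg.continuous hFc)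
    (fun y _ => hF.differentiable (by simp) y) (fun y _ => hg.differentiable (by simp) y)
  rw [pd_eq_fderiv hg, this, ← integral_neg]
  congr 1
  ext y
  rw [hder]
  ring

theorem integral_mpd_mul {f g : Spacetime → ℝ} (hf : ContDiff ℝ ∞ f) (hc : HasCompactSupport f)
    (hg : ContDiff ℝ ∞ g) (k : Fin 4 → ℕ) (x : Spacetime) :
    ∫ y, mpd k f (x - y) * g y = ∫ y, f (x - y) * mpd k g y := by
  induction k using multiIndex_induction generalizing f g with
  | zero => rfl
  | add k i ih =>
    have hc' : HasCompactSupport (pd i f) := by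
      rw [pd_eq_fderiv hf]
      exact (hc.fderiv ℝ).comp_left (g := fun L : Spacetime →L[ℝ] ℝ => L (Pi.single i 1)) rfl
    rw [mpd_add_single hf, ih (contDiff_pd hf i) hc' hg,
      integral_pd_mul hf hc (contDiff_mpd hg k), mpd_add_single hg, pd_mpd hg]

/-- Integrating by parts at each scale moves D^k onto g, after which the sum over scales converges.
This turns the formal coefficients in F_x and J(x) into the Taylor coefficients of K * g. -/
theorem coeffAt_eq {g : Spacetime → ℝ} (hg : ContDiff ℝ ∞ g) (k : Fin 4 → ℕ) (x : Spacetime) :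
    K.coeffAt k x g = mpd k (K.conv g) x := by
  rw [K.mpd_conv hg, ← K.coeffAt_zero (admissible_of_continuous (contDiff_mpd hg k).continuous x)]
  simp only [coeffAt, mpd_zero]
  congr 1
  ext n
  exact integral_mpd_mul (K.smooth_Kn n) (K.hasCompactSupport_Kn n) hg k x

end HeatKernelSplit

end Phi43

namespace Phi43

/-! ## Parabolic Taylor expansion -/

/-- The normalised monomial `v^k / k!`. -/
noncomputable def nmono (k : Fin 4 → ℕ) (v : Spacetime) : ℝ :=
  ∏ i, v i ^ k i / ((k i).factorial : ℝ)

theorem contDiff_nmono (k : Fin 4 → ℕ) : ContDiff ℝ ∞ (nmono k) := by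
  unfold nmono
  refine contDiff_prod fun i _ => ?_
  exact ((contDiff_apply ℝ ℝ i).pow _).div_const _

theorem pd_nmono_add (k : Fin 4 → ℕ) (i : Fin 4) :
    pd i (nmono (k + Pi.single i 1)) = nmono k := by
  ext v
  rw [pd, lineDeriv]
  have h : ∀ t : ℝ, nmono (k + Pi.single i 1) (v + t • Pi.single i 1) =
      (v i + t) ^ (k i + 1) / ((k i + 1).factorial : ℝ) *
        ∏ j ∈ Finset.univ.erase i, v j ^ k j / ((k j).factorial : ℝ) := by
    intro t
    rw [nmono, ← Finset.mul_prod_erase _ _ (Finset.mem_univ i)]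
    congr 1
    · simp
    · refine Finset.prod_congr rfl fun j hj => ?_
      have hj : j ≠ i := Finset.ne_of_mem_erase hj
      simp [hj]
  simp only [h]
  have h1 : HasDerivAt (fun t : ℝ => (v i + t) ^ (k i + 1) / ((k i + 1).factorial : ℝ) *
        ∏ j ∈ Finset.univ.erase i, v j ^ k j / ((k j).factorial : ℝ))
      (((k i + 1 : ℕ) * (v i + 0) ^ (k i) * 1) / ((k i + 1).factorial : ℝ) *
        ∏ j ∈ Finset.univ.erase i, v j ^ k j / ((k j).factorial : ℝ)) 0 := by
    have := ((hasDerivAt_id (0 : ℝ)).const_add (v i)).pow (k i + 1)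
    exact (this.div_const _).mul_const _
  rw [h1.deriv, nmono, ← Finset.mul_prod_erase _ _ (Finset.mem_univ i)]
  congr 1
  rw [Nat.factorial_succ]
  push_cast
  have : (k i : ℝ) + 1 ≠ 0 := by positivity
  field_simp
  simp

theorem pd_nmono_of_eq_zero {k : Fin 4 → ℕ} {i : Fin 4} (hk : k i = 0) :
    pd i (nmono k) = 0 := by
  ext v
  rw [pd, lineDeriv]
  have h : ∀ t : ℝ, nmono k (v + t • Pi.single i 1) = nmono k v := by
    intro t
    refine Finset.prod_congr rfl fun j _ => ?_
    by_cases hj : j = i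
    · subst hj
      simp [hk]
    · simp [hj]
  simp [h]

theorem nmono_zero_apply (k : Fin 4 → ℕ) : nmono k 0 = if k = 0 then 1 else 0 := by
  split_ifs with h
  · subst h
    simp [nmono]
  · obtain ⟨i, hi⟩ : ∃ i, k i ≠ 0 := by
      by_contra! h'
      exact h (funext h')
    exact Finset.prod_eq_zero (Finset.mem_univ i) (by simp [hi])

/-- The remainder of the Taylor expansion of `f` at `x` up to parabolic order `α`. -/
noncomputable def taylorRem (α : ℝ) (f : Spacetime → ℝ) (x v : Spacetime) : ℝ :=
  f (x + v) - ∑ k ∈ multiBelow α, nmono k v * mpd k f x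

theorem contDiff_taylorRem (α : ℝ) {f : Spacetime → ℝ} (hf : ContDiff ℝ ∞ f) (x : Spacetime) :
    ContDiff ℝ ∞ (taylorRem α f x) := by
  refine (hf.comp (contDiff_const.add contDiff_id)).sub ?_
  exact ContDiff.sum fun k _ => (contDiff_nmono k).mul contDiff_const

/-- The parabolic weight of a coordinate. -/
def wt (i : Fin 4) : ℕ := if i = 0 then 2 else 1

theorem sdeg_single (i : Fin 4) : sdeg (Pi.single i 1) = wt i := by
  fin_cases i <;> simp [sdeg, wt]

/-- Differentiating the Taylor polynomial lowers the multiindex by one, hence the admissible order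
by the weight of the coordinate; monomials without that coordinate drop out. -/
theorem pd_taylorRem (α : ℝ) {f : Spacetime → ℝ} (hf : ContDiff ℝ ∞ f) (x : Spacetime)
    (i : Fin 4) : pd i (taylorRem α f x) = taylorRem (α - wt i) (pd i f) x := by
  have hsum : ∑ k ∈ multiBelow (α - wt i), nmono k * (fun _ => mpd k (pd i f) x) =
      ∑ k ∈ multiBelow α, pd i (nmono k) * (fun _ => mpd k f x) := by
    refine Finset.sum_bij_ne_zero (fun k _ _ => k + Pi.single i 1) ?_ ?_ ?_ ?_
    · intro k hk _
      rw [mem_multiBelow, sdeg_add, sdeg_single]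
      rw [mem_multiBelow] at hk
      push_cast
      linarith
    · intro k _ _ l _ _ h
      exact add_right_cancel h
    · intro k hk h
      have hk0 : k i ≠ 0 := by
        intro h0
        rw [pd_nmono_of_eq_zero h0, zero_mul] at h
        exact h rfl
      have h1 : k = (k - Pi.single i 1) + Pi.single i 1 := by
        ext j
        by_cases hj : j = i
        · subst hj
          simp
          omega
        · simp [hj]
      refine ⟨k - Pi.single i 1, ?_, ?_, h1.symm⟩
      · rw [mem_multiBelow] at hk ⊢
        rw [h1, sdeg_add, sdeg_single] at hk
        push_cast at hk
        linarith
      · rw [h1, pd_nmono_add, mpd_add_single hf] at h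
        exact h
    · intro k _ _
      rw [pd_nmono_add, mpd_add_single hf]
  ext v
  have hd : ∀ k, HasFDerivAt (fun v => nmono k v * mpd k f x)
      (mpd k f x • fderiv ℝ (nmono k) v) v := fun k =>
    ((contDiff_nmono k).differentiable (by simp) v).hasFDerivAt.mul_const _
  have hfx : HasFDerivAt (fun v => f (x + v)) (fderiv ℝ f (x + v)) v := by
    have := (hf.differentiable (by simp) (x + v)).hasFDerivAt.comp v ((hasFDerivAt_id v).const_add x)
    rw [ContinuousLinearMap.comp_id] at this
    exact this
  have h1 : HasFDerivAt (taylorRem α f x) (fderiv ℝ f (x + v) -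
      ∑ k ∈ multiBelow α, mpd k f x • fderiv ℝ (nmono k) v) v :=
    hfx.sub (HasFDerivAt.fun_sum fun k _ => hd k)
  rw [pd_eq_fderiv (contDiff_taylorRem α hf x)]
  change fderiv ℝ (taylorRem α f x) v (Pi.single i 1) = _
  rw [h1.fderiv, taylorRem, pd_eq_fderiv hf]
  have h2 := congrFun hsum v
  rw [pd_eq_fderiv hf] at h2
  simp only [Finset.sum_apply, Pi.mul_apply] at h2
  rw [h2]
  simp only [sub_apply, sum_apply, smul_apply, smul_eq_mul]
  congr 1
  refine Finset.sum_congr rfl fun k _ => ?_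
  rw [pd_eq_fderiv (contDiff_nmono k), mul_comm]

theorem taylorRem_zero {α : ℝ} (hα : 0 < α) (f : Spacetime → ℝ) (x : Spacetime) :
    taylorRem α f x 0 = 0 := by
  have h0 : (0 : Fin 4 → ℕ) ∈ multiBelow α := by
    rw [mem_multiBelow]
    simpa [sdeg] using hα
  rw [taylorRem, Finset.sum_eq_single_of_mem 0 h0]
  · simp [nmono_zero_apply, mpd_zero]
  · intro k _ hk
    simp [nmono_zero_apply, hk]

theorem pnorm_smul_le {t : ℝ} (h0 : 0 ≤ t) (h1 : t ≤ 1) (v : Spacetime) :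
    pnorm (t • v) ≤ pnorm v := by
  have h : ∀ i, |(t • v) i| ≤ |v i| := fun i => by
    rw [Pi.smul_apply, smul_eq_mul, abs_mul, abs_of_nonneg h0]
    exact mul_le_of_le_one_left (abs_nonneg _) h1
  unfold pnorm
  have := Real.sqrt_le_sqrt (h 0)
  linarith [h 1, h 2, h 3]

/-- A mean value inequality along the segment from the origin. -/
theorem abs_sub_le_of_pd_le {F : Spacetime → ℝ} (hF : ContDiff ℝ ∞ F) {v : Spacetime}
    {B : Fin 4 → ℝ} (hB : ∀ i, ∀ t ∈ Icc (0 : ℝ) 1, |pd i F (t • v)| ≤ B i) :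
    |F v - F 0| ≤ ∑ i, |v i| * B i := by
  have hd : ∀ t ∈ Icc (0 : ℝ) 1, HasDerivWithinAt (fun t : ℝ => F (t • v))
      (fderiv ℝ F (t • v) v) (Icc 0 1) t := by
    intro t _
    have h1 : HasDerivAt (fun t : ℝ => t • v) v t := by
      simpa using (hasDerivAt_id t).smul_const v
    exact ((hF.differentiable (by simp) (t • v)).hasFDerivAt.comp_hasDerivAt t h1).hasDerivWithinAt
  have := (convex_Icc (0 : ℝ) 1).norm_image_sub_le_of_norm_hasDerivWithin_le hd
    (C := ∑ i, |v i| * B i) (fun t ht => ?_) (left_mem_Icc.2 zero_le_one)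
    (right_mem_Icc.2 zero_le_one)
  · simpa using this
  · have hv : v = ∑ i, v i • (Pi.single i 1 : Spacetime) := by
      ext j
      simp [Finset.sum_apply, Pi.single_apply]
    have h2 : fderiv ℝ F (t • v) v = ∑ i, v i * pd i F (t • v) := by
      conv_lhs => rw [hv]
      rw [map_sum]
      refine Finset.sum_congr rfl fun i _ => ?_
      rw [map_smul, pd_eq_fderiv hF, smul_eq_mul, ← hv]
    rw [h2]
    refine (Finset.abs_sum_le_sum_abs _ _).trans (Finset.sum_le_sum fun i _ => ?_)
    rw [abs_mul]
    exact mul_le_mul_of_nonneg_left (hB i t ht) (abs_nonneg _)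

theorem abs_le_pnorm_pow_wt (v : Spacetime) (i : Fin 4) : |v i| ≤ pnorm v ^ wt i := by
  unfold wt
  split_ifs with h
  · subst h
    exact abs_time_le v
  · rw [pow_one]
    exact abs_space_le v h

/-- Induction on an integer bound for the order. The derivatives of the remainder are remainders of
lower order, and the remainder vanishes at v = 0, so one integrates along the segment from 0;
coordinate i contributes |v_i| ≤ |v|^(weight), exactly the order lost. For nonpositive order nothing
is subtracted and local boundedness is enough. -/
theorem taylorRem_bound (n : ℕ) : ∀ (α : ℝ), α ≤ n → ∀ (f : Spacetime → ℝ), ContDiff ℝ ∞ f →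
    ∀ A : Set Spacetime, IsCompact A → ∃ C : ℝ, 0 ≤ C ∧ ∀ x ∈ A, ∀ v, pnorm v ≤ 1 →
      |taylorRem α f x v| ≤ C * pnorm v ^ max α 0 := by
  induction n using Nat.strong_induction_on with
  | _ n ih =>
    intro α hα f hf A hA
    by_cases hα0 : α ≤ 0
    · have hcomp : IsCompact ((fun p : Spacetime × Spacetime => p.1 + p.2) ''
          (A ×ˢ Metric.closedBall (0 : Spacetime) 1)) :=
        (hA.prod (isCompact_closedBall 0 1)).image continuous_add
      obtain ⟨C, hC⟩ := hcomp.exists_bound_of_continuousOn hf.continuous.continuousOn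
      refine ⟨max C 0, le_max_right _ _, fun x hx v hv => ?_⟩
      rw [taylorRem, multiBelow]
      have : multiBelow α = ∅ := by
        ext k
        rw [mem_multiBelow]
        simp only [Finset.notMem_empty, iff_false, not_lt]
        exact hα0.trans (by positivity)
      rw [multiBelow] at this
      rw [this, Finset.sum_empty, sub_zero, max_eq_right hα0, Real.rpow_zero, mul_one]
      exact (hC _ ⟨(x, v), ⟨hx, by simpa using norm_le_one_of_pnorm_le hv⟩, rfl⟩).trans
        (le_max_left _ _)
    · push Not at hα0
      have hn : 1 ≤ n := by
        by_contra h
        have : n = 0 := by omega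
        subst this
        simp at hα
        linarith
      have hw : ∀ i, 1 ≤ wt i := fun i => by
        unfold wt
        split_ifs <;> norm_num
      have hstep : ∀ i, ∃ C : ℝ, 0 ≤ C ∧ ∀ x ∈ A, ∀ v, pnorm v ≤ 1 →
          |taylorRem (α - wt i) (pd i f) x v| ≤ C * pnorm v ^ max (α - wt i) 0 := by
        intro i
        refine ih (n - 1) (by omega) _ ?_ _ (contDiff_pd hf i) A hA
        have : (1 : ℝ) ≤ wt i := by exact_mod_cast hw i
        rw [Nat.cast_sub hn, Nat.cast_one]
        linarith
      choose C hC0 hC using hstep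
      refine ⟨∑ i, C i, Finset.sum_nonneg fun i _ => hC0 i, fun x hx v hv => ?_⟩
      have h1 := abs_sub_le_of_pd_le (contDiff_taylorRem α hf x) (v := v)
        (B := fun i => C i * pnorm v ^ max (α - wt i) 0) (fun i t ht => ?_)
      · rw [taylorRem_zero hα0, sub_zero] at h1
        refine h1.trans ?_
        rw [Finset.sum_mul]
        refine Finset.sum_le_sum fun i _ => ?_
        rw [mul_left_comm]
        refine mul_le_mul_of_nonneg_left ?_ (hC0 i)
        rcases (pnorm_nonneg v).eq_or_lt with h0 | h0
        · have hv0 : |v i| = 0 := le_antisymm (by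
            have := abs_le_pnorm_pow_wt v i
            rwa [← h0, zero_pow (by have := hw i; omega)] at this) (abs_nonneg _)
          rw [hv0, zero_mul]
          exact Real.rpow_nonneg (pnorm_nonneg v) _
        · calc |v i| * pnorm v ^ max (α - wt i) 0
              ≤ pnorm v ^ (wt i : ℝ) * pnorm v ^ max (α - wt i) 0 := by
                rw [Real.rpow_natCast]
                exact mul_le_mul_of_nonneg_right (abs_le_pnorm_pow_wt v i)
                  (Real.rpow_nonneg h0.le _)
            _ = pnorm v ^ ((wt i : ℝ) + max (α - wt i) 0) := (Real.rpow_add h0 _ _).symm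
            _ ≤ pnorm v ^ max α 0 := by
                refine Real.rpow_le_rpow_of_exponent_ge h0 hv ?_
                rw [max_eq_left hα0.le]
                linarith [le_max_left (α - wt i) 0]
      · rw [pd_taylorRem α hf]
        refine (hC i x hx _ ((pnorm_smul_le ht.1 ht.2 v).trans hv)).trans ?_
        refine mul_le_mul_of_nonneg_left ?_ (hC0 i)
        exact Real.rpow_le_rpow (pnorm_nonneg _) (pnorm_smul_le ht.1 ht.2 v) (le_max_right _ _)

end Phi43

namespace Phi43

open Phi43.Symbol

/-! ## Linearity of iterated derivatives -/

theorem pd_add {f g : Spacetime → ℝ} (hf : ContDiff ℝ ∞ f) (hg : ContDiff ℝ ∞ g) (i : Fin 4) :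
    pd i (f + g) = pd i f + pd i g := by
  have h : ContDiff ℝ ∞ (f + g) := hf.add hg
  rw [pd_eq_fderiv h, pd_eq_fderiv hf, pd_eq_fderiv hg]
  ext z
  rw [fderiv_add (hf.differentiable (by simp) z) (hg.differentiable (by simp) z)]
  rfl

theorem pd_smul {f : Spacetime → ℝ} (hf : ContDiff ℝ ∞ f) (c : ℝ) (i : Fin 4) :
    pd i (c • f) = c • pd i f := by
  have h : ContDiff ℝ ∞ (c • f) := contDiff_const.smul hf
  rw [pd_eq_fderiv h, pd_eq_fderiv hf]
  ext z
  rw [fderiv_const_smul (hf.differentiable (by simp) z)]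
  rfl

theorem mpd_add {f g : Spacetime → ℝ} (hf : ContDiff ℝ ∞ f) (hg : ContDiff ℝ ∞ g)
    (k : Fin 4 → ℕ) : mpd k (f + g) = mpd k f + mpd k g := by
  induction k using multiIndex_induction generalizing f g with
  | zero => rfl
  | add k i ih =>
    have h : ContDiff ℝ ∞ (f + g) := hf.add hg
    rw [mpd_add_single h, mpd_add_single hf, mpd_add_single hg, pd_add hf hg,
      ih (contDiff_pd hf i) (contDiff_pd hg i)]

theorem mpd_smul {f : Spacetime → ℝ} (hf : ContDiff ℝ ∞ f) (c : ℝ) (k : Fin 4 → ℕ) :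
    mpd k (c • f) = c • mpd k f := by
  induction k using multiIndex_induction generalizing f with
  | zero => rfl
  | add k i ih =>
    have h : ContDiff ℝ ∞ (c • f) := contDiff_const.smul hf
    rw [mpd_add_single h, mpd_add_single hf, pd_smul hf,
      ih (contDiff_pd hf i)]

theorem taylorRem_add (α : ℝ) {f g : Spacetime → ℝ} (hf : ContDiff ℝ ∞ f) (hg : ContDiff ℝ ∞ g)
    (x v : Spacetime) : taylorRem α (f + g) x v = taylorRem α f x v + taylorRem α g x v := by
  simp only [taylorRem, mpd_add hf hg, Pi.add_apply, mul_add, Finset.sum_add_distrib]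
  ring

theorem taylorRem_smul (α : ℝ) {f : Spacetime → ℝ} (hf : ContDiff ℝ ∞ f) (c : ℝ)
    (x v : Spacetime) : taylorRem α (c • f) x v = c • taylorRem α f x v := by
  simp only [taylorRem, mpd_smul hf, Pi.smul_apply, smul_eq_mul, mul_sub, Finset.mul_sum]
  congr 1
  exact Finset.sum_congr rfl fun k _ => by ring

/-! ## Families of formal expressions with bounded coefficients -/

/-- Finite sums of constant elements with coefficients that are bounded on `A`. -/
noncomputable def tame (A : Set Spacetime) : Submodule ℝ (Spacetime → Alg) :=
  Submodule.span ℝ {a | ∃ (c : Spacetime → ℝ) (b : Alg),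
    (∃ C, ∀ x ∈ A, |c x| ≤ C) ∧ a = fun x => c x • b}

section tame

variable {A : Set Spacetime}

theorem tame_const (b : Alg) : (fun _ => b) ∈ tame A :=
  Submodule.subset_span ⟨fun _ => 1, b, ⟨1, fun _ _ => by simp⟩, by simp⟩

theorem tame_smul {c : Spacetime → ℝ} (hc : ∃ C, ∀ x ∈ A, |c x| ≤ C) {a : Spacetime → Alg}
    (ha : a ∈ tame A) : (fun x => c x • a x) ∈ tame A := by
  induction ha using Submodule.span_induction with
  | mem a h =>
    obtain ⟨d, b, ⟨D, hD⟩, rfl⟩ := h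
    obtain ⟨C, hC⟩ := hc
    refine Submodule.subset_span ⟨fun x => c x * d x, b, ⟨C * D, fun x hx => ?_⟩, ?_⟩
    · rw [abs_mul]
      exact mul_le_mul (hC x hx) (hD x hx) (abs_nonneg _) ((abs_nonneg _).trans (hC x hx))
    · ext1 x
      rw [smul_smul]
  | zero =>
    convert (tame A).zero_mem using 1
    ext1 x
    simp
  | add a b _ _ ha hb =>
    convert Submodule.add_mem _ ha hb using 1
    ext1 x
    simp
  | smul r a _ ha =>
    convert Submodule.smul_mem _ r ha using 1
    ext1 x
    simp [smul_comm r (c x)]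

theorem tame_map (L : Alg →ₗ[ℝ] Alg) {a : Spacetime → Alg} (ha : a ∈ tame A) :
    (fun x => L (a x)) ∈ tame A := by
  induction ha using Submodule.span_induction with
  | mem a h =>
    obtain ⟨d, b, hD, rfl⟩ := h
    exact Submodule.subset_span ⟨d, L b, hD, by ext1 x; rw [map_smul]⟩
  | zero =>
    convert (tame A).zero_mem using 1
    ext1 x
    simp
  | add a b _ _ ha hb =>
    convert Submodule.add_mem _ ha hb using 1
    ext1 x
    simp
  | smul r a _ ha =>
    convert Submodule.smul_mem _ r ha using 1
    ext1 x
    simp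

theorem tame_mul {a b : Spacetime → Alg} (ha : a ∈ tame A) (hb : b ∈ tame A) :
    (fun x => a x * b x) ∈ tame A := by
  induction hb using Submodule.span_induction with
  | mem b h =>
    obtain ⟨d, b, hD, rfl⟩ := h
    convert tame_smul hD (tame_map (LinearMap.mulRight ℝ b) ha) using 1
    ext1 x
    simp
  | zero =>
    convert (tame A).zero_mem using 1
    ext1 x
    simp
  | add b c _ _ hb hc =>
    convert Submodule.add_mem _ hb hc using 1
    ext1 x
    simp [mul_add]
  | smul r b _ hb =>
    convert Submodule.smul_mem _ r hb using 1
    ext1 x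
    simp

theorem tame_pow {a : Spacetime → Alg} (ha : a ∈ tame A) (n : ℕ) :
    (fun x => a x ^ n) ∈ tame A := by
  induction n with
  | zero => simpa using tame_const 1
  | succ n ih => simpa only [pow_succ] using tame_mul ih ha

theorem tame_prod {ι : Type*} (s : Finset ι) {a : ι → Spacetime → Alg}
    (ha : ∀ i, a i ∈ tame A) : (fun x => ∏ i ∈ s, a i x) ∈ tame A := by
  classical
  induction s using Finset.induction_on with
  | empty => simpa using tame_const 1
  | insert i s hi ih => simpa only [Finset.prod_insert hi] using tame_mul (ha i) ih

theorem tame_sum {ι : Type*} (s : Finset ι) {a : ι → Spacetime → Alg}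
    (ha : ∀ i ∈ s, a i ∈ tame A) : (fun x => ∑ i ∈ s, a i x) ∈ tame A := by
  convert Submodule.sum_mem _ ha using 1
  ext1 x
  simp

/-- Bounds that hold for all constant elements hold for families with bounded coefficients. -/
theorem tame_bound {ι : Type*} (T : Spacetime → ι → Alg →ₗ[ℝ] ℝ) (V : Set ι) (W : ι → ℝ)
    (h : ∀ b, ∃ C, 0 ≤ C ∧ ∀ x ∈ A, ∀ v ∈ V, |T x v b| ≤ C * W v) {a : Spacetime → Alg}
    (ha : a ∈ tame A) : ∃ C, 0 ≤ C ∧ ∀ x ∈ A, ∀ v ∈ V, |T x v (a x)| ≤ C * W v := by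
  induction ha using Submodule.span_induction with
  | mem a ha =>
    obtain ⟨d, b, ⟨D, hD⟩, rfl⟩ := ha
    obtain ⟨C, hC0, hC⟩ := h b
    refine ⟨|D| * C, by positivity, fun x hx v hv => ?_⟩
    rw [map_smul, smul_eq_mul, abs_mul, mul_assoc]
    exact mul_le_mul ((hD x hx).trans (le_abs_self D)) (hC x hx v hv) (abs_nonneg _)
      (abs_nonneg _)
  | zero => exact ⟨0, le_rfl, fun x _ v _ => by simp⟩
  | add a b _ _ ha hb =>
    obtain ⟨C, hC0, hC⟩ := ha
    obtain ⟨D, hD0, hD⟩ := hb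
    refine ⟨C + D, by positivity, fun x hx v hv => ?_⟩
    rw [Pi.add_apply, map_add, add_mul]
    exact (abs_add_le _ _).trans (add_le_add (hC x hx v hv) (hD x hx v hv))
  | smul r a _ ha =>
    obtain ⟨C, hC0, hC⟩ := ha
    refine ⟨|r| * C, by positivity, fun x hx v hv => ?_⟩
    rw [Pi.smul_apply, map_smul, smul_eq_mul, abs_mul, mul_assoc]
    exact mul_le_mul_of_nonneg_left (hC x hx v hv) (abs_nonneg _)

end tame

/-! ## Smooth realisations -/

section realisation

variable {N : ℕ} (K : HeatKernelSplit N)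

/-- The convolution of a smooth realisation with the kernel, as a linear map. -/
noncomputable def convLin (PP : Alg →ₗ[ℝ] (Spacetime → ℝ)) (hPP : ∀ a, ContDiff ℝ ∞ (PP a)) :
    Alg →ₗ[ℝ] (Spacetime → ℝ) where
  toFun a := K.conv (PP a)
  map_add' a b := by
    ext x
    rw [map_add]
    exact K.conv_add (HeatKernelSplit.admissible_of_continuous (hPP a).continuous x)
      (HeatKernelSplit.admissible_of_continuous (hPP b).continuous x)
  map_smul' c a := by
    ext x
    rw [map_smul]
    exact K.conv_smul c

/-- Iterated derivatives of a smooth realisation, as a linear map. -/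
noncomputable def mpdLin (PP : Alg →ₗ[ℝ] (Spacetime → ℝ)) (hPP : ∀ a, ContDiff ℝ ∞ (PP a))
    (k : Fin 4 → ℕ) (x : Spacetime) : Alg →ₗ[ℝ] ℝ where
  toFun a := mpd k (PP a) x
  map_add' a b := by rw [map_add, mpd_add (hPP a) (hPP b), Pi.add_apply]
  map_smul' c a := by rw [map_smul, mpd_smul (hPP a)]; rfl

/-- Taylor remainders of a smooth realisation, as a linear map. -/
noncomputable def taylorLin (PP : Alg →ₗ[ℝ] (Spacetime → ℝ)) (hPP : ∀ a, ContDiff ℝ ∞ (PP a))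
    (α : ℝ) (x v : Spacetime) : Alg →ₗ[ℝ] ℝ where
  toFun a := taylorRem α (PP a) x v
  map_add' a b := by rw [map_add, taylorRem_add α (hPP a) (hPP b)]
  map_smul' c a := by rw [map_smul, taylorRem_smul α (hPP a)]; rfl

theorem tame_taylorRem {A : Set Spacetime} (hA : IsCompact A) (PP : Alg →ₗ[ℝ] (Spacetime → ℝ))
    (hPP : ∀ a, ContDiff ℝ ∞ (PP a)) (α : ℝ) {a : Spacetime → Alg} (ha : a ∈ tame A) :
    ∃ C, 0 ≤ C ∧ ∀ x ∈ A, ∀ v, pnorm v ≤ 1 →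
      |taylorRem α (PP (a x)) x v| ≤ C * pnorm v ^ max α 0 :=
  tame_bound (taylorLin PP hPP α) {v | pnorm v ≤ 1} (fun v => pnorm v ^ max α 0)
    (fun b => taylorRem_bound ⌈α⌉₊ α (Nat.le_ceil α) _ (hPP b) A hA) ha

/-- F_xτ involves a fixed finite set of elements of the algebra; only the coefficients depend on x.
They are built from the coordinates of x and from D^k(K * Π_xσ)(x), which is linear in F_xσ, so
boundedness on a compact set follows by induction on the symbol. -/
theorem tame_recenter {κ : ℝ} {A : Set Spacetime} (hA : IsCompact A)
    (PP : Alg →ₗ[ℝ] (Spacetime → ℝ)) (hPP : ∀ a, ContDiff ℝ ∞ (PP a)) (τ : Symbol) :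
    (fun x => recenter κ K PP x (Alg.of τ)) ∈ tame A := by
  have hcoord : ∀ i, (fun x : Spacetime => Alg.of (coord i) - algebraMap ℝ Alg (x i)) ∈ tame A := by
    intro i
    refine Submodule.sub_mem _ (tame_const _) ?_
    simp only [Algebra.algebraMap_eq_smul_one]
    refine tame_smul ?_ (tame_const _)
    exact hA.exists_bound_of_continuousOn (continuous_apply i).continuousOn
  induction τ using Symbol.induction with
  | one => simpa [Alg.of_one] using tame_const 1
  | noise => simpa [recenter] using tame_const (Alg.of noise)
  | coord i => simpa only [recenter_coord] using hcoord i
  | mul a b ha hb => simpa only [Alg.of_mul, map_mul] using tame_mul ha hb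
  | int τ ih =>
    simp only [recenter_of_int]
    refine Submodule.sub_mem _ (tame_map _ ih) ?_
    simp only [Alg.jet, Alg.jetIn, map_sum, map_smul, map_prod, map_pow, recenter_coord]
    refine tame_sum _ fun k _ => tame_smul ?_ ?_
    · obtain ⟨C, -, hC⟩ := tame_bound (A := A) (ι := Unit)
        (fun x _ => mpdLin (convLin K PP hPP) (fun a => K.contDiff_conv (hPP a)) k x)
        univ (fun _ => 1) (fun b => by
          obtain ⟨C, hC⟩ := hA.exists_bound_of_continuousOn
            (contDiff_mpd (K.contDiff_conv (hPP b)) k).continuous.continuousOn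
          exact ⟨|C|, abs_nonneg _, fun x hx _ _ => by
            rw [mul_one]
            exact (hC x hx).trans (le_abs_self C)⟩) ih
      refine ⟨C * ((∏ i, (k i).factorial : ℕ) : ℝ)⁻¹, fun x hx => ?_⟩
      have h := hC x hx () trivial
      rw [mul_one] at h
      rw [div_eq_mul_inv, abs_mul, abs_inv, Nat.abs_cast]
      refine mul_le_mul_of_nonneg_right ?_ (by positivity)
      rw [modelPi, LinearMap.comp_apply, AlgHom.toLinearMap_apply, K.coeffAt_eq (hPP _)]
      exact h
    · exact tame_prod _ fun i => tame_pow (hcoord i) _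

variable (ξ : Spacetime → ℝ)

theorem canonicalPP_int (τ : Symbol) :
    canonicalPP K ξ (Alg.of τ.int) = K.conv (canonicalPP K ξ (Alg.of τ)) := by
  simp [canonicalPP]

theorem canonicalPP_noise : canonicalPP K ξ (Alg.of noise) = ξ := by simp [canonicalPP]

theorem canonicalPP_shifted_mono (c : Fin 4 → ℝ) (k : Fin 4 → ℕ) (y : Spacetime) :
    canonicalPP K ξ (∏ i, (Alg.of (coord i) + algebraMap ℝ Alg (c i)) ^ k i) y =
      ∏ i, (y i + c i) ^ k i := by
  simp only [canonicalPP, AlgHom.toLinearMap_apply, map_prod, map_pow, map_add, AlgHom.commutes,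
    Alg.extendAlg_of, fold_coord]
  simp [Finset.prod_apply]

theorem canonicalPP_mono (k : Fin 4 → ℕ) (y : Spacetime) :
    canonicalPP K ξ (Alg.of (mono k)) y = ∏ i, y i ^ k i := by
  simpa [Alg.of_mono] using canonicalPP_shifted_mono K ξ 0 k y

variable {ξ}

theorem contDiff_canonicalPP (hξ : ContDiff ℝ ∞ ξ) (a : Alg) :
    ContDiff ℝ ∞ (canonicalPP K ξ a) := by
  induction a using Alg.induction with
  | of τ =>
    induction τ using Symbol.induction with
    | one =>
      have : canonicalPP K ξ (Alg.of 1) = fun _ => 1 := by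
        ext
        simp [canonicalPP]
      rw [this]
      exact contDiff_const
    | noise => rwa [canonicalPP_noise]
    | coord i =>
      have : canonicalPP K ξ (Alg.of (coord i)) = fun x => x i := by simp [canonicalPP]
      rw [this]
      exact contDiff_apply ℝ ℝ i
    | mul a b ha hb =>
      rw [Alg.of_mul, canonicalPP_mul]
      exact ha.mul hb
    | int τ ih =>
      rw [canonicalPP_int]
      exact K.contDiff_conv ih
  | add a b ha hb =>
    rw [map_add]
    exact ha.add hb
  | smul r a ha =>
    rw [map_smul]
    exact contDiff_const.smul ha

theorem integral_Kn_mul_canonicalPP (hξ : ContDiff ℝ ∞ ξ) (n : ℕ) {a : Alg}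
    (ha : a ∈ Alg.spanOf (monoLe N)) : ∫ w, K.Kn n w * canonicalPP K ξ a w = 0 := by
  have hint : ∀ a, Integrable fun w => K.Kn n w * canonicalPP K ξ a w := fun a =>
    ((K.smooth_Kn n).continuous.mul
      (contDiff_canonicalPP K hξ a).continuous).integrable_of_hasCompactSupport
      (K.hasCompactSupport_Kn n).mul_right
  let L : Alg →ₗ[ℝ] ℝ :=
    { toFun := fun a => ∫ w, K.Kn n w * canonicalPP K ξ a w
      map_add' := fun a b => by
        simp only [map_add, Pi.add_apply, mul_add]
        exact integral_add (hint a) (hint b)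
      map_smul' := fun c a => by
        simp only [map_smul, Pi.smul_apply, smul_eq_mul, RingHom.id_apply]
        rw [← integral_const_mul]
        congr 1
        ext w
        ring }
  refine Alg.eq_of_spanOf (f := L) (g := 0) ?_ ha
  rintro _ ⟨k, rfl, hk⟩
  simp only [L, LinearMap.coe_mk, AddHom.coe_mk, canonicalPP_mono]
  exact K.annihilate n k (by exact_mod_cast hk)

/-- K_n annihilates polynomials centred at the origin; substituting w ↦ x − w turns the monomial y^k
into a polynomial in w of no larger parabolic degree. -/
theorem conv_canonicalPP_of_monoLe (hξ : ContDiff ℝ ∞ ξ) {a : Alg}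
    (ha : a ∈ Alg.spanOf (monoLe N)) : K.conv (canonicalPP K ξ a) = 0 := by
  refine Alg.eq_of_spanOf (f := convLin K _ (contDiff_canonicalPP K hξ)) (g := 0) ?_ ha
  rintro _ ⟨k, rfl, hk⟩
  ext x
  have hs := K.hasSum_integral (HeatKernelSplit.admissible_of_continuous
    (contDiff_canonicalPP K hξ (Alg.of (mono k))).continuous x)
  have h0 : ∀ n, ∫ w, K.Kn n (x - w) * canonicalPP K ξ (Alg.of (mono k)) w = 0 := by
    intro n
    rw [← integral_sub_left_eq_self _ volume x]
    have h := integral_Kn_mul_canonicalPP K hξ n (a := ∏ i, (Alg.of (coord i) +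
      algebraMap ℝ Alg (- x i)) ^ k i) (Alg.spanOf_mono ?_ (shifted_mono_mem (fun i => - x i) k))
    · have h2 : ∀ w, K.Kn n (x - (x - w)) * canonicalPP K ξ (Alg.of (mono k)) (x - w) =
          (∏ i, (-1) ^ k i) * (K.Kn n w * canonicalPP K ξ (∏ i, (Alg.of (coord i) +
            algebraMap ℝ Alg (- x i)) ^ k i) w) := by
        intro w
        rw [canonicalPP_shifted_mono K ξ (fun i => - x i), canonicalPP_mono, mul_left_comm,
          ← Finset.prod_mul_distrib, sub_sub_cancel]
        congr 1
        refine Finset.prod_congr rfl fun i _ => ?_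
        rw [← mul_pow, Pi.sub_apply]
        ring
      simp only [h2]
      rw [integral_const_mul, h, mul_zero]
    · rintro _ ⟨l, rfl, hl⟩
      exact ⟨l, rfl, hl.trans hk⟩
  simp only [h0] at hs
  exact hs.unique hasSum_zero

/-- The convention I(X^k) = 0 agrees with convolution only as far as the kernel annihilates
polynomials, whence the restriction of degrees by N. -/
theorem canonicalPP_int_of_polyDegree (hξ : ContDiff ℝ ∞ ξ) {a : Alg}
    (ha : a ∈ Alg.spanOf {σ | polyDegree σ ≤ N}) :
    canonicalPP K ξ (Alg.int a) = K.conv (canonicalPP K ξ a) := by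
  refine Alg.eq_of_spanOf (f := canonicalPP K ξ ∘ₗ Alg.int)
    (g := convLin K _ (contDiff_canonicalPP K hξ)) (fun τ hτ => ?_) ha
  by_cases h : τ.IsPoly
  · obtain ⟨k, rfl⟩ := h
    rw [LinearMap.comp_apply, Alg.int_of_isPoly ⟨k, rfl⟩, map_zero]
    symm
    refine conv_canonicalPP_of_monoLe K hξ (Alg.of_mem_spanOf ⟨k, rfl, ?_⟩)
    simpa using hτ
  · rw [LinearMap.comp_apply, Alg.int_of h, canonicalPP_int]
    rfl

end realisation

/-! ## The renormalised model -/

section model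

variable {κ : ℝ} {N : ℕ} (K : HeatKernelSplit N) (C₁ C₂ : ℝ) {ξ : Spacetime → ℝ}

theorem contDiff_renormPP (hξ : ContDiff ℝ ∞ ξ) (a : Alg) :
    ContDiff ℝ ∞ (renormPP K C₁ C₂ ξ a) :=
  contDiff_canonicalPP K hξ _

theorem contDiff_modelPi (hξ : ContDiff ℝ ∞ ξ) (x : Spacetime) (a : Alg) :
    ContDiff ℝ ∞ (modelPi κ K (renormPP K C₁ C₂ ξ) x a) :=
  contDiff_canonicalPP K hξ _

theorem modelPi_mono (ξ : Spacetime → ℝ) (x : Spacetime) (k : Fin 4 → ℕ) (y : Spacetime) :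
    modelPi κ K (renormPP K C₁ C₂ ξ) x (Alg.of (mono k)) y = ∏ i, (y i - x i) ^ k i := by
  have h1 := map_mono_mem (recenter κ K (renormPP K C₁ C₂ ξ) x) (fun i => by
    rw [recenter_coord]
    exact sub_mem (coord_mem i) (Subalgebra.algebraMap_mem _ _)) k
  rw [modelPi_renormPP, renormMap_of_polySub C₁ C₂ h1, Alg.of_mono, map_prod]
  simp only [map_pow, recenter_coord, sub_eq_add_neg, ← map_neg]
  exact canonicalPP_shifted_mono K ξ (fun i => - x i) k y

theorem modelPi_noise (ξ : Spacetime → ℝ) (x : Spacetime) :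
    modelPi κ K (renormPP K C₁ C₂ ξ) x (Alg.of noise) = ξ := by
  rw [modelPi_renormPP]
  simp [recenter, renormMap_noise, canonicalPP_noise]

theorem modelPi_jet (ξ : Spacetime → ℝ) (x v : Spacetime) (γ : ℝ) (c : (Fin 4 → ℕ) → ℝ) :
    modelPi κ K (renormPP K C₁ C₂ ξ) x (Alg.jet γ c) (x + v) =
      ∑ k ∈ multiBelow γ, nmono k v * c k := by
  simp only [Alg.jet, Alg.jetIn, ← Alg.of_mono, map_sum, map_smul, Finset.sum_apply,
    Pi.smul_apply, modelPi_mono, smul_eq_mul]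
  refine Finset.sum_congr rfl fun k _ => ?_
  rw [nmono, Finset.prod_div_distrib]
  push_cast
  simp only [Pi.add_apply, add_sub_cancel_left]
  ring

/-- M commutes with I, so I(F_xτ) is realised as K * Π_xτ, and the polynomial that F_x subtracts is
the Taylor polynomial of that function by `K.coeffAt_eq`. -/
theorem modelPi_int (hξ : ContDiff ℝ ∞ ξ) (x v : Spacetime) {τ : Symbol}
    (hτ : recenter κ K (renormPP K C₁ C₂ ξ) x (Alg.of τ) ∈ Alg.spanOf {σ | polyDegree σ ≤ N}) :
    modelPi κ K (renormPP K C₁ C₂ ξ) x (Alg.of τ.int) (x + v) =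
      taylorRem (homog κ τ + 2)
        (K.conv (modelPi κ K (renormPP K C₁ C₂ ξ) x (Alg.of τ))) x v := by
  have h1 := modelPi_jet (κ := κ) K C₁ C₂ ξ x v (homog κ τ + 2)
    fun k => K.coeffAt k x (modelPi κ K (renormPP K C₁ C₂ ξ) x (Alg.of τ))
  simp only [K.coeffAt_eq (contDiff_modelPi K C₁ C₂ hξ x _)] at h1
  rw [taylorRem, ← h1, modelPi_renormPP, modelPi_renormPP, recenter_of_int, map_sub, map_sub,
    Pi.sub_apply, renormMap_int, canonicalPP_int_of_polyDegree K hξ (renormMap_polyDegree _ _ hτ)]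
  simp only [K.coeffAt_eq (contDiff_modelPi K C₁ C₂ hξ x _)]
  rfl

theorem recenter_polyDegree (hκ : 0 < κ) (hκ' : κ < 1 / 14) (PP : Alg →ₗ[ℝ] (Spacetime → ℝ))
    (x : Spacetime) {τ : Symbol} (hτ : IsTriple τ) (hN : homog κ τ + 3 / 2 + 3 * κ ≤ N) :
    recenter κ K PP x (Alg.of τ) ∈ Alg.spanOf {σ | polyDegree σ ≤ N} := by
  refine Alg.spanOf_mono ?_ ((isRecentering_recenter K PP x hκ).map_of_triple hτ)
  intro σ hσ
  have := hσ.1.polyDegree_le hκ hκ'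
  have h2 := hσ.2
  rw [mem_ofPred_eq, ← Nat.cast_le (α := ℝ)]
  linarith

theorem recenter_noise (PP : Alg →ₗ[ℝ] (Spacetime → ℝ)) (x : Spacetime) :
    recenter κ K PP x (Alg.of noise) = Alg.of noise := by
  simp [recenter]

theorem modelPi_psi (hκ : 0 < κ) (x : Spacetime) :
    modelPi κ K (renormPP K C₁ C₂ ξ) x (Alg.of (int noise)) = K.conv ξ := by
  rw [modelPi_renormPP, (isRecentering_recenter K _ x hκ).psi, renormMap_psi, canonicalPP_int,
    canonicalPP_noise]

/-- The analytic bound on the model. -/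
theorem modelPi_bound (hκ : 0 < κ) (hκ' : κ < 1 / 14) {γ : ℝ} (hN : rhsOrder κ γ + 2 ≤ N)
    (hξ : ContDiff ℝ ∞ ξ) {A : Set Spacetime} (hA : IsCompact A) {τ : Symbol} (hτ : InU τ)
    (hγ : homog κ τ < γ) :
    ∃ C, 0 ≤ C ∧ ∀ x ∈ A, ∀ v, pnorm v ≤ 1 →
      |modelPi κ K (renormPP K C₁ C₂ ξ) x (Alg.of τ) (x + v)| ≤
        C * pnorm v ^ max (homog κ τ) 0 := by
  have hint : ∀ σ, (∀ x, recenter κ K (renormPP K C₁ C₂ ξ) x (Alg.of σ) ∈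
      Alg.spanOf {σ | polyDegree σ ≤ N}) → ∃ C, 0 ≤ C ∧ ∀ x ∈ A, ∀ v, pnorm v ≤ 1 →
      |modelPi κ K (renormPP K C₁ C₂ ξ) x (Alg.of σ.int) (x + v)| ≤
        C * pnorm v ^ max (homog κ σ.int) 0 := by
    intro σ hσ
    simp only [modelPi_int K C₁ C₂ hξ _ _ (hσ _), homog_int]
    exact tame_taylorRem hA (convLin K _ (contDiff_renormPP K C₁ C₂ hξ))
      (fun a => K.contDiff_conv (contDiff_renormPP K C₁ C₂ hξ a)) _
      (tame_recenter K hA _ (contDiff_renormPP K C₁ C₂ hξ) σ)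
  cases hτ with
  | mono k =>
    refine ⟨1, zero_le_one, fun x _ v hv => ?_⟩
    rw [modelPi_mono, homog_mono, max_eq_left (by positivity), one_mul, Real.rpow_natCast,
      Finset.abs_prod]
    have : pnorm v ^ sdeg k = ∏ i, (pnorm v ^ wt i) ^ k i := by
      simp only [← pow_mul]
      rw [Finset.prod_pow_eq_pow_sum, Fin.sum_univ_four]
      simp [sdeg, wt]
    rw [this]
    refine Finset.prod_le_prod (fun i _ => abs_nonneg _) fun i _ => ?_
    rw [Pi.add_apply, add_sub_cancel_left, abs_pow]
    exact pow_le_pow_left₀ (abs_nonneg _) (abs_le_pnorm_pow_wt v i) _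
  | psi =>
    refine hint noise fun x => ?_
    rw [recenter_noise]
    exact Alg.of_mem_spanOf (by simp)
  | @int a b c ha hb hc _ =>
    -- If |I(τ)| < γ then |τ| < γ − 2, so the degrees in F_xτ are at most γ − 1/2 + 3κ ≤ γ + 1 − 2κ
    -- ≤ N.
    refine hint _ fun x => recenter_polyDegree K hκ hκ' _ x ⟨a, b, c, ha, hb, hc, rfl⟩ ?_
    rw [homog_int] at hγ
    rw [rhsOrder] at hN
    linarith

/-- A Lipschitz bound on the model. -/
theorem modelPi_lipschitz (hξ : ContDiff ℝ ∞ ξ) {A : Set Spacetime} (hA : IsCompact A)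
    (τ : Symbol) :
    ∃ C, 0 ≤ C ∧ ∀ x ∈ A, ∀ v, pnorm v ≤ 1 →
      |modelPi κ K (renormPP K C₁ C₂ ξ) x (Alg.of τ) (x + v) -
        modelPi κ K (renormPP K C₁ C₂ ξ) x (Alg.of τ) x| ≤ C * pnorm v := by
  obtain ⟨C, hC0, hC⟩ := tame_taylorRem hA _ (contDiff_renormPP K C₁ C₂ hξ) 1
    (tame_recenter (κ := κ) K hA _ (contDiff_renormPP K C₁ C₂ hξ) τ)
  refine ⟨C, hC0, fun x hx v hv => ?_⟩
  have h := hC x hx v hv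
  rw [max_eq_left zero_le_one, Real.rpow_one] at h
  refine le_trans (le_of_eq ?_) h
  have h1 : multiBelow 1 = {0} := by
    ext k
    rw [mem_multiBelow, Finset.mem_singleton, Nat.cast_lt_one, sdeg]
    constructor
    · intro h
      ext i
      fin_cases i <;> simp <;> omega
    · rintro rfl
      rfl
  rw [taylorRem, h1, Finset.sum_singleton, mpd_zero]
  simp [nmono, modelPi]

end model

/-- There are finitely many elements of `U` below a given homogeneity. -/
theorem finite_U {κ : ℝ} (hκ : 0 < κ) (hκ' : κ < 1 / 14) (γ : ℝ) :
    {τ | InU τ ∧ homog κ τ < γ}.Finite := by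
  -- Induction in steps of 1 − 2κ: if |I(abc)| lies below a bound, then each factor lies below that
  -- bound minus 2 − 2(1/2 + κ), because the two other factors have homogeneity at least −1/2 − κ.
  have h : ∀ n : ℕ, {τ | InU τ ∧ homog κ τ < -(1 / 2) - κ + n * (1 - 2 * κ)}.Finite := by
    intro n
    induction n with
    | zero =>
      convert Set.finite_empty
      ext τ
      simp only [Nat.cast_zero, zero_mul, add_zero, mem_ofPred_eq, mem_empty_iff_false, iff_false,
        not_and, not_lt]
      exact fun h => h.homog_ge hκ hκ'
    | succ n ih =>
      refine (((Finset.finite_toSet (multiBelow (-(1 / 2) - κ + (n + 1 : ℕ) * (1 - 2 * κ)))).image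
        mono).union ((finite_singleton (int noise)).union
        (((ih.prod ih).prod ih).image fun p => int (p.1.1 * p.1.2 * p.2)))).subset ?_
      rintro τ ⟨hτ, hlt⟩
      cases hτ with
      | mono k => exact .inl ⟨k, mem_multiBelow.2 (by simpa using hlt), rfl⟩
      | psi => exact .inr (.inl rfl)
      | @int a b c ha hb hc _ =>
        have h1 := ha.homog_ge hκ hκ'
        have h2 := hb.homog_ge hκ hκ'
        have h3 := hc.homog_ge hκ hκ'
        simp only [homog_int, homog_mul] at hlt
        push_cast at hlt
        exact .inr (.inr ⟨((a, b), c), ⟨⟨⟨ha, by linarith⟩, ⟨hb, by linarith⟩⟩,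
          ⟨hc, by linarith⟩⟩, rfl⟩)
  obtain ⟨n, hn⟩ := exists_nat_gt ((γ + 1 / 2 + κ) / (1 - 2 * κ))
  rw [div_lt_iff₀ (by linarith)] at hn
  exact (h n).subset fun τ hτ => ⟨hτ.1, by linarith [hτ.2]⟩

end Phi43

namespace Phi43

open Phi43.Symbol

/-! ## Reconstruction -/

theorem boxVec_nonneg {r : ℝ} (hr : 0 ≤ r) : -boxVec r ≤ boxVec r := by
  intro i
  simp only [Pi.neg_apply, boxVec]
  split_ifs <;> nlinarith

theorem volume_box (x : Spacetime) {r : ℝ} (hr : 0 ≤ r) :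
    volume.real (Icc (x - boxVec r) (x + boxVec r)) = 16 * r ^ 5 := by
  have h : x - boxVec r ≤ x + boxVec r := by
    have := boxVec_nonneg hr
    intro i
    have := this i
    simp only [Pi.sub_apply, Pi.add_apply, Pi.neg_apply] at this ⊢
    linarith
  rw [Measure.real, Real.volume_Icc_pi_toReal h, Fin.prod_univ_four]
  simp [boxVec]
  ring

theorem rescale_ne_zero {φ : Spacetime → ℝ} (hφ : IsTest φ) {x y : Spacetime} {r : ℝ} (hr : 0 < r)
    (h : rescale φ x r y ≠ 0) : pnorm (y - x) ≤ r := by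
  have h1 := hφ.2.2 _ (right_ne_zero_of_mul h)
  simp only [pnorm, if_true, Fin.isValue, one_ne_zero, if_false, abs_div, Fin.reduceEq] at h1
  rw [abs_of_pos hr, abs_of_pos (pow_pos hr 2), Real.sqrt_div (abs_nonneg _),
    Real.sqrt_sq hr.le, ← add_div, ← add_div, ← add_div, div_le_one hr] at h1
  exact h1

theorem abs_rescale_le {φ : Spacetime → ℝ} (hφ : IsTest φ) (x y : Spacetime) {r : ℝ} (hr : 0 < r) :
    |rescale φ x r y| ≤ (r ^ 5)⁻¹ := by
  rw [rescale, abs_mul, abs_of_pos (by positivity)]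
  refine mul_le_of_le_one_right (by positivity) ?_
  have := hφ.2.1 0 (by norm_num) (fun i => (y i - x i) / (if i = 0 then r ^ 2 else r))
  rwa [norm_iteratedFDeriv_zero] at this

theorem mem_box_of_pnorm_sub_le {x y : Spacetime} {r : ℝ} (h : pnorm (y - x) ≤ r) :
    y ∈ Icc (x - boxVec r) (x + boxVec r) := by
  have := mem_box_of_pnorm_le h
  constructor
  · intro i
    have := this.1 i
    simp only [Pi.sub_apply, Pi.neg_apply] at this ⊢
    linarith
  · intro i
    have := this.2 i
    simp only [Pi.sub_apply, Pi.add_apply] at this ⊢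
    linarith

theorem abs_integral_rescale_le {φ : Spacetime → ℝ} (hφ : IsTest φ) {x : Spacetime} {r : ℝ}
    (hr : 0 < r) {F : Spacetime → ℝ} {B : ℝ} (hB : 0 ≤ B)
    (hF : ∀ y, pnorm (y - x) ≤ r → |F y| ≤ B) : |∫ y, F y * rescale φ x r y| ≤ 16 * B := by
  rw [← setIntegral_eq_integral_of_forall_compl_eq_zero
    (s := Icc (x - boxVec r) (x + boxVec r))]
  · rw [← Real.norm_eq_abs]
    refine (norm_setIntegral_le_of_norm_le_const (C := B * (r ^ 5)⁻¹) isCompact_Icc.measure_lt_top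
      fun y _ => ?_).trans ?_
    · by_cases h : rescale φ x r y = 0
      · rw [h, mul_zero, norm_zero]
        positivity
      · rw [norm_mul]
        exact mul_le_mul (hF y (rescale_ne_zero hφ hr h)) (abs_rescale_le hφ x y hr)
          (norm_nonneg _) hB
    · rw [volume_box x hr.le]
      apply le_of_eq
      field_simp
  · intro y hy
    by_contra h
    exact hy (mem_box_of_pnorm_sub_le (rescale_ne_zero hφ hr (right_ne_zero_of_mul h)))

/-- Uniqueness of reconstructions needs a single admissible test function whose mass is positive and
independent of centre and scale. A product of bumps on |y_i| ≤ 1/16 fits into the parabolic unit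
ball, since 1/4 + 3/16 ≤ 1; dividing by a bound for its derivatives makes it admissible. -/
theorem exists_test : ∃ φ : Spacetime → ℝ, IsTest φ ∧ ∃ c > 0, ∀ x r, 0 < r →
    ∫ y, rescale φ x r y = c := by
  let ψ : ContDiffBump (0 : ℝ) := ⟨1 / 32, 1 / 16, by norm_num, by norm_num⟩
  let φ : Spacetime → ℝ := fun y => ∏ i, ψ (y i)
  have hφ : ContDiff ℝ 3 φ := contDiff_prod fun i _ => ψ.contDiff.comp (contDiff_apply ℝ ℝ i)
  have hsupp : ∀ y, φ y ≠ 0 → ∀ i, |y i| ≤ 1 / 16 := by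
    intro y hy i
    rw [Finset.prod_ne_zero_iff] at hy
    by_contra! h
    refine hy i (Finset.mem_univ i) (ψ.zero_of_le_dist ?_)
    rw [Real.dist_eq, sub_zero]
    exact h.le
  have hc : HasCompactSupport φ := by
    refine HasCompactSupport.intro (isCompact_closedBall (0 : Spacetime) 1) fun y hy => ?_
    by_contra h
    refine hy ?_
    rw [mem_closedBall_zero_iff, pi_norm_le_iff_of_nonneg zero_le_one]
    intro i
    have := hsupp y h i
    rw [Real.norm_eq_abs]
    linarith
  have hbd : ∀ m : ℕ, m ≤ 3 → ∃ C, ∀ y, ‖iteratedFDeriv ℝ m φ y‖ ≤ C := fun m hm =>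
    (hc.iteratedFDeriv m).exists_bound_of_continuous
      (hφ.continuous_iteratedFDeriv (by exact_mod_cast hm))
  choose! C hC using hbd
  obtain ⟨B, hB1, hB⟩ : ∃ B : ℝ, 1 ≤ B ∧ ∀ m ≤ 3, C m ≤ B :=
    ⟨1 + ∑ m ∈ Finset.range 4, |C m|, by
      have : 0 ≤ ∑ m ∈ Finset.range 4, |C m| := Finset.sum_nonneg fun _ _ => abs_nonneg _
      linarith, fun m hm => by
      have := Finset.single_le_sum (f := fun m => |C m|) (fun _ _ => abs_nonneg _)
        (Finset.mem_range.2 (show m < 4 by omega))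
      linarith [le_abs_self (C m)]⟩
  have hB0 : 0 < B := by linarith
  refine ⟨fun y => B⁻¹ • φ y, ⟨hφ.const_smul B⁻¹, fun m hm y => ?_, fun y hy => ?_⟩,
    B⁻¹ * (∫ t, ψ t) ^ 4, mul_pos (inv_pos.2 hB0) (pow_pos ψ.integral_pos 4), fun x r hr => ?_⟩
  · have h1 := iteratedFDeriv_const_smul_apply (x := y) (a := (B⁻¹ : ℝ)) (i := m)
      ((hφ.of_le (by exact_mod_cast hm)).contDiffAt)
    have h2 : (fun y => B⁻¹ • φ y) = B⁻¹ • φ := rfl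
    rw [h2, h1, norm_smul, norm_inv, Real.norm_of_nonneg hB0.le, inv_mul_le_iff₀ hB0, mul_one]
    exact (hC m hm y).trans (hB m hm)
  · have h := hsupp y (right_ne_zero_of_mul hy)
    have h0 : √|y 0| ≤ 1 / 4 := by
      rw [Real.sqrt_le_left (by norm_num)]
      exact (h 0).trans (by norm_num)
    rw [pnorm]
    linarith [h 1, h 2, h 3]
  · have h1 : ∀ y, rescale (fun y => B⁻¹ • φ y) x r y =
        (r ^ 5)⁻¹ * B⁻¹ * ∏ i, ψ ((y i - x i) / (if i = 0 then r ^ 2 else r)) := fun y => by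
      simp only [rescale, φ, smul_eq_mul]
      ring
    simp only [h1]
    rw [integral_const_mul, integral_fintype_prod_volume_eq_prod
      (f := fun i t => ψ ((t - x i) / (if i = 0 then r ^ 2 else r)))]
    have h2 : ∀ i : Fin 4, ∫ t, ψ ((t - x i) / (if i = 0 then r ^ 2 else r)) =
        (if i = 0 then r ^ 2 else r) * ∫ t, ψ t := by
      intro i
      rw [integral_sub_right_eq_self (fun t => ψ (t / (if i = 0 then r ^ 2 else r))),
        Measure.integral_comp_div, smul_eq_mul, abs_of_pos]
      split_ifs <;> positivity
    simp only [h2]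
    rw [Fin.prod_univ_four]
    simp only [if_true, Fin.isValue, one_ne_zero, if_false, Fin.reduceEq]
    field_simp

theorem isOpen_slab (T : ℝ) : IsOpen (slab T) :=
  (isOpen_lt continuous_const (continuous_apply 0)).inter
    (isOpen_lt (continuous_apply 0) continuous_const)

/-- Near a compact subset of the slab, increments are small compared to the distance to the
boundary. -/
theorem exists_radius {T : ℝ} {A : Set Spacetime} (hA : IsCompact A) (hAT : A ⊆ slab T) :
    ∃ r : ℝ, 0 < r ∧ r ≤ 1 ∧ ∀ x ∈ A, ∀ v, pnorm v ≤ r → x + v ∈ slab T ∧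
      r ≤ min 1 √(min (x 0) ((x + v) 0)) := by
  obtain ⟨δ, hδ, h⟩ : ∃ δ : ℝ, 0 < δ ∧ ∀ x ∈ A, δ ≤ x 0 ∧ x 0 ≤ T - δ := by
    rcases A.eq_empty_or_nonempty with rfl | hne
    · exact ⟨1, one_pos, by simp⟩
    · obtain ⟨a, ha, ha'⟩ := hA.exists_isMinOn hne (continuous_apply 0).continuousOn
      obtain ⟨b, hb, hb'⟩ := hA.exists_isMaxOn hne (continuous_apply 0).continuousOn
      refine ⟨min (a 0) (T - b 0), lt_min (hAT ha).1 (by linarith [(hAT hb).2]), fun x hx => ?_⟩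
      have h1 : a 0 ≤ x 0 := ha' hx
      have h2 : x 0 ≤ b 0 := hb' hx
      exact ⟨(min_le_left _ _).trans h1, by linarith [min_le_right (a 0) (T - b 0)]⟩
  refine ⟨min 1 √(δ / 2), lt_min one_pos (Real.sqrt_pos.2 (by linarith)), min_le_left _ _,
    fun x hx v hv => ?_⟩
  have hsq : pnorm v ^ 2 ≤ δ / 2 := by
    calc pnorm v ^ 2 ≤ √(δ / 2) ^ 2 :=
          pow_le_pow_left₀ (pnorm_nonneg v) (hv.trans (min_le_right _ _)) 2
      _ = δ / 2 := Real.sq_sqrt (by linarith)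
  have hv0 := abs_le.1 ((abs_time_le v).trans hsq)
  obtain ⟨h1, h2⟩ := h x hx
  refine ⟨⟨?_, ?_⟩, min_le_min le_rfl (Real.sqrt_le_sqrt (le_min ?_ ?_))⟩ <;>
    (try simp only [Pi.add_apply]) <;> linarith

section

variable {κ : ℝ} {N : ℕ} (K : HeatKernelSplit N) (C₁ C₂ : ℝ) {ξ : Spacetime → ℝ}

/-- Tested against a bump of mass c shrinking to x, the difference of two reconstructions tends to
c(g(x) − h(x)) by continuity, while the two reconstruction bounds force it to be of order r^γ. -/
theorem IsReconstruction.eq (hξ : ContDiff ℝ ∞ ξ) {γ T : ℝ} (hγ : 0 < γ) {f : Spacetime → Alg}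
    {g h : Spacetime → ℝ} (hg : IsReconstruction κ K (renormPP K C₁ C₂ ξ) γ T f g)
    (hh : IsReconstruction κ K (renormPP K C₁ C₂ ξ) γ T f h) : g = h := by
  ext x
  by_cases hx : x ∈ slab T
  swap
  · rw [hg.1 x hx, hh.1 x hx]
  obtain ⟨φ, hφ, c, hc, hint⟩ := exists_test
  obtain ⟨C, r₁, hr₁, hC⟩ := hg.2.2 {x} (by simpa using hx) isCompact_singleton
  obtain ⟨D, r₂, hr₂, hD⟩ := hh.2.2 {x} (by simpa using hx) isCompact_singleton
  obtain ⟨r₃, hr₃, -, hr⟩ := exists_radius (isCompact_singleton (x := x)) (by simpa using hx)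
  set p := modelPi κ K (renormPP K C₁ C₂ ξ) x (f x)
  have hp : Continuous p := (contDiff_modelPi K C₁ C₂ hξ x (f x)).continuous
  have hcφ : ∀ r, 0 < r → Continuous (rescale φ x r) := fun r hr => by
    refine continuous_const.mul (hφ.1.continuous.comp (continuous_pi fun i => ?_))
    fun_prop
  have hball : ∀ y, pnorm (y - x) ≤ r₃ → y ∈ slab T := fun y hy => by
    have := (hr x rfl (y - x) hy).1
    rwa [add_sub_cancel] at this
  have hI : ∀ r, 0 < r → r ≤ r₃ → ∀ F : Spacetime → ℝ, ContinuousOn F (slab T) →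
      Integrable fun y => F y * rescale φ x r y := by
    intro r hr0 hr3 F hF
    have hcl : IsCompact {y | pnorm (y - x) ≤ r} :=
      isCompact_Icc.of_isClosed_subset (isClosed_le
        (pnorm_continuous.comp (continuous_id.sub continuous_const)) continuous_const)
        fun y hy => mem_box_of_pnorm_sub_le hy
    refine (integrableOn_iff_integrable_of_support_subset (s := {y | pnorm (y - x) ≤ r})
      fun y hy => rescale_ne_zero hφ hr0 (right_ne_zero_of_mul hy)).1 ?_
    refine ContinuousOn.integrableOn_compact hcl (ContinuousOn.mul (hF.mono fun y hy => ?_)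
      (hcφ r hr0).continuousOn)
    exact hball y (le_trans hy hr3)
  have hd : ContinuousOn (fun y => g y - h y) (slab T) := hg.2.1.sub hh.2.1
  by_contra hne
  set d := g x - h x with hd_def
  have hd0 : 0 < |d| := abs_pos.2 (sub_ne_zero.2 hne)
  -- The factor 16 from `abs_integral_rescale_le` turns 1/64 into 1/4; together with the 1/2
  -- allotted to the reconstruction bounds this stays below |d|c.
  have hev : ∀ᶠ r in 𝓝[>] (0 : ℝ), ∀ y, pnorm (y - x) ≤ r → |(g y - h y) - d| ≤ |d| * c / 64 := by
    have hcont : ContinuousAt (fun y => g y - h y) x := hd.continuousAt ((isOpen_slab T).mem_nhds hx)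
    rw [Metric.continuousAt_iff] at hcont
    obtain ⟨δ, hδ, hδ'⟩ := hcont (|d| * c / 64) (by positivity)
    have : ∀ᶠ r in 𝓝[>] (0 : ℝ), r ∈ Ioo 0 (min 1 (δ / 2)) :=
      Ioo_mem_nhdsGT (lt_min one_pos (by linarith))
    filter_upwards [this] with r hr y hy
    refine (hδ' ?_).le
    rw [dist_eq_norm]
    have hr1 : r < 1 := hr.2.trans_le (min_le_left _ _)
    have hr2 : r < δ / 2 := hr.2.trans_le (min_le_right _ _)
    refine lt_of_le_of_lt ?_ (show δ / 2 < δ by linarith)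
    rw [pi_norm_le_iff_of_nonneg (by linarith)]
    intro i
    by_cases hi : i = 0
    · subst hi
      have := abs_time_le (y - x)
      have := pnorm_nonneg (y - x)
      rw [Real.norm_eq_abs]
      nlinarith
    · have := abs_space_le (y - x) hi
      rw [Real.norm_eq_abs]
      linarith
  have hpow : Tendsto (fun r : ℝ => (C + D) * r ^ γ) (𝓝[>] 0) (𝓝 0) := by
    have h1 : Tendsto (fun r : ℝ => r ^ γ) (𝓝 0) (𝓝 (0 ^ γ)) :=
      (Real.continuousAt_rpow_const 0 γ (Or.inr hγ.le))
    rw [Real.zero_rpow hγ.ne'] at h1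
    simpa using (h1.mono_left nhdsWithin_le_nhds).const_mul (C + D)
  have hev2 := hpow.eventually (gt_mem_nhds (show (0 : ℝ) < |d| * c / 2 by positivity))
  have hev3 : ∀ᶠ r in 𝓝[>] (0 : ℝ), r ∈ Ioo 0 (min (min r₁ r₂) r₃) :=
    Ioo_mem_nhdsGT (lt_min (lt_min hr₁ hr₂) hr₃)
  obtain ⟨r, h1, h2, h3⟩ := (hev.and (hev2.and hev3)).exists
  have hr0 := h3.1
  have hr1 : r ≤ r₁ := (h3.2.le.trans (min_le_left _ _)).trans (min_le_left _ _)
  have hr2 : r ≤ r₂ := (h3.2.le.trans (min_le_left _ _)).trans (min_le_right _ _)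
  have hr3 : r ≤ r₃ := h3.2.le.trans (min_le_right _ _)
  have e1 := hC x rfl r hr0 hr1 φ hφ
  have e2 := hD x rfl r hr0 hr2 φ hφ
  have e3 := abs_integral_rescale_le hφ (x := x) hr0 (by positivity) h1
  have i1 := hI r hr0 hr3 _ (hg.2.1.sub hp.continuousOn)
  have i2 := hI r hr0 hr3 _ (hh.2.1.sub hp.continuousOn)
  have i3 := hI r hr0 hr3 _ hd
  have i4 := hI r hr0 hr3 (fun _ => d) continuousOn_const
  have e4 : ∫ y, (g y - h y) * rescale φ x r y =
      (∫ y, (g y - p y) * rescale φ x r y) - ∫ y, (h y - p y) * rescale φ x r y := by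
    rw [← integral_sub (f := fun y => (g y - p y) * rescale φ x r y)
      (g := fun y => (h y - p y) * rescale φ x r y) i1 i2]
    congr 1
    ext y
    ring
  have e5 : ∫ y, (g y - h y - d) * rescale φ x r y =
      (∫ y, (g y - h y) * rescale φ x r y) - d * c := by
    rw [← hint x r hr0, ← integral_const_mul, ← integral_sub i3 i4]
    congr 1
    ext y
    ring
  rw [e5, e4] at e3
  have e6 : |d| * c = |d * c| := by rw [abs_mul, abs_of_pos hc]
  have e7 : (C + D) * r ^ γ = C * r ^ γ + D * r ^ γ := by ring
  rw [e7] at h2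
  rw [e6] at e3 h2
  have t1 := abs_sub_abs_le_abs_sub (d * c) ((∫ y, (g y - p y) * rescale φ x r y) -
    ∫ y, (h y - p y) * rescale φ x r y)
  have t2 := abs_sub (∫ y, (g y - p y) * rescale φ x r y) (∫ y, (h y - p y) * rescale φ x r y)
  rw [abs_sub_comm (d * c)] at t1
  have t3 : 0 < |d * c| := by rw [← e6]; positivity
  linarith

/-- A continuous function that is pointwise close to the local descriptions is the
reconstruction. -/
theorem reconstruct_eq (hξ : ContDiff ℝ ∞ ξ) {γ T : ℝ} (hγ : 0 < γ) {f : Spacetime → Alg}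
    {g : Spacetime → ℝ} (h0 : ∀ z ∉ slab T, g z = 0) (hc : ContinuousOn g (slab T))
    (hg : ∀ A ⊆ slab T, IsCompact A → ∃ C r : ℝ, 0 < r ∧ ∀ x ∈ A, ∀ v, pnorm v ≤ r →
      |g (x + v) - modelPi κ K (renormPP K C₁ C₂ ξ) x (f x) (x + v)| ≤ C * pnorm v ^ γ) :
    reconstruct κ K (renormPP K C₁ C₂ ξ) γ T f = g := by
  have h : IsReconstruction κ K (renormPP K C₁ C₂ ξ) γ T f g := by
    refine ⟨h0, hc, fun A hAT hA => ?_⟩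
    obtain ⟨C, r₀, hr₀, hC⟩ := hg A hAT hA
    refine ⟨16 * |C|, r₀, hr₀, fun x hx r hr hrr φ hφ => ?_⟩
    refine (abs_integral_rescale_le hφ hr (B := |C| * r ^ γ) (by positivity)
      fun y hy => ?_).trans_eq (by ring)
    have := hC x hx (y - x) (hy.trans hrr)
    rw [add_sub_cancel] at this
    refine this.trans (mul_le_mul (le_abs_self C) (Real.rpow_le_rpow (pnorm_nonneg _) hy hγ.le)
      (Real.rpow_nonneg (pnorm_nonneg _) _) (abs_nonneg _))
  have hex : ∃ g, IsReconstruction κ K (renormPP K C₁ C₂ ξ) γ T f g := ⟨g, h⟩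
  rw [reconstruct, dif_pos hex]
  exact hex.choose_spec.eq K C₁ C₂ hξ hγ h

end

end Phi43

/-! ### Pointwise bounds for modelled distributions in a smooth model -/

namespace Phi43

open Phi43.Symbol

theorem abs_coeff_le_normAt (κ : ℝ) (τ : Symbol) (a : Alg) :
    |a.coeff τ| ≤ Alg.normAt κ (homog κ τ) a := by
  classical
  rw [Alg.normAt]
  by_cases h : τ ∈ a.coeff.support
  · exact Finset.single_le_sum (f := fun τ => |a.coeff τ|) (fun _ _ => abs_nonneg _)
      (Finset.mem_filter.2 ⟨h, rfl⟩)
  · rw [Finsupp.notMem_support_iff.1 h, abs_zero]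
    exact Finset.sum_nonneg fun _ _ => abs_nonneg _

theorem Alg.map_eq_sum {E : Type*} [AddCommGroup E] [Module ℝ E] (L : Alg →ₗ[ℝ] E)
    {s : Finset Symbol} {a : Alg} (ha : a ∈ Alg.spanOf (s : Set Symbol)) :
    L a = ∑ τ ∈ s, a.coeff τ • L (Alg.of τ) := by
  conv_lhs => rw [Alg.eq_sum a, map_sum]
  simp only [map_smul]
  refine Finset.sum_subset (fun τ hτ => Alg.mem_spanOf.1 ha τ hτ) fun τ _ hτ => ?_
  rw [Finsupp.notMem_support_iff.1 hτ, zero_smul]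

/-- Finite sums preserve bounds. -/
theorem exists_sum_bound {ι X : Type*} (s : Finset ι) {V : Set X} {W : X → ℝ} {f : ι → X → ℝ}
    (hf : ∀ i ∈ s, ∃ C, 0 ≤ C ∧ ∀ v ∈ V, |f i v| ≤ C * W v) :
    ∃ C, 0 ≤ C ∧ ∀ v ∈ V, |∑ i ∈ s, f i v| ≤ C * W v := by
  classical
  induction s using Finset.induction_on with
  | empty => exact ⟨0, le_rfl, by simp⟩
  | insert i s hi ih =>
    obtain ⟨C, hC0, hC⟩ := hf i (Finset.mem_insert_self _ _)
    obtain ⟨D, hD0, hD⟩ := ih fun j hj => hf j (Finset.mem_insert_of_mem hj)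
    refine ⟨C + D, by positivity, fun v hv => ?_⟩
    rw [Finset.sum_insert hi, add_mul]
    exact (abs_add_le _ _).trans (add_le_add (hC v hv) (hD v hv))

theorem pnorm_rpow_le {v : Spacetime} (hv : pnorm v ≤ 1) {a b : ℝ} (ha : 0 ≤ a) (h : a ≤ b) :
    pnorm v ^ b ≤ pnorm v ^ a :=
  Real.rpow_le_rpow_of_exponent_ge' (pnorm_nonneg v) hv ha h

/-- The elements of `U` of homogeneity less than `γ`. -/
def setUlt (κ γ : ℝ) : Set Symbol := {τ | InU τ ∧ homog κ τ < γ}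

section

variable {κ : ℝ} {N : ℕ} (K : HeatKernelSplit N) (C₁ C₂ : ℝ) {ξ : Spacetime → ℝ}

/-- The value of a modelled distribution at the base point. -/
noncomputable def diag (κ : ℝ) (ξ : Spacetime → ℝ) (f : Spacetime → Alg) (z : Spacetime) : ℝ :=
  modelPi κ K (renormPP K C₁ C₂ ξ) z (f z) z

/-- Finitely many symbols contribute, each with the decay e(τ) of its coefficient plus the decay
max(|τ|, 0) of the model. Used with e = γ − |τ| for increments, with e = 0 for values, and with a
two-valued e for truncation errors. -/
theorem modelPi_sum_bound (hκ : 0 < κ) (hκ' : κ < 1 / 14) {γ : ℝ} (hN : rhsOrder κ γ + 2 ≤ N)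
    (hξ : ContDiff ℝ ∞ ξ) {A : Set Spacetime} (hA : IsCompact A) (e : Symbol → ℝ) {δ r : ℝ}
    (hδ : 0 ≤ δ) (hr : r ≤ 1) (he : ∀ τ ∈ setUlt κ γ, 0 ≤ e τ)
    (heδ : ∀ τ ∈ setUlt κ γ, δ ≤ e τ + max (homog κ τ) 0)
    {a : Spacetime → Spacetime → Alg}
    (ha : ∀ x ∈ A, ∀ v, pnorm v ≤ r → a x v ∈ Alg.spanOf (setUlt κ γ))
    (hc : ∀ τ ∈ setUlt κ γ, ∃ C, ∀ x ∈ A, ∀ v, pnorm v ≤ r →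
      |(a x v).coeff τ| ≤ C * pnorm v ^ e τ) :
    ∃ C, 0 ≤ C ∧ ∀ x ∈ A, ∀ v, pnorm v ≤ r →
      |modelPi κ K (renormPP K C₁ C₂ ξ) x (a x v) (x + v)| ≤ C * pnorm v ^ δ := by
  have hfin := finite_U hκ hκ' γ
  obtain ⟨C, hC0, hC⟩ := exists_sum_bound hfin.toFinset
    (V := {p : Spacetime × Spacetime | p.1 ∈ A ∧ pnorm p.2 ≤ r}) (W := fun p => pnorm p.2 ^ δ)
    (f := fun τ p => (a p.1 p.2).coeff τ *
      modelPi κ K (renormPP K C₁ C₂ ξ) p.1 (Alg.of τ) (p.1 + p.2)) (fun τ hτ => by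
      have hτ' : τ ∈ setUlt κ γ := by simpa [setUlt] using hτ
      obtain ⟨C, hC⟩ := hc τ hτ'
      obtain ⟨D, hD0, hD⟩ := modelPi_bound K C₁ C₂ hκ hκ' hN hξ hA hτ'.1 hτ'.2
      refine ⟨|C| * D, by positivity, ?_⟩
      rintro ⟨x, v⟩ ⟨hx, hv⟩
      simp only at hx hv ⊢
      rw [abs_mul]
      calc _ ≤ (|C| * pnorm v ^ e τ) * (D * pnorm v ^ max (homog κ τ) 0) := by
            refine mul_le_mul ((hC x hx v hv).trans (mul_le_mul_of_nonneg_right (le_abs_self C)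
              (Real.rpow_nonneg (pnorm_nonneg v) _))) (hD x hx v (hv.trans hr)) (abs_nonneg _)
              (mul_nonneg (abs_nonneg C) (Real.rpow_nonneg (pnorm_nonneg v) _))
        _ = |C| * D * pnorm v ^ (e τ + max (homog κ τ) 0) := by
            rw [Real.rpow_add_of_nonneg (pnorm_nonneg v) (he τ hτ') (le_max_right _ _)]
            ring
        _ ≤ _ := by
            refine mul_le_mul_of_nonneg_left (pnorm_rpow_le (hv.trans hr) hδ (heδ τ hτ'))
              (by positivity))
  refine ⟨C, hC0, fun x hx v hv => ?_⟩
  have h := hC (x, v) ⟨hx, hv⟩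
  refine le_trans (le_of_eq ?_) h
  have h2 := Alg.map_eq_sum (modelPi κ K (renormPP K C₁ C₂ ξ) x) (s := hfin.toFinset)
    (a := a x v) (by simpa [setUlt] using ha x hx v hv)
  rw [h2]
  simp

variable {γ η T : ℝ} {Φ : Spacetime → Alg}

theorem IsModelled.mem_span {PP : Alg →ₗ[ℝ] (Spacetime → ℝ)} (hΦ : IsModelled κ K PP γ η T Φ)
    {z : Spacetime} (hz : z ∈ slab T) : Φ z ∈ Alg.spanOf (setUlt κ γ) :=
  Alg.mem_spanOf.2 fun τ hτ => hΦ.mem_U z hz τ hτ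

theorem IsModelled.mem_spanU {PP : Alg →ₗ[ℝ] (Spacetime → ℝ)} (hΦ : IsModelled κ K PP γ η T Φ)
    {z : Spacetime} (hz : z ∈ slab T) : Φ z ∈ spanU :=
  Alg.spanOf_mono (fun _ h => h.1) (hΦ.mem_span K hz)

theorem IsModelled.coeff_bounded {PP : Alg →ₗ[ℝ] (Spacetime → ℝ)}
    (hΦ : IsModelled κ K PP γ η T Φ) {A : Set Spacetime} (hA : IsCompact A) (hAT : A ⊆ slab T)
    {τ : Symbol} (hτ : homog κ τ < γ) : ∃ C, 0 ≤ C ∧ ∀ x ∈ A, |(Φ x).coeff τ| ≤ C := by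
  obtain ⟨C, hC⟩ := hΦ.size _ hτ
  have hcont : ContinuousOn (fun z : Spacetime => C * (min 1 √(z 0)) ^ (min (η - homog κ τ) 0)) A := by
    refine continuousOn_const.mul (ContinuousOn.rpow_const ?_ fun z hz => Or.inl ?_)
    · fun_prop
    · have := (hAT hz).1
      positivity
  obtain ⟨D, hD⟩ := hA.exists_bound_of_continuousOn hcont
  refine ⟨|D|, abs_nonneg _, fun x hx => ?_⟩
  exact (abs_coeff_le_normAt κ τ _).trans ((hC x (hAT hx)).trans
    ((le_abs_self _).trans ((hD x hx).trans (le_abs_self D))))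

theorem modelGamma_mem_lt (hκ : 0 < κ) (PP : Alg →ₗ[ℝ] (Spacetime → ℝ)) (x y : Spacetime) {a : Alg}
    (ha : a ∈ Alg.spanOf (setUlt κ γ)) :
    modelGamma κ K PP x y a ∈ Alg.spanOf (setUlt κ γ) := by
  have h : ∀ τ ∈ setUlt κ γ, (modelGamma κ K PP x y).toLinearMap (Alg.of τ) ∈
      Alg.spanOf (setUlt κ γ) := fun τ hτ =>
    Alg.spanOf_mono (s := setU κ (homog κ τ)) (t := setUlt κ γ)
      (fun σ hσ => ⟨hσ.1, hσ.2.trans_lt hτ.2⟩) (modelGamma_mem K PP x hκ y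
        (Alg.of_mem_spanOf (s := setU κ (homog κ τ)) ⟨hτ.1, le_rfl⟩))
  exact Alg.map_spanOf _ h ha

theorem IsModelled.coeff_increment {PP : Alg →ₗ[ℝ] (Spacetime → ℝ)}
    (hΦ : IsModelled κ K PP γ η T Φ) {A : Set Spacetime} (hAT : A ⊆ slab T) {r : ℝ} (hr0 : 0 < r)
    (hr : ∀ x ∈ A, ∀ v, pnorm v ≤ r → x + v ∈ slab T ∧ r ≤ min 1 √(min (x 0) ((x + v) 0)))
    {τ : Symbol} (hτ : homog κ τ < γ) :
    ∃ C, ∀ x ∈ A, ∀ v, pnorm v ≤ r →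
      |(Φ x - modelGamma κ K PP x (x + v) (Φ (x + v))).coeff τ| ≤
        C * pnorm v ^ (γ - homog κ τ) := by
  obtain ⟨C, hC⟩ := hΦ.increment _ hτ
  refine ⟨|C| * (1 + r ^ (η - γ)), fun x hx v hv => ?_⟩
  obtain ⟨hy, hrad⟩ := hr x hx v hv
  have hpn : pnorm (x - (x + v)) = pnorm v := by
    rw [pnorm_sub_comm, add_sub_cancel_left]
  have h := hC x (hAT hx) (x + v) hy (by rw [hpn]; exact hv.trans hrad)
  rw [hpn] at h
  refine (abs_coeff_le_normAt κ τ _).trans (h.trans ?_)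
  have hb1 : min 1 √(min (x 0) ((x + v) 0)) ≤ 1 := min_le_left _ _
  generalize min 1 √(min (x 0) ((x + v) 0)) = b at hrad hb1 ⊢
  -- The weight satisfies r ≤ b ≤ 1 and the exponent may have either sign; the sum of the two
  -- extreme values covers both cases.
  have hb : b ^ (η - γ) ≤ 1 + r ^ (η - γ) := by
    rcases le_total 0 (η - γ) with h0 | h0
    · have := Real.rpow_le_one (hr0.le.trans hrad) hb1 h0
      have := Real.rpow_nonneg hr0.le (η - γ)
      linarith
    · have := Real.rpow_le_rpow_of_nonpos hr0 hrad h0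
      linarith
  have hp := Real.rpow_nonneg (pnorm_nonneg v) (γ - homog κ τ)
  have hbp := Real.rpow_nonneg (hr0.le.trans hrad) (η - γ)
  calc C * pnorm v ^ (γ - homog κ τ) * b ^ (η - γ)
      ≤ |C| * pnorm v ^ (γ - homog κ τ) * b ^ (η - γ) :=
        mul_le_mul_of_nonneg_right (mul_le_mul_of_nonneg_right (le_abs_self C) hp) hbp
    _ ≤ |C| * pnorm v ^ (γ - homog κ τ) * (1 + r ^ (η - γ)) :=
        mul_le_mul_of_nonneg_left hb (mul_nonneg (abs_nonneg _) hp)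
    _ = _ := by ring

/-- The local descriptions at nearby points are close to each other. -/
theorem IsModelled.increment_bound (hκ : 0 < κ) (hκ' : κ < 1 / 14) (hN : rhsOrder κ γ + 2 ≤ N)
    (hγ : 0 ≤ γ) (hξ : ContDiff ℝ ∞ ξ) (hΦ : IsModelled κ K (renormPP K C₁ C₂ ξ) γ η T Φ)
    {A : Set Spacetime} (hA : IsCompact A) (hAT : A ⊆ slab T) :
    ∃ C r : ℝ, 0 ≤ C ∧ 0 < r ∧ r ≤ 1 ∧ ∀ x ∈ A, ∀ v, pnorm v ≤ r → x + v ∈ slab T ∧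
      |diag K C₁ C₂ κ ξ Φ (x + v) - modelPi κ K (renormPP K C₁ C₂ ξ) x (Φ x) (x + v)| ≤
        C * pnorm v ^ γ := by
  obtain ⟨r, hr0, hr1, hr⟩ := exists_radius hA hAT
  obtain ⟨C, hC0, hC⟩ := modelPi_sum_bound K C₁ C₂ hκ hκ' hN hξ hA (fun τ => γ - homog κ τ)
    hγ hr1 (fun τ hτ => (sub_pos.2 hτ.2).le)
    (fun τ _ => by linarith [le_max_left (homog κ τ) 0])
    (a := fun x v => Φ x - modelGamma κ K (renormPP K C₁ C₂ ξ) x (x + v) (Φ (x + v)))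
    (fun x hx v hv => Submodule.sub_mem _ (hΦ.mem_span K (hAT hx))
      (modelGamma_mem_lt K hκ _ x (x + v) (hΦ.mem_span K (hr x hx v hv).1)))
    (fun τ hτ => hΦ.coeff_increment K hAT hr0 hr hτ.2)
  refine ⟨C, r, hC0, hr0, hr1, fun x hx v hv => ⟨(hr x hx v hv).1, ?_⟩⟩
  have h := hC x hx v hv
  rw [map_sub, modelPi_modelGamma K _ x hκ (x + v) (hΦ.mem_spanU K (hr x hx v hv).1),
    Pi.sub_apply, abs_sub_comm] at h
  exact h

theorem pnorm_zero : pnorm 0 = 0 := by simp [pnorm]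

theorem IsModelled.continuousOn_diag (hκ : 0 < κ) (hκ' : κ < 1 / 14)
    (hN : rhsOrder κ γ + 2 ≤ N) (hγ : 0 < γ) (hξ : ContDiff ℝ ∞ ξ)
    (hΦ : IsModelled κ K (renormPP K C₁ C₂ ξ) γ η T Φ) :
    ContinuousOn (diag K C₁ C₂ κ ξ Φ) (slab T) := by
  intro x hx
  obtain ⟨C, r, hC0, hr0, hr1, h⟩ := hΦ.increment_bound K C₁ C₂ hκ hκ' hN hγ.le hξ
    (isCompact_singleton (x := x)) (by simpa using hx)
  have hp := (contDiff_modelPi (κ := κ) K C₁ C₂ hξ x (Φ x)).continuous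
  have hpn : Continuous fun y : Spacetime => pnorm (y - x) :=
    pnorm_continuous.comp (continuous_id.sub continuous_const)
  have hlim : Tendsto (fun y => C * pnorm (y - x) ^ γ) (𝓝 x) (𝓝 0) := by
    have h1 := ((hpn.rpow_const fun _ => Or.inr hγ.le).const_mul C).tendsto x
    simpa [pnorm_zero, Real.zero_rpow hγ.ne'] using h1
  have hsmall : ∀ᶠ y in 𝓝 x, pnorm (y - x) ≤ r := by
    have := hpn.tendsto x
    rw [sub_self, pnorm_zero] at this
    exact this.eventually (Iic_mem_nhds hr0)
  have hd : Tendsto (fun y => diag K C₁ C₂ κ ξ Φ y -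
      modelPi κ K (renormPP K C₁ C₂ ξ) x (Φ x) y) (𝓝 x) (𝓝 0) := by
    refine squeeze_zero_norm' ?_ hlim
    filter_upwards [hsmall] with y hy
    have := (h x rfl (y - x) hy).2
    rwa [add_sub_cancel] at this
  have h2 := hd.add (hp.tendsto x)
  simp only [sub_add_cancel, zero_add] at h2
  exact ContinuousAt.continuousWithinAt h2

/-- By Π_xΓ_{xy} = Π_y, the value of the local description at its own base point x + v differs from
the description based at x by the increment of Φ, which is of order |v|^γ. So the diagonal already
satisfies the defining bound. -/
theorem IsModelled.reconstruct_eq (hκ : 0 < κ) (hκ' : κ < 1 / 14)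
    (hN : rhsOrder κ γ + 2 ≤ N) (hγ : 0 < γ) (hξ : ContDiff ℝ ∞ ξ)
    (hΦ : IsModelled κ K (renormPP K C₁ C₂ ξ) γ η T Φ) :
    reconstruct κ K (renormPP K C₁ C₂ ξ) γ T Φ = (slab T).indicator (diag K C₁ C₂ κ ξ Φ) := by
  refine Phi43.reconstruct_eq K C₁ C₂ hξ hγ (fun z hz => indicator_of_notMem hz _) ?_ ?_
  · exact (hΦ.continuousOn_diag K C₁ C₂ hκ hκ' hN hγ hξ).congr fun z hz => indicator_of_mem hz _
  · intro A hAT hA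
    obtain ⟨C, r, hC0, hr0, hr1, h⟩ := hΦ.increment_bound K C₁ C₂ hκ hκ' hN hγ.le hξ hA hAT
    refine ⟨C, r, hr0, fun x hx v hv => ?_⟩
    obtain ⟨hy, hb⟩ := h x hx v hv
    rwa [indicator_of_mem hy]

theorem IsModelled.value_bound (hκ : 0 < κ) (hκ' : κ < 1 / 14)
    (hN : rhsOrder κ γ + 2 ≤ N) (hξ : ContDiff ℝ ∞ ξ)
    (hΦ : IsModelled κ K (renormPP K C₁ C₂ ξ) γ η T Φ) {A : Set Spacetime} (hA : IsCompact A)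
    (hAT : A ⊆ slab T) :
    ∃ C, 0 ≤ C ∧ ∀ x ∈ A, ∀ v, pnorm v ≤ 1 →
      |modelPi κ K (renormPP K C₁ C₂ ξ) x (Φ x) (x + v)| ≤ C := by
  obtain ⟨C, hC0, hC⟩ := modelPi_sum_bound K C₁ C₂ hκ hκ' hN hξ hA (fun _ => 0) le_rfl le_rfl
    (fun _ _ => le_rfl) (fun τ _ => by simp) (a := fun x _ => Φ x)
    (fun x hx v _ => hΦ.mem_span K (hAT hx)) (fun τ hτ => by
      obtain ⟨C, _, hC⟩ := hΦ.coeff_bounded K hA hAT hτ.2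
      exact ⟨C, fun x hx v _ => by simpa using hC x hx⟩)
  exact ⟨C, hC0, fun x hx v hv => by simpa using hC x hx v hv⟩

/-- An increment costs |v|^γ ≤ |v|, because γ ≥ 1, and Π_xΦ(x) is a smooth function, Lipschitz with
a constant uniform in x over compact sets. -/
theorem IsModelled.lipschitz_diag (hκ : 0 < κ) (hκ' : κ < 1 / 14)
    (hN : rhsOrder κ γ + 2 ≤ N) (hγ : 1 ≤ γ) (hξ : ContDiff ℝ ∞ ξ)
    (hΦ : IsModelled κ K (renormPP K C₁ C₂ ξ) γ η T Φ) {A : Set Spacetime} (hA : IsCompact A)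
    (hAT : A ⊆ slab T) :
    ∃ C r : ℝ, 0 ≤ C ∧ 0 < r ∧ ∀ x ∈ A, ∀ v, pnorm v ≤ r →
      |diag K C₁ C₂ κ ξ Φ (x + v) - diag K C₁ C₂ κ ξ Φ x| ≤ C * pnorm v := by
  obtain ⟨C, r, hC0, hr0, hr1, h⟩ :=
    hΦ.increment_bound K C₁ C₂ hκ hκ' hN (by linarith) hξ hA hAT
  have hfin := finite_U hκ hκ' γ
  obtain ⟨D, hD0, hD⟩ := exists_sum_bound hfin.toFinset
    (V := {p : Spacetime × Spacetime | p.1 ∈ A ∧ pnorm p.2 ≤ 1}) (W := fun p => pnorm p.2)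
    (f := fun τ p => (Φ p.1).coeff τ *
      (modelPi κ K (renormPP K C₁ C₂ ξ) p.1 (Alg.of τ) (p.1 + p.2) -
        modelPi κ K (renormPP K C₁ C₂ ξ) p.1 (Alg.of τ) p.1)) (fun τ hτ => by
      have hτ' : τ ∈ setUlt κ γ := by simpa [setUlt] using hτ
      obtain ⟨C, hC0, hC⟩ := hΦ.coeff_bounded K hA hAT hτ'.2
      obtain ⟨D, hD0, hD⟩ := modelPi_lipschitz (κ := κ) K C₁ C₂ hξ hA τ
      refine ⟨C * D, by positivity, ?_⟩
      rintro ⟨x, v⟩ ⟨hx, hv⟩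
      rw [abs_mul, mul_assoc]
      exact mul_le_mul (hC x hx) (hD x hx v hv) (abs_nonneg _) hC0)
  refine ⟨C + D, r, by positivity, hr0, fun x hx v hv => ?_⟩
  have hv1 := hv.trans hr1
  have e1 := (h x hx v hv).2
  have e2 := hD (x, v) ⟨hx, hv1⟩
  have e3 := Alg.map_eq_sum (modelPi κ K (renormPP K C₁ C₂ ξ) x) (s := hfin.toFinset)
    (a := Φ x) (by simpa [setUlt] using hΦ.mem_span K (hAT hx))
  have e4 : (∑ τ ∈ hfin.toFinset, (Φ x).coeff τ *
      (modelPi κ K (renormPP K C₁ C₂ ξ) x (Alg.of τ) (x + v) -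
        modelPi κ K (renormPP K C₁ C₂ ξ) x (Alg.of τ) x)) =
      modelPi κ K (renormPP K C₁ C₂ ξ) x (Φ x) (x + v) - diag K C₁ C₂ κ ξ Φ x := by
    rw [diag, e3]
    simp [mul_sub]
  simp only at e2
  rw [e4] at e2
  have e5 : pnorm v ^ γ ≤ pnorm v := by
    simpa using pnorm_rpow_le hv1 zero_le_one hγ
  have e6 := abs_add_le (diag K C₁ C₂ κ ξ Φ (x + v) -
    modelPi κ K (renormPP K C₁ C₂ ξ) x (Φ x) (x + v))
    (modelPi κ K (renormPP K C₁ C₂ ξ) x (Φ x) (x + v) - diag K C₁ C₂ κ ξ Φ x)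
  rw [sub_add_sub_cancel] at e6
  have e7 := mul_le_mul_of_nonneg_left e5 hC0
  rw [add_mul]
  linarith

end

end Phi43

namespace Phi43

open Phi43.Symbol

/-! ## Truncations -/

theorem Alg.trunc_mem (κ γ : ℝ) {s : Set Symbol} {a : Alg} (ha : a ∈ Alg.spanOf s) :
    Alg.trunc κ γ a ∈ Alg.spanOf {τ | τ ∈ s ∧ homog κ τ < γ} := by
  refine Alg.map_spanOf _ (fun τ hτ => ?_) ha
  rw [Alg.trunc_of]
  split_ifs with h
  · exact Alg.of_mem_spanOf ⟨hτ, h⟩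
  · exact Submodule.zero_mem _

theorem Alg.mem_spanOf_univ (a : Alg) : a ∈ Alg.spanOf univ := Alg.mem_spanOf.2 fun _ _ => trivial

theorem Alg.trunc_trunc (κ : ℝ) {γ δ : ℝ} (h : γ ≤ δ) (a : Alg) :
    Alg.trunc κ γ (Alg.trunc κ δ a) = Alg.trunc κ γ a := by
  refine Alg.eq_of_spanOf (f := Alg.trunc κ γ ∘ₗ Alg.trunc κ δ) (fun τ _ => ?_)
    (Alg.mem_spanOf_univ a)
  rw [LinearMap.comp_apply, Alg.trunc_of κ δ]
  split_ifs with h1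
  · rfl
  · rw [map_zero, Alg.trunc_of, if_neg]
    exact fun h2 => h1 (h2.trans_le h)

theorem Alg.trunc_int (κ γ : ℝ) (a : Alg) :
    Alg.trunc κ γ (Alg.int a) = Alg.int (Alg.trunc κ (γ - 2) a) := by
  have h : Alg.trunc κ γ ∘ₗ Alg.int = Alg.int ∘ₗ Alg.trunc κ (γ - 2) := Alg.ext_of fun τ => by
    rw [LinearMap.comp_apply, LinearMap.comp_apply, Alg.trunc_of]
    by_cases hp : τ.IsPoly
    · rw [Alg.int_of_isPoly hp]
      split_ifs
      · rw [Alg.int_of_isPoly hp, map_zero]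
      · simp
    · rw [Alg.int_of hp, Alg.trunc_of, homog_int]
      by_cases h : homog κ τ < γ - 2
      · rw [if_pos h, if_pos (by linarith), Alg.int_of hp]
      · rw [if_neg h, if_neg (by linarith), map_zero]
  exact LinearMap.congr_fun h a

theorem Alg.lcoeff_trunc (κ γ : ℝ) {σ : Symbol} (h : homog κ σ < γ) (a : Alg) :
    Alg.lcoeff σ (Alg.trunc κ γ a) = Alg.lcoeff σ a := by
  refine Alg.eq_of_spanOf (f := Alg.lcoeff σ ∘ₗ Alg.trunc κ γ) (fun τ _ => ?_)
    (Alg.mem_spanOf_univ a)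
  rw [LinearMap.comp_apply, Alg.trunc_of]
  split_ifs with h1
  · rfl
  · rw [map_zero, Alg.lcoeff_of, if_neg]
    rintro rfl
    exact h1 h

/-- Removing two factors `I(Ξ)` raises the homogeneity by exactly 1 + 2κ. -/
theorem rootContract_trunc (κ γ : ℝ) (a : Alg) :
    rootContract (Alg.trunc κ γ a) = Alg.trunc κ (γ + 1 + 2 * κ) (rootContract a) := by
  refine Alg.eq_of_spanOf (f := rootContract ∘ₗ Alg.trunc κ γ)
    (g := Alg.trunc κ (γ + 1 + 2 * κ) ∘ₗ rootContract) (fun τ _ => ?_) (Alg.mem_spanOf_univ a)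
  rw [LinearMap.comp_apply, LinearMap.comp_apply, Alg.trunc_of, rootContract_of]
  by_cases h : 2 ≤ numPsi τ
  · have h1 := congrArg (homog κ) (prune_mul (pair_le_children h))
    simp only [Multiset.insert_eq_cons, Multiset.map_cons, Multiset.map_singleton,
      Multiset.prod_cons, Multiset.prod_singleton, homog_mul, homog_int, homog_noise] at h1
    rw [contract₁, map_smul, Alg.trunc_of]
    simp only [Multiset.insert_eq_cons]
    by_cases h2 : homog κ τ < γ
    · rw [if_pos h2, if_pos (by linarith), rootContract_of]
      rfl
    · rw [if_neg h2, if_neg (by linarith), map_zero, smul_zero]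
  · rw [contract₁_of_lt (by omega), map_zero]
    split_ifs
    · rw [rootContract_of, contract₁_of_lt (by omega)]
    · exact map_zero _

theorem childContract_trunc_of_mono (κ γ : ℝ) {β : ℝ} {a : Alg} (ha : a ∈ Alg.spanOf (monoLt β)) :
    childContract (Alg.trunc κ γ a) = 0 :=
  childContract_of_mono (β := β) (Alg.spanOf_mono (fun _ h => h.1) (Alg.trunc_mem κ γ ha))

theorem lcoeff_one_jet {γ : ℝ} (hγ : 0 < γ) (c : (Fin 4 → ℕ) → ℝ) :
    Alg.lcoeff 1 (Alg.jet γ c) = c 0 := by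
  have h0 : (0 : Fin 4 → ℕ) ∈ multiBelow γ := mem_multiBelow.2 (by simpa [sdeg] using hγ)
  simp only [Alg.jet, Alg.jetIn, ← Alg.of_mono, map_sum, map_smul, Alg.lcoeff_of, smul_eq_mul]
  rw [Finset.sum_eq_single_of_mem 0 h0]
  · simp [mono_one]
  · intro k _ hk
    rw [if_neg, mul_zero]
    rw [← mono_one]
    exact fun h => hk (mono_injective h)

theorem lcoeff_one_int (a : Alg) : Alg.lcoeff 1 (Alg.int a) = 0 := by
  refine Alg.eq_of_spanOf (f := Alg.lcoeff 1 ∘ₗ Alg.int) (g := 0) (fun τ _ => ?_)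
    (Alg.mem_spanOf_univ a)
  rw [LinearMap.comp_apply, LinearMap.zero_apply]
  by_cases h : τ.IsPoly
  · rw [Alg.int_of_isPoly h, map_zero]
  · rw [Alg.int_of h, Alg.lcoeff_of, if_neg]
    exact fun h1 => not_isPoly_int τ ⟨0, by rw [h1, mono_one]⟩

section

variable {κ : ℝ} {N : ℕ} (K : HeatKernelSplit N) (C₁ C₂ : ℝ) {ξ : Spacetime → ℝ}

/-! ## The product of the solution with itself -/

/-- If two factors are `I(Ξ)` and the third has homogeneity below γ, the total is below γ − 1 − 2κ.
So no product discarded by truncating the right-hand side can be contracted. -/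
theorem contractTriple_of_large (F : Alg →ₗ[ℝ] Alg) {γ : ℝ} {a b c : Symbol} (ha : homog κ a < γ)
    (hb : homog κ b < γ) (hc : homog κ c < γ)
    (h : rhsOrder κ γ ≤ homog κ a + homog κ b + homog κ c) :
    contractTriple F (Alg.of a) (Alg.of b) (Alg.of c) = 0 := by
  have hpsi : ∀ σ, psi (Alg.of σ) ≠ 0 → homog κ σ = -(1 / 2) - κ := by
    intro σ hσ
    by_contra h1
    refine hσ (psi_of_ne ?_)
    rintro rfl
    refine h1 ?_
    simp
    ring
  have hz : ∀ {a b c : Symbol}, homog κ c < γ →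
      rhsOrder κ γ ≤ homog κ a + homog κ b + homog κ c →
      psi (Alg.of a) * psi (Alg.of b) = 0 := by
    intro a b c hc h
    by_contra h1
    have := hpsi a (left_ne_zero_of_mul h1)
    have := hpsi b (right_ne_zero_of_mul h1)
    rw [rhsOrder] at h
    linarith
  rw [contractTriple, hz hc h, hz (a := a) (b := c) hb (by linarith),
    hz (a := b) (b := c) ha (by linarith)]
  simp

variable {γ η T : ℝ} {Φ : Spacetime → Alg}

/-- The discarded products have total homogeneity at least γ − 1 − 2κ and no contraction term, so
Π_x maps each to the product of three functions, of size |v| to the power of the sum of the positive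
parts. -/
theorem IsModelled.cube_remainder (hκ : 0 < κ) (hκ' : κ < 1 / 14)
    (hN : rhsOrder κ γ + 2 ≤ N) (hγ : 0 < rhsOrder κ γ) (hξ : ContDiff ℝ ∞ ξ)
    (hΦ : IsModelled κ K (renormPP K C₁ C₂ ξ) γ η T Φ) {A : Set Spacetime} (hA : IsCompact A)
    (hAT : A ⊆ slab T) :
    ∃ C, 0 ≤ C ∧ ∀ x ∈ A, ∀ v, pnorm v ≤ 1 →
      |modelPi κ K (renormPP K C₁ C₂ ξ) x
        (Φ x ^ 3 - Alg.trunc κ (rhsOrder κ γ) (Φ x ^ 3)) (x + v)| ≤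
        C * pnorm v ^ rhsOrder κ γ := by
  have hfin := finite_U hκ hκ' γ
  set S := hfin.toFinset with hS
  have hmem : ∀ τ ∈ S, InU τ ∧ homog κ τ < γ := fun τ hτ => by simpa [hS] using hτ
  let L : Spacetime → Spacetime → Alg →ₗ[ℝ] ℝ := fun x v =>
    (LinearMap.proj (x + v) ∘ₗ modelPi κ K (renormPP K C₁ C₂ ξ) x) ∘ₗ
      (LinearMap.id - Alg.trunc κ (rhsOrder κ γ))
  have hLdef : ∀ x v a, L x v a = modelPi κ K (renormPP K C₁ C₂ ξ) x
    (a - Alg.trunc κ (rhsOrder κ γ) a) (x + v) := fun _ _ _ => rfl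
  have hL : ∀ τ₁ ∈ S, ∀ τ₂ ∈ S, ∀ τ₃ ∈ S, ∃ C, 0 ≤ C ∧ ∀ x ∈ A, ∀ v, pnorm v ≤ 1 →
      |L x v (Alg.of (τ₁ * τ₂ * τ₃))| ≤ C * pnorm v ^ rhsOrder κ γ := by
    intro τ₁ h₁ τ₂ h₂ τ₃ h₃
    obtain ⟨i₁, l₁⟩ := hmem _ h₁
    obtain ⟨i₂, l₂⟩ := hmem _ h₂
    obtain ⟨i₃, l₃⟩ := hmem _ h₃
    by_cases hlt : homog κ (τ₁ * τ₂ * τ₃) < rhsOrder κ γ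
    · refine ⟨0, le_rfl, fun x _ v _ => ?_⟩
      rw [hLdef, Alg.trunc_of, if_pos hlt, sub_self, map_zero]
      simp
    · obtain ⟨D₁, p₁, b₁⟩ := modelPi_bound K C₁ C₂ hκ hκ' hN hξ hA i₁ l₁
      obtain ⟨D₂, p₂, b₂⟩ := modelPi_bound K C₁ C₂ hκ hκ' hN hξ hA i₂ l₂
      obtain ⟨D₃, p₃, b₃⟩ := modelPi_bound K C₁ C₂ hκ hκ' hN hξ hA i₃ l₃
      refine ⟨D₁ * D₂ * D₃, by positivity, fun x hx v hv => ?_⟩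
      have e1 : L x v (Alg.of (τ₁ * τ₂ * τ₃)) =
          modelPi κ K (renormPP K C₁ C₂ ξ) x (Alg.of τ₁) (x + v) *
          modelPi κ K (renormPP K C₁ C₂ ξ) x (Alg.of τ₂) (x + v) *
          modelPi κ K (renormPP K C₁ C₂ ξ) x (Alg.of τ₃) (x + v) := by
        have h := modelPi_mul K x C₁ C₂ ξ hκ (Alg.of_mem_spanOf (s := {τ | InU τ}) i₁)
          (Alg.of_mem_spanOf (s := {τ | InU τ}) i₂) (Alg.of_mem_spanOf (s := {τ | InU τ}) i₃)
        rw [contractTriple_of_large _ l₁ l₂ l₃ (by simpa using hlt), map_zero, add_zero] at h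
        rw [hLdef, Alg.trunc_of, if_neg hlt, sub_zero, Alg.of_mul, Alg.of_mul, h]
        rfl
      have hp := fun σ => Real.rpow_nonneg (pnorm_nonneg v) (max (homog κ σ) 0)
      rw [e1, abs_mul, abs_mul]
      calc _ ≤ (D₁ * pnorm v ^ max (homog κ τ₁) 0) * (D₂ * pnorm v ^ max (homog κ τ₂) 0) *
            (D₃ * pnorm v ^ max (homog κ τ₃) 0) := by
            refine mul_le_mul (mul_le_mul (b₁ x hx v hv) (b₂ x hx v hv) (abs_nonneg _)
              (mul_nonneg p₁ (hp _))) (b₃ x hx v hv) (abs_nonneg _)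
              (mul_nonneg (mul_nonneg p₁ (hp _)) (mul_nonneg p₂ (hp _)))
        _ = D₁ * D₂ * D₃ * pnorm v ^ (max (homog κ τ₁) 0 + max (homog κ τ₂) 0 +
            max (homog κ τ₃) 0) := by
            rw [Real.rpow_add_of_nonneg (pnorm_nonneg v) (add_nonneg (le_max_right _ _)
              (le_max_right _ _)) (le_max_right _ _), Real.rpow_add_of_nonneg (pnorm_nonneg v)
              (le_max_right _ _) (le_max_right _ _)]
            ring
        _ ≤ _ := by
            refine mul_le_mul_of_nonneg_left (pnorm_rpow_le hv hγ.le ?_) (by positivity)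
            rw [homog_mul, homog_mul, not_lt] at hlt
            linarith [le_max_left (homog κ τ₁) 0, le_max_left (homog κ τ₂) 0,
              le_max_left (homog κ τ₃) 0]
  obtain ⟨C, hC0, hC⟩ := exists_sum_bound (S ×ˢ S ×ˢ S)
    (V := {p : Spacetime × Spacetime | p.1 ∈ A ∧ pnorm p.2 ≤ 1})
    (W := fun p => pnorm p.2 ^ rhsOrder κ γ)
    (f := fun t p => ((Φ p.1).coeff t.1 * ((Φ p.1).coeff t.2.1 * (Φ p.1).coeff t.2.2)) *
      L p.1 p.2 (Alg.of (t.1 * t.2.1 * t.2.2))) (by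
      rintro ⟨τ₁, τ₂, τ₃⟩ hτ
      simp only [Finset.mem_product] at hτ
      obtain ⟨h₁, h₂, h₃⟩ := hτ
      obtain ⟨D₁, p₁, b₁⟩ := hΦ.coeff_bounded K hA hAT (hmem _ h₁).2
      obtain ⟨D₂, p₂, b₂⟩ := hΦ.coeff_bounded K hA hAT (hmem _ h₂).2
      obtain ⟨D₃, p₃, b₃⟩ := hΦ.coeff_bounded K hA hAT (hmem _ h₃).2
      obtain ⟨D, p, b⟩ := hL _ h₁ _ h₂ _ h₃
      refine ⟨D₁ * (D₂ * D₃) * D, by positivity, ?_⟩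
      rintro ⟨x, v⟩ ⟨hx, hv⟩
      simp only at hx hv ⊢
      rw [abs_mul, abs_mul, abs_mul, mul_assoc _ D]
      exact mul_le_mul (mul_le_mul (b₁ x hx) (mul_le_mul (b₂ x hx) (b₃ x hx) (abs_nonneg _) p₂)
        (by positivity) p₁) (b x hx v hv) (abs_nonneg _) (by positivity))
  refine ⟨C, hC0, fun x hx v hv => ?_⟩
  have h := hC (x, v) ⟨hx, hv⟩
  refine le_trans (le_of_eq ?_) h
  have e1 : Φ x = ∑ τ ∈ S, (Φ x).coeff τ • Alg.of τ :=
    Alg.map_eq_sum LinearMap.id (s := S) (by simpa [hS, setUlt] using hΦ.mem_span K (hAT hx))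
  have e2 : L x v (Φ x ^ 3) = ∑ t ∈ S ×ˢ S ×ˢ S,
      ((Φ x).coeff t.1 * ((Φ x).coeff t.2.1 * (Φ x).coeff t.2.2)) *
      L x v (Alg.of (t.1 * t.2.1 * t.2.2)) := by
    have e3 : Φ x ^ 3 = ∑ t ∈ S ×ˢ S ×ˢ S,
        ((Φ x).coeff t.1 * ((Φ x).coeff t.2.1 * (Φ x).coeff t.2.2)) •
        Alg.of (t.1 * t.2.1 * t.2.2) := by
      have : Φ x ^ 3 = Φ x * (Φ x * Φ x) := by ring
      rw [this]
      generalize (Φ x).coeff = c at e1 ⊢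
      rw [e1, Finset.sum_mul_sum, Finset.sum_mul_sum, Finset.sum_product]
      refine Finset.sum_congr rfl fun τ₁ _ => ?_
      rw [Finset.sum_product, ← Finset.mul_sum, Finset.mul_sum]
      refine Finset.sum_congr rfl fun τ₂ _ => ?_
      rw [Finset.mul_sum]
      refine Finset.sum_congr rfl fun τ₃ _ => ?_
      rw [smul_mul_smul_comm, smul_mul_smul_comm, Alg.of_mul, Alg.of_mul, mul_assoc (Alg.of τ₁)]
    rw [e3, map_sum]
    simp only [map_smul, smul_eq_mul]
  rw [← e2]
  rfl

/-- The reconstruction of the right hand side of the equation. -/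
theorem IsModelled.reconstruct_rhs (hκ : 0 < κ) (hκ' : κ < 1 / 14)
    (hN : rhsOrder κ γ + 2 ≤ N) (hγ : 0 < rhsOrder κ γ) (hξ : ContDiff ℝ ∞ ξ)
    (hΦ : IsModelled κ K (renormPP K C₁ C₂ ξ) γ η T Φ)
    (hψ : ∀ z ∈ slab T, psi (Φ z) = 1)
    (hQ : ∀ z ∈ slab T, childContract (Φ z) = -((3 : ℝ) • Alg.trunc κ (γ - 1 + 2 * κ) (Φ z))) :
    reconstruct κ K (renormPP K C₁ C₂ ξ) (rhsOrder κ γ) T (rhs κ γ Φ) =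
      (slab T).indicator fun z => ξ z - diag K C₁ C₂ κ ξ Φ z ^ 3 +
        (3 * C₁ - 9 * C₂) * diag K C₁ C₂ κ ξ Φ z := by
  have hγ0 : 0 < γ := by
    rw [rhsOrder] at hγ
    linarith
  have hcont := hΦ.continuousOn_diag K C₁ C₂ hκ hκ' hN hγ0 hξ
  refine Phi43.reconstruct_eq K C₁ C₂ hξ hγ (fun z hz => indicator_of_notMem hz _) ?_ ?_
  · refine ContinuousOn.congr ?_ fun z hz => indicator_of_mem hz _
    exact (hξ.continuous.continuousOn.sub (hcont.pow 3)).add (continuousOn_const.mul hcont)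
  · intro A hAT hA
    obtain ⟨C, r, hC0, hr0, hr1, hC⟩ :=
      hΦ.increment_bound K C₁ C₂ hκ hκ' hN hγ0.le hξ hA hAT
    obtain ⟨D, hD0, hD⟩ := hΦ.cube_remainder K C₁ C₂ hκ hκ' hN hγ hξ hA hAT
    obtain ⟨B, hB0, hB⟩ := hΦ.value_bound K C₁ C₂ hκ hκ' hN hξ hA hAT
    -- QΦ determines Φ only below γ − 1 + 2κ. In the error, coefficients below that level vanish, so
    -- any exponent may be claimed for them; the others have homogeneity above γ − 1 − 2κ and need
    -- no decay.
    obtain ⟨E, hE0, hE⟩ := modelPi_sum_bound K C₁ C₂ hκ hκ' hN hξ hA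
      (fun τ => if homog κ τ < γ - 1 + 2 * κ then rhsOrder κ γ else 0) hγ.le le_rfl
      (fun τ _ => by
        split_ifs
        exacts [hγ.le, le_rfl])
      (fun τ _ => by
        split_ifs with h
        · linarith [le_max_right (homog κ τ) 0]
        · have := le_max_left (homog κ τ) 0
          rw [rhsOrder]
          linarith)
      (a := fun x _ => Φ x - Alg.trunc κ (γ - 1 + 2 * κ) (Φ x))
      (fun x hx v _ => Submodule.sub_mem _ (hΦ.mem_span K (hAT hx))
        (Alg.spanOf_mono (fun _ h => h.1) (Alg.trunc_mem κ _ (hΦ.mem_span K (hAT hx)))))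
      (fun τ hτ => by
        obtain ⟨C, hC0, hC⟩ := hΦ.coeff_bounded K hA hAT hτ.2
        refine ⟨C, fun x hx v _ => ?_⟩
        split_ifs with h
        · have h1 := Alg.lcoeff_trunc κ _ h (Φ x)
          rw [Alg.lcoeff_apply, Alg.lcoeff_apply] at h1
          have h2 : (Φ x - Alg.trunc κ (γ - 1 + 2 * κ) (Φ x)).coeff τ = 0 := by
            rw [← Alg.lcoeff_apply, map_sub, Alg.lcoeff_apply, Alg.lcoeff_apply, h1, sub_self]
          rw [h2, abs_zero]
          exact mul_nonneg hC0 (Real.rpow_nonneg (pnorm_nonneg v) _)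
        · have h1 : Alg.lcoeff τ (Alg.trunc κ (γ - 1 + 2 * κ) (Φ x)) = 0 := by
            have := Alg.trunc_mem κ (γ - 1 + 2 * κ) (Alg.mem_spanOf_univ (Φ x))
            rw [Alg.mem_spanOf] at this
            by_contra h3
            exact h (this τ (Finsupp.mem_support_iff.2 h3)).2
          have h2 : (Φ x - Alg.trunc κ (γ - 1 + 2 * κ) (Φ x)).coeff τ = (Φ x).coeff τ := by
            rw [← Alg.lcoeff_apply, map_sub, h1, sub_zero, Alg.lcoeff_apply]
          rw [h2, Real.rpow_zero, mul_one]
          exact hC x hx)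
    refine ⟨C * ((B + C) ^ 2 + (B + C) * B + B ^ 2) + |3 * C₁ - 9 * C₂| * C + |9 * C₂| * E + D, r,
      hr0, fun x hx v hv => ?_⟩
    obtain ⟨hy, h1⟩ := hC x hx v hv
    have hv1 := hv.trans hr1
    have h2 := hD x hx v hv1
    have h3 := hB x hx v hv1
    have h4 := hE x hx v hv1
    rw [indicator_of_mem hy]
    have hΦu := hΦ.mem_spanU K (hAT hx)
    -- The contraction term is 3(−C₁Φ − C₂QΦ) with QΦ equal to −3 times the truncation of Φ. This is
    -- where the constant 3C₁ − 9C₂ arises; the last term is the truncation error.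
    have hcube : modelPi κ K (renormPP K C₁ C₂ ξ) x (Φ x ^ 3) =
        modelPi κ K (renormPP K C₁ C₂ ξ) x (Φ x) ^ 3 -
        (3 * C₁ - 9 * C₂) • modelPi κ K (renormPP K C₁ C₂ ξ) x (Φ x) -
        (9 * C₂) • modelPi κ K (renormPP K C₁ C₂ ξ) x
          (Φ x - Alg.trunc κ (γ - 1 + 2 * κ) (Φ x)) := by
      have e1 : Φ x ^ 3 = Φ x * Φ x * Φ x := by ring
      rw [e1, modelPi_mul K x C₁ C₂ ξ hκ hΦu hΦu hΦu, contractTriple, hψ x (hAT hx), genLoop]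
      simp only [LinearMap.sub_apply, LinearMap.neg_apply, LinearMap.smul_apply,
        LinearMap.id_apply, hQ x (hAT hx), map_add, map_sub, map_neg, map_smul, mul_one, one_smul]
      ext y
      simp only [Pi.add_apply, Pi.sub_apply, Pi.neg_apply, Pi.smul_apply, Pi.mul_apply,
        Pi.pow_apply, smul_eq_mul]
      ring
    have hrhs : rhs κ γ Φ x = Alg.of noise - Φ x ^ 3 +
        (Φ x ^ 3 - Alg.trunc κ (rhsOrder κ γ) (Φ x ^ 3)) := by
      rw [rhs, map_sub, Alg.trunc_of, if_pos]
      · abel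
      · rw [homog_noise]
        linarith
    rw [hrhs, map_add, map_sub, modelPi_noise, hcube]
    simp only [Pi.add_apply, Pi.sub_apply, Pi.smul_apply, Pi.pow_apply, smul_eq_mul]
    set p := modelPi κ K (renormPP K C₁ C₂ ξ) x (Φ x) (x + v)
    set q := modelPi κ K (renormPP K C₁ C₂ ξ) x
      (Φ x - Alg.trunc κ (γ - 1 + 2 * κ) (Φ x)) (x + v)
    set s := modelPi κ K (renormPP K C₁ C₂ ξ) x
      (Φ x ^ 3 - Alg.trunc κ (rhsOrder κ γ) (Φ x ^ 3)) (x + v)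
    set u := diag K C₁ C₂ κ ξ Φ (x + v)
    set W := pnorm v ^ rhsOrder κ γ with hW
    have hW0 : 0 ≤ W := Real.rpow_nonneg (pnorm_nonneg v) _
    have hup : |u - p| ≤ C * W := by
      refine h1.trans (mul_le_mul_of_nonneg_left (pnorm_rpow_le hv1 hγ.le ?_) hC0)
      rw [rhsOrder]
      linarith
    have hW1 : W ≤ 1 := Real.rpow_le_one (pnorm_nonneg v) hv1 hγ.le
    have hu : |u| ≤ B + C := by
      have := abs_add_le (u - p) p
      rw [sub_add_cancel] at this
      have := mul_le_mul_of_nonneg_left hW1 hC0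
      linarith
    have e1 : ξ (x + v) - u ^ 3 + (3 * C₁ - 9 * C₂) * u -
        (ξ (x + v) - (p ^ 3 - (3 * C₁ - 9 * C₂) * p - 9 * C₂ * q) + s) =
        -((u - p) * (u ^ 2 + u * p + p ^ 2)) + (3 * C₁ - 9 * C₂) * (u - p) - 9 * C₂ * q - s := by
      ring
    have e2 : |u ^ 2 + u * p + p ^ 2| ≤ (B + C) ^ 2 + (B + C) * B + B ^ 2 := by
      refine (abs_add_le _ _).trans (add_le_add ((abs_add_le _ _).trans (add_le_add ?_ ?_)) ?_)
      · rw [abs_pow]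
        exact pow_le_pow_left₀ (abs_nonneg _) hu 2
      · rw [abs_mul]
        exact mul_le_mul hu h3 (abs_nonneg _) (by positivity)
      · rw [abs_pow]
        exact pow_le_pow_left₀ (abs_nonneg _) h3 2
    rw [e1]
    refine (abs_sub _ _).trans ?_
    rw [add_mul]
    refine add_le_add ((abs_sub _ _).trans ?_) h2
    rw [add_mul]
    refine add_le_add ((abs_add_le _ _).trans ?_) ?_
    · rw [add_mul]
      refine add_le_add ?_ ?_
      · rw [abs_neg, abs_mul, mul_right_comm]
        exact mul_le_mul hup e2 (abs_nonneg _) (by positivity)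
      · rw [abs_mul, mul_assoc]
        exact mul_le_mul_of_nonneg_left hup (abs_nonneg _)
    · rw [abs_mul, mul_assoc]
      exact mul_le_mul_of_nonneg_left h4 (abs_nonneg _)

end

end Phi43

/-! ### From the fixed point problem to the mild equation -/

namespace Phi43

open Phi43.Symbol

section

variable {κ : ℝ} {N : ℕ} (K : HeatKernelSplit N) (C₁ C₂ : ℝ) {ξ : Spacetime → ℝ}

/-- A product of three elements of U has |τ| + 2 ≥ 1/2 − 3κ > 0, so its jet contains a constant
term, the convolution at z. For monomials J(z) is 0 by convention, and so is the convolution, since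
the kernel annihilates polynomials of degree below N. -/
theorem lcoeff_one_modelJ (hκ : 0 < κ) (hκ' : κ < 1 / 14) (hξ : ContDiff ℝ ∞ ξ)
    (z : Spacetime) {a : Alg} (ha : a ∈ Alg.spanOf {τ | IsTriple τ ∧ homog κ τ < N}) :
    Alg.lcoeff 1 (modelJ κ K (renormPP K C₁ C₂ ξ) z a) =
      K.conv (modelPi κ K (renormPP K C₁ C₂ ξ) z a) z := by
  have h := Alg.eq_of_spanOf (f := Alg.lcoeff 1 ∘ₗ modelJ κ K (renormPP K C₁ C₂ ξ) z)
    (g := LinearMap.proj z ∘ₗ convLin K _ (contDiff_modelPi (κ := κ) K C₁ C₂ hξ z)) ?_ ha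
  · exact h
  rintro τ ⟨hτ, hN⟩
  change Alg.lcoeff 1 (modelJ κ K (renormPP K C₁ C₂ ξ) z (Alg.of τ)) =
    K.conv (modelPi κ K (renormPP K C₁ C₂ ξ) z (Alg.of τ)) z
  by_cases hp : τ.IsPoly
  · rw [modelJ, Alg.extend_of, if_pos hp, map_zero]
    obtain ⟨k, rfl⟩ := hp
    have h1 := map_mono_mem (recenter κ K (renormPP K C₁ C₂ ξ) z) (fun i => by
      rw [recenter_coord]
      exact sub_mem (coord_mem i) (Subalgebra.algebraMap_mem _ _)) k
    rw [modelPi_renormPP, renormMap_of_polySub C₁ C₂ h1, conv_canonicalPP_of_monoLe K hξ]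
    · rfl
    · refine Alg.spanOf_mono ?_ ((isRecentering_recenter K (renormPP K C₁ C₂ ξ) z hκ).mono k)
      rintro _ ⟨l, rfl, hl⟩
      rw [homog_mono] at hN
      exact ⟨l, rfl, hl.trans hN.le⟩
  · have h2 := hτ.homog_ge hκ hκ'
    rw [modelJ, Alg.extend_of, if_neg hp, lcoeff_one_jet (by linarith), K.coeffAt_zero]
    exact HeatKernelSplit.admissible_of_continuous (contDiff_modelPi K C₁ C₂ hξ z _).continuous z

theorem homog_rhs_noise (hκ : 0 < κ) {γ : ℝ} (hγ : 1 + 2 * κ < γ) :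
    homog κ noise < rhsOrder κ γ := by
  rw [homog_noise, rhsOrder]
  linarith

variable {γ η T : ℝ} {Φ : Spacetime → Alg}
  {Φ₀ : 𝓢(EuclideanSpace ℝ (Fin 3), ℝ) →L[ℝ] ℝ}

/-- Symbols of positive homogeneity vanish at the base point, and 1 and `I(Ξ)` are the only elements
of U that are not of positive homogeneity, since |I(abc)| ≥ 1/2 − 3κ. -/
theorem diag_eq (hκ : 0 < κ) (hκ' : κ < 1 / 14) (hN : rhsOrder κ γ + 2 ≤ N)
    (hξ : ContDiff ℝ ∞ ξ) {z : Spacetime} (hΦ : Φ z ∈ Alg.spanOf (setUlt κ γ)) :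
    diag K C₁ C₂ κ ξ Φ z = Alg.lcoeff 1 (Φ z) + psi (Φ z) * K.conv ξ z := by
  have h := Alg.eq_of_spanOf (f := LinearMap.proj z ∘ₗ modelPi κ K (renormPP K C₁ C₂ ξ) z)
    (g := Alg.lcoeff 1 + K.conv ξ z • psi) ?_ hΦ
  · rw [diag]
    refine h.trans ?_
    simp [mul_comm]
  rintro τ ⟨hτ, hlt⟩
  change modelPi κ K (renormPP K C₁ C₂ ξ) z (Alg.of τ) z =
    Alg.lcoeff 1 (Alg.of τ) + K.conv ξ z * psi (Alg.of τ)
  have hpos : 0 < homog κ τ → modelPi κ K (renormPP K C₁ C₂ ξ) z (Alg.of τ) z = 0 := by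
    intro h0
    obtain ⟨C, -, hC⟩ := modelPi_bound K C₁ C₂ hκ hκ' hN hξ (isCompact_singleton (x := z)) hτ hlt
    have := hC z rfl 0 (by rw [pnorm_zero]; exact zero_le_one)
    rw [pnorm_zero, max_eq_left h0.le, Real.zero_rpow h0.ne', mul_zero, add_zero] at this
    exact abs_eq_zero.1 (le_antisymm this (abs_nonneg _))
  cases hτ with
  | mono k =>
    rw [psi_of_ne (mono_ne_psi k), mul_zero, add_zero, Alg.lcoeff_of]
    by_cases hk : k = 0
    · subst hk
      rw [if_pos mono_one, modelPi_mono]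
      simp
    · rw [if_neg, hpos]
      · rw [homog_mono, Nat.cast_pos, pos_iff_ne_zero]
        intro h0
        refine hk ?_
        rw [sdeg] at h0
        ext i
        fin_cases i <;> simp <;> omega
      · rw [← mono_one]
        exact fun h => hk (mono_injective h)
  | psi =>
    rw [psi_psi, modelPi_psi K C₁ C₂ hκ, Alg.lcoeff_of, if_neg]
    · ring
    · exact fun h => mono_ne_psi 0 (by rw [mono_one, h])
  | @int a b c ha hb hc _ =>
    have ht : IsTriple (a * b * c) := ⟨a, b, c, ha, hb, hc, rfl⟩
    have h1 := ht.homog_ge hκ hκ'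
    rw [hpos (by rw [homog_int]; linarith), psi_of_ne (int_ne_psi ht), Alg.lcoeff_of, if_neg]
    · ring
    · exact fun h => not_isPoly_int _ ⟨0, by rw [h, mono_one]⟩

theorem rhs_mem {PP : Alg →ₗ[ℝ] (Spacetime → ℝ)} (hΦ : IsModelled κ K PP γ η T Φ)
    {z : Spacetime} (hz : z ∈ slab T) :
    Alg.trunc κ (rhsOrder κ γ) (Φ z ^ 3) ∈
      Alg.spanOf {τ | IsTriple τ ∧ homog κ τ < rhsOrder κ γ} := by
  have h := hΦ.mem_spanU K hz
  have e : Φ z ^ 3 = Φ z * Φ z * Φ z := by ring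
  rw [e]
  exact Alg.trunc_mem κ _ (mul_mem_spanT h h h)

namespace IsAbstractSolution

/-- Everything in the fixed point equation except I f is polynomial; γ + 10 is merely a generous
common bound for the degrees. -/
theorem exists_poly {PP : Alg →ₗ[ℝ] (Spacetime → ℝ)} (hκ : 0 < κ)
    (hΦ : IsAbstractSolution κ K PP γ η T Φ₀ Φ) {z : Spacetime} (hz : z ∈ slab T) :
    ∃ P ∈ Alg.spanOf (monoLt (γ + 10)), Φ z = Alg.trunc κ γ (Alg.int (rhs κ γ Φ z) + P) := by
  have hmono : ∀ {β a}, β ≤ γ + 10 → a ∈ Alg.spanOf (monoLt β) →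
      a ∈ Alg.spanOf (monoLt (γ + 10)) := by
    intro β a hβ ha
    refine Alg.spanOf_mono ?_ ha
    rintro _ ⟨k, rfl, hk⟩
    exact ⟨k, rfl, hk.trans_le hβ⟩
  have hr : rhsOrder κ γ + 2 ≤ γ + 10 := by
    rw [rhsOrder]
    linarith
  have h := hΦ.fixedPoint z hz
  rw [liftK, liftKhat, add_assoc, add_assoc, add_assoc] at h
  refine ⟨_, ?_, h⟩
  refine Submodule.add_mem _ (hmono hr (modelJ_mem K PP z (β := rhsOrder κ γ)
    (s := {τ | τ ∈ univ ∧ homog κ τ < rhsOrder κ γ}) (fun τ hτ => hτ.2.le)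
    (Alg.trunc_mem κ _ (Alg.mem_spanOf_univ _)))) (Submodule.add_mem _ (hmono hr (jet_mem _ _))
    (Submodule.add_mem _ (hmono (by linarith) (jet_mem _ _)) (hmono (by linarith) (jet_mem _ _))))

/-- Polynomials contain no `I(Ξ)`, and Φ³ contains no `Ξ`, so the only contribution is from the
noise in the right-hand side. Neither truncation reaches it. -/
theorem psi_eq {PP : Alg →ₗ[ℝ] (Spacetime → ℝ)} (hκ : 0 < κ) (hγ : 1 + 2 * κ < γ)
    (hΦ : IsAbstractSolution κ K PP γ η T Φ₀ Φ) {z : Spacetime} (hz : z ∈ slab T) :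
    psi (Φ z) = 1 := by
  obtain ⟨P, hP, h⟩ := hΦ.exists_poly K hκ hz
  have h1 : psi (Φ z) = psi (Alg.int (rhs κ γ Φ z) + P) := by
    conv_lhs => rw [h]
    refine Alg.lcoeff_trunc κ γ ?_ _
    simp
    linarith
  have hu := hΦ.modelled.mem_spanU K hz
  have e : Φ z ^ 3 = Φ z * Φ z * Φ z := by ring
  rw [h1, map_add, psi_of_mono hP, psi_int, add_zero, rhs,
    Alg.lcoeff_trunc κ _ (homog_rhs_noise hκ hγ), map_sub, Alg.lcoeff_of, if_pos rfl, e,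
    lcoeff_noise_of_spanT (mul_mem_spanT hu hu hu), sub_zero]

/-- Q kills the polynomial part and turns I(Ξ − Φ³) into the contraction of −Φ³ at the root, which
is −3Φ as the coefficient of `I(Ξ)` is 1. The truncation at γ − 2 is moved by 1 + 2κ in passing
through the contraction. -/
theorem childContract_eq {PP : Alg →ₗ[ℝ] (Spacetime → ℝ)} (hκ : 0 < κ) (hκ' : κ < 1 / 14)
    (hγ : 1 + 2 * κ < γ) (hΦ : IsAbstractSolution κ K PP γ η T Φ₀ Φ) {z : Spacetime}
    (hz : z ∈ slab T) :
    childContract (Φ z) = -((3 : ℝ) • Alg.trunc κ (γ - 1 + 2 * κ) (Φ z)) := by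
  obtain ⟨P, hP, h⟩ := hΦ.exists_poly K hκ hz
  have hu := hΦ.modelled.mem_spanU K hz
  have hψ := hΦ.psi_eq K hκ hγ hz
  have e : Φ z ^ 3 = Φ z * Φ z * Φ z := by ring
  have h1 : childContract (Φ z) =
      childContract (Alg.trunc κ γ (Alg.int (rhs κ γ Φ z) + P)) := congrArg _ h
  rw [h1, map_add, map_add, childContract_trunc_of_mono κ γ hP, add_zero, Alg.trunc_int,
    childContract_int, rhs, Alg.trunc_trunc κ (by rw [rhsOrder]; linarith), rootContract_trunc,
    map_sub, rootContract_of, contract₁_noise, zero_sub, e, rootContract_mul hu hu hu,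
    contractTriple, hψ]
  have h2 : γ - 2 + 1 + 2 * κ = γ - 1 + 2 * κ := by ring
  rw [h2, map_neg, ← map_smul (Alg.trunc κ _)]
  refine congrArg (fun a => -Alg.trunc κ (γ - 1 + 2 * κ) a) ?_
  simp only [mul_one, one_smul, LinearMap.id_apply]
  module

/-- The mild formulation of the equation. -/
theorem diag_eq_integral (hκ : 0 < κ) (hκ' : κ < 1 / 14) (hγ : 1 + 2 * κ < γ)
    (hN : rhsOrder κ γ + 2 ≤ N) (hξ : ContDiff ℝ ∞ ξ)
    (hΦ : IsAbstractSolution κ K (renormPP K C₁ C₂ ξ) γ η T Φ₀ Φ) {z : Spacetime}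
    (hz : z ∈ slab T) {g : Spacetime → ℝ}
    (hg : reconstruct κ K (renormPP K C₁ C₂ ξ) (rhsOrder κ γ) T (rhs κ γ Φ) = g)
    (hadm : HeatKernelSplit.Admissible z g)
    (hheat : Integrable fun w => heatKernel (z - w) * g w) :
    diag K C₁ C₂ κ ξ Φ z = (∫ w, heatKernel (z - w) * g w) + harmonicExt Φ₀ z := by
  have hγ' : 0 < rhsOrder κ γ := by
    rw [rhsOrder]
    linarith
  have hc := fun a => HeatKernelSplit.admissible_of_continuous
    (contDiff_modelPi (κ := κ) K C₁ C₂ hξ z a).continuous z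
  have h1 : Alg.lcoeff 1 (Φ z) = K.conv g z - K.conv ξ z +
      (∫ w, K.Khat (z - w) * g w) + harmonicExt Φ₀ z := by
    conv_lhs => rw [hΦ.fixedPoint z hz]
    rw [Alg.lcoeff_trunc κ γ (by rw [homog_one]; linarith), liftK, liftKhat, map_add, map_add,
      map_add, map_add, lcoeff_one_int, lcoeff_one_jet (by linarith), lcoeff_one_jet (by linarith),
      lcoeff_one_jet (by linarith), mpd_zero, mpd_zero, hg]
    have hrhs : rhs κ γ Φ z = Alg.of noise - Alg.trunc κ (rhsOrder κ γ) (Φ z ^ 3) := by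
      rw [rhs, map_sub, Alg.trunc_of, if_pos (homog_rhs_noise hκ hγ)]
    -- As |Ξ| + 2 ≤ 0, J(z) does not compensate the subtracted Π_zΞ = ξ. This leaves −K * ξ in the
    -- constant component, to be cancelled by the value of `I(Ξ)` at the base point.
    have hJ : modelJ κ K (renormPP K C₁ C₂ ξ) z (Alg.of noise) = 0 := by
      have h : homog κ noise + 2 ≤ 0 := by
        rw [homog_noise]
        linarith
      rw [modelJ, Alg.extend_of, if_neg not_isPoly_noise, Alg.jet, Alg.jetIn,
        multiBelow_of_nonpos h, Finset.sum_empty]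
    have hJ2 := lcoeff_one_modelJ K C₁ C₂ hκ hκ' hξ z
      (a := Alg.trunc κ (rhsOrder κ γ) (Φ z ^ 3))
      (Alg.spanOf_mono (s := {τ | IsTriple τ ∧ homog κ τ < rhsOrder κ γ})
        (t := {τ | IsTriple τ ∧ homog κ τ < N}) (fun τ hτ => ⟨hτ.1, hτ.2.trans_le (by linarith)⟩)
        (rhs_mem K hΦ.modelled hz))
    rw [K.coeffAt_zero (hadm.sub (hc _)), K.conv_sub hadm (hc _), hrhs, map_sub, map_sub, hJ, map_zero, hJ2, map_sub, modelPi_noise]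
    have h3 := K.conv_sub (HeatKernelSplit.admissible_of_continuous hξ.continuous z)
      (hc (Alg.trunc κ (rhsOrder κ γ) (Φ z ^ 3)))
    have h4 : K.conv (ξ - modelPi κ K (renormPP K C₁ C₂ ξ) z
      (Alg.trunc κ (rhsOrder κ γ) (Φ z ^ 3))) z = _ := h3
    rw [h4]
    ring
  -- The decomposition of the heat kernel is available away from the origin only, that is for almost
  -- every w.
  have h2 : ∀ᵐ w, K.total (z - w) * g w + K.Khat (z - w) * g w = heatKernel (z - w) * g w := by
    filter_upwards [Measure.ae_ne volume z] with w hw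
    have := (K.decomp (z - w) (sub_ne_zero.2 hw.symm)).tsum_eq
    rw [HeatKernelSplit.total, this]
    ring
  -- No decay of K̂ is assumed; integrability comes from writing it as heat kernel minus singular
  -- part.
  have h3 : Integrable fun w => K.Khat (z - w) * g w := by
    refine (hheat.sub (K.integrable_total_mul hadm)).congr ?_
    filter_upwards [h2] with w hw
    rw [Pi.sub_apply, ← hw]
    ring
  have h4 : ∫ w, heatKernel (z - w) * g w = K.conv g z + ∫ w, K.Khat (z - w) * g w := by
    rw [← integral_congr_ae h2, integral_add (K.integrable_total_mul hadm) h3]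
    rfl
  rw [diag_eq K C₁ C₂ hκ hκ' hN hξ (hΦ.modelled.mem_span K hz), hΦ.psi_eq K hκ hγ hz, h1, h4]
  ring

end IsAbstractSolution

end

end Phi43

/-! ### Second-order expansion of translations of Schwartz functions -/

namespace Phi43

section translation

open LineDeriv

variable {E : Type*} [NormedAddCommGroup E] [NormedSpace ℝ E]

theorem contDiff_iteratedFDeriv (F : 𝓢(E, ℝ)) (n : ℕ) : ContDiff ℝ ∞ (iteratedFDeriv ℝ n F) :=
  contDiff_infty.2 fun m => (F.smooth (m + n : ℕ)).iteratedFDeriv_right (by norm_cast)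

theorem iteratedFDeriv_lineDerivOp (F : 𝓢(E, ℝ)) (v : E) (n : ℕ) (x : E) :
    iteratedFDeriv ℝ n (∂_{v} F : 𝓢(E, ℝ)) x = fderiv ℝ (iteratedFDeriv ℝ n F) x v := by
  have hdiff (n : ℕ) := (contDiff_iteratedFDeriv F n).differentiable (by simp)
  induction n generalizing x with
  | zero =>
    ext m
    rw [← fderiv_continuousMultilinear_apply_const_apply (hdiff 0 x), iteratedFDeriv_zero_apply,
      SchwartzMap.lineDerivOp_apply_eq_fderiv]
    rfl
  | succ n ih =>
    have hd : Differentiable ℝ (fderiv ℝ (iteratedFDeriv ℝ n F)) :=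
      ((contDiff_iteratedFDeriv F n).fderiv_right (m := 1) (by norm_cast)).differentiable (by simp)
    have hsymm := ((contDiff_iteratedFDeriv F n).contDiffAt (x := x)).isSymmSndFDerivAt
      (by simp only [minSmoothness_of_isRCLikeNormedField]; norm_cast)
    ext m
    rw [← fderiv_continuousMultilinear_apply_const_apply (hdiff (n + 1) x),
      iteratedFDeriv_succ_apply_left, show iteratedFDeriv ℝ n (∂_{v} F : 𝓢(E, ℝ)) =
      fun y => fderiv ℝ (iteratedFDeriv ℝ n F) y v from funext ih]
    simp only [iteratedFDeriv_succ_apply_left]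
    rw [fderiv_continuousMultilinear_apply_const_apply
      (c := fun y => fderiv ℝ (iteratedFDeriv ℝ n F) y (m 0))
      ((hd x).clm_apply (differentiableAt_const _)),
      fderiv_clm_apply (hd x) (by fun_prop), fderiv_clm_apply (hd x) (by fun_prop)]
    simp [hsymm.eq v (m 0)]

/-- The second-order mean value inequality for the n-th derivative of F. Since ‖v‖ ≤ 1, the weights
1 + ‖x‖ and 1 + ‖y‖ are comparable along the segment, so the decay of derivative n + 2 can be used
at x. -/
theorem seminorm_increment_le (F : 𝓢(E, ℝ)) (k n : ℕ) : ∃ C : ℝ, ∀ v : E, ‖v‖ ≤ 1 →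
    SchwartzMap.seminorm ℝ k n (SchwartzMap.compSubConstCLM ℝ (-v) F - F - ∂_{v} F) ≤
      C * ‖v‖ ^ 2 := by
  set B : ℝ := 2 ^ k * (2 ^ k * (Finset.Iic (k, n + 2)).sup
    (fun m => SchwartzMap.seminorm ℝ m.1 m.2) F) with hB
  have hB0 : 0 ≤ B := by positivity
  refine ⟨B, fun v hv => SchwartzMap.seminorm_le_bound ℝ k n _ (by positivity) fun x => ?_⟩
  have hH := contDiff_iteratedFDeriv F n
  have hH1 := contDiff_iteratedFDeriv F (n + 1)
  have heq : iteratedFDeriv ℝ n (SchwartzMap.compSubConstCLM ℝ (-v) F - F - ∂_{v} F : 𝓢(E, ℝ)) x =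
      iteratedFDeriv ℝ n F (x + v) - iteratedFDeriv ℝ n F x -
        fderiv ℝ (iteratedFDeriv ℝ n F) x (x + v - x) := by
    have h1 : ((SchwartzMap.compSubConstCLM ℝ (-v) F - F - ∂_{v} F : 𝓢(E, ℝ)) : E → ℝ) =
        fun y => F (y + v) - F y - (∂_{v} F : 𝓢(E, ℝ)) y := by
      ext y
      simp
    have hs (G : 𝓢(E, ℝ)) (y : E) : ContDiffAt ℝ n G y := (G.smooth n).contDiffAt
    have hs' : ContDiffAt ℝ n (fun y => F (y + v)) x :=
      ((F.smooth n).comp (contDiff_id.add contDiff_const)).contDiffAt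
    rw [h1, fun_iteratedFDeriv_sub_apply (hs'.sub (hs F x)) (hs _ x),
      fun_iteratedFDeriv_sub_apply hs' (hs F x), iteratedFDeriv_comp_add_right,
      iteratedFDeriv_lineDerivOp, add_sub_cancel_left]
  have hbound : ∀ y ∈ Metric.closedBall x 1, ‖fderiv ℝ (iteratedFDeriv ℝ (n + 1) F) y‖ ≤
      B / (1 + ‖x‖) ^ k := by
    intro y hy
    rw [norm_fderiv_iteratedFDeriv, le_div_iff₀ (by positivity)]
    have h1 : 1 + ‖x‖ ≤ 2 * (1 + ‖y‖) := by
      rw [mem_closedBall_iff_norm'] at hy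
      have := norm_sub_norm_le x y
      linarith [norm_nonneg y]
    calc ‖iteratedFDeriv ℝ (n + 1 + 1) F y‖ * (1 + ‖x‖) ^ k
        ≤ ‖iteratedFDeriv ℝ (n + 1 + 1) F y‖ * (2 * (1 + ‖y‖)) ^ k := by gcongr
      _ = 2 ^ k * ((1 + ‖y‖) ^ k * ‖iteratedFDeriv ℝ (n + 2) F y‖) := by
        rw [mul_pow]
        ring
      _ ≤ B := by
        rw [hB]
        refine mul_le_mul_of_nonneg_left ?_ (by positivity)
        exact SchwartzMap.one_add_le_sup_seminorm_apply (m := (k, n + 2)) le_rfl le_rfl F y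
  have hbound' : ∀ y ∈ Metric.closedBall x ‖v‖,
      ‖fderiv ℝ (iteratedFDeriv ℝ n F) y - fderiv ℝ (iteratedFDeriv ℝ n F) x‖ ≤
        B / (1 + ‖x‖) ^ k * ‖v‖ := by
    intro y hy
    have hcurry : fderiv ℝ (iteratedFDeriv ℝ n F) y - fderiv ℝ (iteratedFDeriv ℝ n F) x =
      (iteratedFDeriv ℝ (n + 1) F y - iteratedFDeriv ℝ (n + 1) F x).curryLeft := rfl
    rw [hcurry, ContinuousMultilinearMap.curryLeft_norm]
    refine ((convex_closedBall x 1).norm_image_sub_le_of_norm_fderiv_le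
      (fun z _ => hH1.differentiable (by simp) z) hbound (Metric.mem_closedBall_self zero_le_one)
      (Metric.closedBall_subset_closedBall hv hy)).trans ?_
    gcongr
    exact mem_closedBall_iff_norm.1 hy
  have := (convex_closedBall x ‖v‖).norm_image_sub_le_of_norm_fderiv_le'
    (fun z _ => hH.differentiable (by simp) z) hbound'
    (Metric.mem_closedBall_self (norm_nonneg v)) (y := x + v) (by simp)
  rw [heq]
  calc ‖x‖ ^ k * _ ≤ (1 + ‖x‖) ^ k * (B / (1 + ‖x‖) ^ k * ‖v‖ * ‖v‖) := by
        gcongr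
        · linarith
        · simpa using this
    _ = B * ‖v‖ ^ 2 := by
        field_simp

/-- A tempered distribution is bounded by finitely many seminorms, each of which is quadratically
small by `seminorm_increment_le`. -/
theorem exists_translation_bound (Ψ : 𝓢(E, ℝ) →L[ℝ] ℝ) (F : 𝓢(E, ℝ)) : ∃ C : ℝ, ∀ v : E, ‖v‖ ≤ 1 →
    ‖Ψ (SchwartzMap.compSubConstCLM ℝ (-v) F) - Ψ F - Ψ (∂_{v} F)‖ ≤ C * ‖v‖ ^ 2 := by
  obtain ⟨s, c, -, hc⟩ := Seminorm.bound_of_continuous (schwartz_withSeminorms ℝ E ℝ)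
    ((normSeminorm ℝ ℝ).comp Ψ.toLinearMap) (continuous_norm.comp Ψ.continuous)
  choose C hC using fun m : ℕ × ℕ => seminorm_increment_le F m.1 m.2
  refine ⟨c * ∑ m ∈ s, |C m|, fun v hv => ?_⟩
  rw [← map_sub, ← map_sub]
  refine (hc _).trans ?_
  rw [smul_apply, NNReal.smul_def, smul_eq_mul, mul_assoc]
  gcongr
  refine Seminorm.finset_sup_apply_le (by positivity) fun m hm => (hC m v hv).trans ?_
  gcongr
  exact (le_abs_self _).trans (Finset.single_le_sum (fun i _ => abs_nonneg (C i)) hm)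

end translation

end Phi43

/-! ### Convolution of tempered distributions with Schwartz functions -/

namespace Phi43

open LineDeriv

/-- The Schwartz function `w ↦ F (p - w)`. -/
noncomputable def mirror (p : Spacetime) : 𝓢(Spacetime, ℝ) →L[ℝ] 𝓢(Spacetime, ℝ) :=
  SchwartzMap.compSubConstCLM ℝ p ∘L
    SchwartzMap.compCLMOfContinuousLinearEquiv ℝ (ContinuousLinearEquiv.neg ℝ)

@[simp] theorem mirror_apply (p : Spacetime) (F : 𝓢(Spacetime, ℝ)) (w : Spacetime) :
    mirror p F w = F (p - w) := by
  simp [mirror]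

/-- The convolution of a tempered distribution with a Schwartz function. -/
noncomputable def potential (Ψ : 𝓢(Spacetime, ℝ) →L[ℝ] ℝ) (F : 𝓢(Spacetime, ℝ)) : Spacetime → ℝ :=
  fun p => Ψ (mirror p F)

/-- The partial derivative of a Schwartz function. -/
noncomputable abbrev spd (i : Fin 4) (F : 𝓢(Spacetime, ℝ)) : 𝓢(Spacetime, ℝ) :=
  ∂_{(Pi.single i 1 : Spacetime)} F

theorem lineDerivOp_eq_sum (F : 𝓢(Spacetime, ℝ)) (v : Spacetime) :
    ∂_{v} F = ∑ i, v i • spd i F := by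
  ext x
  simp only [SchwartzMap.lineDerivOp_apply_eq_fderiv, sum_apply, smul_apply]
  conv_lhs => rw [pi_eq_sum_univ' v]
  simp [map_sum]

theorem hasFDerivAt_potential (Ψ : 𝓢(Spacetime, ℝ) →L[ℝ] ℝ) (F : 𝓢(Spacetime, ℝ)) (p : Spacetime) :
    HasFDerivAt (potential Ψ F)
      (∑ i, potential Ψ (spd i F) p • ContinuousLinearMap.proj (R := ℝ) (φ := fun _ : Fin 4 => ℝ) i)
      p := by
  obtain ⟨C, hC⟩ := exists_translation_bound (Ψ ∘L mirror p) F
  rw [hasFDerivAt_iff_isLittleO_nhds_zero]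
  refine Asymptotics.IsBigO.trans_isLittleO (g := fun v : Spacetime => ‖v‖ ^ 2) ?_ ?_
  · refine Asymptotics.IsBigO.of_bound C ?_
    filter_upwards [Metric.closedBall_mem_nhds (0 : Spacetime) one_pos] with v hv
    rw [mem_closedBall_zero_iff] at hv
    refine (le_of_eq ?_).trans ((hC v hv).trans (by simp))
    congr 1
    have h1 : mirror (p + v) F = mirror p (SchwartzMap.compSubConstCLM ℝ (-v) F) := by
      ext w
      simp only [mirror_apply, SchwartzMap.compSubConstCLM_apply]
      congr 1
      abel
    simp only [potential, h1, lineDerivOp_eq_sum F v, ContinuousLinearMap.comp_apply, map_sum,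
      map_smul, smul_eq_mul, sum_apply, smul_apply,
      ContinuousLinearMap.proj_apply]
    simp only [mul_comm]
  · exact Asymptotics.isLittleO_norm_pow_id one_lt_two

/-- The partial derivatives of a potential are again potentials, with the derivative falling on the
Schwartz function, so differentiability bootstraps. -/
theorem contDiff_potential (Ψ : 𝓢(Spacetime, ℝ) →L[ℝ] ℝ) (F : 𝓢(Spacetime, ℝ)) :
    ContDiff ℝ ∞ (potential Ψ F) := by
  refine contDiff_infty.2 fun n => ?_
  induction n generalizing F with
  | zero =>
    exact contDiff_zero.2 (continuous_iff_continuousAt.2 fun p =>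
      (hasFDerivAt_potential Ψ F p).continuousAt)
  | succ n ih =>
    refine (contDiff_succ_iff_hasFDerivAt (n := n)).2 ⟨_, ?_, hasFDerivAt_potential Ψ F⟩
    exact ContDiff.sum fun i _ => (ih (spd i F)).smul contDiff_const

theorem pd_potential (Ψ : 𝓢(Spacetime, ℝ) →L[ℝ] ℝ) (F : 𝓢(Spacetime, ℝ)) (i : Fin 4) :
    pd i (potential Ψ F) = potential Ψ (spd i F) := by
  ext p
  rw [pd, ((hasFDerivAt_potential Ψ F p).hasLineDerivAt _).lineDeriv]
  simp [Pi.single_apply]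

end Phi43

/-! ### Heat kernels with a time cutoff as Schwartz functions -/

namespace Phi43

/-- Derivatives of exp ∘ f are bounded by exp f times powers of 1 + ‖x‖, because f has temperate
growth; the linear upper bound on f makes exp f beat all of these powers. -/
theorem exists_schwartz_exp {E : Type*} [NormedAddCommGroup E] [NormedSpace ℝ E] {f : E → ℝ}
    (hf : f.HasTemperateGrowth) {a b : ℝ} (hb : 0 < b) (h : ∀ x, f x ≤ a - b * (1 + ‖x‖)) :
    ∃ F : 𝓢(E, ℝ), ∀ x, F x = Real.exp (f x) := by
  refine ⟨⟨fun x => Real.exp (f x), Real.contDiff_exp.comp hf.1, fun k n => ?_⟩, fun x => rfl⟩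
  obtain ⟨l, C, hC, hbd⟩ := hf.norm_iteratedFDeriv_le_uniform n
  set m := k + l * n
  refine ⟨n.factorial * (C + 1) ^ n * (Real.exp a * (m.factorial / b ^ m)), fun x => ?_⟩
  have h1 : ‖iteratedFDeriv ℝ n (Real.exp ∘ f) x‖ ≤
      n.factorial * Real.exp (f x) * ((C + 1) * (1 + ‖x‖) ^ l) ^ n := by
    refine norm_iteratedFDeriv_comp_le (N := ∞) (n := n) Real.contDiff_exp hf.1 (by norm_cast; exact le_top) x ?_ ?_
    · intro i _
      rw [norm_iteratedFDeriv_eq_norm_iteratedDeriv, iteratedDeriv_eq_iterate, Real.iter_deriv_exp]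
      simp
    · intro i hi hin
      have hone : 1 ≤ (C + 1) * (1 + ‖x‖) ^ l :=
        one_le_mul_of_one_le_of_one_le (by linarith) (one_le_pow₀ (by simp))
      calc ‖iteratedFDeriv ℝ i f x‖ ≤ C * (1 + ‖x‖) ^ l := hbd i hin x
        _ ≤ (C + 1) * (1 + ‖x‖) ^ l := by gcongr; linarith
        _ ≤ _ := le_self_pow₀ hone (by omega)
  have h2 : (1 + ‖x‖) ^ m * Real.exp (f x) ≤ Real.exp a * (m.factorial / b ^ m) := by
    have h3 := Real.pow_div_factorial_le_exp (b * (1 + ‖x‖)) (by positivity) m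
    have h4 : Real.exp (f x) ≤ Real.exp a * (Real.exp (b * (1 + ‖x‖)))⁻¹ := by
      rw [← Real.exp_neg, ← Real.exp_add]
      exact Real.exp_le_exp.2 (by linarith [h x])
    have h5 : (1 + ‖x‖) ^ m ≤ m.factorial / b ^ m * Real.exp (b * (1 + ‖x‖)) := by
      rw [mul_pow] at h3
      have hm : (0 : ℝ) < m.factorial := by positivity
      rw [div_le_iff₀ hm] at h3
      rw [div_mul_eq_mul_div, le_div_iff₀ (by positivity)]
      linarith
    calc _ ≤ (m.factorial / b ^ m * Real.exp (b * (1 + ‖x‖))) *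
          (Real.exp a * (Real.exp (b * (1 + ‖x‖)))⁻¹) := by gcongr
      _ = _ := by
        have := (Real.exp_pos (b * (1 + ‖x‖))).ne'
        field_simp
  calc ‖x‖ ^ k * ‖iteratedFDeriv ℝ n (fun x => Real.exp (f x)) x‖
      ≤ (1 + ‖x‖) ^ k * (n.factorial * Real.exp (f x) * ((C + 1) * (1 + ‖x‖) ^ l) ^ n) := by
        gcongr
        · linarith
        · exact h1
    _ = n.factorial * (C + 1) ^ n * ((1 + ‖x‖) ^ m * Real.exp (f x)) := by
        simp only [m, pow_add, mul_pow, pow_mul]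
        ring
    _ ≤ _ := by gcongr

theorem contDiff_mul_of_support {φ h : ℝ → ℝ} (hφ : ContDiff ℝ ∞ φ) {a : ℝ} (ha : 0 < a)
    (hφa : ∀ s, φ s ≠ 0 → a ≤ s) (hh : ∀ s, 0 < s → ContDiffAt ℝ ∞ h s) :
    ContDiff ℝ ∞ fun s => φ s * h s := by
  refine contDiff_iff_contDiffAt.2 fun s => ?_
  rcases lt_or_ge 0 s with hs | hs
  · exact hφ.contDiffAt.mul (hh s hs)
  · refine (contDiffAt_const (c := (0 : ℝ))).congr_of_eventuallyEq ?_
    filter_upwards [Iio_mem_nhds (hs.trans_lt ha)] with t ht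
    have : φ t = 0 := by
      by_contra h
      exact absurd (hφa t h) (not_le.2 ht)
    simp [this]

theorem hasTemperateGrowth_of_support {φ : ℝ → ℝ} (hφ : ContDiff ℝ ∞ φ) {a b : ℝ}
    (hφs : ∀ s, φ s ≠ 0 → a ≤ s ∧ s ≤ b) : φ.HasTemperateGrowth :=
  (HasCompactSupport.of_support_subset_isCompact isCompact_Icc fun s hs =>
    ⟨(hφs s hs).1, (hφs s hs).2⟩).hasTemperateGrowth hφ

theorem exists_plateau {a b : ℝ} (ha : 0 < a) : ∃ χ : ℝ → ℝ, ContDiff ℝ ∞ χ ∧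
    (∀ s, 0 ≤ χ s ∧ χ s ≤ 1) ∧ (∀ s, χ s ≠ 0 → a / 2 ≤ s ∧ s ≤ b + 1) ∧
    ∀ s, a ≤ s → s ≤ b → χ s = 1 := by
  refine ⟨fun s => Real.smoothTransition (2 / a * s - 1) * Real.smoothTransition (b + 1 - s),
    ?_, fun s => ⟨?_, ?_⟩, fun s hs => ?_, fun s h1 h2 => ?_⟩
  · exact (Real.smoothTransition.contDiff.comp (by fun_prop)).mul
      (Real.smoothTransition.contDiff.comp (by fun_prop))
  · exact mul_nonneg (Real.smoothTransition.nonneg _) (Real.smoothTransition.nonneg _)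
  · exact mul_le_one₀ (Real.smoothTransition.le_one _) (Real.smoothTransition.nonneg _)
      (Real.smoothTransition.le_one _)
  · constructor
    · by_contra! h
      refine hs (mul_eq_zero_of_left (Real.smoothTransition.zero_of_nonpos ?_) _)
      have : 2 / a * s ≤ 2 / a * (a / 2) := by gcongr
      have h' : 2 / a * (a / 2) = 1 := by field_simp
      linarith
    · by_contra! h
      exact hs (mul_eq_zero_of_right _ (Real.smoothTransition.zero_of_nonpos (by linarith)))
  · have : 2 / a * a ≤ 2 / a * s := by gcongr
    have h' : 2 / a * a = 2 := by field_simp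
    beta_reduce
    rw [Real.smoothTransition.one_of_one_le (by linarith),
      Real.smoothTransition.one_of_one_le (by linarith), one_mul]

theorem hasTemperateGrowth_coord (i : Fin 4) :
    Function.HasTemperateGrowth fun w : Spacetime => w i :=
  (ContinuousLinearMap.proj (R := ℝ) (φ := fun _ : Fin 4 => ℝ) i).hasTemperateGrowth

/-- The exponent −|y|²/(4s) is not temperate near s = 0. The coefficient 1/(4s) is therefore
replaced by a temperate function that agrees with it on [a, b] and is bounded below. An additional
Gaussian in time gives decay in all directions and is undone in the prefactor. -/
theorem exists_schwartz_heat {φ : ℝ → ℝ} (hφ : ContDiff ℝ ∞ φ) {a b : ℝ} (ha : 0 < a) (hab : a ≤ b)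
    (hφs : ∀ s, φ s ≠ 0 → a ≤ s ∧ s ≤ b) :
    ∃ Θ : 𝓢(Spacetime, ℝ), ∀ w, Θ w = φ (w 0) * heatKernel w := by
  obtain ⟨χ, hχ, hχ01, hχs, hχ1⟩ := exists_plateau (b := b) ha
  set κ : ℝ → ℝ := fun s => χ s * (4 * s)⁻¹ + (1 - χ s) with hκ
  have hinv (s : ℝ) (hs : 0 < s) : ContDiffAt ℝ ∞ (fun s : ℝ => (4 * s)⁻¹) s :=
    ContDiffAt.inv (by fun_prop) (by positivity)
  have hκt : κ.HasTemperateGrowth := by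
    refine (hasTemperateGrowth_of_support (contDiff_mul_of_support hχ (half_pos ha)
      (fun s hs => (hχs s hs).1) hinv) (a := a / 2) (b := b + 1) fun s hs =>
        hχs s (left_ne_zero_of_mul hs)).add ?_
    exact (Function.HasTemperateGrowth.const 1).sub (hasTemperateGrowth_of_support hχ hχs)
  set c : ℝ := (4 * (b + 1))⁻¹ with hc
  have hb1 : 0 < b + 1 := by linarith
  have hc0 : 0 < c := by positivity
  have hc1 : c ≤ 1 := inv_le_one_of_one_le₀ (by linarith)
  have hκc (s : ℝ) : c ≤ κ s := by
    rcases eq_or_ne (χ s) 0 with h | h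
    · simp [hκ, h, hc1]
    · obtain ⟨h1, h2⟩ := hχs s h
      have h3 : c ≤ (4 * s)⁻¹ := inv_anti₀ (by linarith) (by linarith)
      obtain ⟨h4, h5⟩ := hχ01 s
      simp only [hκ]
      nlinarith
  have hf : Function.HasTemperateGrowth fun w : Spacetime =>
      -(κ (w 0) * (w 1 ^ 2 + w 2 ^ 2 + w 3 ^ 2) + w 0 ^ 2) := by
    have hκw : Function.HasTemperateGrowth fun w : Spacetime => κ (w 0) :=
      hκt.comp (hasTemperateGrowth_coord 0)
    have h0 := hasTemperateGrowth_coord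
    exact ((hκw.mul ((((h0 1).pow 2).add ((h0 2).pow 2)).add ((h0 3).pow 2))).add ((h0 0).pow 2)).neg
  -- Using x² ≥ 2|x| − 1 in each of the four coordinates, the exponent is at most −c(2‖w‖ − 4) = 6c
  -- − 2c(1 + ‖w‖).
  obtain ⟨F, hF⟩ := exists_schwartz_exp hf (a := 6 * c) (b := 2 * c) (by positivity) (by
    intro w
    have hn : ‖w‖ ≤ |w 0| + |w 1| + |w 2| + |w 3| := by
      refine (pi_norm_le_iff_of_nonneg (by positivity)).2 fun i => ?_
      rw [Real.norm_eq_abs]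
      have := abs_nonneg (w 0)
      have := abs_nonneg (w 1)
      have := abs_nonneg (w 2)
      have := abs_nonneg (w 3)
      fin_cases i <;> simp <;> linarith
    have hsq (i : Fin 4) : 2 * |w i| - 1 ≤ w i ^ 2 := by
      rw [← sq_abs]
      nlinarith [sq_nonneg (|w i| - 1)]
    have h1 : c * (w 1 ^ 2 + w 2 ^ 2 + w 3 ^ 2) ≤ κ (w 0) * (w 1 ^ 2 + w 2 ^ 2 + w 3 ^ 2) := by
      gcongr
      exact hκc _
    have h2 : c * w 0 ^ 2 ≤ w 0 ^ 2 := mul_le_of_le_one_left (sq_nonneg _) hc1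
    have h3 : c * (2 * ‖w‖ - 4) ≤ c * (w 0 ^ 2 + w 1 ^ 2 + w 2 ^ 2 + w 3 ^ 2) := by
      gcongr
      linarith [hsq 0, hsq 1, hsq 2, hsq 3]
    linarith)
  -- The factor exp(s²) cancels the artificial Gaussian in time; it is harmless because φ has
  -- compact support.
  set B : ℝ → ℝ := fun s => φ s * ((4 * Real.pi * s) ^ (-(3 / 2) : ℝ) * Real.exp (s ^ 2)) with hB
  have hBt : Function.HasTemperateGrowth fun w : Spacetime => B (w 0) := by
    have hBs : ContDiff ℝ ∞ B := contDiff_mul_of_support hφ ha (fun s hs => (hφs s hs).1) ?_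
    · exact (hasTemperateGrowth_of_support hBs (a := a) (b := b) fun s hs =>
        hφs s (left_ne_zero_of_mul hs)).comp (hasTemperateGrowth_coord 0)
    intro s hs
    refine ContDiffAt.mul ?_ (by fun_prop)
    exact ContDiffAt.rpow_const_of_ne (by fun_prop) (by positivity)
  refine ⟨SchwartzMap.smulLeftCLM ℝ (fun w : Spacetime => B (w 0)) F, fun w => ?_⟩
  rw [SchwartzMap.smulLeftCLM_apply_apply hBt, hF]
  rcases eq_or_ne (φ (w 0)) 0 with h | h
  · simp [hB, h]
  · obtain ⟨h1, h2⟩ := hφs _ h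
    have hpos : 0 < w 0 := ha.trans_le h1
    simp only [hB, hκ, hχ1 _ h1 h2, heatKernel, if_pos hpos, smul_eq_mul]
    rw [mul_assoc, mul_assoc, ← Real.exp_add]
    congr 4
    field_simp
    ring

end Phi43

/-! ### Derivatives of the heat kernel and of its cutoffs -/

namespace Phi43

open LineDeriv

/-- The first spatial derivatives of the heat kernel. -/
noncomputable def heatD (i : Fin 4) (w : Spacetime) : ℝ := -(w i) / (2 * w 0) * heatKernel w

/-- The second spatial derivatives of the heat kernel. -/
noncomputable def heatDD (i j : Fin 4) (w : Spacetime) : ℝ :=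
  (w i * w j / (4 * w 0 ^ 2) - (if i = j then 1 / (2 * w 0) else 0)) * heatKernel w

theorem heatKernel_of_nonpos {w : Spacetime} (h : w 0 ≤ 0) : heatKernel w = 0 := by
  rw [heatKernel, if_neg (not_lt.2 h)]

theorem heatKernel_add_single {i : Fin 4} (hi : i ≠ 0) (w : Spacetime) (t : ℝ) :
    heatKernel (w + t • Pi.single i 1) =
      heatKernel w * Real.exp (-(2 * t * w i + t ^ 2) / (4 * w 0)) := by
  have h0 : (w + t • (Pi.single i 1 : Spacetime)) 0 = w 0 := by simp [hi.symm]
  rw [heatKernel, heatKernel, h0]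
  split_ifs with h
  · rw [mul_assoc _ (Real.exp _), ← Real.exp_add, ← add_div]
    congr 3
    fin_cases i <;> simp at hi ⊢ <;> ring
  · simp

theorem hasLineDerivAt_heatKernel {i : Fin 4} (hi : i ≠ 0) (w : Spacetime) :
    HasLineDerivAt ℝ heatKernel (heatD i w) w (Pi.single i 1) := by
  unfold HasLineDerivAt
  simp only [heatKernel_add_single hi]
  have h : HasDerivAt (fun t : ℝ => -(2 * t * w i + t ^ 2) / (4 * w 0))
      (-(2 * w i) / (4 * w 0)) 0 := by
    have := ((((hasDerivAt_id (0 : ℝ)).const_mul 2).mul_const (w i)).add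
      ((hasDerivAt_id (0 : ℝ)).pow 2)).neg.div_const (4 * w 0)
    simpa using this
  refine (h.exp.const_mul (heatKernel w)).congr_deriv ?_
  rw [heatD, show (4 : ℝ) * w 0 = 2 * (2 * w 0) by ring, ← mul_neg,
    mul_div_mul_left _ _ (two_ne_zero)]
  simp [mul_comm]

theorem hasLineDerivAt_heatD {j : Fin 4} (i : Fin 4) (hj : j ≠ 0) (w : Spacetime) :
    HasLineDerivAt ℝ (heatD i) (heatDD i j w) w (Pi.single j 1) := by
  have h1 : HasDerivAt (fun t : ℝ => -(w i + t * (Pi.single j 1 : Spacetime) i) / (2 * w 0))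
      (-((Pi.single j 1 : Spacetime) i) / (2 * w 0)) 0 := by
    have := (((hasDerivAt_id (0 : ℝ)).mul_const ((Pi.single j 1 : Spacetime) i)).const_add
      (w i)).neg.div_const (2 * w 0)
    simpa using this
  have h2 := h1.mul (hasLineDerivAt_heatKernel hj w)
  refine (h2.congr_of_eventuallyEq (.of_forall fun t => ?_)).congr_deriv ?_
  · simp [heatD, hj.symm]
  · simp only [heatDD, heatD, zero_mul, add_zero, zero_smul, Pi.single_apply]
    rcases lt_or_ge 0 (w 0) with h | h
    · split_ifs <;> field_simp <;> ring
    · simp [heatKernel_of_nonpos h]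

theorem hasLineDerivAt_heatKernel_time {w : Spacetime} (hw : 0 < w 0) :
    HasLineDerivAt ℝ heatKernel (heatDD 1 1 w + heatDD 2 2 w + heatDD 3 3 w) w (Pi.single 0 1) := by
  have h1 : HasDerivAt (fun t : ℝ => w 0 + t) 1 0 := (hasDerivAt_id (0 : ℝ)).const_add (w 0)
  have h2 : HasDerivAt (fun t : ℝ => (4 * Real.pi * (w 0 + t)) ^ (-(3 / 2) : ℝ))
      (4 * Real.pi * 1 * (-(3 / 2)) * (4 * Real.pi * (w 0 + 0)) ^ (-(3 / 2) - 1 : ℝ)) 0 :=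
    (h1.const_mul (4 * Real.pi)).rpow_const (Or.inl (by simp; positivity))
  have h3 : HasDerivAt (fun t : ℝ => -(w 1 ^ 2 + w 2 ^ 2 + w 3 ^ 2) / (4 * (w 0 + t)))
      ((0 * (4 * (w 0 + 0)) - -(w 1 ^ 2 + w 2 ^ 2 + w 3 ^ 2) * (4 * 1)) / (4 * (w 0 + 0)) ^ 2) 0 :=
    (hasDerivAt_const _ _).div (h1.const_mul 4) (by simp; positivity)
  have h4 := h2.mul h3.exp
  unfold HasLineDerivAt
  refine (h4.congr_of_eventuallyEq ?_).congr_deriv ?_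
  · filter_upwards [Ioi_mem_nhds (neg_lt_zero.2 hw)] with t ht
    have : 0 < w 0 + t := by linarith [mem_Ioi.1 ht]
    simp [heatKernel, this]
  · simp only [heatDD, if_true, heatKernel, if_pos hw, add_zero]
    rw [Real.rpow_sub_one (by positivity)]
    field_simp
    ring

section cutoff

variable {φ : ℝ → ℝ} {Θ : 𝓢(Spacetime, ℝ)} (hΘ : ∀ w, Θ w = φ (w 0) * heatKernel w)
include hΘ

theorem spd_heat {i : Fin 4} (hi : i ≠ 0) (w : Spacetime) : spd i Θ w = φ (w 0) * heatD i w := by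
  rw [SchwartzMap.lineDerivOp_apply]
  refine HasLineDerivAt.lineDeriv ?_
  refine ((hasLineDerivAt_heatKernel hi w).const_mul (φ (w 0))).congr_of_eventuallyEq
    (.of_forall fun t => ?_)
  simp [hΘ, hi.symm]

theorem spd_spd_heat {i j : Fin 4} (hi : i ≠ 0) (hj : j ≠ 0) (w : Spacetime) :
    spd j (spd i Θ) w = φ (w 0) * heatDD i j w := by
  rw [SchwartzMap.lineDerivOp_apply]
  refine HasLineDerivAt.lineDeriv ?_
  refine ((hasLineDerivAt_heatD i hj w).const_mul (φ (w 0))).congr_of_eventuallyEq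
    (.of_forall fun t => ?_)
  simp [spd_heat hΘ hi, hj.symm]

/-- At positive times this is the product rule and the heat equation for G. At times s ≤ 0 the
cutoff vanishes in a neighbourhood, so the singularity of G at the origin is never seen. Subtracting
the Laplacian leaves φ′G alone. -/
theorem spd_zero_heat (hφ : ContDiff ℝ ∞ φ) {a : ℝ} (ha : 0 < a) (hφa : ∀ s, φ s ≠ 0 → a ≤ s)
    (w : Spacetime) :
    spd 0 Θ w = deriv φ (w 0) * heatKernel w +
      φ (w 0) * (heatDD 1 1 w + heatDD 2 2 w + heatDD 3 3 w) := by
  rw [SchwartzMap.lineDerivOp_apply]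
  refine HasLineDerivAt.lineDeriv ?_
  rcases lt_or_ge 0 (w 0) with h | h
  · have h1 : HasDerivAt (fun t : ℝ => φ (w 0 + t)) (deriv φ (w 0)) 0 := by
      have := (hφ.differentiable (by simp) (w 0 + 0)).hasDerivAt.comp_const_add (w 0) (0 : ℝ)
      simpa using this
    refine ((h1.mul (hasLineDerivAt_heatKernel_time h)).congr_of_eventuallyEq
      (.of_forall fun t => ?_)).congr_deriv ?_
    · simp [hΘ]
    · simp
  · rw [heatKernel_of_nonpos h]
    simp only [heatDD, heatKernel_of_nonpos h, mul_zero, add_zero]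
    refine (hasDerivAt_const (0 : ℝ) (0 : ℝ)).congr_of_eventuallyEq ?_
    filter_upwards [Iio_mem_nhds ha] with t ht
    have : φ (w 0 + t) = 0 := by
      by_contra hne
      linarith [hφa _ hne, mem_Iio.1 ht]
    simp [hΘ, this]

end cutoff

/-- The embedding of space as the time-zero plane. -/
noncomputable def timeZero : EuclideanSpace ℝ (Fin 3) →L[ℝ] Spacetime :=
  ContinuousLinearMap.pi fun i => Fin.cases 0 (fun j => EuclideanSpace.proj j) i

/-- The restriction of Schwartz functions to the time-zero plane. -/
noncomputable def restrictTimeZero : 𝓢(Spacetime, ℝ) →L[ℝ] 𝓢(EuclideanSpace ℝ (Fin 3), ℝ) :=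
  SchwartzMap.compCLM ℝ (g := timeZero) timeZero.hasTemperateGrowth ⟨1, 2, fun y => by
    have h (j : Fin 3) : y j ^ 2 ≤ ‖timeZero y‖ ^ 2 := by
      rw [← sq_abs]
      gcongr
      exact norm_le_pi_norm (timeZero y) j.succ
    rw [EuclideanSpace.norm_eq, pow_one]
    refine Real.sqrt_le_iff.2 ⟨by positivity, ?_⟩
    simp only [Real.norm_eq_abs, sq_abs, Fin.sum_univ_three]
    nlinarith [h 0, h 1, h 2, norm_nonneg (timeZero y)]⟩

/-- The initial datum becomes a space-time distribution carried by the time-zero plane. Where the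
cutoff equals 1, convolving it with the cut-off kernel uses the full heat kernel at time z₀. -/
theorem harmonicExt_eq_potential (Φ₀ : 𝓢(EuclideanSpace ℝ (Fin 3), ℝ) →L[ℝ] ℝ) {φ : ℝ → ℝ}
    {Θ : 𝓢(Spacetime, ℝ)} (hΘ : ∀ w, Θ w = φ (w 0) * heatKernel w) {z : Spacetime}
    (hz : φ (z 0) = 1) : harmonicExt Φ₀ z = potential (Φ₀ ∘L restrictTimeZero) Θ z := by
  have hg (y : EuclideanSpace ℝ (Fin 3)) : restrictTimeZero (mirror z Θ) y =
      heatKernel (Fin.cons (z 0) fun i : Fin 3 => z i.succ - y i) := by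
    have : z - timeZero y = Fin.cons (z 0) fun i : Fin 3 => z i.succ - y i := by
      ext i
      refine Fin.cases ?_ (fun j => ?_) i <;> simp [timeZero]
    simp only [restrictTimeZero, SchwartzMap.compCLM_apply, Function.comp_apply, mirror_apply, hΘ,
      this, Fin.cons_zero, hz, one_mul]
  have hex : ∃ g : 𝓢(EuclideanSpace ℝ (Fin 3), ℝ),
      ∀ y, g y = heatKernel (Fin.cons (z 0) fun i : Fin 3 => z i.succ - y i) := ⟨_, hg⟩
  rw [harmonicExt, dif_pos hex]
  simp only [potential, ContinuousLinearMap.comp_apply]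
  congr 1
  ext y
  rw [hex.choose_spec, hg]

end Phi43

/-! ### Integrals of Gaussians over space-time -/

namespace Phi43

/-- Separation of the time variable from the space variables. -/
def timeSpace : Spacetime ≃ᵐ ℝ × (Fin 3 → ℝ) := MeasurableEquiv.piFinSuccAbove (fun _ => ℝ) 0

theorem measurePreserving_timeSpace : MeasurePreserving timeSpace :=
  volume_preserving_piFinSuccAbove (fun _ : Fin 4 => ℝ) 0

theorem integrable_timeSpace {F : ℝ × (Fin 3 → ℝ) → ℝ} (hF : Integrable F) :
    Integrable fun w : Spacetime => F (w 0, fun i => w i.succ) :=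
  measurePreserving_timeSpace.integrable_comp_of_integrable hF

theorem integral_timeSpace (F : ℝ × (Fin 3 → ℝ) → ℝ) :
    ∫ w : Spacetime, F (w 0, fun i => w i.succ) = ∫ p, F p :=
  measurePreserving_timeSpace.integral_comp' F

/-- A Gaussian of variance proportional to time. -/
noncomputable def gaussian (c : ℝ) (w : Spacetime) : ℝ :=
  if 0 < w 0 then w 0 ^ (-(3 / 2) : ℝ) * Real.exp (-c * (w 1 ^ 2 + w 2 ^ 2 + w 3 ^ 2) / w 0) else 0

theorem gaussian_nonneg (c : ℝ) (w : Spacetime) : 0 ≤ gaussian c w := by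
  rw [gaussian]
  split_ifs <;> positivity

theorem integrable_exp_space {b : ℝ} (hb : 0 < b) :
    Integrable fun y : Fin 3 → ℝ => Real.exp (-b * (y 0 ^ 2 + y 1 ^ 2 + y 2 ^ 2)) := by
  have := Integrable.fintype_prod (μ := fun _ => volume) (f := fun _ : Fin 3 => fun x : ℝ =>
    Real.exp (-b * x ^ 2)) fun _ => integrable_exp_neg_mul_sq hb
  refine this.congr (.of_forall fun y => ?_)
  simp only [Fin.prod_univ_three, ← Real.exp_add]
  ring_nf

theorem integral_exp_space (b : ℝ) :
    ∫ y : Fin 3 → ℝ, Real.exp (-b * (y 0 ^ 2 + y 1 ^ 2 + y 2 ^ 2)) = √(Real.pi / b) ^ 3 := by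
  have := integral_fintype_prod_volume_eq_pow (ι := Fin 3) (fun x : ℝ => Real.exp (-b * x ^ 2))
  rw [integral_gaussian, Fintype.card_fin] at this
  rw [← this]
  congr 1
  ext y
  simp only [Fin.prod_univ_three, ← Real.exp_add]
  ring_nf

section

variable {q : ℝ → ℝ} {c : ℝ}

theorem integral_gaussian_fiber (hc : 0 < c) {s : ℝ} (hs : 0 < s) :
    ∫ y : Fin 3 → ℝ, s ^ (-(3 / 2) : ℝ) * Real.exp (-c * (y 0 ^ 2 + y 1 ^ 2 + y 2 ^ 2) / s) =
      √(Real.pi / c) ^ 3 := by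
  have h (y : Fin 3 → ℝ) : -c * (y 0 ^ 2 + y 1 ^ 2 + y 2 ^ 2) / s =
    -(c / s) * (y 0 ^ 2 + y 1 ^ 2 + y 2 ^ 2) := by ring
  simp only [h]
  rw [integral_const_mul, integral_exp_space, show Real.pi / (c / s) = Real.pi / c * s by field_simp,
    Real.sqrt_mul (by positivity), mul_pow, Real.sqrt_eq_rpow s, ← Real.rpow_natCast (s ^ _),
    ← Real.rpow_mul hs.le, mul_left_comm, ← Real.rpow_add hs]
  norm_num

/-- The function `q(t) · gaussian c (t, y)` on the product of time and space. -/
theorem gaussian_product (hc : 0 < c) (hq : Integrable q) :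
    Integrable (fun p : ℝ × (Fin 3 → ℝ) => (Ioi 0).indicator q p.1 * (p.1 ^ (-(3 / 2) : ℝ) *
      Real.exp (-c * (p.2 0 ^ 2 + p.2 1 ^ 2 + p.2 2 ^ 2) / p.1))) := by
  have hq' := hq.indicator (measurableSet_Ioi (a := (0 : ℝ)))
  have hm : Measurable fun p : ℝ × (Fin 3 → ℝ) => p.1 ^ (-(3 / 2) : ℝ) *
      Real.exp (-c * (p.2 0 ^ 2 + p.2 1 ^ 2 + p.2 2 ^ 2) / p.1) := by fun_prop
  have hmeas : AEStronglyMeasurable (fun p : ℝ × (Fin 3 → ℝ) => (Ioi 0).indicator q p.1 *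
      (p.1 ^ (-(3 / 2) : ℝ) * Real.exp (-c * (p.2 0 ^ 2 + p.2 1 ^ 2 + p.2 2 ^ 2) / p.1)))
      ((volume : Measure ℝ).prod volume) :=
    hq'.aestronglyMeasurable.comp_fst.mul hm.aestronglyMeasurable
  refine (integrable_prod_iff hmeas).2
    ⟨.of_forall fun s => ?_, ?_⟩
  · rcases lt_or_ge 0 s with hs | hs
    · refine (((integrable_exp_space (div_pos hc hs)).const_mul (s ^ (-(3 / 2) : ℝ))).const_mul
        ((Ioi 0).indicator q s)).congr (.of_forall fun y => ?_)
      simp only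
      ring_nf
    · simp [hs]
  · refine (hq'.norm.mul_const (√(Real.pi / c) ^ 3)).congr (.of_forall fun s => ?_)
    rcases lt_or_ge 0 s with hs | hs
    · simp only [norm_mul]
      rw [integral_const_mul, ← integral_gaussian_fiber hc hs]
      congr 2
      ext y
      rw [Real.norm_of_nonneg (by positivity), Real.norm_of_nonneg (by positivity)]
    · simp [hs]

theorem mul_gaussian_eq (w : Spacetime) : q (w 0) * gaussian c w =
    (Ioi 0).indicator q (w 0) * (w 0 ^ (-(3 / 2) : ℝ) *
      Real.exp (-c * (w 1 ^ 2 + w 2 ^ 2 + w 3 ^ 2) / w 0)) := by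
  rw [gaussian]
  split_ifs with h
  · rw [indicator_of_mem (by exact h)]
  · rw [indicator_of_notMem (by exact h)]
    simp

theorem integrable_mul_gaussian (hc : 0 < c) (hq : Integrable q) :
    Integrable fun w : Spacetime => q (w 0) * gaussian c w := by
  simp only [mul_gaussian_eq]
  exact integrable_timeSpace (gaussian_product hc hq)

theorem integral_mul_gaussian (hc : 0 < c) (hq : Integrable q) :
    ∫ w : Spacetime, q (w 0) * gaussian c w = √(Real.pi / c) ^ 3 * ∫ s in Ioi 0, q s := by
  simp only [mul_gaussian_eq]
  refine (integral_timeSpace (fun p => (Ioi 0).indicator q p.1 * (p.1 ^ (-(3 / 2) : ℝ) *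
      Real.exp (-c * (p.2 0 ^ 2 + p.2 1 ^ 2 + p.2 2 ^ 2) / p.1)))).trans ?_
  rw [Measure.volume_eq_prod, integral_prod _ (gaussian_product hc hq), ← integral_const_mul,
    ← integral_indicator measurableSet_Ioi]
  congr 1
  ext s
  rcases lt_or_ge 0 s with hs | hs
  · simp only
    rw [integral_const_mul, integral_gaussian_fiber hc hs, indicator_of_mem (by exact hs),
      indicator_of_mem (by exact hs), mul_comm]
  · simp [hs]

end

theorem heatKernel_eq (w : Spacetime) :
    heatKernel w = (√(4 * Real.pi) ^ 3)⁻¹ * gaussian (1 / 4) w := by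
  rw [heatKernel, gaussian]
  split_ifs with h
  · rw [Real.mul_rpow (by positivity) h.le, Real.sqrt_eq_rpow,
      ← Real.rpow_natCast (_ ^ (1 / 2 : ℝ)), ← Real.rpow_mul (by positivity),
      ← Real.rpow_neg (by positivity), mul_assoc]
    rw [show -(w 1 ^ 2 + w 2 ^ 2 + w 3 ^ 2) / (4 * w 0) =
        -(1 / 4) * (w 1 ^ 2 + w 2 ^ 2 + w 3 ^ 2) / w 0 by ring,
      show -(1 / 2 * ((3 : ℕ) : ℝ)) = -(3 / 2) by norm_num]
  · simp

theorem heatKernel_nonneg (w : Spacetime) : 0 ≤ heatKernel w := by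
  rw [heatKernel]
  split_ifs <;> positivity

theorem mul_heatKernel_eq (q : ℝ → ℝ) (w : Spacetime) :
    q (w 0) * heatKernel w = (√(4 * Real.pi) ^ 3)⁻¹ * (q (w 0) * gaussian (1 / 4) w) := by
  rw [heatKernel_eq, mul_left_comm]

theorem integrable_mul_heatKernel {q : ℝ → ℝ} (hq : Integrable q) :
    Integrable fun w : Spacetime => q (w 0) * heatKernel w := by
  simp only [mul_heatKernel_eq]
  exact (integrable_mul_gaussian (by norm_num) hq).const_mul _

/-- Every positive time slice of the heat kernel has mass 1. -/
theorem integral_mul_heatKernel {q : ℝ → ℝ} (hq : Integrable q) :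
    ∫ w : Spacetime, q (w 0) * heatKernel w = ∫ s in Ioi 0, q s := by
  simp only [mul_heatKernel_eq]
  rw [integral_const_mul, integral_mul_gaussian (by norm_num) hq, ← mul_assoc]
  have : √(4 * Real.pi) ≠ 0 := by positivity
  rw [show Real.pi / (1 / 4) = 4 * Real.pi by ring, inv_mul_cancel₀ (by positivity), one_mul]

end Phi43

/-! ### Gaussian bounds for the heat kernel and its derivatives -/

namespace Phi43

/-- The constant in the Gaussian bounds for the heat kernel. -/
noncomputable def heatConst : ℝ := (√(4 * Real.pi) ^ 3)⁻¹ * (48 * Real.exp (3 / 2))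

theorem heatConst_pos : 0 < heatConst := by
  have := Real.pi_pos
  unfold heatConst
  positivity

theorem cube_mul_exp_le {r : ℝ} (hr : 0 ≤ r) :
    (1 + r) ^ 3 * Real.exp (-(r ^ 2 / 16)) ≤ 48 * Real.exp (3 / 2) := by
  -- From x³/3! ≤ eˣ at x = (1 + r)/2 comes the constant 48 = 6·8; the factor exp(3/2) comes from
  -- completing the square, (r/4 − 1)² ≥ 0.
  have h1 := Real.pow_div_factorial_le_exp ((1 + r) / 2) (by positivity) 3
  have h2 : Real.exp (-(r ^ 2 / 16)) ≤ Real.exp (3 / 2) * (Real.exp ((1 + r) / 2))⁻¹ := by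
    rw [← Real.exp_neg, ← Real.exp_add]
    exact Real.exp_le_exp.2 (by nlinarith [sq_nonneg (r / 4 - 1)])
  have h3 : (1 + r) ^ 3 ≤ 48 * Real.exp ((1 + r) / 2) := by
    simp only [Nat.factorial] at h1
    norm_num at h1
    nlinarith
  calc _ ≤ (48 * Real.exp ((1 + r) / 2)) * (Real.exp (3 / 2) * (Real.exp ((1 + r) / 2))⁻¹) := by
        gcongr
    _ = _ := by
        have := (Real.exp_pos ((1 + r) / 2)).ne'
        field_simp

/-- The spatial size relative to the square root of time. -/
noncomputable def aspect (w : Spacetime) : ℝ := (|w 1| + |w 2| + |w 3|) / √(w 0)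

theorem aspect_nonneg (w : Spacetime) : 0 ≤ aspect w := by
  unfold aspect
  positivity

/-- The exponent 1/4 is split as 3/16 + 1/16. Since aspect² ≤ 3|y|²/t, the first share controls
exp(−aspect²/16), which absorbs the cubic factor; the second share stays as a Gaussian. -/
theorem heatKernel_bound {w : Spacetime} (hw : 0 < w 0) :
    (1 + aspect w) ^ 3 * heatKernel w ≤ heatConst * gaussian (1 / 16) w := by
  have hs : 0 < √(w 0) := Real.sqrt_pos.2 hw
  have h1 : aspect w ^ 2 ≤ 3 * (w 1 ^ 2 + w 2 ^ 2 + w 3 ^ 2) / w 0 := by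
    rw [aspect, div_pow, Real.sq_sqrt hw.le]
    gcongr
    nlinarith [sq_nonneg (|w 1| - |w 2|), sq_nonneg (|w 1| - |w 3|), sq_nonneg (|w 2| - |w 3|),
      sq_abs (w 1), sq_abs (w 2), sq_abs (w 3)]
  have h2 : gaussian (1 / 4) w ≤ Real.exp (-(aspect w ^ 2 / 16)) * gaussian (1 / 16) w := by
    rw [gaussian, gaussian, if_pos hw, if_pos hw, mul_left_comm, ← Real.exp_add]
    gcongr
    have : 0 ≤ (w 1 ^ 2 + w 2 ^ 2 + w 3 ^ 2) / w 0 := by positivity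
    rw [mul_div_assoc] at *
    rw [mul_div_assoc]
    linarith
  rw [heatKernel_eq, heatConst]
  calc _ ≤ (1 + aspect w) ^ 3 * ((√(4 * Real.pi) ^ 3)⁻¹ *
        (Real.exp (-(aspect w ^ 2 / 16)) * gaussian (1 / 16) w)) := by
        have := aspect_nonneg w
        gcongr
    _ = (√(4 * Real.pi) ^ 3)⁻¹ * ((1 + aspect w) ^ 3 * Real.exp (-(aspect w ^ 2 / 16))) *
        gaussian (1 / 16) w := by ring
    _ ≤ _ := by
        have := gaussian_nonneg (1 / 16) w
        refine mul_le_mul_of_nonneg_right (mul_le_mul_of_nonneg_left ?_ (by positivity)) this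
        exact cube_mul_exp_le (aspect_nonneg w)

theorem pnorm_eq_aspect {w : Spacetime} (hw : 0 < w 0) : pnorm w = √(w 0) * (1 + aspect w) := by
  have hs : √(w 0) ≠ 0 := (Real.sqrt_pos.2 hw).ne'
  rw [pnorm, aspect, abs_of_pos hw]
  field_simp
  ring

theorem abs_le_aspect {w : Spacetime} (hw : 0 < w 0) {i : Fin 4} (hi : i ≠ 0) :
    |w i| ≤ √(w 0) * aspect w := by
  have hs : √(w 0) ≠ 0 := (Real.sqrt_pos.2 hw).ne'
  rw [aspect, mul_div_cancel₀ _ hs]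
  have := abs_nonneg (w 1)
  have := abs_nonneg (w 2)
  have := abs_nonneg (w 3)
  fin_cases i <;> simp at hi ⊢ <;> linarith

theorem heatKernel_mul_pnorm_le {w : Spacetime} (hw : 0 < w 0) :
    heatKernel w * pnorm w ≤ √(w 0) * (heatConst * gaussian (1 / 16) w) := by
  have ha := aspect_nonneg w
  have hG := heatKernel_nonneg w
  calc heatKernel w * pnorm w = √(w 0) * ((1 + aspect w) ^ 1 * heatKernel w) := by
        rw [pnorm_eq_aspect hw]
        ring
    _ ≤ √(w 0) * ((1 + aspect w) ^ 3 * heatKernel w) := by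
        gcongr
        · linarith
        · norm_num
    _ ≤ _ := by
        exact mul_le_mul_of_nonneg_left (heatKernel_bound hw) (by positivity)

/-- One derivative costs t^(−1/2) and the factor `pnorm` gives t^(1/2) back; for t ≤ 1 the bound is
weakened to t^(−1/2), so that first and second derivatives share one estimate. -/
theorem heatD_mul_pnorm_le {w : Spacetime} (hw : 0 < w 0) (hw1 : w 0 ≤ 1) {i : Fin 4} (hi : i ≠ 0) :
    |heatD i w| * pnorm w ≤ (√(w 0))⁻¹ * (heatConst * gaussian (1 / 16) w) := by
  have ha := aspect_nonneg w
  have hG := heatKernel_nonneg w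
  have hs : 0 < √(w 0) := Real.sqrt_pos.2 hw
  have hs1 : √(w 0) ≤ 1 := Real.sqrt_le_one.2 hw1
  have hsq : w 0 = √(w 0) ^ 2 := (Real.sq_sqrt hw.le).symm
  have h1 : |heatD i w| ≤ (√(w 0))⁻¹ * (aspect w * heatKernel w) := by
    rw [heatD, abs_mul, abs_of_nonneg hG, ← mul_assoc, abs_div, abs_neg,
      abs_of_pos (show 0 < 2 * w 0 by positivity)]
    gcongr
    rw [div_le_iff₀ (by positivity)]
    refine (abs_le_aspect hw hi).trans ?_
    have : (√(w 0))⁻¹ * aspect w * (2 * w 0) = 2 * (√(w 0) * aspect w) := by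
      nth_rewrite 2 [hsq]
      field_simp
    rw [this]
    have : 0 ≤ √(w 0) * aspect w := by positivity
    linarith
  calc |heatD i w| * pnorm w ≤ (√(w 0))⁻¹ * (aspect w * heatKernel w) * (1 * (1 + aspect w)) := by
        rw [pnorm_eq_aspect hw]
        gcongr
    _ = (√(w 0))⁻¹ * ((aspect w * (1 + aspect w)) * heatKernel w) := by ring
    _ ≤ (√(w 0))⁻¹ * ((1 + aspect w) ^ 3 * heatKernel w) := by
        gcongr
        nlinarith [pow_nonneg ha 3, pow_nonneg ha 2]
    _ ≤ _ := by
        exact mul_le_mul_of_nonneg_left (heatKernel_bound hw) (by positivity)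

/-- Two derivatives cost t⁻¹, which is not integrable in time. The factor `pnorm`, paid for by the
Lipschitz source, improves this to the integrable t^(−1/2). -/
theorem heatDD_mul_pnorm_le {w : Spacetime} (hw : 0 < w 0) {i j : Fin 4} (hi : i ≠ 0)
    (hj : j ≠ 0) :
    |heatDD i j w| * pnorm w ≤ (√(w 0))⁻¹ * (heatConst * gaussian (1 / 16) w) := by
  have ha := aspect_nonneg w
  have hG := heatKernel_nonneg w
  have hs : 0 < √(w 0) := Real.sqrt_pos.2 hw
  have hsq : w 0 = √(w 0) ^ 2 := (Real.sq_sqrt hw.le).symm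
  have h1 : |heatDD i j w| ≤ (w 0)⁻¹ * ((1 + aspect w) ^ 2 * heatKernel w) := by
    rw [heatDD, abs_mul, abs_of_nonneg hG, ← mul_assoc]
    gcongr
    have h2 : |w i * w j / (4 * w 0 ^ 2)| ≤ (w 0)⁻¹ * (aspect w ^ 2 / 4) := by
      rw [abs_div, abs_mul, abs_of_pos (show 0 < 4 * w 0 ^ 2 by positivity),
        div_le_iff₀ (by positivity)]
      calc |w i| * |w j| ≤ (√(w 0) * aspect w) * (√(w 0) * aspect w) := by
            gcongr
            · exact abs_le_aspect hw hi
            · exact abs_le_aspect hw hj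
        _ = √(w 0) ^ 2 * aspect w ^ 2 := by ring
        _ = _ := by
            rw [← hsq]
            field_simp
    have h3 : |if i = j then 1 / (2 * w 0) else 0| ≤ (w 0)⁻¹ * (1 / 2) := by
      split_ifs
      · rw [abs_of_pos (by positivity)]
        exact le_of_eq (by field_simp)
      · simpa using hw.le
    refine (abs_sub _ _).trans ((add_le_add h2 h3).trans ?_)
    rw [← mul_add]
    gcongr
    nlinarith
  calc |heatDD i j w| * pnorm w
      ≤ (w 0)⁻¹ * ((1 + aspect w) ^ 2 * heatKernel w) * (√(w 0) * (1 + aspect w)) := by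
        rw [pnorm_eq_aspect hw]
        gcongr
    _ = ((w 0)⁻¹ * √(w 0)) * ((1 + aspect w) ^ 3 * heatKernel w) := by ring
    _ = (√(w 0))⁻¹ * ((1 + aspect w) ^ 3 * heatKernel w) := by
        congr 1
        nth_rewrite 1 [hsq]
        field_simp
    _ ≤ _ := by
        exact mul_le_mul_of_nonneg_left (heatKernel_bound hw) (by positivity)

end Phi43

/-! ### Convolution with Lipschitz sources -/

namespace Phi43

/-- A source term on `(0, T) × ℝ³`, dominated by an integrable function of time and Lipschitz
away from the initial and terminal times. -/
structure IsSource (T : ℝ) (h : ℝ → ℝ) (g : Spacetime → ℝ) : Prop where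
  measurable : AEStronglyMeasurable g
  integrable : Integrable h
  bound : ∀ w, |g w| ≤ h (w 0)
  zero : ∀ w, w 0 ≤ 0 → g w = 0
  lipschitz : ∀ a b, 0 < a → b < T → ∃ L, 0 ≤ L ∧ ∀ z w : Spacetime, z 0 ∈ Icc a b →
    w 0 ∈ Icc a b → |g z - g w| ≤ L * pnorm (z - w)

/-- The integrable weight used to bound the pairing of a source with Schwartz functions. -/
noncomputable def sourceWeight (h : ℝ → ℝ) (w : Spacetime) : ℝ :=
  h (w 0) * (1 + ‖fun i : Fin 3 => w i.succ‖) ^ (-4 : ℝ)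

namespace IsSource

variable {T : ℝ} {h : ℝ → ℝ} {g : Spacetime → ℝ} (hg : IsSource T h g)
include hg

theorem nonneg (s : ℝ) : 0 ≤ h s :=
  (abs_nonneg _).trans (hg.bound fun _ => s)

theorem integrable_weight : Integrable (sourceWeight h) := by
  -- Any exponent beyond the space dimension 3 would do; the decay seminorm of order 4 matches it.
  have h1 : Integrable fun y : Fin 3 → ℝ => (1 + ‖y‖) ^ (-4 : ℝ) :=
    integrable_one_add_norm (by simp; norm_num)
  exact integrable_timeSpace (F := fun p => h p.1 * (1 + ‖p.2‖) ^ (-4 : ℝ))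
    (hg.integrable.mul_prod h1)

theorem abs_mul_le (F : 𝓢(Spacetime, ℝ)) (w : Spacetime) :
    |F w * g w| ≤ 2 ^ 4 * (Finset.Iic (4, 0)).sup (fun m => SchwartzMap.seminorm ℝ m.1 m.2) F *
      sourceWeight h w := by
  have h1 := SchwartzMap.one_add_le_sup_seminorm_apply (𝕜 := ℝ) (m := (4, 0)) (k := 4) (n := 0) le_rfl le_rfl F w
  rw [norm_iteratedFDeriv_zero, Real.norm_eq_abs] at h1
  have h2 : ‖fun i : Fin 3 => w i.succ‖ ≤ ‖w‖ :=
    (pi_norm_le_iff_of_nonneg (norm_nonneg w)).2 fun i => norm_le_pi_norm w i.succ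
  set y := fun i : Fin 3 => w i.succ
  have h3 : |F w| ≤ 2 ^ 4 * (Finset.Iic (4, 0)).sup (fun m => SchwartzMap.seminorm ℝ m.1 m.2) F *
      (1 + ‖y‖) ^ (-4 : ℝ) := by
    rw [Real.rpow_neg (by positivity), ← div_eq_mul_inv, le_div_iff₀ (by positivity)]
    refine le_trans ?_ h1
    rw [mul_comm]
    norm_cast
    gcongr
  rw [abs_mul, sourceWeight]
  calc |F w| * |g w| ≤ _ * h (w 0) := mul_le_mul h3 (hg.bound w) (abs_nonneg _) (by positivity)
    _ = _ := by ring

theorem integrable_mul (F : 𝓢(Spacetime, ℝ)) : Integrable fun w => F w * g w :=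
  (hg.integrable_weight.const_mul _).mono' (F.continuous.aestronglyMeasurable.mul hg.measurable)
    (.of_forall fun w => by simpa using hg.abs_mul_le F w)

/-- Integration against a source, as a tempered distribution. -/
noncomputable def distribution : 𝓢(Spacetime, ℝ) →L[ℝ] ℝ :=
  SchwartzMap.mkCLMtoNormedSpace (𝕜 := ℝ) (σ := RingHom.id ℝ) (fun F => ∫ w, F w * g w)
    (fun F G => by
      rw [← integral_add (hg.integrable_mul F) (hg.integrable_mul G)]
      simp [add_mul])
    (fun a F => by
      simp [← integral_const_mul, mul_assoc])
    ⟨Finset.Iic (4, 0), 2 ^ 4 * ∫ w, sourceWeight h w, by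
      have : 0 ≤ ∫ w, sourceWeight h w := integral_nonneg fun w =>
        mul_nonneg (hg.nonneg _) (by positivity)
      positivity, fun F => by
      refine (norm_integral_le_of_norm_le (hg.integrable_weight.const_mul _)
        (.of_forall fun w => hg.abs_mul_le F w)).trans (le_of_eq ?_)
      rw [integral_const_mul, mul_right_comm]
      rfl⟩

theorem potential_eq (F : 𝓢(Spacetime, ℝ)) (p : Spacetime) :
    potential hg.distribution F p = ∫ w, F w * g (p - w) := by
  have h1 : potential hg.distribution F p = ∫ w, mirror p F w * g w := rfl
  rw [h1, ← integral_sub_left_eq_self _ volume p]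
  simp

theorem integrable_mul_sub (F : 𝓢(Spacetime, ℝ)) (p : Spacetime) :
    Integrable fun w => F w * g (p - w) := by
  have := (hg.integrable_mul (mirror p F)).comp_sub_left p
  simpa using this

/-- Convolution against differences of kernels that are concentrated at small times. -/
theorem uniformCauchySeqOn_potential {F : ℕ → 𝓢(Spacetime, ℝ)} (hF : ∀ n, ∫ w, F n w = 0)
    {C : ℝ} (hC : 0 ≤ C) (hFC : ∀ N : ℕ, ∀ n ≥ N, ∀ m ≥ N, ∀ w, F n w - F m w ≠ 0 →
      0 < w 0 ∧ w 0 ≤ 2 * (1 / 2) ^ N ∧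
        (w 0 ≤ 1 → |F n w - F m w| * pnorm w ≤ (√(w 0))⁻¹ * (C * gaussian (1 / 16) w)))
    {a b : ℝ} (ha : 0 < a) (hb : b < T) :
    UniformCauchySeqOn (fun n => potential hg.distribution (F n)) atTop
      {p | a < p 0 ∧ p 0 < b} := by
  -- The kernel differences live at times at most a/2 once N is large, so p − w stays at times above
  -- a/2 when p is above a.
  obtain ⟨L, hL0, hL⟩ := hg.lipschitz (a / 2) b (half_pos ha) hb
  set q : ℝ → ℝ → ℝ := fun δ => (Ioc 0 δ).indicator fun s => s ^ (-(1 / 2) : ℝ) with hq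
  have hqint (δ : ℝ) (hδ : 0 ≤ δ) : Integrable (q δ) := by
    rw [hq]
    refine (integrable_indicator_iff measurableSet_Ioc).2 ?_
    exact (intervalIntegrable_iff_integrableOn_Ioc_of_le hδ).1
      (intervalIntegral.intervalIntegrable_rpow' (by norm_num))
  have hqval (δ : ℝ) (hδ : 0 ≤ δ) : ∫ s in Ioi 0, q δ s = 2 * √δ := by
    rw [hq, setIntegral_indicator measurableSet_Ioc,
      inter_eq_self_of_subset_right Ioc_subset_Ioi_self, ← intervalIntegral.integral_of_le hδ,
      integral_rpow (Or.inl (by norm_num)), Real.sqrt_eq_rpow]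
    norm_num
    ring
  have hlim : Tendsto (fun N : ℕ => 2 * (1 / 2 : ℝ) ^ N) atTop (𝓝 0) := by
    simpa using (tendsto_pow_atTop_nhds_zero_of_lt_one (by norm_num : (0 : ℝ) ≤ 1 / 2)
      (by norm_num)).const_mul 2
  have hlim2 : Tendsto (fun N : ℕ => L * C * (√(Real.pi / (1 / 16)) ^ 3 *
      (2 * √(2 * (1 / 2) ^ N)))) atTop (𝓝 0) := by
    have := (((Real.continuous_sqrt.tendsto _).comp hlim).const_mul 2).const_mul
      (√(Real.pi / (1 / 16)) ^ 3)
    simpa using this.const_mul (L * C)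
  rw [Metric.uniformCauchySeqOn_iff]
  intro ε hε
  obtain ⟨N, hN⟩ := ((hlim.eventually (gt_mem_nhds (lt_min (half_pos ha) one_pos))).and
    (hlim2.eventually (gt_mem_nhds hε))).exists
  obtain ⟨hN1, hN2⟩ := hN
  refine ⟨N, fun m hm n hn p hp => lt_of_le_of_lt ?_ hN2⟩
  set δ : ℝ := 2 * (1 / 2) ^ N with hδ
  have hδ0 : 0 ≤ δ := by positivity
  have hint (n : ℕ) : Integrable (F n) := (F n).integrable
  rw [Real.dist_eq, hg.potential_eq, hg.potential_eq,
    ← integral_sub (hg.integrable_mul_sub _ _) (hg.integrable_mul_sub _ _)]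
  -- The kernels have integral zero, so g(p) may be subtracted; the increment of g then supplies the
  -- factor `pnorm w`.
  have h1 : ∫ w, (F m w * g (p - w) - F n w * g (p - w)) =
      ∫ w, (F m w - F n w) * (g (p - w) - g p) := by
    have h2 : ∫ w, (F m w - F n w) * g p = 0 := by
      rw [integral_mul_const, integral_sub (hint m) (hint n), hF, hF, sub_zero, zero_mul]
    have h3 : Integrable fun w => (F m w - F n w) * g p :=
      ((hint m).sub (hint n)).mul_const _
    have h4 : Integrable fun w => F m w * g (p - w) - F n w * g (p - w) :=
      (hg.integrable_mul_sub _ _).sub (hg.integrable_mul_sub _ _)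
    rw [← sub_zero (∫ w, (F m w * g (p - w) - F n w * g (p - w))), ← h2, ← integral_sub h4 h3]
    congr 1
    ext w
    ring
  rw [h1]
  have hbd : ∀ w, ‖(F m w - F n w) * (g (p - w) - g p)‖ ≤
      L * C * (q δ (w 0) * gaussian (1 / 16) w) := by
    intro w
    have hG := gaussian_nonneg (1 / 16) w
    rcases eq_or_ne (F m w - F n w) 0 with h0 | h0
    · rw [h0, zero_mul, norm_zero]
      have : 0 ≤ q δ (w 0) := indicator_nonneg (fun s hs => Real.rpow_nonneg hs.1.le _) _
      positivity
    · obtain ⟨hw0, hwδ, hw⟩ := hFC N m hm n hn w h0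
      have hw1 : w 0 ≤ 1 := hwδ.trans (hN1.le.trans (min_le_right _ _))
      have hwa : w 0 ≤ a / 2 := hwδ.trans (hN1.le.trans (min_le_left _ _))
      have hlip := hL (p - w) p ⟨by simp; linarith [hp.1], by simp; linarith [hp.2]⟩
        ⟨by linarith [hp.1], hp.2.le⟩
      have hpn : pnorm (p - w - p) = pnorm w := by
        rw [pnorm_sub_comm]
        simp
      rw [hpn] at hlip
      rw [norm_mul, Real.norm_eq_abs, Real.norm_eq_abs]
      have hqw : q δ (w 0) = (√(w 0))⁻¹ := by
        simp only [hq]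
        rw [indicator_of_mem (show w 0 ∈ Ioc 0 δ from ⟨hw0, hwδ⟩), Real.rpow_neg hw0.le, Real.sqrt_eq_rpow]
      calc |F m w - F n w| * |g (p - w) - g p| ≤ |F m w - F n w| * (L * pnorm w) := by gcongr
        _ = L * (|F m w - F n w| * pnorm w) := by ring
        _ ≤ L * ((√(w 0))⁻¹ * (C * gaussian (1 / 16) w)) := by
          exact mul_le_mul_of_nonneg_left (hw hw1) hL0
        _ = _ := by
          rw [hqw]
          ring
  refine (norm_integral_le_of_norm_le ((integrable_mul_gaussian (by norm_num)
    (hqint δ hδ0)).const_mul (L * C)) (.of_forall hbd)).trans (le_of_eq ?_)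
  rw [integral_const_mul, integral_mul_gaussian (by norm_num) (hqint δ hδ0), hqval δ hδ0]

/-- At time s of the kernel the source is at most h(p₀ − s), and the time slices of G have finite
mass, so only integrability of h is needed. -/
theorem integrable_heat (p : Spacetime) : Integrable fun w => heatKernel w * g (p - w) := by
  have hq := hg.integrable.comp_sub_left (p 0)
  have hm : AEStronglyMeasurable fun w : Spacetime => g (p - w) :=
    hg.measurable.comp_quasiMeasurePreserving
      (Measure.measurePreserving_sub_left volume p).quasiMeasurePreserving
  have hGm : Measurable heatKernel := by
    unfold heatKernel
    refine Measurable.ite (measurableSet_lt (by fun_prop) (by fun_prop)) (by fun_prop) (by fun_prop)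
  refine (integrable_mul_heatKernel hq).mono' (hGm.aestronglyMeasurable.mul hm)
    (.of_forall fun w => ?_)
  rw [norm_mul, Real.norm_of_nonneg (heatKernel_nonneg w), mul_comm]
  gcongr
  · exact heatKernel_nonneg w
  · exact hg.bound (p - w)

end IsSource

end Phi43

/-! ### Approximation of the heat kernel by time cutoffs -/

namespace Phi43

/-- A smooth monotone step from `0` to `1` between the times `2⁻ⁿ` and `2 · 2⁻ⁿ`. -/
noncomputable def step (n : ℕ) (s : ℝ) : ℝ := Real.smoothTransition (2 ^ n * s - 1)

/-- A smooth cutoff in time away from `0` and from large times. -/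
noncomputable def cut (T : ℝ) (n : ℕ) (s : ℝ) : ℝ := step n s * Real.smoothTransition (T + 2 - s)

theorem contDiff_step (n : ℕ) : ContDiff ℝ ∞ (step n) :=
  Real.smoothTransition.contDiff.comp (by fun_prop)

theorem contDiff_cut (T : ℝ) (n : ℕ) : ContDiff ℝ ∞ (cut T n) :=
  (contDiff_step n).mul (Real.smoothTransition.contDiff.comp (by fun_prop))

theorem step_of_le {n : ℕ} {s : ℝ} (h : s ≤ (1 / 2) ^ n) : step n s = 0 := by
  refine Real.smoothTransition.zero_of_nonpos ?_
  have : (2 : ℝ) ^ n * s ≤ 2 ^ n * (1 / 2) ^ n := by gcongr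
  rw [← mul_pow] at this
  norm_num at this
  linarith

theorem step_of_ge {N n : ℕ} (hn : N ≤ n) {s : ℝ} (h : 2 * (1 / 2) ^ N ≤ s) : step n s = 1 := by
  refine Real.smoothTransition.one_of_one_le ?_
  have h1 : (2 : ℝ) ^ n * (2 * (1 / 2) ^ n) ≤ 2 ^ n * s := by
    gcongr
    refine le_trans ?_ h
    gcongr 2 * ?_
    exact pow_le_pow_of_le_one (by norm_num) (by norm_num) hn
  have h2 : (2 : ℝ) ^ n * (2 * (1 / 2) ^ n) = 2 := by
    rw [mul_left_comm, ← mul_pow]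
    norm_num
  linarith

theorem cut_of_lt {T : ℝ} (n : ℕ) {s : ℝ} (h : s ≤ T + 1) : cut T n s = step n s := by
  rw [cut, Real.smoothTransition.one_of_one_le (by linarith), mul_one]

theorem cut_ne_zero {T : ℝ} {n : ℕ} {s : ℝ} (h : cut T n s ≠ 0) : (1 / 2) ^ n ≤ s ∧ s ≤ T + 2 := by
  constructor
  · by_contra! hs
    exact h (mul_eq_zero_of_left (step_of_le hs.le) _)
  · by_contra! hs
    exact h (mul_eq_zero_of_right _ (Real.smoothTransition.zero_of_nonpos (by linarith)))

theorem cut_mem (T : ℝ) (n : ℕ) (s : ℝ) : cut T n s ∈ Icc (0 : ℝ) 1 :=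
  ⟨mul_nonneg (Real.smoothTransition.nonneg _) (Real.smoothTransition.nonneg _),
    mul_le_one₀ (Real.smoothTransition.le_one _) (Real.smoothTransition.nonneg _)
      (Real.smoothTransition.le_one _)⟩

theorem cut_sub_cut {T : ℝ} {N n m : ℕ} (hn : N ≤ n) (hm : N ≤ m) {s : ℝ}
    (h : cut T n s - cut T m s ≠ 0) : 0 < s ∧ s ≤ 2 * (1 / 2) ^ N := by
  constructor
  · by_contra! hs
    have (n : ℕ) : cut T n s = 0 := mul_eq_zero_of_left (step_of_le (hs.trans (by positivity))) _
    exact h (by rw [this, this, sub_zero])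
  · by_contra! hs
    exact h (by rw [cut, cut, step_of_ge hn hs.le, step_of_ge hm hs.le, sub_self])

theorem abs_cut_sub_cut_le (T : ℝ) (n m : ℕ) (s : ℝ) : |cut T n s - cut T m s| ≤ 1 := by
  have h1 := cut_mem T n s
  have h2 := cut_mem T m s
  rw [abs_le]
  constructor <;> linarith [h1.1, h1.2, h2.1, h2.2]

theorem monotone_step (n : ℕ) : Monotone (step n) := by
  intro s t hst
  refine Real.smoothTransition.monotone ?_
  have : (2 : ℝ) ^ n * s ≤ 2 ^ n * t := by gcongr
  linarith

theorem deriv_step_nonneg (n : ℕ) (s : ℝ) : 0 ≤ deriv (step n) s :=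
  (monotone_step n).deriv_nonneg

theorem deriv_step_ne_zero {n : ℕ} {s : ℝ} (h : deriv (step n) s ≠ 0) :
    0 < s ∧ s ≤ 2 * (1 / 2) ^ n := by
  constructor
  · by_contra! hs
    refine h ?_
    have : step n =ᶠ[𝓝 s] fun _ => 0 := by
      filter_upwards [Iio_mem_nhds (hs.trans_lt (show (0 : ℝ) < (1 / 2) ^ n by positivity))] with t ht
      exact step_of_le (le_of_lt ht)
    rw [this.deriv_eq, deriv_const]
  · by_contra! hs
    refine h ?_
    have : step n =ᶠ[𝓝 s] fun _ => 1 := by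
      filter_upwards [Ioi_mem_nhds hs] with t ht
      exact step_of_ge le_rfl (le_of_lt ht)
    rw [this.deriv_eq, deriv_const]

theorem integrable_deriv_step (n : ℕ) : Integrable (deriv (step n)) := by
  refine ((contDiff_step n).continuous_deriv (by simp)).integrable_of_hasCompactSupport ?_
  exact HasCompactSupport.of_support_subset_isCompact isCompact_Icc fun s hs =>
    ⟨(deriv_step_ne_zero hs).1.le, (deriv_step_ne_zero hs).2⟩

theorem integral_deriv_step (n : ℕ) : ∫ s in Ioi 0, deriv (step n) s = 1 := by
  have hd (s : ℝ) : HasDerivAt (step n) (deriv (step n) s) s :=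
    ((contDiff_step n).differentiable (by simp) s).hasDerivAt
  rw [integral_Ioi_of_hasDerivAt_of_tendsto' (m := 1) (fun s _ => hd s)
    (integrable_deriv_step n).integrableOn ?_, step_of_le (by positivity), sub_zero]
  refine tendsto_const_nhds.congr' ?_
  filter_upwards [eventually_ge_atTop (2 * (1 / 2) ^ n)] with s hs
  exact (step_of_ge le_rfl hs).symm

theorem exists_heatApprox {T : ℝ} (hT : 0 < T) (n : ℕ) :
    ∃ Θ : 𝓢(Spacetime, ℝ), ∀ w, Θ w = cut T n (w 0) * heatKernel w :=
  exists_schwartz_heat (contDiff_cut T n) (by positivity)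
    ((pow_le_one₀ (by norm_num) (by norm_num)).trans (by linarith)) fun _ => cut_ne_zero

theorem integral_spd (F : 𝓢(Spacetime, ℝ)) (i : Fin 4) : ∫ w, spd i F w = 0 := by
  have h := integral_bilinear_hasLineDerivAt_right_eq_neg_left_of_integrable (μ := volume)
    (f := fun _ : Spacetime => (1 : ℝ)) (f' := fun _ => 0) (g := F) (g' := spd i F)
    (v := Pi.single i 1) (B := ContinuousLinearMap.mul ℝ ℝ) (by simp)
    (by simpa using (spd i F).integrable) (by simpa using F.integrable)
    (fun x _ => hasDerivAt_const (0 : ℝ) (1 : ℝ)) (fun x _ => by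
      rw [SchwartzMap.lineDerivOp_apply]
      exact (F.differentiableAt.lineDifferentiableAt).hasLineDerivAt)
  simpa using h

namespace IsSource

variable {T : ℝ} {h : ℝ → ℝ} {g : Spacetime → ℝ} (hg : IsSource T h g)
  {Θ : ℕ → 𝓢(Spacetime, ℝ)} (hΘ : ∀ n w, Θ n w = cut T n (w 0) * heatKernel w)
include hg hΘ

/-- The cutoff at large times is invisible, since the source vanishes at nonpositive times; at each
fixed positive time the cutoff at small times is eventually 1. The full integrand dominates. -/
theorem tendsto_potential {p : Spacetime} (hp : p 0 < T) :
    Tendsto (fun n => potential hg.distribution (Θ n) p) atTop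
      (𝓝 (∫ w, heatKernel (p - w) * g w)) := by
  have h1 : ∫ w, heatKernel (p - w) * g w = ∫ w, heatKernel w * g (p - w) := by
    rw [← integral_sub_left_eq_self _ volume p]
    simp
  simp only [hg.potential_eq, h1]
  refine tendsto_integral_of_dominated_convergence (fun w => |heatKernel w * g (p - w)|)
    (fun n => (hg.integrable_mul_sub _ _).aestronglyMeasurable) (hg.integrable_heat p).abs
    (fun n => .of_forall fun w => ?_) (.of_forall fun w => ?_)
  · have := cut_mem T n (w 0)
    rw [hΘ, mul_assoc, norm_mul, Real.norm_eq_abs, Real.norm_eq_abs, abs_of_nonneg this.1]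
    exact mul_le_of_le_one_left (abs_nonneg _) this.2
  · rcases le_or_gt (w 0) 0 with h0 | h0
    · simp [hΘ, heatKernel_of_nonpos h0]
    rcases le_or_gt T (w 0) with h1 | h1
    · have : g (p - w) = 0 := hg.zero _ (by simp; linarith)
      simp [this]
    · have hlim : Tendsto (fun N : ℕ => 2 * (1 / 2 : ℝ) ^ N) atTop (𝓝 0) := by
        simpa using (tendsto_pow_atTop_nhds_zero_of_lt_one (by norm_num : (0 : ℝ) ≤ 1 / 2)
          (by norm_num)).const_mul 2
      refine tendsto_const_nhds.congr' ?_
      filter_upwards [hlim.eventually (gt_mem_nhds h0)] with n hn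
      rw [hΘ, cut_of_lt n (by linarith), step_of_ge le_rfl hn.le, one_mul]

variable {a b : ℝ} (ha : 0 < a) (hb : b < T)
include ha hb

theorem uniformCauchySeqOn_spd {i : Fin 4} (hi : i ≠ 0) :
    UniformCauchySeqOn (fun n => potential hg.distribution (spd i (Θ n))) atTop
      {p | a < p 0 ∧ p 0 < b} := by
  refine hg.uniformCauchySeqOn_potential (fun n => integral_spd _ i) heatConst_pos.le
    (fun N n hn m hm w hw => ?_) ha hb
  rw [spd_heat (hΘ n) hi, spd_heat (hΘ m) hi, ← sub_mul] at hw
  obtain ⟨h1, h2⟩ := cut_sub_cut hn hm (left_ne_zero_of_mul hw)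
  refine ⟨h1, h2, fun h3 => ?_⟩
  rw [spd_heat (hΘ n) hi, spd_heat (hΘ m) hi, ← sub_mul, abs_mul]
  refine le_trans ?_ (heatD_mul_pnorm_le h1 h3 hi)
  gcongr
  · exact pnorm_nonneg w
  · exact mul_le_of_le_one_left (abs_nonneg _) (abs_cut_sub_cut_le T n m _)

theorem uniformCauchySeqOn_spd_spd {i j : Fin 4} (hi : i ≠ 0) (hj : j ≠ 0) :
    UniformCauchySeqOn (fun n => potential hg.distribution (spd j (spd i (Θ n)))) atTop
      {p | a < p 0 ∧ p 0 < b} := by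
  refine hg.uniformCauchySeqOn_potential (fun n => integral_spd _ j) heatConst_pos.le
    (fun N n hn m hm w hw => ?_) ha hb
  rw [spd_spd_heat (hΘ n) hi hj, spd_spd_heat (hΘ m) hi hj, ← sub_mul] at hw
  obtain ⟨h1, h2⟩ := cut_sub_cut hn hm (left_ne_zero_of_mul hw)
  refine ⟨h1, h2, fun h3 => ?_⟩
  rw [spd_spd_heat (hΘ n) hi hj, spd_spd_heat (hΘ m) hi hj, ← sub_mul, abs_mul]
  refine le_trans ?_ (heatDD_mul_pnorm_le h1 hi hj)
  gcongr
  · exact pnorm_nonneg w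
  · exact mul_le_of_le_one_left (abs_nonneg _) (abs_cut_sub_cut_le T n m _)

/-- ∂_t − Δ applied to the cut-off kernel leaves step′·G wherever the source is nonzero. This is
nonnegative, has mass 1 and is concentrated at times below 2·2⁻ⁿ, so the error is at most L∫
step′·G·`pnorm`, of order 2^(−n/2). -/
theorem tendstoUniformlyOn_heat_operator :
    TendstoUniformlyOn (fun n p => potential hg.distribution (spd 0 (Θ n)) p -
      ∑ i : Fin 3, potential hg.distribution (spd i.succ (spd i.succ (Θ n))) p) g atTop
      {p | a < p 0 ∧ p 0 < b} := by
  obtain ⟨L, hL0, hL⟩ := hg.lipschitz (a / 2) b (half_pos ha) hb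
  have hlim : Tendsto (fun N : ℕ => 2 * (1 / 2 : ℝ) ^ N) atTop (𝓝 0) := by
    simpa using (tendsto_pow_atTop_nhds_zero_of_lt_one (by norm_num : (0 : ℝ) ≤ 1 / 2)
      (by norm_num)).const_mul 2
  have hlim2 : Tendsto (fun N : ℕ => L * heatConst * √(2 * (1 / 2) ^ N) *
      (√(Real.pi / (1 / 16)) ^ 3 * 1)) atTop (𝓝 0) := by
    have := (((Real.continuous_sqrt.tendsto _).comp hlim).const_mul (L * heatConst)).mul_const
      (√(Real.pi / (1 / 16)) ^ 3 * 1)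
    simpa using this
  rw [Metric.tendstoUniformlyOn_iff]
  intro ε hε
  filter_upwards [hlim.eventually (gt_mem_nhds (half_pos ha)), hlim2.eventually (gt_mem_nhds hε)]
    with n hn hn2 p hp
  refine lt_of_le_of_lt ?_ hn2
  set q := deriv (step n) with hq
  have hqi : Integrable q := integrable_deriv_step n
  have h1 : potential hg.distribution (spd 0 (Θ n)) p -
      ∑ i : Fin 3, potential hg.distribution (spd i.succ (spd i.succ (Θ n))) p =
      ∫ w, q (w 0) * heatKernel w * g (p - w) := by
    have h2 : potential hg.distribution (spd 0 (Θ n)) p -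
      ∑ i : Fin 3, potential hg.distribution (spd i.succ (spd i.succ (Θ n))) p =
      potential hg.distribution (spd 0 (Θ n) - ∑ i : Fin 3, spd i.succ (spd i.succ (Θ n))) p := by
      simp only [potential, map_sub, map_sum]
    rw [h2, hg.potential_eq]
    refine integral_congr_ae (.of_forall fun w => ?_)
    simp only [Fin.sum_univ_three, sub_apply, add_apply]
    rw [spd_zero_heat (hΘ n) (contDiff_cut T n) (a := (1 / 2) ^ n) (by positivity)
      (fun s hs => (cut_ne_zero hs).1), spd_spd_heat (hΘ n) (Fin.succ_ne_zero _) (Fin.succ_ne_zero _),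
      spd_spd_heat (hΘ n) (Fin.succ_ne_zero _) (Fin.succ_ne_zero _),
      spd_spd_heat (hΘ n) (Fin.succ_ne_zero _) (Fin.succ_ne_zero _)]
    rcases lt_or_ge (w 0) (T + 1) with hw | hw
    · have : cut T n =ᶠ[𝓝 (w 0)] step n := by
        filter_upwards [Iio_mem_nhds hw] with s hs using cut_of_lt n (le_of_lt hs)
      rw [this.deriv_eq]
      simp only [hq, Fin.succ_zero_eq_one, Fin.succ_one_eq_two, show (2 : Fin 3).succ = 3 from rfl]
      ring
    -- Beyond time T + 1 the second cutoff may be active, but p − w then has negative time, where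
    -- the source vanishes.
    · have : g (p - w) = 0 := hg.zero _ (by simp; linarith [hp.2])
      rw [this, mul_zero, mul_zero]
  have hqG : Integrable fun w : Spacetime => q (w 0) * heatKernel w := integrable_mul_heatKernel hqi
  have h3 : ∫ w : Spacetime, q (w 0) * heatKernel w * g p = g p := by
    rw [integral_mul_const, integral_mul_heatKernel hqi, integral_deriv_step, one_mul]
  have h5 : Integrable fun w => q (w 0) * heatKernel w * g (p - w) := by
    obtain ⟨M, hM⟩ := ((contDiff_step n).continuous_deriv (by simp)).bounded_above_of_compact_support
      (HasCompactSupport.of_support_subset_isCompact isCompact_Icc fun s hs =>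
      ⟨(deriv_step_ne_zero hs).1.le, (deriv_step_ne_zero hs).2⟩)
    simp only [mul_assoc]
    refine (hg.integrable_heat p).bdd_mul (c := M) ?_ (.of_forall fun w => hM _)
    exact (((contDiff_step n).continuous_deriv (by simp)).comp (continuous_apply 0)).aestronglyMeasurable
  rw [h1, dist_comm, Real.dist_eq]
  nth_rewrite 1 [← h3]
  rw [← integral_sub h5 (hqG.mul_const _)]
  have hbd : ∀ w : Spacetime, ‖q (w 0) * heatKernel w * g (p - w) - q (w 0) * heatKernel w * g p‖ ≤
      L * heatConst * √(2 * (1 / 2) ^ n) * (q (w 0) * gaussian (1 / 16) w) := by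
    intro w
    have hG := gaussian_nonneg (1 / 16) w
    have hq0 := deriv_step_nonneg n (w 0)
    have hc := heatConst_pos
    rcases eq_or_ne (q (w 0)) 0 with h0 | h0
    · simp [h0]
    · obtain ⟨hw0, hwδ⟩ := deriv_step_ne_zero h0
      have hlip := hL (p - w) p ⟨by simp; linarith [hp.1], by simp; linarith [hp.2]⟩
        ⟨by linarith [hp.1], hp.2.le⟩
      have hpn : pnorm (p - w - p) = pnorm w := by
        rw [pnorm_sub_comm]
        simp
      rw [hpn] at hlip
      rw [← mul_sub, norm_mul, norm_mul, Real.norm_of_nonneg hq0,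
        Real.norm_of_nonneg (heatKernel_nonneg w), Real.norm_eq_abs]
      calc q (w 0) * heatKernel w * |g (p - w) - g p|
          ≤ q (w 0) * heatKernel w * (L * pnorm w) := by
            refine mul_le_mul_of_nonneg_left hlip ?_
            have := heatKernel_nonneg w
            positivity
        _ = L * q (w 0) * (heatKernel w * pnorm w) := by ring
        _ ≤ L * q (w 0) * (√(w 0) * (heatConst * gaussian (1 / 16) w)) := by
          refine mul_le_mul_of_nonneg_left (heatKernel_mul_pnorm_le hw0) (by positivity)
        _ ≤ L * q (w 0) * (√(2 * (1 / 2) ^ n) * (heatConst * gaussian (1 / 16) w)) := by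
          gcongr
        _ = _ := by ring
  refine (norm_integral_le_of_norm_le ((integrable_mul_gaussian (by norm_num)
    hqi).const_mul _) (.of_forall hbd)).trans (le_of_eq ?_)
  rw [integral_const_mul, integral_mul_gaussian (by norm_num) hqi, integral_deriv_step]

end IsSource

end Phi43

/-! ### Uniform limits in the heat equation -/

namespace Phi43

theorem exists_uniform_limit {X : Type*} {F : ℕ → X → ℝ} {U : Set X}
    (h : UniformCauchySeqOn F atTop U) : ∃ d, TendstoUniformlyOn F d atTop U := by
  have hex : ∀ x, ∃ y, x ∈ U → Tendsto (fun n => F n x) atTop (𝓝 y) := by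
    intro x
    by_cases hx : x ∈ U
    · obtain ⟨y, hy⟩ := cauchySeq_tendsto_of_complete (h.cauchySeq hx)
      exact ⟨y, fun _ => hy⟩
    · exact ⟨0, fun h => absurd h hx⟩
  choose d hd using hex
  exact ⟨d, h.tendstoUniformlyOn_of_tendsto hd⟩

/-- The linear form on space with given coefficients. -/
noncomputable def spaceForm (c : Fin 3 → ℝ) : (Fin 3 → ℝ) →L[ℝ] ℝ :=
  ∑ i, c i • ContinuousLinearMap.proj (R := ℝ) (φ := fun _ : Fin 3 => ℝ) i

theorem spaceForm_apply (c y : Fin 3 → ℝ) : spaceForm c y = ∑ i, c i * y i := by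
  simp [spaceForm, sum_apply]

theorem norm_spaceForm_sub_le (c d : Fin 3 → ℝ) :
    ‖spaceForm c - spaceForm d‖ ≤ ∑ i, |c i - d i| := by
  refine ContinuousLinearMap.opNorm_le_bound _ (by positivity) fun y => ?_
  rw [sub_apply, spaceForm_apply, spaceForm_apply, ← Finset.sum_sub_distrib, Finset.sum_mul]
  refine (norm_sum_le _ _).trans (Finset.sum_le_sum fun i _ => ?_)
  rw [← sub_mul, norm_mul]
  gcongr
  · exact le_rfl
  · exact norm_le_pi_norm y i

/-- The inclusion of space as a time slice, as a linear map. -/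
noncomputable def spaceIncl : (Fin 3 → ℝ) →L[ℝ] Spacetime :=
  ContinuousLinearMap.pi fun i =>
    Fin.cases 0 (fun j => ContinuousLinearMap.proj (R := ℝ) (φ := fun _ : Fin 3 => ℝ) j) i

theorem cons_eq_add_spaceIncl (t : ℝ) (x : Fin 3 → ℝ) :
    (Fin.cons t x : Spacetime) = Fin.cons t (0 : Fin 3 → ℝ) + spaceIncl x := by
  ext i
  refine Fin.cases ?_ (fun j => ?_) i <;> simp [spaceIncl]

theorem spaceIncl_eq_sum (y : Fin 3 → ℝ) :
    spaceIncl y = ∑ i, y i • (Pi.single i.succ 1 : Spacetime) := by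
  ext i
  refine Fin.cases ?_ (fun j => ?_) i
  · rw [show spaceIncl y 0 = 0 from rfl]
    simp
  · rw [show spaceIncl y j.succ = y j from rfl]
    simp [Pi.single_apply]

theorem hasFDerivAt_slice {f : Spacetime → ℝ} (hf : ContDiff ℝ ∞ f) (t : ℝ) (x : Fin 3 → ℝ) :
    HasFDerivAt (fun x : Fin 3 → ℝ => f (Fin.cons t x))
      (spaceForm fun i => pd i.succ f (Fin.cons t x)) x := by
  have h1 : HasFDerivAt (fun x : Fin 3 → ℝ => (Fin.cons t x : Spacetime)) spaceIncl x := by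
    rw [funext (cons_eq_add_spaceIncl t)]
    exact spaceIncl.hasFDerivAt.const_add _
  have h2 := ((hf.differentiable (by simp) (Fin.cons t x)).hasFDerivAt).comp x h1
  have h3 : (spaceForm fun i => pd i.succ f (Fin.cons t x)) =
      (fderiv ℝ f (Fin.cons t x)).comp spaceIncl := by
    refine ContinuousLinearMap.ext fun y => ?_
    rw [spaceForm_apply, ContinuousLinearMap.comp_apply, spaceIncl_eq_sum, map_sum]
    simp only [map_smul, pd_eq_fderiv hf, smul_eq_mul, mul_comm]
  rw [h3]
  exact h2

theorem pd_succ_of_slice {v : Spacetime → ℝ} {c : Fin 3 → ℝ} {z : Spacetime}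
    (h : HasFDerivAt (fun x : Fin 3 → ℝ => v (Fin.cons (z 0) x)) (spaceForm c) fun i => z i.succ)
    (i : Fin 3) : pd i.succ v z = c i := by
  refine HasLineDerivAt.lineDeriv ?_
  have h1 := h.hasLineDerivAt (Pi.single i 1)
  unfold HasLineDerivAt at h1 ⊢
  have h2 : spaceForm c (Pi.single i 1) = c i := by
    simp [spaceForm_apply, Pi.single_apply]
  rw [h2] at h1
  refine h1.congr_of_eventuallyEq (.of_forall fun s => ?_)
  refine congrArg v ?_
  ext j
  refine Fin.cases ?_ (fun k => ?_) j
  · simp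
  · simp [Pi.single_apply]

theorem pd_zero_of_hasDerivAt {v : Spacetime → ℝ} {c : ℝ} {z : Spacetime}
    (h : HasDerivAt (fun t => v (Function.update z 0 t)) c (z 0)) : pd 0 v z = c := by
  refine HasLineDerivAt.lineDeriv ?_
  have h1 : HasDerivAt (fun s => v (Function.update z 0 (z 0 + s))) c 0 :=
    HasDerivAt.comp_const_add (z 0) 0 (by simpa using h)
  refine h1.congr_of_eventuallyEq (.of_forall fun s => ?_)
  refine congrArg v ?_
  ext j
  refine Fin.cases ?_ (fun k => ?_) j <;> simp

theorem hasDerivAt_time {f : Spacetime → ℝ} (hf : ContDiff ℝ ∞ f) (z : Spacetime) (t : ℝ) :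
    HasDerivAt (fun t => f (Function.update z 0 t)) (pd 0 f (Function.update z 0 t)) t := by
  rw [pd_eq_fderiv hf]
  exact ((hf.differentiable (by simp) _).hasFDerivAt).comp_hasDerivAt t (hasDerivAt_update z 0 t)

section limit

variable {w : ℕ → Spacetime → ℝ} {u f : Spacetime → ℝ} {a b : ℝ}

theorem hasFDerivAt_slice_limit (hw : ∀ n, ContDiff ℝ ∞ (w n))
    (hlim : ∀ p : Spacetime, a < p 0 → p 0 < b → Tendsto (fun n => w n p) atTop (𝓝 (u p)))
    {d : Fin 3 → Spacetime → ℝ}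
    (hd : ∀ i : Fin 3, TendstoUniformlyOn (fun n => pd i.succ (w n)) (d i) atTop
      {p | a < p 0 ∧ p 0 < b}) {t : ℝ} (hat : a < t) (htb : t < b) (x : Fin 3 → ℝ) :
    HasFDerivAt (fun x : Fin 3 → ℝ => u (Fin.cons t x)) (spaceForm fun i => d i (Fin.cons t x)) x := by
  refine hasFDerivAt_of_tendstoUniformly (l := atTop)
    (g' := fun x => spaceForm fun i => d i (Fin.cons t x)) ?_
    (fun n x => hasFDerivAt_slice (hw n) t x) (fun x => hlim (Fin.cons t x) hat htb) x
  rw [Metric.tendstoUniformly_iff]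
  intro ε hε
  have : ∀ᶠ n in atTop, ∀ i : Fin 3, ∀ p ∈ {p : Spacetime | a < p 0 ∧ p 0 < b},
      dist (d i p) (pd i.succ (w n) p) < ε / 3 :=
    Filter.eventually_all.2 fun i => Metric.tendstoUniformlyOn_iff.1 (hd i) _ (by positivity)
  filter_upwards [this] with n hn y
  rw [dist_eq_norm]
  refine (norm_spaceForm_sub_le _ _).trans_lt ?_
  have h (i : Fin 3) := hn i (Fin.cons t y) ⟨hat, htb⟩
  simp only [Real.dist_eq] at h
  rw [Fin.sum_univ_three]
  linarith [h 0, h 1, h 2]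

/-- Passage to the limit in the heat equation. -/
theorem heat_limit (hw : ∀ n, ContDiff ℝ ∞ (w n))
    (hlim : ∀ p : Spacetime, a < p 0 → p 0 < b → Tendsto (fun n => w n p) atTop (𝓝 (u p)))
    (h1 : ∀ i : Fin 3, UniformCauchySeqOn (fun n => pd i.succ (w n)) atTop
      {p | a < p 0 ∧ p 0 < b})
    (h2 : ∀ i j : Fin 3, UniformCauchySeqOn (fun n => pd j.succ (pd i.succ (w n))) atTop
      {p | a < p 0 ∧ p 0 < b})
    (h3 : TendstoUniformlyOn (fun n p => pd 0 (w n) p - ∑ i : Fin 3, pd i.succ (pd i.succ (w n)) p)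
      f atTop {p | a < p 0 ∧ p 0 < b}) :
    ContinuousOn (pd 0 u) {p | a < p 0 ∧ p 0 < b} ∧ ∀ z : Spacetime, a < z 0 → z 0 < b →
      DifferentiableAt ℝ (fun t => u (Function.update z 0 t)) (z 0) ∧
      ContDiff ℝ 2 (fun x : Fin 3 → ℝ => u (Fin.cons (z 0) x)) ∧
      pd 0 u z = ∑ i : Fin 3, pd i.succ (pd i.succ u) z + f z := by
  choose d hd using fun i => exists_uniform_limit (h1 i)
  choose dd hdd using fun i j => exists_uniform_limit (h2 i j)
  have hopen : IsOpen {p : Spacetime | a < p 0 ∧ p 0 < b} :=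
    (isOpen_lt continuous_const (continuous_apply 0)).inter
      (isOpen_lt (continuous_apply 0) continuous_const)
  have hsl {t : ℝ} (hat : a < t) (htb : t < b) (x : Fin 3 → ℝ) :=
    hasFDerivAt_slice_limit hw hlim hd hat htb x
  have hsl2 (i : Fin 3) {t : ℝ} (hat : a < t) (htb : t < b) (x : Fin 3 → ℝ) :=
    hasFDerivAt_slice_limit (fun n => contDiff_pd (hw n) i.succ)
      (fun p hp hp' => (hd i).tendsto_at ⟨hp, hp'⟩) (hdd i) hat htb x
  have hddc (i j : Fin 3) : ContinuousOn (dd i j) {p | a < p 0 ∧ p 0 < b} :=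
    (hdd i j).continuousOn (.of_forall fun n =>
      (contDiff_pd (contDiff_pd (hw n) i.succ) j.succ).continuous.continuousOn)
  have hpd {z : Spacetime} (hz : a < z 0) (hz' : z 0 < b) (i : Fin 3) : pd i.succ u z = d i z := by
    have := hsl hz hz' fun i => z i.succ
    have h := pd_succ_of_slice this i
    rw [h]
    exact congrArg (d i) (Fin.cons_self_tail z)
  have hpd2 {z : Spacetime} (hz : a < z 0) (hz' : z 0 < b) (i : Fin 3) :
      pd i.succ (pd i.succ u) z = dd i i z := by
    have := hsl2 i hz hz' fun i => z i.succ
    have heq : (fun x : Fin 3 → ℝ => d i (Fin.cons (z 0) x)) =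
        fun x : Fin 3 → ℝ => pd i.succ u (Fin.cons (z 0) x) :=
      funext fun x => (hpd (z := Fin.cons (z 0) x) hz hz' i).symm
    rw [heq] at this
    rw [pd_succ_of_slice this i]
    exact congrArg (dd i i) (Fin.cons_self_tail z)
  -- No direct estimate of the time derivatives is needed: they are the heat operator plus the
  -- Laplacian, both of which converge uniformly.
  have htime : TendstoUniformlyOn (fun n => pd 0 (w n)) (fun p => ∑ i, dd i i p + f p) atTop
      {p | a < p 0 ∧ p 0 < b} := by
    have := (((hdd 0 0).add (hdd 1 1)).add (hdd 2 2)).add h3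
    refine (this.congr (.of_forall fun n p _ => ?_)).congr_right fun p _ => ?_
    · simp [Fin.sum_univ_three]
    · simp [Fin.sum_univ_three]
  have hder {z : Spacetime} (hz : a < z 0) (hz' : z 0 < b) :
      HasDerivAt (fun t => u (Function.update z 0 t)) (∑ i, dd i i z + f z) (z 0) := by
    have hu := htime.comp fun t : ℝ => Function.update z 0 t
    have := hasDerivAt_of_tendstoUniformlyOn (s := Ioo a b) isOpen_Ioo
      (hu.mono fun t ht => by simpa using ht)
      (.of_forall fun n t _ => hasDerivAt_time (hw n) z t)
      (fun t ht => hlim (Function.update z 0 t) (by simpa using ht.1) (by simpa using ht.2))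
      ⟨hz, hz'⟩
    simpa using this
  refine ⟨?_, fun z hz hz' => ⟨(hder hz hz').differentiableAt, ?_, ?_⟩⟩
  · refine ContinuousOn.congr (f := fun p => ∑ i, dd i i p + f p) ?_ fun z hz =>
      pd_zero_of_hasDerivAt (hder hz.1 hz.2)
    exact htime.continuousOn (.of_forall fun n => (contDiff_pd (hw n) 0).continuous.continuousOn)
  · have hcont (i j : Fin 3) : Continuous fun x : Fin 3 → ℝ => dd i j (Fin.cons (z 0) x) := by
      refine (hddc i j).comp_continuous ?_ fun x => ⟨hz, hz'⟩
      rw [funext (cons_eq_add_spaceIncl (z 0))]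
      fun_prop
    have hform {n : WithTop ℕ∞} {e : Fin 3 → (Fin 3 → ℝ) → ℝ} (he : ∀ i, ContDiff ℝ n (e i)) :
        ContDiff ℝ n fun x => spaceForm fun i => e i x :=
      ContDiff.sum fun i _ => (he i).smul contDiff_const
    have hC1 (i : Fin 3) : ContDiff ℝ 1 fun x : Fin 3 → ℝ => d i (Fin.cons (z 0) x) := by
      refine (contDiff_succ_iff_hasFDerivAt (n := 0)).2 ⟨_, ?_, hsl2 i hz hz'⟩
      exact hform fun j => contDiff_zero.2 (hcont i j)
    exact (contDiff_succ_iff_hasFDerivAt (n := 1)).2 ⟨_, hform hC1, hsl hz hz'⟩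
  · rw [pd_zero_of_hasDerivAt (hder hz hz')]
    simp only [hpd2 hz hz']

end limit

end Phi43

/-! ### Mild solutions are classical -/

namespace Phi43

theorem potential_eq_zero {Φ₀ : 𝓢(EuclideanSpace ℝ (Fin 3), ℝ) →L[ℝ] ℝ} {F : 𝓢(Spacetime, ℝ)}
    {p : Spacetime} (hF : ∀ w : Spacetime, w 0 = p 0 → F w = 0) :
    potential (Φ₀ ∘L restrictTimeZero) F p = 0 := by
  have : restrictTimeZero (mirror p F) = 0 := by
    ext y
    simp only [restrictTimeZero, SchwartzMap.compCLM_apply, Function.comp_apply, mirror_apply]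
    rw [hF _ (by simp [timeZero])]
    rfl
  rw [potential, ContinuousLinearMap.comp_apply, this, map_zero]

/-- Solutions of the mild formulation of the heat equation are classical solutions. -/
theorem classical_of_mild {T : ℝ} (hT : 0 < T) {h : ℝ → ℝ} {g u : Spacetime → ℝ}
    (hg : IsSource T h g) (Φ₀ : 𝓢(EuclideanSpace ℝ (Fin 3), ℝ) →L[ℝ] ℝ)
    (hu : ∀ z ∈ slab T, u z = (∫ w, heatKernel (z - w) * g w) + harmonicExt Φ₀ z) :
    ContinuousOn (pd 0 u) (slab T) ∧ ∀ z ∈ slab T,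
      DifferentiableAt ℝ (fun t => u (Function.update z 0 t)) (z 0) ∧
      ContDiff ℝ 2 (fun x : Fin 3 → ℝ => u (Fin.cons (z 0) x)) ∧
      pd 0 u z = ∑ i : Fin 3, pd i.succ (pd i.succ u) z + g z := by
  choose Θ hΘ using exists_heatApprox hT
  have key {a b : ℝ} (ha : 0 < a) (hab : a < b) (hb : b < T) :
      ContinuousOn (pd 0 u) {p | a < p 0 ∧ p 0 < b} ∧ ∀ z : Spacetime, a < z 0 → z 0 < b →
      DifferentiableAt ℝ (fun t => u (Function.update z 0 t)) (z 0) ∧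
      ContDiff ℝ 2 (fun x : Fin 3 → ℝ => u (Fin.cons (z 0) x)) ∧
      pd 0 u z = ∑ i : Fin 3, pd i.succ (pd i.succ u) z + g z := by
    -- A fixed cutoff equal to 1 on [a, b] suffices for the initial datum, because at times in (a,
    -- b) its evolution only involves the heat kernel at those same times.
    obtain ⟨χ, hχ, -, hχs, hχ1⟩ := exists_plateau (b := b) ha
    obtain ⟨Υ, hΥ⟩ := exists_schwartz_heat hχ (half_pos ha) (by linarith) hχs
    set Ψ := Φ₀ ∘L restrictTimeZero
    have hsm (F G : 𝓢(Spacetime, ℝ)) (i : Fin 4) :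
        pd i (potential hg.distribution F + potential Ψ G) =
          potential hg.distribution (spd i F) + potential Ψ (spd i G) := by
      rw [pd_add (contDiff_potential _ _) (contDiff_potential _ _), pd_potential, pd_potential]
    have hadd {F : ℕ → Spacetime → ℝ} {f : Spacetime → ℝ} {U : Set Spacetime}
        (hF : UniformCauchySeqOn F atTop U) : UniformCauchySeqOn (fun n => F n + f) atTop U := by
      rw [Metric.uniformCauchySeqOn_iff] at hF ⊢
      simpa using hF
    refine heat_limit (w := fun n => potential hg.distribution (Θ n) + potential Ψ Υ)
      (fun n => (contDiff_potential _ _).add (contDiff_potential _ _)) ?_ ?_ ?_ ?_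
    · intro p hp hp'
      rw [hu p ⟨ha.trans hp, hp'.trans hb⟩,
        harmonicExt_eq_potential Φ₀ hΥ (hχ1 _ hp.le hp'.le)]
      exact (hg.tendsto_potential hΘ (hp'.trans hb)).add_const _
    · intro i
      simp only [hsm]
      exact hadd (hg.uniformCauchySeqOn_spd hΘ ha hb i.succ_ne_zero)
    · intro i j
      simp only [hsm]
      exact hadd (hg.uniformCauchySeqOn_spd_spd hΘ ha hb i.succ_ne_zero j.succ_ne_zero)
    · refine (hg.tendstoUniformlyOn_heat_operator hΘ ha hb).congr (.of_forall fun n p hp => ?_)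
      have h0 : potential Ψ (spd 0 Υ) p -
          ∑ i : Fin 3, potential Ψ (spd i.succ (spd i.succ Υ)) p = 0 := by
        have h2 : potential Ψ (spd 0 Υ) p - ∑ i : Fin 3, potential Ψ (spd i.succ (spd i.succ Υ)) p =
            potential Ψ (spd 0 Υ - ∑ i : Fin 3, spd i.succ (spd i.succ Υ)) p := by
          simp only [potential, map_sub, map_sum]
        rw [h2]
        refine potential_eq_zero fun w hw => ?_
        -- The heat operator leaves only χ′G, and χ is constant near every time in (a, b).
        have hd : deriv χ (w 0) = 0 := by
          have : χ =ᶠ[𝓝 (w 0)] fun _ => 1 := by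
            filter_upwards [Ioo_mem_nhds (hw ▸ hp.1) (hw ▸ hp.2)] with s hs
            exact hχ1 s hs.1.le hs.2.le
          rw [this.deriv_eq, deriv_const]
        simp only [Fin.sum_univ_three, sub_apply, add_apply]
        rw [spd_zero_heat hΥ hχ (half_pos ha) (fun s hs => (hχs s hs).1),
          spd_spd_heat hΥ (Fin.succ_ne_zero _) (Fin.succ_ne_zero _),
          spd_spd_heat hΥ (Fin.succ_ne_zero _) (Fin.succ_ne_zero _),
          spd_spd_heat hΥ (Fin.succ_ne_zero _) (Fin.succ_ne_zero _), hd]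
        simp only [Fin.succ_zero_eq_one, Fin.succ_one_eq_two, show (2 : Fin 3).succ = 3 from rfl]
        ring
      simp only [hsm, Pi.add_apply, Finset.sum_add_distrib]
      linarith
  have hz' {z : Spacetime} (hz : z ∈ slab T) :=
    key (a := z 0 / 2) (b := (z 0 + T) / 2) (half_pos hz.1) (by linarith [hz.1, hz.2])
      (by linarith [hz.2])
  refine ⟨fun z hz => ?_, fun z hz => ?_⟩
  · have hopen : IsOpen {p : Spacetime | z 0 / 2 < p 0 ∧ p 0 < (z 0 + T) / 2} :=
      (isOpen_lt continuous_const (continuous_apply 0)).inter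
        (isOpen_lt (continuous_apply 0) continuous_const)
    exact ((hz' hz).1.continuousAt (hopen.mem_nhds ⟨by linarith [hz.1], by linarith [hz.2]⟩)).continuousWithinAt
  · exact (hz' hz).2 z (by linarith [hz.1]) (by linarith [hz.2])

end Phi43

/-! ### Periodicity and uniform bounds over space -/

namespace Phi43

/-- The translate of a space-time point into the unit cell in space. -/
noncomputable def foldCell (z : Spacetime) : Spacetime :=
  z - ⌊z 1⌋ • (Pi.single 1 1 : Spacetime) - ⌊z 2⌋ • (Pi.single 2 1 : Spacetime) -
    ⌊z 3⌋ • (Pi.single 3 1 : Spacetime)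

/-- Space-time points with times in `[a, b]` and space variable in the unit cell. -/
def cell (a b : ℝ) : Set Spacetime := Icc (Fin.cons a 0) (Fin.cons b 1)

theorem isCompact_cell (a b : ℝ) : IsCompact (cell a b) := isCompact_Icc

theorem time_mem_of_mem_cell {a b : ℝ} {z : Spacetime} (hz : z ∈ cell a b) : z 0 ∈ Icc a b :=
  ⟨hz.1 0, hz.2 0⟩

@[simp] theorem foldCell_zero (z : Spacetime) : foldCell z 0 = z 0 := by
  simp [foldCell]

theorem foldCell_mem {a b : ℝ} {z : Spacetime} (hz : z 0 ∈ Icc a b) : foldCell z ∈ cell a b := by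
  have h (i : Fin 4) (hi : i ≠ 0) : foldCell z i = Int.fract (z i) := by
    fin_cases i <;> simp [foldCell] at hi ⊢
  refine ⟨fun i => ?_, fun i => ?_⟩ <;> refine Fin.cases ?_ (fun j => ?_) i
  · simpa using hz.1
  · rw [h _ j.succ_ne_zero]
    simp [Int.fract_nonneg]
  · simpa using hz.2
  · rw [h _ j.succ_ne_zero]
    simpa using (Int.fract_lt_one _).le

namespace SpacePeriodic

variable {V : Type*} {f : Spacetime → V}

theorem periodic (hf : SpacePeriodic f) {i : Fin 4} (hi : i ≠ 0) :
    Function.Periodic f (Pi.single i 1 : Spacetime) := by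
  obtain ⟨j, rfl⟩ := Fin.exists_succ_eq.2 hi
  exact fun z => hf z j

theorem apply_foldCell_add (hf : SpacePeriodic f) (z v : Spacetime) :
    f (foldCell z + v) = f (z + v) := by
  have h (i : Fin 4) (hi : i ≠ 0) := fun n : ℤ => (hf.periodic hi).zsmul n
  have e : foldCell z + v = z + v - ⌊z 1⌋ • (Pi.single 1 1 : Spacetime) -
      ⌊z 2⌋ • (Pi.single 2 1 : Spacetime) - ⌊z 3⌋ • (Pi.single 3 1 : Spacetime) := by
    rw [foldCell]
    abel
  rw [e, (h 3 (by decide) _).sub_eq, (h 2 (by decide) _).sub_eq, (h 1 (by decide) _).sub_eq]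

theorem apply_foldCell (hf : SpacePeriodic f) (z : Spacetime) : f (foldCell z) = f z := by
  simpa using hf.apply_foldCell_add z 0

/-- Folding into the unit cell preserves time and the value of f, and the cell over a bounded time
interval is compact. -/
theorem exists_bound {f : Spacetime → ℝ} (hf : SpacePeriodic f) {a b : ℝ}
    (hc : ContinuousOn f {z | z 0 ∈ Icc a b}) :
    ∃ M, 0 ≤ M ∧ ∀ z : Spacetime, z 0 ∈ Icc a b → |f z| ≤ M := by
  obtain ⟨M, hM⟩ := (isCompact_cell a b).exists_bound_of_continuousOn
    (hc.mono fun z => time_mem_of_mem_cell)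
  refine ⟨max M 0, le_max_right _ _, fun z hz => ?_⟩
  rw [← hf.apply_foldCell z]
  exact (hM _ (foldCell_mem hz)).trans (le_max_left _ _)

theorem conv {N : ℕ} (K : HeatKernelSplit N) {f : Spacetime → ℝ} (hf : SpacePeriodic f) :
    SpacePeriodic (K.conv f) := by
  intro z i
  rw [K.conv_eq, K.conv_eq]
  congr 1
  ext w
  rw [add_sub_right_comm, hf]

end SpacePeriodic

/-- The parabolic size controls |v₀| only through its square root; on a bounded time range |v₀| =
√|v₀|·√|v₀| ≤ √b·`pnorm v`. -/
theorem norm_le_pnorm {v : Spacetime} {b : ℝ} (hv : |v 0| ≤ b) : ‖v‖ ≤ (1 + √b) * pnorm v := by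
  have hp := pnorm_nonneg v
  have hb := Real.sqrt_nonneg b
  refine (pi_norm_le_iff_of_nonneg (by positivity)).2 fun i => ?_
  rw [Real.norm_eq_abs]
  by_cases hi : i = 0
  · subst hi
    have h1 : √|v 0| ≤ pnorm v := by
      rw [pnorm]
      linarith [abs_nonneg (v 1), abs_nonneg (v 2), abs_nonneg (v 3)]
    calc |v 0| = √|v 0| * √|v 0| := (Real.mul_self_sqrt (abs_nonneg _)).symm
      _ ≤ √b * pnorm v := by gcongr
      _ ≤ _ := by nlinarith
  · refine (abs_space_le v hi).trans ?_
    nlinarith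

/-- The gradient is periodic along with f, hence bounded over all of space, and the slab of times is
convex; the Euclidean increment is then converted by `norm_le_pnorm`. -/
theorem SpacePeriodic.exists_lipschitz {f : Spacetime → ℝ} (hf : SpacePeriodic f)
    (hs : ContDiff ℝ ∞ f) (a b : ℝ) : ∃ L, 0 ≤ L ∧ ∀ z w : Spacetime, z 0 ∈ Icc a b →
      w 0 ∈ Icc a b → |f z - f w| ≤ L * pnorm (z - w) := by
  have hper : SpacePeriodic fun z => ‖fderiv ℝ f z‖ := by
    intro z i
    have : fderiv ℝ f (z + Pi.single i.succ 1) = fderiv ℝ f z := by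
      rw [← fderiv_comp_add_right]
      congr 1
      exact funext fun w => hf w i
    simp only [this]
  obtain ⟨M, hM0, hM⟩ := hper.exists_bound (a := a) (b := b)
    (hs.continuous_fderiv (by simp)).norm.continuousOn
  refine ⟨M * (1 + √(b - a)), by positivity, fun z w hz hw => ?_⟩
  have hconv : Convex ℝ {z : Spacetime | z 0 ∈ Icc a b} :=
    (convex_Icc a b).linear_preimage
      (ContinuousLinearMap.proj (R := ℝ) (φ := fun _ : Fin 4 => ℝ) 0).toLinearMap
  have h1 := hconv.norm_image_sub_le_of_norm_fderiv_le
    (fun x _ => hs.differentiable (by simp) x) (C := M)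
    (fun x hx => by simpa using hM x hx) hw hz
  have h2 : ‖z - w‖ ≤ (1 + √(b - a)) * pnorm (z - w) := by
    refine norm_le_pnorm ?_
    rw [Pi.sub_apply, abs_le]
    constructor <;> linarith [hz.1, hz.2, hw.1, hw.2]
  calc |f z - f w| ≤ M * ‖z - w‖ := h1
    _ ≤ M * ((1 + √(b - a)) * pnorm (z - w)) := by gcongr
    _ = _ := by ring

end Phi43

namespace Phi43

/-! ### The reconstructed right-hand side as a source -/

section

variable {T η c : ℝ} {u ξ : Spacetime → ℝ}

/-- Pairs closer than r are moved into the unit cell by folding the second point and keeping the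
difference; for pairs farther apart the crude bound 2M is at most (2M/r)·`pnorm`. -/
theorem exists_lipschitz_of_local (hu : SpacePeriodic u) (hc : ContinuousOn u (slab T))
    (hlip : ∀ A ⊆ slab T, IsCompact A → ∃ C r : ℝ, 0 ≤ C ∧ 0 < r ∧ ∀ x ∈ A, ∀ v, pnorm v ≤ r →
      |u (x + v) - u x| ≤ C * pnorm v) {a b : ℝ} (ha : 0 < a) (hb : b < T) :
    ∃ L M, 0 ≤ L ∧ 0 ≤ M ∧ ∀ z : Spacetime, z 0 ∈ Icc a b → |u z| ≤ M ∧ ∀ w : Spacetime,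
      w 0 ∈ Icc a b → |u z - u w| ≤ L * pnorm (z - w) := by
  have hsub : cell a b ⊆ slab T := fun z hz =>
    ⟨ha.trans_le (time_mem_of_mem_cell hz).1, (time_mem_of_mem_cell hz).2.trans_lt hb⟩
  obtain ⟨M, hM0, hM⟩ := hu.exists_bound (a := a) (b := b)
    (hc.mono fun z hz => ⟨ha.trans_le hz.1, hz.2.trans_lt hb⟩)
  obtain ⟨C, r, hC, hr, hCr⟩ := hlip _ hsub (isCompact_cell a b)
  refine ⟨C + 2 * M / r, M, by positivity, hM0, fun z hz => ⟨hM z hz, fun w hw => ?_⟩⟩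
  have hp := pnorm_nonneg (z - w)
  rcases le_or_gt (pnorm (z - w)) r with h | h
  · have := hCr _ (foldCell_mem hw) (z - w) h
    rw [hu.apply_foldCell_add, hu.apply_foldCell, add_sub_cancel] at this
    refine this.trans ?_
    gcongr
    have : 0 ≤ 2 * M / r := by positivity
    linarith
  · calc |u z - u w| ≤ |u z| + |u w| := abs_sub _ _
      _ ≤ 2 * M / r * r := by
        rw [div_mul_cancel₀ _ hr.ne']
        linarith [hM z hz, hM w hw]
      _ ≤ (C + 2 * M / r) * pnorm (z - w) := by
        gcongr
        linarith

theorem weight_le {s : ℝ} (hs : 0 < s) (e : ℝ) :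
    (min 1 √s) ^ e ≤ 1 + s ^ (e / 2) := by
  have h0 : 0 ≤ s ^ (e / 2) := Real.rpow_nonneg hs.le _
  rcases le_total 1 √s with h | h
  · rw [min_eq_left h, Real.one_rpow]
    linarith
  · rw [min_eq_right h, Real.sqrt_eq_rpow, ← Real.rpow_mul hs.le, one_div, inv_mul_eq_div]
    linarith

theorem one_le_weight {s e : ℝ} (hs : 0 < s) (he : e ≤ 0) : 1 ≤ (min 1 √s) ^ e :=
  Real.one_le_rpow_of_pos_of_le_one_of_nonpos (lt_min one_pos (Real.sqrt_pos.2 hs))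
    (min_le_left _ _) he

/-- The right hand side `ξ - u³ + c u` on the slab. -/
noncomputable def source (T c : ℝ) (ξ u : Spacetime → ℝ) : Spacetime → ℝ :=
  (slab T).indicator fun z => ξ z - u z ^ 3 + c * u z

/-- All terms are dominated by the cube of the weight of u, that is by 1 + t^(3e/2) with e = min(η,
0). -/
theorem isSource_source (hη : -(2 / 3) < η) (hu : SpacePeriodic u) (hc : ContinuousOn u (slab T))
    (hlip : ∀ A ⊆ slab T, IsCompact A → ∃ C r : ℝ, 0 ≤ C ∧ 0 < r ∧ ∀ x ∈ A, ∀ v, pnorm v ≤ r →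
      |u (x + v) - u x| ≤ C * pnorm v)
    (hbd : ∃ B, ∀ z ∈ slab T, |u z| ≤ B * (min 1 √(z 0)) ^ (min η 0))
    (hξ : ContDiff ℝ ∞ ξ) (hξp : SpacePeriodic ξ) : ∃ h, IsSource T h (source T c ξ u) := by
  obtain ⟨B₀, hB₀⟩ := hbd
  set B := max B₀ 0
  have hB0 : 0 ≤ B := le_max_right _ _
  obtain ⟨M, hM0, hM⟩ := hξp.exists_bound (a := 0) (b := T) hξ.continuous.continuousOn
  set e := min η 0
  have he0 : e ≤ 0 := min_le_right _ _
  have he : -(2 / 3) < e := lt_min hη (by norm_num)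
  set D := M + B ^ 3 + |c| * B
  have hD0 : 0 ≤ D := by positivity
  have hmeas : MeasurableSet (slab T) := (isOpen_slab T).measurableSet
  refine ⟨(Ioo 0 T).indicator fun s => D * (1 + s ^ (3 * e / 2)), ?_, ?_, ?_, ?_, ?_⟩
  · refine (aestronglyMeasurable_indicator_iff hmeas).2 (ContinuousOn.aestronglyMeasurable ?_ hmeas)
    exact (hξ.continuous.continuousOn.sub (hc.pow 3)).add (continuousOn_const.mul hc)
  · refine (integrable_indicator_iff measurableSet_Ioo).2 (Integrable.const_mul ?_ D)
    rcases le_or_gt T 0 with hT | hT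
    · simp [Ioo_eq_empty (not_lt.2 hT)]
    refine Integrable.add (by simp) ?_
    have := (intervalIntegrable_iff_integrableOn_Ioc_of_le hT.le).1
      -- Here η > −2/3 is decisive: it gives 3e/2 > −1.
      (intervalIntegral.intervalIntegrable_rpow' (a := 0) (b := T) (r := 3 * e / 2) (by linarith))
    exact this.mono_set Ioo_subset_Ioc_self
  · intro z
    by_cases hz : z ∈ slab T
    · rw [source, indicator_of_mem hz, indicator_of_mem (show z 0 ∈ Ioo 0 T from hz)]
      set m := (min 1 √(z 0)) ^ e
      have hm1 : 1 ≤ m := one_le_weight hz.1 he0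
      have hm0 : 0 ≤ m := zero_le_one.trans hm1
      have h1 : |u z| ≤ B * m := (hB₀ z hz).trans (by gcongr; exact le_max_left _ _)
      have h3 : m ^ 3 ≤ 1 + z 0 ^ (3 * e / 2) := by
        have : m ^ 3 = (min 1 √(z 0)) ^ (3 * e) := by
          rw [← Real.rpow_natCast, ← Real.rpow_mul (by positivity)]
          congr 1
          push_cast
          ring
        rw [this]
        exact weight_le hz.1 _
      have hm3 : m ≤ m ^ 3 := le_self_pow₀ hm1 (by norm_num)
      calc |ξ z - u z ^ 3 + c * u z| ≤ |ξ z| + |u z| ^ 3 + |c| * |u z| := by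
            rw [← abs_pow, ← abs_mul]
            exact (abs_add_le _ _).trans (by gcongr; exact abs_sub _ _)
        _ ≤ M * m ^ 3 + (B * m) ^ 3 + |c| * (B * m ^ 3) := by
            have h4 : |ξ z| ≤ M * m ^ 3 := (hM z ⟨hz.1.le, hz.2.le⟩).trans
              (le_mul_of_one_le_right hM0 (hm1.trans hm3))
            have h5 : |u z| ≤ B * m ^ 3 := h1.trans (by gcongr)
            gcongr
        _ = D * m ^ 3 := by ring
        _ ≤ _ := by gcongr
    · rw [source, indicator_of_notMem hz, abs_zero]
      refine indicator_nonneg (fun s hs => ?_) _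
      have := Real.rpow_nonneg hs.1.le (3 * e / 2)
      positivity
  · intro z hz
    exact indicator_of_notMem (fun h => absurd h.1 (not_lt.2 hz)) _
  · intro a b ha hb
    obtain ⟨L, M, hL0, hM0, hLM⟩ := exists_lipschitz_of_local hu hc hlip ha hb
    obtain ⟨L', hL'0, hL'⟩ := hξp.exists_lipschitz hξ a b
    refine ⟨L' + 3 * M ^ 2 * L + |c| * L, by positivity, fun z w hz hw => ?_⟩
    have hzT : z ∈ slab T := ⟨ha.trans_le hz.1, hz.2.trans_lt hb⟩
    have hwT : w ∈ slab T := ⟨ha.trans_le hw.1, hw.2.trans_lt hb⟩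
    rw [source, indicator_of_mem hzT, indicator_of_mem hwT]
    obtain ⟨hz1, hzw⟩ := hLM z hz
    obtain ⟨hw1, -⟩ := hLM w hw
    have hp := pnorm_nonneg (z - w)
    have hsq : |u z ^ 2 + u z * u w + u w ^ 2| ≤ 3 * M ^ 2 := by
      have h1 : |u z ^ 2| ≤ M ^ 2 := by
        rw [abs_pow]
        gcongr
      have h2 : |u w ^ 2| ≤ M ^ 2 := by
        rw [abs_pow]
        gcongr
      have h3 : |u z * u w| ≤ M * M := by
        rw [abs_mul]
        gcongr
      refine (abs_add_three _ _ _).trans ?_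
      linarith
    calc _ = |(ξ z - ξ w) - (u z - u w) * (u z ^ 2 + u z * u w + u w ^ 2) + c * (u z - u w)| := by
          congr 1
          ring
      _ ≤ |ξ z - ξ w| + |u z - u w| * |u z ^ 2 + u z * u w + u w ^ 2| + |c| * |u z - u w| := by
          rw [← abs_mul, ← abs_mul]
          exact (abs_add_le _ _).trans (by gcongr; exact abs_sub _ _)
      _ ≤ L' * pnorm (z - w) + L * pnorm (z - w) * (3 * M ^ 2) + |c| * (L * pnorm (z - w)) := by
          have := hL' z w hz hw
          have := hzw w hw
          gcongr
      _ = _ := by ring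

/-- On the unit ball the weight (1 + ‖y‖)⁻⁴ is bounded below, so the integrable weight dominates the
source. Very near z the times stay away from 0 and T, and the Lipschitz bound gives boundedness. -/
theorem IsSource.admissible {h : ℝ → ℝ} {g : Spacetime → ℝ} (hg : IsSource T h g)
    {z : Spacetime} (hz : z ∈ slab T) :
    HeatKernelSplit.Admissible z g := by
  constructor
  · refine Integrable.mono' ((hg.integrable_weight.const_mul ((2 + ‖z‖) ^ 4)).integrableOn)
      hg.measurable.restrict ?_
    refine (ae_restrict_iff' Metric.isClosed_closedBall.measurableSet).2 (.of_forall fun w hw => ?_)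
    set y := fun i : Fin 3 => w i.succ with hy
    have h1 : 1 + ‖y‖ ≤ 2 + ‖z‖ := by
      have h2 : ‖y‖ ≤ ‖w‖ :=
        (pi_norm_le_iff_of_nonneg (norm_nonneg w)).2 fun i => norm_le_pi_norm w i.succ
      have h3 : ‖w‖ ≤ ‖z‖ + 1 := by
        have := norm_sub_norm_le w z
        rw [mem_closedBall_iff_norm] at hw
        linarith
      linarith
    have h4 : 1 ≤ (2 + ‖z‖) ^ 4 * (1 + ‖y‖) ^ (-4 : ℝ) := by
      rw [Real.rpow_neg (by positivity), ← div_eq_mul_inv, le_div_iff₀ (by positivity), one_mul]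
      norm_cast
      gcongr
    rw [sourceWeight, ← hy, mul_left_comm]
    exact (hg.bound w).trans (le_mul_of_one_le_right (hg.nonneg _) h4)
  · obtain ⟨L, hL0, hL⟩ := hg.lipschitz (z 0 / 2) ((z 0 + T) / 2) (half_pos hz.1)
      (by linarith [hz.2])
    have hd : 0 < min (z 0 / 2) ((T - z 0) / 2) := lt_min (half_pos hz.1) (by linarith [hz.2])
    refine ⟨√(min (z 0 / 2) ((T - z 0) / 2)), Real.sqrt_pos.2 hd,
      |g z| + L * √(min (z 0 / 2) ((T - z 0) / 2)), fun w hw => ?_⟩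
    have h1 : |z 0 - w 0| ≤ min (z 0 / 2) ((T - z 0) / 2) := by
      refine (abs_time_le (z - w)).trans ?_
      rw [← Real.sq_sqrt hd.le]
      have := pnorm_nonneg (z - w)
      gcongr
    have h2 := h1.trans (min_le_left _ _)
    have h3 := h1.trans (min_le_right _ _)
    rw [abs_le] at h2 h3
    have h4 := hL z w ⟨by linarith [hz.1], by linarith [hz.2]⟩ ⟨by linarith, by linarith⟩
    have h5 : L * pnorm (z - w) ≤ L * √(min (z 0 / 2) ((T - z 0) / 2)) := by gcongr
    have h6 := abs_sub_abs_le_abs_sub (g w) (g z)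
    rw [abs_sub_comm] at h6
    linarith

end

end Phi43

/-! ### Conclusion -/

namespace Phi43

open Phi43.Symbol

theorem classicalSolution {κ : ℝ} (hκ : 0 < κ) (hκ' : κ < 1 / 14) {γ η : ℝ} (hγ : 1 + 2 * κ < γ)
    (hη : -(2 / 3) < η) {N : ℕ} (hN : rhsOrder κ γ + 2 ≤ N) (K : HeatKernelSplit N) (C₁ C₂ : ℝ)
    {ξ : Spacetime → ℝ} (hξ : ContDiff ℝ ∞ ξ) (hξp : SpacePeriodic ξ)
    {Φ₀ : 𝓢(EuclideanSpace ℝ (Fin 3), ℝ) →L[ℝ] ℝ} {T : ℝ} (hT : 0 < T) {Φ : Spacetime → Alg}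
    (hΦ : IsAbstractSolution κ K (renormPP K C₁ C₂ ξ) γ η T Φ₀ Φ) :
    IsClassicalSolution T (3 * C₁ - 9 * C₂) ξ (reconstruct κ K (renormPP K C₁ C₂ ξ) γ T Φ) := by
  have hγ' : 0 < rhsOrder κ γ := by
    rw [rhsOrder]
    linarith
  have hγ1 : 1 ≤ γ := by linarith
  have hγ0 : 0 < γ := by linarith
  set c := 3 * C₁ - 9 * C₂
  set v := diag K C₁ C₂ κ ξ Φ with hv
  set u := (slab T).indicator v with hu
  have huv {z : Spacetime} (hz : z ∈ slab T) : u z = v z := indicator_of_mem hz _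
  have hval {z : Spacetime} (hz : z ∈ slab T) : v z = (Φ z).coeff 1 + K.conv ξ z := by
    rw [hv, diag_eq K C₁ C₂ hκ hκ' hN hξ (hΦ.modelled.mem_span K hz), hΦ.psi_eq K hκ hγ hz, one_mul,
      Alg.lcoeff_apply]
  have hconvp : SpacePeriodic (K.conv ξ) := hξp.conv K
  -- Periodicity is read off from u = ⟨Φ, 1⟩ + K * ξ; the symbols and the maps Π_z are not
  -- themselves invariant under translations.
  have hup : SpacePeriodic u := by
    intro z i
    have hmem : z + Pi.single i.succ 1 ∈ slab T ↔ z ∈ slab T := by simp [slab]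
    by_cases hz : z ∈ slab T
    · rw [huv hz, huv (hmem.2 hz), hval hz, hval (hmem.2 hz), hΦ.periodic, hconvp]
    · rw [hu, indicator_of_notMem hz, indicator_of_notMem (mt hmem.1 hz)]
  have hvc : ContinuousOn v (slab T) := hΦ.modelled.continuousOn_diag K C₁ C₂ hκ hκ' hN hγ0 hξ
  have huc : ContinuousOn u (slab T) := hvc.congr fun z hz => huv hz
  have hlip : ∀ A ⊆ slab T, IsCompact A → ∃ C r : ℝ, 0 ≤ C ∧ 0 < r ∧ ∀ x ∈ A, ∀ w, pnorm w ≤ r →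
      |u (x + w) - u x| ≤ C * pnorm w := by
    intro A hAT hA
    obtain ⟨C, r, hC, hr, h⟩ := hΦ.modelled.lipschitz_diag K C₁ C₂ hκ hκ' hN hγ1 hξ hA hAT
    obtain ⟨r', hr', -, h'⟩ := exists_radius hA hAT
    refine ⟨C, min r r', hC, lt_min hr hr', fun x hx w hw => ?_⟩
    rw [huv (hAT hx), huv (h' x hx w (hw.trans (min_le_right _ _))).1]
    exact h x hx w (hw.trans (min_le_left _ _))
  -- The same formula shows that only the component of homogeneity 0 can blow up at time 0, with
  -- weight min(η, 0); K * ξ is bounded, and the weight is at least 1.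
  have hbd : ∃ B, ∀ z ∈ slab T, |u z| ≤ B * (min 1 √(z 0)) ^ (min η 0) := by
    obtain ⟨B, hB⟩ := hΦ.modelled.size 0 hγ0
    obtain ⟨M, hM0, hM⟩ := hconvp.exists_bound (a := 0) (b := T)
      (K.contDiff_conv hξ).continuous.continuousOn
    refine ⟨B + M, fun z hz => ?_⟩
    have h1 := abs_coeff_le_normAt κ 1 (Φ z)
    rw [homog_one] at h1
    have h2 := hB z hz
    rw [sub_zero] at h2
    have h3 := hM z ⟨hz.1.le, hz.2.le⟩
    have h4 := one_le_weight hz.1 (min_le_right η 0)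
    rw [huv hz, hval hz]
    calc _ ≤ |(Φ z).coeff 1| + |K.conv ξ z| := abs_add_le _ _
      _ ≤ B * (min 1 √(z 0)) ^ (min η 0) + M * (min 1 √(z 0)) ^ (min η 0) :=
        add_le_add (h1.trans h2) (h3.trans (le_mul_of_one_le_right hM0 h4))
      _ = _ := by ring
  obtain ⟨h, hg⟩ := isSource_source (c := c) hη hup huc hlip hbd hξ hξp
  have hrec : reconstruct κ K (renormPP K C₁ C₂ ξ) (rhsOrder κ γ) T (rhs κ γ Φ) =
      source T c ξ u := by
    rw [hΦ.modelled.reconstruct_rhs K C₁ C₂ hκ hκ' hN hγ' hξ (fun z hz => hΦ.psi_eq K hκ hγ hz)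
      fun z hz => hΦ.childContract_eq K hκ hκ' hγ hz]
    refine indicator_congr fun z hz => ?_
    rw [huv hz]
  have hmild : ∀ z ∈ slab T,
      u z = (∫ w, heatKernel (z - w) * source T c ξ u w) + harmonicExt Φ₀ z := by
    intro z hz
    rw [huv hz]
    refine hΦ.diag_eq_integral K C₁ C₂ hκ hκ' hγ hN hξ hz hrec (hg.admissible hz) ?_
    have := (hg.integrable_heat z).comp_sub_left z
    simpa using this
  obtain ⟨h1, h2⟩ := classical_of_mild hT hg Φ₀ hmild
  rw [hΦ.modelled.reconstruct_eq K C₁ C₂ hκ hκ' hN hγ0 hξ]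
  refine ⟨huc, fun z hz => (h2 z hz).1, h1, fun z hz => (h2 z hz).2.1.contDiffAt, fun z hz => ?_⟩
  have h3 := (h2 z hz).2.2
  rw [source, indicator_of_mem hz] at h3
  rw [h3]
  ring

end Phi43

theorem mainTheorem6
    (κ : ℝ) (hκ : 0 < κ) (hκ' : κ < 1 / 14)
    (γ η : ℝ) (hγ : 1 + 2 * κ < γ) (hη : -(2 / 3) < η)
    (N : ℕ) (hN : Phi43.rhsOrder κ γ + 2 ≤ N) (K : Phi43.HeatKernelSplit N)
    (C₁ C₂ : ℝ)
    (ξ : Phi43.Spacetime → ℝ) (hξ : ContDiff ℝ ∞ ξ) (hξp : Phi43.SpacePeriodic ξ)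
    (Φ₀ : 𝓢(EuclideanSpace ℝ (Fin 3), ℝ) →L[ℝ] ℝ) (hΦ₀ : Phi43.PeriodicDistribution Φ₀)
    (T : ℝ) (hT : 0 < T)
    (Φ : Phi43.Spacetime → Phi43.Alg)
    (hΦ : Phi43.IsAbstractSolution κ K (Phi43.renormPP K C₁ C₂ ξ) γ η T Φ₀ Φ) :
    Phi43.IsClassicalSolution T (3 * C₁ - 9 * C₂) ξ
      (Phi43.reconstruct κ K (Phi43.renormPP K C₁ C₂ ξ) γ T Φ) :=
  Phi43.classicalSolution hκ hκ' hγ hη hN K C₁ C₂ hξ hξp hT hΦ
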